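/- Call a set $S\subseteq[n]$ a $\rho$-approximation to unconstrained MAP inference on a matrix $A\in\mathbb{Q}^{n\times n}$ if $\det(A_{S,S})\ge\frac1\rho\max_{T\subseteq[n]}\det(A_{T,T})$, where $A_{S,S}$ is the principal submatrix of $A$ indexed by $S$ and $\det(A_{\emptyset,\emptyset})=1$. The treewidth of $A$ is the treewidth of the graph on $[n]$ in which $i\ne j$ are adjacent if and only if $A_{i,j}\neq0$ or $A_{j,i}\ne 0$. The size of a rational $p/q$ in lowest terms (with $q\ge 1$) is $1+\lceil\log_2(|p|+1)\rceil+\lceil\log_2(q+1)\rceil$, and $\mathrm{size}(A)=n^2+\sum_{i,j}\mathrm{size}(A_{i,j})$. Running time is the number of instructions executed by a unit-cost random-access machine that performs rational arithmetic, comparisons, indirect memory accesses and fair coin tosses. Theorem. There is a single randomized algorithm with the following properties. Given any positive semi-definite matrix $A\in\mathbb{Q}^{n\times n}$ (and no tree decomposition of it), of treewidth $w$, it halts for every outcome of its coin tosses within $$C\,(w+1)^{C\,w\sqrt n}\,(n+1)^{C}$$ steps, that is, in time $w^{O(w\sqrt n)}n^{O(1)}$, and every number that it ever stores has size at most $C(\mathrm{size}(A)+1)^{C}$,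 where $C$ is an absolute constant. With probability at least $1-2^{-n}$ it outputs a set $S\subseteq[n]$ that is a $2^{\sqrt n}$-approximation to unconstrained MAP inference on $A$, i.e. $$\det(A_{S,S})\ \ge\ 2^{-\sqrt n}\,\max_{T\subseteq[n]}\det(A_{T,T}).$$ In particular, if the treewidth is $O(1)$, the running time is $2^{O(\sqrt n)}$: for every $w_0$ there is a constant $K$ such that on every positive semi-definite $A\in\mathbb{Q}^{n\times n}$ of treewidth at most $w_0$ the same algorithm always halts within $K\,2^{K\sqrt n}$ steps. -/

import Mathlib

/-! ### Treewidth of graphs and of matrices -/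

/-- A tree decomposition of a graph `G`: a finite tree whose nodes carry sets of vertices (bags). -/
structure TreeDecomposition {V : Type*} (G : SimpleGraph V) where
  /-- the number of nodes of the tree -/
  size : ℕ
  /-- the tree -/
  tree : SimpleGraph (Fin size)
  isTree : tree.IsTree
  /-- the bags -/
  bag : Fin size → Finset V
  bag_cover : ∀ v : V, ∃ t, v ∈ bag t
  edge_cover : ∀ u v : V, G.Adj u v → ∃ t, u ∈ bag t ∧ v ∈ bag t
  connected : ∀ v : V, (tree.induce {t | v ∈ bag t}).Connected

/-- The width: the maximum size of a bag, minus one. -/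
def TreeDecomposition.width {V : Type*} {G : SimpleGraph V} (D : TreeDecomposition G) : ℕ :=
  (Finset.univ.sup fun t => (D.bag t).card) - 1

/-- The treewidth of a graph: the minimum width of its tree decompositions. -/
noncomputable def SimpleGraph.treewidth {V : Type*} (G : SimpleGraph V) : ℕ :=
  sInf {k | ∃ D : TreeDecomposition G, D.width = k}

/-- The tree decomposition of a finite graph with a single bag. -/
def TreeDecomposition.trivial {V : Type*} [Fintype V] (G : SimpleGraph V) :
    TreeDecomposition G where
  size := 1
  tree := ⊥
  isTree := SimpleGraph.IsTree.of_subsingleton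
  bag := fun _ => Finset.univ
  bag_cover := fun v => ⟨0, Finset.mem_univ v⟩
  edge_cover := fun u v _ => ⟨0, Finset.mem_univ u, Finset.mem_univ v⟩
  connected := fun v => by
    have : Nonempty {t : Fin 1 | v ∈ (Finset.univ : Finset V)} := ⟨⟨0, Finset.mem_univ v⟩⟩
    exact SimpleGraph.Connected.of_subsingleton

/-- The minimum in the definition of the treewidth of a finite graph is attained. -/
theorem SimpleGraph.exists_width_eq_treewidth {V : Type*} [Fintype V] (G : SimpleGraph V) :
    ∃ D : TreeDecomposition G, D.width = G.treewidth :=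
  Nat.sInf_mem (s := {k | ∃ D : TreeDecomposition G, D.width = k})
    ⟨_, TreeDecomposition.trivial G, rfl⟩

/-- The graph formed by the off-diagonal nonzero entries of a matrix. -/
def Matrix.supportGraph {n : ℕ} (A : Matrix (Fin n) (Fin n) ℚ) : SimpleGraph (Fin n) :=
  SimpleGraph.fromRel fun i j => A i j ≠ 0

/-- The treewidth of a matrix. -/
noncomputable def Matrix.treewidth {n : ℕ} (A : Matrix (Fin n) (Fin n) ℚ) : ℕ :=
  A.supportGraph.treewidth

/-! ### Unconstrained MAP inference -/

/-- The principal minor `det (A_{S,S})` (equal to `1` for `S = ∅`). -/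
def Matrix.principalMinor {n : ℕ} (A : Matrix (Fin n) (Fin n) ℚ) (S : Finset (Fin n)) : ℚ :=
  (A.submatrix (fun i : S => (i : Fin n)) (fun i : S => (i : Fin n))).det

/-- The optimum of unconstrained MAP inference: the maximum of all principal minors. -/
def Matrix.mapOpt {n : ℕ} (A : Matrix (Fin n) (Fin n) ℚ) : ℚ :=
  Finset.univ.sup' Finset.univ_nonempty A.principalMinor

/-- `S` is a `ρ`-approximation to unconstrained MAP inference on `A`. -/
def Matrix.IsMapApprox {n : ℕ} (A : Matrix (Fin n) (Fin n) ℚ) (ρ : ℝ) (S : Finset (Fin n)) :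
    Prop :=
  (1 / ρ) * (A.mapOpt : ℝ) ≤ (A.principalMinor S : ℝ)

/-! ### Bit sizes -/

/-- The number of bits of a rational `p / q` in lowest terms:
`1 + ⌈log₂ (|p| + 1)⌉ + ⌈log₂ (q + 1)⌉`. -/
def ratSize (x : ℚ) : ℕ :=
  1 + Nat.clog 2 (x.num.natAbs + 1) + Nat.clog 2 (x.den + 1)

/-- The number of bits of a rational matrix. -/
def Matrix.bitSize {n : ℕ} (A : Matrix (Fin n) (Fin n) ℚ) : ℕ :=
  n * n + ∑ i, ∑ j, ratSize (A i j)

/-! ### Randomized unit-cost random-access machines -/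

namespace RAM

/-- The instructions of a unit-cost random-access machine that computes with rational numbers.
It has registers `r₀, r₁, …`, addressed directly, and a memory `M[0], M[1], …`, addressed through
registers. Labels are positions in the program. -/
inductive Instr where
  /-- `r_d := q` -/
  | const (d : ℕ) (q : ℚ)
  /-- `r_d := r_a` -/
  | copy (d a : ℕ)
  /-- `r_d := r_a + r_b` -/
  | add (d a b : ℕ)
  /-- `r_d := r_a - r_b` -/
  | sub (d a b : ℕ)
  /-- `r_d := r_a * r_b` -/
  | mul (d a b : ℕ)
  /-- `r_d := r_a / r_b`, with the value `0` if `r_b = 0` -/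
  | div (d a b : ℕ)
  /-- `r_d := M[r_a]` -/
  | load (d a : ℕ)
  /-- `M[r_d] := r_a` -/
  | store (d a : ℕ)
  /-- go to `l` -/
  | jump (l : ℕ)
  /-- if `r_a < r_b`, go to `l` -/
  | jumpLt (a b l : ℕ)
  /-- if `r_a = r_b`, go to `l` -/
  | jumpEq (a b l : ℕ)
  /-- `r_d := 0` or `r_d := 1`, according to a fresh fair coin -/
  | coin (d : ℕ)

/-- A program is a finite list of instructions. -/
abbrev Program := List Instr

/-- A configuration: program counter, number of coins tossed so far, registers and memory. -/
@[ext] structure Config where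
  pc : ℕ
  tossed : ℕ
  reg : ℕ → ℚ
  mem : ℕ → ℚ

/-- Assign the value `x` to the register `r_d` and go to the next instruction. -/
def Config.assign (c : Config) (d : ℕ) (x : ℚ) : Config :=
  { c with pc := c.pc + 1, reg := Function.update c.reg d x }

/-- The effect of one instruction; `ω k` is the outcome of the `k`-th coin. An access to a memory
address that is not a natural number makes the machine hang: it stays in its configuration
forever, and so it never halts. -/
def Instr.exec (ω : ℕ → Bool) (c : Config) : Instr → Config
  | .const d q => c.assign d q
  | .copy d a => c.assign d (c.reg a)
  | .add d a b => c.assign d (c.reg a + c.reg b)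
  | .sub d a b => c.assign d (c.reg a - c.reg b)
  | .mul d a b => c.assign d (c.reg a * c.reg b)
  | .div d a b => c.assign d (c.reg a / c.reg b)
  | .load d a =>
      if c.reg a = ((c.reg a).num.toNat : ℚ) then c.assign d (c.mem (c.reg a).num.toNat) else c
  | .store d a =>
      if c.reg d = ((c.reg d).num.toNat : ℚ) then
        { c with pc := c.pc + 1, mem := Function.update c.mem (c.reg d).num.toNat (c.reg a) }
      else c
  | .jump l => { c with pc := l }
  | .jumpLt a b l => { c with pc := if c.reg a < c.reg b then l else c.pc + 1 }
  | .jumpEq a b l => { c with pc := if c.reg a = c.reg b then l else c.pc + 1 }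
  | .coin d => { c.assign d (if ω c.tossed then 1 else 0) with tossed := c.tossed + 1 }

/-- One step of the machine. The machine has halted once the program counter has left the
program. -/
def step (P : Program) (ω : ℕ → Bool) (c : Config) : Config :=
  match P[c.pc]? with
  | some i => i.exec ω c
  | none => c

/-- The machine has halted. -/
def Halted (P : Program) (c : Config) : Prop := P.length ≤ c.pc

/-- The initial configuration on an `n × n` matrix `A`: `r₀ = n`, the memory holds the entries of
`A` row by row (so that `M[i * n + j] = A i j` for `i, j < n`), everything else is `0`. -/
def init {n : ℕ} (A : Matrix (Fin n) (Fin n) ℚ) : Config where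
  pc := 0
  tossed := 0
  reg := fun k => if k = 0 then (n : ℚ) else 0
  mem := fun a => if h : a < n * n then
    A ⟨a / n, Nat.div_lt_of_lt_mul h⟩
      ⟨a % n, Nat.mod_lt _ (Nat.pos_of_ne_zero fun h0 => by simp [h0] at h)⟩
    else 0

/-- The configuration reached from input `A` after `t` steps with coin outcomes `ω`. -/
def run (P : Program) {n : ℕ} (A : Matrix (Fin n) (Fin n) ℚ) (ω : ℕ → Bool) (t : ℕ) : Config :=
  (step P ω)^[t] (init A)

/-- The set `S ⊆ [n]` described by a configuration: `i ∈ S` if and only if `M[i] = 1`. -/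
def Config.outputSet (c : Config) (n : ℕ) : Finset (Fin n) :=
  {i | c.mem i = 1}

/-- On input `A` and coin outcomes `ω`, the program halts within `T` steps. -/
def HaltsWithin (P : Program) {n : ℕ} (A : Matrix (Fin n) (Fin n) ℚ) (ω : ℕ → Bool) (T : ℝ) :
    Prop :=
  ∃ t : ℕ, (t : ℝ) ≤ T ∧ Halted P (run P A ω t)

/-- On input `A` and coin outcomes `ω`, the program halts with output `S`. -/
def Outputs (P : Program) {n : ℕ} (A : Matrix (Fin n) (Fin n) ℚ) (ω : ℕ → Bool)
    (S : Finset (Fin n)) : Prop :=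
  ∃ t : ℕ, Halted P (run P A ω t) ∧ (run P A ω t).outputSet n = S

/-- On input `A` and coin outcomes `ω`, all numbers that are ever in the registers or in the memory
have at most `B` bits. -/
def NumbersBounded (P : Program) {n : ℕ} (A : Matrix (Fin n) (Fin n) ℚ) (ω : ℕ → Bool) (B : ℕ) :
    Prop :=
  ∀ t k : ℕ, ratSize ((run P A ω t).reg k) ≤ B ∧ ratSize ((run P A ω t).mem k) ≤ B

/-- The law of an infinite sequence of independent fair coins. -/
noncomputable def fairCoins : MeasureTheory.Measure (ℕ → Bool) :=
  MeasureTheory.Measure.infinitePi fun _ => (PMF.uniformOfFintype Bool).toMeasure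

end RAM

/-! ### A structured language with bounded loops, and its compilation to the machine -/

set_option linter.unusedSimpArgs false

namespace Imp

/-! Let `p` be `√n` rounded up. A set `S` with `det(A_T)^p ≤ 2^n det(A_S)^p` for all `T` is a
`2^√n`-approximation, by taking `p`-th roots. Such a set is found by conditional sums
(`Rounded.step`, `Rounded.last`): decide vertex by vertex whether it belongs to `S`, always keeping
the larger half of `∑_S det(A_S)^p`. The terms are nonnegative, and each of the `n` decisions loses
at most a factor 2. So it suffices to evaluate weighted sums `powSum` exactly. No coin is needed,
and the success probability is one.

The sums are evaluated by dynamic programming over separators. Let `D` be a set of vertices behind a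
separator with `k` places. What a subset `S ⊆ D` passes on to the rest is its determinant and the
matrix `K_S` that eliminating `S` subtracts on the separator; there are too many such matrices to
list them. Instead one stores the single element `∑_S wt(S) det(A_S)^p exp(-∑ ψ K_S ψ')` of a
Grassmann algebra, the inner sum running over `p` copies of the separator (`Rep`). It has `2^(2pk)`
coefficients. Sets `D` without edges between them multiply (`Rep.union`). A vertex `u` is eliminated
by `Rep.elim`: leaving `u` out means setting its generators to zero; taking it means multiplying by
its edges and integrating over its generators, which gives the `p`-th power of the pivot times the
Gaussian element of the next Schur complement (`integs_gauss`). The computation never divides, so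
all numbers have a controlled common denominator, and the ℓ¹ norms of tables are submultiplicative
(`Bt.tmul`, `bt_elim`). Vanishing pivots are harmless, because positive semidefiniteness makes the
whole row vanish (`Psd.pivot_zero`, `integs_gauss_zero`).

No tree decomposition is given. A position assigns a vertex, or nothing, to each of `k` slots. A
component of the unoccupied graph can be eliminated if a slot that does not touch it can move into
it so that all components left can be eliminated in turn. All `(n+1)^k` positions are searched. A
tree decomposition of width `w` gives a strategy with `w + 1` slots (`win_of_treeDecomposition`):
occupy the vertices in the order of the depths of their topmost bags. Since `k = 1, 2, …` are tried
in turn, `k` never exceeds `w + 1`, and `n + 1 ≤ 2^(2√n)` turns `(n+1)^k 2^(2pk)` into `2^O(w√n)`.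
Treewidth 0 means a diagonal matrix; there the time bound is polynomial and the optimum is read off
from the diagonal.

The algorithm is written in a language of bounded loops with a verified compiler. By `Cmd.sim` the
running time is at most a fixed power of the largest loop length, and the constant `C` absorbs that
power. -/

/-- A state: natural variables, arrays of naturals, arrays of rationals. -/
structure St where
  nv : ℕ → ℕ
  na : Fin 16 → ℕ → ℕ
  qa : Fin 16 → ℕ → ℚ

def St.setV (σ : St) (i m : ℕ) : St := { σ with nv := Function.update σ.nv i m }

def St.setN (σ : St) (r : Fin 16) (a m : ℕ) : St :=
  { σ with na := Function.update σ.na r (Function.update (σ.na r) a m) }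

def St.setQ (σ : St) (r : Fin 16) (a : ℕ) (x : ℚ) : St :=
  { σ with qa := Function.update σ.qa r (Function.update (σ.qa r) a x) }

/-- Natural expressions. -/
inductive NE where
  | lit (m : ℕ)
  | var (i : ℕ)
  | rd (r : Fin 16) (e : NE)
  | add (a b : NE)
  | mul (a b : NE)
  | sub (a b : NE)

/-- Rational expressions. -/
inductive QE where
  | nat (e : NE)
  | rd (r : Fin 16) (e : NE)
  | add (a b : QE)
  | mul (a b : QE)
  | sub (a b : QE)

/-- Tests. -/
inductive BE where
  | lt (a b : QE)
  | eq (a b : QE)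

/-- Commands. `loop i e c` runs `c` with `i = 0, 1, …, e - 1`. -/
inductive Cmd where
  | skip
  | set (i : ℕ) (e : NE)
  | nwr (r : Fin 16) (a e : NE)
  | qwr (r : Fin 16) (a : NE) (e : QE)
  | seq (c₁ c₂ : Cmd)
  | ite (b : BE) (c₁ c₂ : Cmd)
  | loop (i : ℕ) (e : NE) (c : Cmd)

def NE.eval (σ : St) : NE → ℕ
  | .lit m => m
  | .var i => σ.nv i
  | .rd r e => σ.na r (e.eval σ)
  | .add a b => a.eval σ + b.eval σ
  | .mul a b => a.eval σ * b.eval σ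
  | .sub a b => a.eval σ - b.eval σ

def QE.eval (σ : St) : QE → ℚ
  | .nat e => e.eval σ
  | .rd r e => σ.qa r (e.eval σ)
  | .add a b => a.eval σ + b.eval σ
  | .mul a b => a.eval σ * b.eval σ
  | .sub a b => a.eval σ - b.eval σ

def BE.eval (σ : St) : BE → Prop
  | .lt a b => a.eval σ < b.eval σ
  | .eq a b => a.eval σ = b.eval σ

/-- The states at the beginning of the iterations of a loop. -/
def loopSt (i : ℕ) (f : St → St) (σ : St) : ℕ → St
  | 0 => σ
  | j + 1 => f ((loopSt i f σ j).setV i j)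

open Classical in
noncomputable def Cmd.run : Cmd → St → St
  | .skip, σ => σ
  | .set i e, σ => σ.setV i (e.eval σ)
  | .nwr r a e, σ => σ.setN r (a.eval σ) (e.eval σ)
  | .qwr r a e, σ => σ.setQ r (a.eval σ) (e.eval σ)
  | .seq c₁ c₂, σ => c₂.run (c₁.run σ)
  | .ite b c₁ c₂, σ => if b.eval σ then c₁.run σ else c₂.run σ
  | .loop i e c, σ => loopSt i c.run σ (e.eval σ)

/-- Resource bounds: the size of the input array, a bound on all naturals, a bound on all lengths
of loops, and a predicate on all rationals. -/
structure Par where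
  inp : ℕ
  NB : ℕ
  B : ℕ
  V : ℚ → Prop

/-- In the clause for `sub` the inequality is needed because evaluation truncates whereas the
machine subtracts rationals; the two agree only if nothing is truncated. -/
def NE.Ok (Γ : Par) (σ : St) : NE → Prop
  | .lit m => m ≤ Γ.NB
  | .var _ => True
  | .rd _ e => e.Ok Γ σ ∧ e.eval σ ≤ Γ.NB
  | .add a b => a.Ok Γ σ ∧ b.Ok Γ σ ∧ a.eval σ + b.eval σ ≤ Γ.NB
  | .mul a b => a.Ok Γ σ ∧ b.Ok Γ σ ∧ a.eval σ * b.eval σ ≤ Γ.NB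
  | .sub a b => a.Ok Γ σ ∧ b.Ok Γ σ ∧ b.eval σ ≤ a.eval σ ∧ a.eval σ ≤ Γ.NB

/-- Array 0 is the input, kept in place at the addresses below `inp`. A larger index would run into
the other arrays, hence the extra condition for `r = 0`. -/
def QE.Ok (Γ : Par) (σ : St) : QE → Prop
  | .nat e => e.Ok Γ σ
  | .rd r e => e.Ok Γ σ ∧ e.eval σ ≤ Γ.NB ∧ (r = 0 → e.eval σ < Γ.inp)
  | .add a b => a.Ok Γ σ ∧ b.Ok Γ σ ∧ Γ.V (a.eval σ + b.eval σ)
  | .mul a b => a.Ok Γ σ ∧ b.Ok Γ σ ∧ Γ.V (a.eval σ * b.eval σ)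
  | .sub a b => a.Ok Γ σ ∧ b.Ok Γ σ ∧ Γ.V (a.eval σ - b.eval σ)

def BE.Ok (Γ : Par) (σ : St) : BE → Prop
  | .lt a b => a.Ok Γ σ ∧ b.Ok Γ σ
  | .eq a b => a.Ok Γ σ ∧ b.Ok Γ σ

def Cmd.Safe (Γ : Par) : Cmd → St → Prop
  | .skip, _ => True
  | .set _ e, σ => e.Ok Γ σ
  | .nwr _ a e, σ => a.Ok Γ σ ∧ a.eval σ ≤ Γ.NB ∧ e.Ok Γ σ
  | .qwr r a e, σ => a.Ok Γ σ ∧ a.eval σ ≤ Γ.NB ∧ (r = 0 → a.eval σ < Γ.inp) ∧ e.Ok Γ σ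
  | .seq c₁ c₂, σ => c₁.Safe Γ σ ∧ c₂.Safe Γ (c₁.run σ)
  | .ite b c₁ c₂, σ => b.Ok Γ σ ∧ (b.eval σ → c₁.Safe Γ σ) ∧ (¬ b.eval σ → c₂.Safe Γ σ)
  | .loop i e c, σ => e.Ok Γ σ ∧ e.eval σ ≤ Γ.B ∧
      ∀ j < e.eval σ, c.Safe Γ ((loopSt i c.run σ j).setV i j)

/-! #### Compilation -/

open RAM

/-- Temporary registers. -/
abbrev T (t : ℕ) : ℕ := 4 * t + 1

/-- Address computation for array slot `m`: register 7 holds the stride 32, register 3 the offset. -/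
def adr (m t : ℕ) : List Instr :=
  [.mul (T t) (T t) 7, .const (T (t + 1)) m, .add (T t) (T t) (T (t + 1)), .add (T t) (T t) 3]

def adrQ (r : Fin 16) (t : ℕ) : List Instr := if r = 0 then [] else adr (2 * r + 1) t

def NE.code : NE → ℕ → List Instr
  | .lit m, t => [.const (T t) m]
  | .var i, t => [.copy (T t) (4 * i)]
  | .rd r e, t => e.code t ++ (adr (2 * r) t ++ [.load (T t) (T t)])
  | .add a b, t => a.code t ++ (b.code (t + 1) ++ [.add (T t) (T t) (T (t + 1))])
  | .mul a b, t => a.code t ++ (b.code (t + 1) ++ [.mul (T t) (T t) (T (t + 1))])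
  | .sub a b, t => a.code t ++ (b.code (t + 1) ++ [.sub (T t) (T t) (T (t + 1))])

def QE.code : QE → ℕ → List Instr
  | .nat e, t => e.code t
  | .rd r e, t => e.code t ++ (adrQ r t ++ [.load (T t) (T t)])
  | .add a b, t => a.code t ++ (b.code (t + 1) ++ [.add (T t) (T t) (T (t + 1))])
  | .mul a b, t => a.code t ++ (b.code (t + 1) ++ [.mul (T t) (T t) (T (t + 1))])
  | .sub a b, t => a.code t ++ (b.code (t + 1) ++ [.sub (T t) (T t) (T (t + 1))])

def BE.code : BE → List Instr
  | .lt a b => a.code 0 ++ b.code 1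
  | .eq a b => a.code 0 ++ b.code 1

def BE.test : BE → ℕ → Instr
  | .lt _ _, l => .jumpLt (T 0) (T 1) l
  | .eq _ _, l => .jumpEq (T 0) (T 1) l

/-- Counter of a loop at nesting depth `d`. -/
abbrev CT (d : ℕ) : ℕ := 8 * d + 2

/-- Bound of a loop at nesting depth `d`. -/
abbrev BD (d : ℕ) : ℕ := 8 * d + 6

/-- The length depends neither on the position nor on the nesting depth, so jump targets beyond a
block are known before the block is compiled. -/
def Cmd.len : Cmd → ℕ
  | .skip => 0
  | .set _ e => (e.code 0).length + 1
  | .nwr _ a e => (a.code 0).length + 4 + (e.code 1).length + 1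
  | .qwr r a e => (a.code 0).length + (adrQ r 0).length + (e.code 1).length + 1
  | .seq c₁ c₂ => c₁.len + c₂.len
  | .ite b c₁ c₂ => b.code.length + 1 + c₂.len + 1 + c₁.len
  | .loop _ e c => (e.code 0).length + 4 + 1 + c.len + 2

/-- The code of a command at nesting depth `d` that is to be placed at position `pc`. -/
def Cmd.code : Cmd → ℕ → ℕ → List Instr
  | .skip, _, _ => []
  | .set i e, _, _ => e.code 0 ++ [.copy (4 * i) (T 0)]
  | .nwr r a e, _, _ => a.code 0 ++ (adr (2 * r) 0 ++ (e.code 1 ++ [.store (T 0) (T 1)]))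
  | .qwr r a e, _, _ => a.code 0 ++ (adrQ r 0 ++ (e.code 1 ++ [.store (T 0) (T 1)]))
  | .seq c₁ c₂, d, pc => c₁.code d pc ++ c₂.code d (pc + c₁.len)
  | .ite b c₁ c₂, d, pc =>
      b.code ++ ([b.test (pc + b.code.length + 1 + c₂.len + 1)] ++
        (c₂.code d (pc + b.code.length + 1) ++
          ([.jump (pc + b.code.length + 1 + c₂.len + 1 + c₁.len)] ++
            c₁.code d (pc + b.code.length + 1 + c₂.len + 1))))
  | .loop i e c, d, pc =>
      e.code 0 ++ ([.copy (BD d) (T 0), .const (CT d) 0,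
        .jumpLt (CT d) (BD d) (pc + (e.code 0).length + 4),
        .jump (pc + (e.code 0).length + 4 + 1 + c.len + 2), .copy (4 * i) (CT d)] ++
          (c.code (d + 1) (pc + (e.code 0).length + 4 + 1) ++
            [.add (CT d) (CT d) 11, .jump (pc + (e.code 0).length + 2)]))

theorem Cmd.code_length (c : Cmd) (d pc : ℕ) : (c.code d pc).length = c.len := by
  induction c generalizing d pc with
  | skip => rfl
  | set i e => simp [code, len]
  | nwr r a e => simp [code, len, adr]; omega
  | qwr r a e => simp [code, len]; omega
  | seq c₁ c₂ h₁ h₂ => simp [code, len, h₁, h₂]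
  | ite b c₁ c₂ h₁ h₂ => simp [code, len, h₁, h₂]; omega
  | loop i e c h => simp [code, len, h]; omega

/-! #### Simulation -/

/-- `code` occurs in `P` at position `pc`. -/
def CodeAt (P : Program) (pc : ℕ) (code : List Instr) : Prop :=
  ∀ j < code.length, P[pc + j]? = code[j]?

theorem CodeAt.left {P : Program} {pc : ℕ} {a b : List Instr} (h : CodeAt P pc (a ++ b)) :
    CodeAt P pc a := fun j hj => by
  rw [h j (by simp; omega), List.getElem?_append_left hj]

theorem CodeAt.right {P : Program} {pc : ℕ} {a b : List Instr} (h : CodeAt P pc (a ++ b)) :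
    CodeAt P (pc + a.length) b := fun j hj => by
  rw [add_assoc, h (a.length + j) (by simp; omega), List.getElem?_append_right (by omega)]
  congr 1; omega

theorem CodeAt.head {P : Program} {pc : ℕ} {i : Instr} {l : List Instr}
    (h : CodeAt P pc (i :: l)) : P[pc]? = some i := by
  simpa using h 0 (by simp)

theorem CodeAt.tail {P : Program} {pc : ℕ} {i : Instr} {l : List Instr}
    (h : CodeAt P pc (i :: l)) : CodeAt P (pc + 1) l :=
  CodeAt.right (a := [i]) h

/-- All numbers of a configuration satisfy `V`. -/
def AllV (V : ℚ → Prop) (c : Config) : Prop := ∀ k, V (c.reg k) ∧ V (c.mem k)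

/-- `c'` is reached from `c` in `t` steps, and all numbers on the way satisfy `V`. -/
def Run (P : Program) (ω : ℕ → Bool) (V : ℚ → Prop) (c c' : Config) (t : ℕ) : Prop :=
  (step P ω)^[t] c = c' ∧ ∀ s ≤ t, AllV V ((step P ω)^[s] c)

section Simulation

variable {P : Program} {ω : ℕ → Bool} {V : ℚ → Prop}

theorem Run.refl {c : Config} (h : AllV V c) : Run P ω V c c 0 :=
  ⟨rfl, fun s hs => by obtain rfl : s = 0 := by omega
                       exact h⟩

theorem Run.trans {c c' c'' : Config} {t t' : ℕ} (h : Run P ω V c c' t)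
    (h' : Run P ω V c' c'' t') : Run P ω V c c'' (t + t') := by
  refine ⟨by rw [add_comm, Function.iterate_add_apply, h.1, h'.1], fun s hs => ?_⟩
  rcases le_total s t with hst | hst
  · exact h.2 s hst
  · obtain ⟨r, rfl⟩ := Nat.exists_eq_add_of_le hst
    rw [add_comm, Function.iterate_add_apply, h.1]
    exact h'.2 r (by omega)

theorem Run.allV {c c' : Config} {t : ℕ} (h : Run P ω V c c' t) : AllV V c' := by
  rw [← h.1]; exact h.2 t le_rfl

theorem Run.single {c : Config} {i : Instr} (hi : P[c.pc]? = some i) (h : AllV V c)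
    (h' : AllV V (i.exec ω c)) : Run P ω V c (i.exec ω c) 1 := by
  have hs : step P ω c = i.exec ω c := by simp [step, hi]
  refine ⟨hs, fun s hs' => ?_⟩
  rcases Nat.le_one_iff_eq_zero_or_eq_one.mp hs' with rfl | rfl
  · exact h
  · rw [Function.iterate_one, hs]; exact h'

theorem AllV.assign {c : Config} (h : AllV V c) (d : ℕ) {x : ℚ} (hx : V x) :
    AllV V (c.assign d x) := fun k => by
  refine ⟨?_, (h k).2⟩
  simp only [Config.assign, Function.update_apply]
  split_ifs
  · exact hx
  · exact (h k).1

theorem Run.assign {c : Config} {i : Instr} {d : ℕ} {x : ℚ} (hi : P[c.pc]? = some i)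
    (he : i.exec ω c = c.assign d x) (h : AllV V c) (hx : V x) :
    Run P ω V c (c.assign d x) 1 := by
  rw [← he]; exact Run.single hi h (by rw [he]; exact h.assign d hx)

/-- The address of a cell of an array of naturals. -/
def locN (inp : ℕ) (r : Fin 16) (a : ℕ) : ℕ := inp + 32 * a + 2 * r

/-- The address of a cell of an array of rationals; array `0` is the input. -/
def locQ (inp : ℕ) (r : Fin 16) (a : ℕ) : ℕ := if r = 0 then a else inp + 32 * a + 2 * r + 1

/-- The configuration `c` represents the state `σ`. -/
structure Rel (Γ : Par) (σ : St) (c : Config) : Prop where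
  nv : ∀ i, c.reg (4 * i) = σ.nv i
  off : c.reg 3 = Γ.inp
  stride : c.reg 7 = 32
  one : c.reg 11 = 1
  na : ∀ r a, c.mem (locN Γ.inp r a) = σ.na r a
  qa : ∀ r a, (r = 0 → a < Γ.inp) → c.mem (locQ Γ.inp r a) = σ.qa r a

/-- The registers `j` that an expression evaluated at level `t` may change. -/
def IsTemp (t j : ℕ) : Prop := ∃ s ≥ t, j = T s

/-- Registers are sorted by their residue modulo 4: variables (0), temporaries (1), counters and
bounds of loops (2), and the constants in registers 3, 7 and 11 (3). -/
theorem not_isTemp_of_mod {t j : ℕ} (h : j % 4 ≠ 1) : ¬ IsTemp t j := by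
  rintro ⟨s, _, rfl⟩; simp only [T] at h; omega

/-- The effect of the evaluation of an expression. -/
def Eff (P : Program) (ω : ℕ → Bool) (V : ℚ → Prop) (c : Config) (l t : ℕ) (x : ℚ) : Prop :=
  ∃ ρ : ℕ → ℚ, Run P ω V c { c with pc := c.pc + l, reg := ρ } l ∧ ρ (T t) = x ∧
    ∀ j, ¬ IsTemp t j → ρ j = c.reg j

theorem Rel.of_reg {Γ : Par} {σ : St} {c : Config} (h : Rel Γ σ c) {pc t : ℕ} {ρ : ℕ → ℚ}
    (hρ : ∀ j, ¬ IsTemp t j → ρ j = c.reg j) : Rel Γ σ { c with pc := pc, reg := ρ } where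
  nv i := by rw [← h.nv i]; exact hρ _ (not_isTemp_of_mod (by omega))
  off := by rw [← h.off]; exact hρ _ (not_isTemp_of_mod (by omega))
  stride := by rw [← h.stride]; exact hρ _ (not_isTemp_of_mod (by omega))
  one := by rw [← h.one]; exact hρ _ (not_isTemp_of_mod (by omega))
  na := h.na
  qa := h.qa

theorem Eff.of_assign {c : Config} {i : Instr} {t : ℕ} {x : ℚ} (hi : P[c.pc]? = some i)
    (he : i.exec ω c = c.assign (T t) x) (h : AllV V c) (hx : V x) : Eff P ω V c 1 t x := by
  refine ⟨_, Run.assign hi he h hx, by simp, fun j hj => ?_⟩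
  have : j ≠ T t := fun e => hj ⟨t, le_rfl, e⟩
  simp [this]

/-- An evaluation at level `t'` touches only temporaries of level at least `t'`, so an earlier
result at a lower level survives it. -/
theorem Eff.trans {c : Config} {l l' t t' : ℕ} {x x' : ℚ} (h : Eff P ω V c l t x) (ht : t ≤ t')
    (h' : ∀ ρ, Run P ω V c { c with pc := c.pc + l, reg := ρ } l → ρ (T t) = x →
      (∀ j, ¬ IsTemp t j → ρ j = c.reg j) →
      Eff P ω V { c with pc := c.pc + l, reg := ρ } l' t' x') :
    ∃ ρ : ℕ → ℚ, Run P ω V c { c with pc := c.pc + (l + l'), reg := ρ } (l + l') ∧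
      (t < t' → ρ (T t) = x) ∧ ρ (T t') = x' ∧ ∀ j, ¬ IsTemp t j → ρ j = c.reg j := by
  obtain ⟨ρ, hr, hx, hj⟩ := h
  obtain ⟨ρ', hr', hx', hj'⟩ := h' ρ hr hx hj
  refine ⟨ρ', by simpa [add_assoc] using hr.trans hr', fun htt => ?_, hx', fun j hjt => ?_⟩
  · rw [hj' (T t) (by rintro ⟨s, hs, e⟩; simp only [T] at e; omega)]; exact hx
  · rw [hj' j (by rintro ⟨s, hs, e⟩; exact hjt ⟨s, by omega, e⟩)]; exact hj j hjt

theorem Eff.seq {c : Config} {l l' t : ℕ} {x x' : ℚ} (h : Eff P ω V c l t x)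
    (h' : ∀ ρ, Run P ω V c { c with pc := c.pc + l, reg := ρ } l → ρ (T t) = x →
      (∀ j, ¬ IsTemp t j → ρ j = c.reg j) →
      Eff P ω V { c with pc := c.pc + l, reg := ρ } l' t x') : Eff P ω V c (l + l') t x' := by
  obtain ⟨ρ, h₁, -, h₂, h₃⟩ := h.trans le_rfl h'
  exact ⟨ρ, h₁, h₂, h₃⟩

theorem Eff.binop {Γ : Par} {c : Config} {l l' t : ℕ} {x y z : ℚ} {σ : St} {i : Instr}
    (hrel : Rel Γ σ c) (h : Eff P ω V c l t x)
    (h' : ∀ c', c'.pc = c.pc + l → AllV V c' → Rel Γ σ c' → Eff P ω V c' l' (t + 1) y)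
    (hi : P[c.pc + l + l']? = some i)
    (he : ∀ c' : Config, c'.reg (T t) = x → c'.reg (T (t + 1)) = y →
      i.exec ω c' = c'.assign (T t) z) (hz : V z) : Eff P ω V c (l + (l' + 1)) t z := by
  obtain ⟨ρ, h₁, h₂, h₃, h₄⟩ := h.trans (Nat.le_succ t)
    (fun ρ hr _ hj => h' _ rfl hr.allV (hrel.of_reg hj))
  have h₅ := Run.assign (c := { c with pc := c.pc + (l + l'), reg := ρ }) (d := T t) (x := z)
    (by simpa [add_assoc] using hi) (he _ (h₂ (Nat.lt_succ_self t)) h₃) h₁.allV hz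
  refine ⟨Function.update ρ (T t) z, by simpa [add_assoc, Config.assign] using h₁.trans h₅,
    by simp, fun j hj => ?_⟩
  have : j ≠ T t := fun e => hj ⟨t, le_rfl, e⟩
  simp [this, h₄ j hj]

/-- The assumptions on the bounds: naturals up to `32 * NB + 64 + inp + B` satisfy `V`. -/
def Par.Wf (Γ : Par) : Prop := ∀ m : ℕ, m ≤ 32 * Γ.NB + 64 + Γ.inp + Γ.B → Γ.V m

theorem eff_adr {Γ : Par} (hΓ : Γ.Wf) {c : Config} {σ : St} {t m a : ℕ} (hc : CodeAt P c.pc (adr m t))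
    (hrel : Rel Γ σ c) (hV : AllV Γ.V c) (hx : c.reg (T t) = a) (ha : a ≤ Γ.NB) (hm : m < 32) :
    Eff P ω Γ.V c 4 t ((Γ.inp + 32 * a + m : ℕ) : ℚ) := by
  have h1 : Eff P ω Γ.V c 1 t ((32 * a : ℕ) : ℚ) :=
    Eff.of_assign hc.head (by simp [Instr.exec, hx, hrel.stride, mul_comm]) hV (hΓ _ (by omega))
  have h2 : Eff P ω Γ.V c (1 + (1 + 1)) t ((32 * a + m : ℕ) : ℚ) := by
    refine Eff.binop hrel h1 (y := m) (i := .add (T t) (T t) (T (t + 1)))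
      (fun c' hc' hV' _ => Eff.of_assign (i := .const (T (t + 1)) m) (by rw [hc']; exact hc.tail.head)
        rfl hV' (hΓ _ (by omega))) hc.tail.tail.head ?_ (hΓ _ (by omega))
    intro c' e1 e2
    simp [Instr.exec, e1, e2]
  have := h2.seq (l' := 1) (x' := ((Γ.inp + 32 * a + m : ℕ) : ℚ)) (fun ρ hr e hj => by
    refine Eff.of_assign hc.tail.tail.tail.head ?_ hr.allV (hΓ _ (by omega))
    have : ρ 3 = Γ.inp := by rw [← hrel.off]; exact hj _ (not_isTemp_of_mod (by omega))
    simp only [Instr.exec, e, this]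
    congr 1; push_cast; ring)
  exact this

theorem exec_load {c : Config} {d a m : ℕ} (h : c.reg a = m) :
    (Instr.load d a).exec ω c = c.assign d (c.mem m) := by
  simp [Instr.exec, h]

theorem exec_store {c : Config} {d a m : ℕ} (h : c.reg d = m) :
    (Instr.store d a).exec ω c =
      { c with pc := c.pc + 1, mem := Function.update c.mem m (c.reg a) } := by
  simp [Instr.exec, h]

theorem NE.eff {Γ : Par} (hΓ : Γ.Wf) {σ : St} (e : NE) : ∀ {t : ℕ} {c : Config},
    CodeAt P c.pc (e.code t) → Rel Γ σ c → AllV Γ.V c → e.Ok Γ σ →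
      Eff P ω Γ.V c (e.code t).length t (e.eval σ) := by
  induction e with
  | lit m =>
    intro t c hc hrel hV hok
    exact Eff.of_assign hc.head rfl hV (hΓ _ (by have : m ≤ Γ.NB := hok
                                                 simp only [NE.eval]; omega))
  | var i =>
    intro t c hc hrel hV hok
    exact Eff.of_assign hc.head (by simp [Instr.exec, hrel.nv, NE.eval]) hV
      (by simp only [NE.eval]; rw [← hrel.nv]; exact (hV _).1)
  | rd r e ih =>
    intro t c hc hrel hV hok
    simp only [NE.code, List.length_append]
    refine (ih hc.left hrel hV hok.1).seq fun ρ hr hx hj => ?_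
    have hlen : (adr (2 * (r : ℕ)) t).length = 4 := rfl
    have hr4 := r.isLt
    rw [hlen]
    refine (eff_adr hΓ (a := e.eval σ) (σ := σ) hc.right.left (hrel.of_reg hj) hr.allV hx hok.2
      (by omega)).seq fun ρ' hr' hx' hj' => ?_
    have hm := hrel.na r (e.eval σ)
    refine Eff.of_assign hc.right.right.head ?_ hr'.allV ?_
    · rw [exec_load hx']; simp only [NE.eval]; rw [← hm]; rfl
    · simp only [NE.eval]; rw [← hm]; exact (hV _).2
  | add a b iha ihb =>
    intro t c hc hrel hV hok
    simp only [NE.code, List.length_append]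
    refine Eff.binop (z := (NE.eval σ (.add a b) : ℚ)) hrel (iha hc.left hrel hV hok.1)
      (fun c' hpc hV' hrel' => ihb (hpc ▸ hc.right.left) hrel' hV' hok.2.1)
      hc.right.right.head (fun c' h1 h2 => by simp [Instr.exec, h1, h2, NE.eval]) (hΓ _ ?_)
    have := hok.2.2; simp only [NE.eval]; omega
  | mul a b iha ihb =>
    intro t c hc hrel hV hok
    simp only [NE.code, List.length_append]
    refine Eff.binop (z := (NE.eval σ (.mul a b) : ℚ)) hrel (iha hc.left hrel hV hok.1)
      (fun c' hpc hV' hrel' => ihb (hpc ▸ hc.right.left) hrel' hV' hok.2.1)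
      hc.right.right.head (fun c' h1 h2 => by simp [Instr.exec, h1, h2, NE.eval]) (hΓ _ ?_)
    have := hok.2.2; simp only [NE.eval]; omega
  | sub a b iha ihb =>
    intro t c hc hrel hV hok
    simp only [NE.code, List.length_append]
    have hab := hok.2.2
    refine Eff.binop (z := (NE.eval σ (.sub a b) : ℚ)) hrel (iha hc.left hrel hV hok.1)
      (fun c' hpc hV' hrel' => ihb (hpc ▸ hc.right.left) hrel' hV' hok.2.1)
      hc.right.right.head (fun c' h1 h2 => by simp [Instr.exec, h1, h2, NE.eval, hab.1]) (hΓ _ ?_)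
    simp only [NE.eval]; omega

theorem QE.eff {Γ : Par} (hΓ : Γ.Wf) {σ : St} (e : QE) : ∀ {t : ℕ} {c : Config},
    CodeAt P c.pc (e.code t) → Rel Γ σ c → AllV Γ.V c → e.Ok Γ σ →
      Eff P ω Γ.V c (e.code t).length t (e.eval σ) := by
  induction e with
  | nat e => exact fun hc hrel hV hok => NE.eff hΓ e hc hrel hV hok
  | rd r e =>
    intro t c hc hrel hV hok
    simp only [QE.code, List.length_append]
    refine (NE.eff hΓ e hc.left hrel hV hok.1).seq fun ρ hr hx hj => ?_
    have hm := hrel.qa r (e.eval σ) hok.2.2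
    have hr4 := r.isLt
    by_cases h0 : r = 0
    · have hc' := hc.right
      simp only [adrQ, if_pos h0, List.nil_append, List.length_nil, zero_add] at hc' ⊢
      refine Eff.of_assign hc'.head ?_ hr.allV ?_
      · rw [exec_load hx]; simp only [QE.eval]; rw [← hm, locQ, if_pos h0]
      · simp only [QE.eval]; rw [← hm]; exact (hV _).2
    · have hc' := hc.right
      simp only [adrQ, if_neg h0] at hc' ⊢
      refine (eff_adr hΓ (a := e.eval σ) (σ := σ) hc'.left (hrel.of_reg hj) hr.allV hx hok.2.1
        (by omega)).seq fun ρ' hr' hx' hj' => ?_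
      refine Eff.of_assign hc'.right.head ?_ hr'.allV ?_
      · rw [exec_load hx']; simp only [QE.eval]; rw [← hm, locQ, if_neg h0]; rfl
      · simp only [QE.eval]; rw [← hm]; exact (hV _).2
  | add a b iha ihb =>
    intro t c hc hrel hV hok
    simp only [QE.code, List.length_append]
    exact Eff.binop (z := QE.eval σ (.add a b)) hrel (iha hc.left hrel hV hok.1)
      (fun c' hpc hV' hrel' => ihb (hpc ▸ hc.right.left) hrel' hV' hok.2.1)
      hc.right.right.head (fun c' h1 h2 => by simp [Instr.exec, h1, h2, QE.eval]) hok.2.2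
  | mul a b iha ihb =>
    intro t c hc hrel hV hok
    simp only [QE.code, List.length_append]
    exact Eff.binop (z := QE.eval σ (.mul a b)) hrel (iha hc.left hrel hV hok.1)
      (fun c' hpc hV' hrel' => ihb (hpc ▸ hc.right.left) hrel' hV' hok.2.1)
      hc.right.right.head (fun c' h1 h2 => by simp [Instr.exec, h1, h2, QE.eval]) hok.2.2
  | sub a b iha ihb =>
    intro t c hc hrel hV hok
    simp only [QE.code, List.length_append]
    exact Eff.binop (z := QE.eval σ (.sub a b)) hrel (iha hc.left hrel hV hok.1)
      (fun c' hpc hV' hrel' => ihb (hpc ▸ hc.right.left) hrel' hV' hok.2.1)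
      hc.right.right.head (fun c' h1 h2 => by simp [Instr.exec, h1, h2, QE.eval]) hok.2.2

/-- Evaluation of two expressions into the registers `T 0` and `T 1`. -/
theorem eff_pair {Γ : Par} {σ : St} {c : Config} {l l' : ℕ} {x y : ℚ} (hrel : Rel Γ σ c)
    (h : Eff P ω V c l 0 x)
    (h' : ∀ c', c'.pc = c.pc + l → AllV V c' → Rel Γ σ c' → Eff P ω V c' l' 1 y) :
    ∃ ρ : ℕ → ℚ, Run P ω V c { c with pc := c.pc + (l + l'), reg := ρ } (l + l') ∧
      ρ (T 0) = x ∧ ρ (T 1) = y ∧ ∀ j, ¬ IsTemp 0 j → ρ j = c.reg j := by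
  obtain ⟨ρ, h₁, h₂, h₃, h₄⟩ := h.trans (Nat.le_succ 0)
    (fun ρ hr _ hj => h' _ rfl hr.allV (hrel.of_reg hj))
  exact ⟨ρ, h₁, h₂ one_pos, h₃, h₄⟩

/-- The offset of an array is below the stride 32, so the array and the index can be recovered from
the address. Even offsets belong to naturals and odd ones to rationals. -/
theorem loc_injective {inp : ℕ} {r r' : Fin 16} {a a' : ℕ} (h : locN inp r a = locN inp r' a') :
    r = r' ∧ a = a' := by
  simp only [locN] at h
  have := r.isLt; have := r'.isLt
  exact ⟨Fin.ext (by omega), by omega⟩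

theorem locQ_injective {inp : ℕ} {r r' : Fin 16} {a a' : ℕ} (hr : r = 0 → a < inp)
    (hr' : r' = 0 → a' < inp) (h : locQ inp r a = locQ inp r' a') : r = r' ∧ a = a' := by
  simp only [locQ] at h
  have := r.isLt; have := r'.isLt
  split_ifs at h with h1 h2 h2
  · exact ⟨h1.trans h2.symm, h⟩
  · have := hr h1; omega
  · have := hr' h2; omega
  · exact ⟨Fin.ext (by omega), by omega⟩

theorem locN_ne_locQ {inp : ℕ} {r r' : Fin 16} {a a' : ℕ} (hr' : r' = 0 → a' < inp) :
    locN inp r a ≠ locQ inp r' a' := by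
  simp only [locN, locQ]
  split_ifs with h
  · have := hr' h; omega
  · omega

theorem AllV.store {c : Config} (h : AllV V c) {a pc : ℕ} {x : ℚ} (hx : V x) :
    AllV V { c with pc := pc, mem := Function.update c.mem a x } := fun k => by
  refine ⟨(h k).1, ?_⟩
  simp only [Function.update_apply]
  split_ifs
  · exact hx
  · exact (h k).2

/-- `c'` agrees with `c` on the registers that hold the state of the loops of depth below `d`. -/
def KeepLoops (d : ℕ) (c c' : Config) : Prop := ∀ e < d, c'.reg (CT e) = c.reg (CT e) ∧
  c'.reg (BD e) = c.reg (BD e)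

theorem keepLoops_of_reg {d : ℕ} {c c' : Config}
    (h : ∀ j, ¬ IsTemp 0 j → c'.reg j = c.reg j) : KeepLoops d c c' := fun _ _ =>
  ⟨h _ (not_isTemp_of_mod (by simp only [CT]; omega)),
    h _ (not_isTemp_of_mod (by simp only [BD]; omega))⟩

theorem KeepLoops.trans {d : ℕ} {c c' c'' : Config} (h : KeepLoops d c c')
    (h' : KeepLoops d c' c'') : KeepLoops d c c'' := fun e he =>
  ⟨(h' e he).1.trans (h e he).1, (h' e he).2.trans (h e he).2⟩

/-- The number of instructions outside of loops, and the depth of nesting of the loops. -/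
def Cmd.size : Cmd → ℕ
  | .skip => 0
  | .set _ e => (e.code 0).length + 1
  | .nwr _ a e => (a.code 0).length + 4 + (e.code 1).length + 1
  | .qwr r a e => (a.code 0).length + (adrQ r 0).length + (e.code 1).length + 1
  | .seq c₁ c₂ => c₁.size + c₂.size
  | .ite b c₁ c₂ => b.code.length + 2 + c₂.size + c₁.size
  | .loop _ e c => (e.code 0).length + 8 + c.size

def Cmd.depth : Cmd → ℕ
  | .seq c₁ c₂ => max c₁.depth c₂.depth
  | .ite _ c₁ c₂ => max c₁.depth c₂.depth
  | .loop _ _ c => c.depth + 1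
  | _ => 0

/-- What a simulation of a command achieves. -/
def Sim (P : Program) (ω : ℕ → Bool) (Γ : Par) (c : Config) (d l : ℕ) (τ : St) (b : ℕ) : Prop :=
  ∃ c' t, Run P ω Γ.V c c' t ∧ c'.pc = c.pc + l ∧ Rel Γ τ c' ∧ KeepLoops d c c' ∧ t ≤ b

theorem Rel.keep {Γ : Par} {σ : St} {c c' : Config} (h : Rel Γ σ c) (hm : c'.mem = c.mem)
    (hr : ∀ j, j % 4 ≠ 1 → j % 4 ≠ 2 → c'.reg j = c.reg j) : Rel Γ σ c' where
  nv i := by rw [← h.nv i]; exact hr _ (by omega) (by omega)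
  off := by rw [← h.off]; exact hr _ (by omega) (by omega)
  stride := by rw [← h.stride]; exact hr _ (by omega) (by omega)
  one := by rw [← h.one]; exact hr _ (by omega) (by omega)
  na := by rw [hm]; exact h.na
  qa := by rw [hm]; exact h.qa

theorem Rel.setV {Γ : Par} {σ : St} {c : Config} (h : Rel Γ σ c) (i : ℕ) {m : ℕ} {x : ℚ}
    (hx : x = m) : Rel Γ (σ.setV i m) (c.assign (4 * i) x) where
  nv i' := by
    by_cases hi : i' = i
    · subst hi; simp [Config.assign, St.setV, hx]
    · have : 4 * i' ≠ 4 * i := by omega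
      simp [Config.assign, St.setV, this, hi, h.nv]
  off := by rw [← h.off]; exact Function.update_of_ne (by omega) _ _
  stride := by rw [← h.stride]; exact Function.update_of_ne (by omega) _ _
  one := by rw [← h.one]; exact Function.update_of_ne (by omega) _ _
  na := h.na
  qa := h.qa

theorem Rel.setN {Γ : Par} {σ : St} {c : Config} (h : Rel Γ σ c) (r : Fin 16) (a : ℕ) {m pc : ℕ}
    {x : ℚ} (hx : x = m) : Rel Γ (σ.setN r a m)
      { c with pc := pc, mem := Function.update c.mem (locN Γ.inp r a) x } where
  nv := h.nv
  off := h.off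
  stride := h.stride
  one := h.one
  na r' a' := by
    simp only [St.setN, Function.update_apply]
    by_cases hr : r' = r
    · subst hr
      by_cases ha : a' = a
      · subst ha; simp [hx]
      · have : locN Γ.inp r' a' ≠ locN Γ.inp r' a := fun e => ha (loc_injective e).2
        simp [this, ha, h.na]
    · have : locN Γ.inp r' a' ≠ locN Γ.inp r a := fun e => hr (loc_injective e).1
      simp [this, hr, h.na]
  qa r' a' hr' := by
    have : locQ Γ.inp r' a' ≠ locN Γ.inp r a := fun e => locN_ne_locQ hr' e.symm
    simp only [St.setN, Function.update_apply, if_neg this]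
    exact h.qa r' a' hr'

theorem Rel.setQ {Γ : Par} {σ : St} {c : Config} (h : Rel Γ σ c) (r : Fin 16) (a : ℕ) {pc : ℕ}
    {x : ℚ} (hr : r = 0 → a < Γ.inp) : Rel Γ (σ.setQ r a x)
      { c with pc := pc, mem := Function.update c.mem (locQ Γ.inp r a) x } where
  nv := h.nv
  off := h.off
  stride := h.stride
  one := h.one
  na r' a' := by
    have : locN Γ.inp r' a' ≠ locQ Γ.inp r a := locN_ne_locQ hr
    simp only [St.setQ, Function.update_apply, if_neg this]
    exact h.na r' a'
  qa r' a' hr' := by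
    simp only [St.setQ, Function.update_apply]
    by_cases hrr : r' = r
    · subst hrr
      by_cases ha : a' = a
      · subst ha; simp
      · have : locQ Γ.inp r' a' ≠ locQ Γ.inp r' a := fun e => ha (locQ_injective hr' hr e).2
        simp [this, ha, h.qa r' a' hr']
    · have : locQ Γ.inp r' a' ≠ locQ Γ.inp r a := fun e => hrr (locQ_injective hr' hr e).1
      simp [this, hrr, h.qa r' a' hr']

theorem BE.eff {Γ : Par} (hΓ : Γ.Wf) {σ : St} {c : Config} (b : BE) (hc : CodeAt P c.pc b.code)
    (hrel : Rel Γ σ c) (hV : AllV Γ.V c) (hok : b.Ok Γ σ) :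
    ∃ ρ : ℕ → ℚ, Run P ω Γ.V c { c with pc := c.pc + b.code.length, reg := ρ } b.code.length ∧
      (∀ j, ¬ IsTemp 0 j → ρ j = c.reg j) ∧ ∀ l, (b.test l).exec ω
        { c with pc := c.pc + b.code.length, reg := ρ } =
        { c with
          pc := (open Classical in if b.eval σ then l else c.pc + b.code.length + 1), reg := ρ } := by
  cases b with
  | lt x y =>
    obtain ⟨ρ, h₁, h₂, h₃, h₄⟩ := eff_pair hrel (QE.eff hΓ x hc.left hrel hV hok.1)
      (fun c' hpc hV' hrel' => QE.eff hΓ y (hpc ▸ hc.right) hrel' hV' hok.2)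
    refine ⟨ρ, by simpa [BE.code] using h₁, h₄, fun l => ?_⟩
    simp only [BE.test, Instr.exec, h₂, h₃, BE.eval]
    congr
  | eq x y =>
    obtain ⟨ρ, h₁, h₂, h₃, h₄⟩ := eff_pair hrel (QE.eff hΓ x hc.left hrel hV hok.1)
      (fun c' hpc hV' hrel' => QE.eff hΓ y (hpc ▸ hc.right) hrel' hV' hok.2)
    refine ⟨ρ, by simpa [BE.code] using h₁, h₄, fun l => ?_⟩
    simp only [BE.test, Instr.exec, h₂, h₃, BE.eval]
    congr

theorem Run.step_pc {c : Config} {i : Instr} {pc : ℕ} {t : ℕ} {c₀ : Config}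
    (h : Run P ω V c₀ c t) (hi : P[c.pc]? = some i) (he : i.exec ω c = { c with pc := pc }) :
    Run P ω V c₀ { c with pc := pc } (t + 1) := by
  refine h.trans ?_
  rw [← he]
  exact Run.single hi h.allV (by rw [he]; exact h.allV)

theorem size_pow_le {a b B d e : ℕ} (h : d ≤ e) : a * (B + 1) ^ d + b ≤ (a + b) * (B + 1) ^ e := by
  have h1 : (B + 1) ^ d ≤ (B + 1) ^ e := Nat.pow_le_pow_right (Nat.succ_pos _) h
  have h2 : 1 ≤ (B + 1) ^ e := Nat.one_le_pow _ _ (Nat.succ_pos _)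
  nlinarith [Nat.mul_le_mul_left a h1, Nat.mul_le_mul_left b h2]

/-- A compiled command does what the command says, within `size * (B + 1) ^ depth` steps. -/
theorem Cmd.sim {Γ : Par} (hΓ : Γ.Wf) (cmd : Cmd) : ∀ {σ : St} {d : ℕ} {c : Config},
    CodeAt P c.pc (cmd.code d c.pc) → Rel Γ σ c → AllV Γ.V c → cmd.Safe Γ σ →
      Sim P ω Γ c d cmd.len (cmd.run σ) (cmd.size * (Γ.B + 1) ^ cmd.depth) := by
  induction cmd with
  | skip =>
    intro σ d c _ hrel hV _
    exact ⟨c, 0, Run.refl hV, rfl, hrel, fun _ _ => ⟨rfl, rfl⟩, Nat.zero_le _⟩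
  | set i e =>
    intro σ d c hc hrel hV hs
    obtain ⟨ρ, hr, hx, hj⟩ := NE.eff hΓ e hc.left hrel hV hs (ω := ω)
    have hrel' := hrel.of_reg (pc := c.pc + (e.code 0).length) hj
    have h := hr.trans (Run.assign (hc.right.head) (by simp only [Instr.exec]; rfl) hr.allV
      (hr.allV _).1)
    refine ⟨_, _, h, rfl, hrel'.setV i hx, fun e' _ => ?_, by simp [size, depth]⟩
    constructor
    · refine (Function.update_of_ne (by simp only [CT, BD, T]; omega) _ _).trans (hj _ (not_isTemp_of_mod (by simp only [CT, BD, T]; omega)))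
    · refine (Function.update_of_ne (by simp only [CT, BD, T]; omega) _ _).trans (hj _ (not_isTemp_of_mod (by simp only [CT, BD, T]; omega)))
  | nwr r a e =>
    intro σ d c hc hrel hV hs
    have hr4 := r.isLt
    have h1 := (NE.eff hΓ a hc.left hrel hV hs.1 (ω := ω)).seq fun ρ hr hx hj =>
      eff_adr hΓ (a := a.eval σ) (σ := σ) hc.right.left (hrel.of_reg hj) hr.allV hx hs.2.1
        (by omega)
    obtain ⟨ρ, hr, h0, h1, hj⟩ := eff_pair hrel h1 (fun c' hpc hV' hrel' =>
      NE.eff hΓ e (by rw [hpc, ← add_assoc]; exact hc.right.right.left) hrel' hV' hs.2.2)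
    have hrel' := hrel.of_reg (pc := c.pc + ((a.code 0).length + 4 + (e.code 1).length)) hj
    have hi : P[c.pc + ((a.code 0).length + 4 + (e.code 1).length)]? = some (.store (T 0) (T 1)) := by
      have := hc.right.right.right.head
      rwa [add_assoc c.pc, add_assoc c.pc] at this
    have hex := exec_store (ω := ω) (c := { c with
      pc := c.pc + ((a.code 0).length + 4 + (e.code 1).length), reg := ρ }) (a := T 1) h0
    have hq := Run.single hi hr.allV (by rw [hex]; exact hr.allV.store (hr.allV _).1)
    rw [hex] at hq
    refine ⟨_, _, hr.trans hq, ?_, ?_, keepLoops_of_reg hj, ?_⟩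
    · simp only [len]; omega
    · exact hrel'.setN r _ h1
    · simp [size, depth]
  | qwr r a e =>
    intro σ d c hc hrel hV hs
    have hr4 := r.isLt
    have h1 : Eff P ω Γ.V c ((a.code 0).length + (adrQ r 0).length) 0
        ((locQ Γ.inp r (a.eval σ) : ℕ) : ℚ) := by
      by_cases h0 : r = 0
      · simpa [adrQ, h0, locQ] using NE.eff hΓ a hc.left hrel hV hs.1 (ω := ω)
      · have hl : (adrQ r 0).length = 4 := by rw [adrQ, if_neg h0]; rfl
        rw [hl]
        refine (NE.eff hΓ a hc.left hrel hV hs.1 (ω := ω)).seq fun ρ hr hx hj => ?_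
        rw [locQ, if_neg h0]
        exact eff_adr hΓ (a := a.eval σ) (σ := σ) (by simpa [adrQ, h0] using hc.right.left)
          (hrel.of_reg hj) hr.allV hx hs.2.1 (by omega)
    obtain ⟨ρ, hr, h0, h1, hj⟩ := eff_pair hrel h1 (fun c' hpc hV' hrel' =>
      QE.eff hΓ e (by rw [hpc, ← add_assoc]; exact hc.right.right.left) hrel' hV' hs.2.2.2)
    have hrel' := hrel.of_reg (pc := c.pc + ((a.code 0).length + (adrQ r 0).length +
      (e.code 1).length)) hj
    have hi : P[c.pc + ((a.code 0).length + (adrQ r 0).length + (e.code 1).length)]? =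
        some (.store (T 0) (T 1)) := by
      have := hc.right.right.right.head
      rwa [add_assoc c.pc, add_assoc c.pc] at this
    have hex := exec_store (ω := ω) (c := { c with
      pc := c.pc + ((a.code 0).length + (adrQ r 0).length + (e.code 1).length), reg := ρ })
      (a := T 1) h0
    have hq := Run.single hi hr.allV (by rw [hex]; exact hr.allV.store (hr.allV _).1)
    rw [hex] at hq
    refine ⟨_, _, hr.trans hq, ?_, ?_, keepLoops_of_reg hj, ?_⟩
    · simp only [len]; omega
    · have := hrel'.setQ (pc := c.pc + ((a.code 0).length + (adrQ r 0).length +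
        (e.code 1).length) + 1) r (a.eval σ) (x := e.eval σ) hs.2.2.1
      rw [← h1] at this
      simpa only [Cmd.run, h1] using this
    · simp [size, depth]
  | seq c₁ c₂ ih₁ ih₂ =>
    intro σ d c hc hrel hV hs
    obtain ⟨c', t, hr, hpc, hrel', hk, ht⟩ := ih₁ hc.left hrel hV hs.1
    have hc2 := hc.right
    rw [Cmd.code_length, ← hpc] at hc2
    obtain ⟨c'', t', hr', hpc', hrel'', hk', ht'⟩ := ih₂ hc2 hrel' hr.allV hs.2
    refine ⟨c'', t + t', hr.trans hr', by rw [hpc', hpc, len, add_assoc], hrel'', hk.trans hk', ?_⟩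
    have h1 := size_pow_le (a := c₁.size) (b := 0) (B := Γ.B) (le_max_left c₁.depth c₂.depth)
    have h2 := size_pow_le (a := c₂.size) (b := 0) (B := Γ.B) (le_max_right c₁.depth c₂.depth)
    simp only [size, depth, add_mul]
    simp only [add_zero] at h1 h2
    omega
  | ite b c₁ c₂ ih₁ ih₂ =>
    intro σ d c hc hrel hV hs
    obtain ⟨ρ, hr, hj, hex⟩ := BE.eff hΓ b hc.left hrel hV hs.1 (ω := ω)
    have htest := hc.right.left.head
    have h1 := Run.step_pc hr htest (hex _)
    have hsz : b.code.length + 1 + 1 ≤ (b.code.length + 2) *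
      (Γ.B + 1) ^ (max c₁.depth c₂.depth) := Nat.le_mul_of_pos_right _ (by positivity)
    by_cases hb : b.eval σ
    · rw [if_pos hb] at h1
      have hc1 := hc.right.right.right.right
      simp only [Cmd.code_length, List.length_singleton] at hc1
      obtain ⟨c', t, hr', hpc', hrel', hk', ht'⟩ := ih₁ (d := d) hc1 (hrel.of_reg hj) h1.allV
        (hs.2.1 hb)
      refine ⟨c', _, h1.trans hr', ?_, ?_, (keepLoops_of_reg hj).trans hk', ?_⟩
      · rw [hpc']; simp only [len]; omega
      · simpa only [Cmd.run, if_pos hb] using hrel'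
      · have h1 := size_pow_le (a := c₁.size) (b := 0) (B := Γ.B) (le_max_left c₁.depth c₂.depth)
        simp only [size, depth, add_mul] at hsz ⊢
        simp only [add_zero] at h1
        have : 0 ≤ c₂.size * (Γ.B + 1) ^ (max c₁.depth c₂.depth) := Nat.zero_le _
        omega
    · rw [if_neg hb] at h1
      have hc1 := hc.right.right.left
      simp only [List.length_singleton] at hc1
      obtain ⟨c', t, hr', hpc', hrel', hk', ht'⟩ := ih₂ (d := d) hc1 (hrel.of_reg hj) h1.allV
        (hs.2.2 hb)
      have hjump := hc.right.right.right.left.head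
      simp only [Cmd.code_length, List.length_singleton] at hjump
      have h2 := Run.step_pc (h1.trans hr') (i := .jump _) (by rw [hpc']; exact hjump) rfl
      refine ⟨_, _, h2, ?_, ?_, (keepLoops_of_reg hj).trans hk', ?_⟩
      · simp only [len]; omega
      · simp only [Cmd.run, if_neg hb]
        exact hrel'.keep rfl (fun _ _ _ => rfl)
      · have h1 := size_pow_le (a := c₂.size) (b := 0) (B := Γ.B) (le_max_right c₁.depth c₂.depth)
        simp only [size, depth, add_mul] at hsz ⊢
        simp only [add_zero] at h1
        have : 0 ≤ c₁.size * (Γ.B + 1) ^ (max c₁.depth c₂.depth) := Nat.zero_le _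
        omega
  | loop i e body ih =>
    intro σ d c hc hrel hV hs
    obtain ⟨hok, hB, hbody⟩ := hs
    obtain ⟨ρ, hr, hx, hj⟩ := NE.eff hΓ e hc.left hrel hV hok (ω := ω)
    have hl := hc.right.left
    set pe := c.pc + (e.code 0).length with hpe
    -- the two assignments before the loop
    have hr1 := hr.trans (Run.assign (d := BD d) (x := ρ (T 0)) hl.head rfl hr.allV (hr.allV _).1)
    have h0V : Γ.V ((0 : ℕ) : ℚ) := hΓ 0 (Nat.zero_le _)
    have hr2 := hr1.trans (Run.assign (d := CT d) (x := 0) hl.tail.head (by simp [Instr.exec])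
      hr1.allV (by simpa using h0V))
    set N := e.eval σ with hN
    -- the invariant at the loop head
    have key : ∀ j ≤ N, ∃ c' t, Run P ω Γ.V c c' t ∧ c'.pc = pe + 2 ∧
        Rel Γ (loopSt i body.run σ j) c' ∧ KeepLoops d c c' ∧ c'.reg (CT d) = j ∧
        c'.reg (BD d) = N ∧
        t ≤ (e.code 0).length + 2 + j * (body.size * (Γ.B + 1) ^ body.depth + 4) := by
      intro j
      induction j with
      | zero =>
        intro _
        refine ⟨_, _, hr2, rfl, ?_, ?_, ?_, ?_, by omega⟩
        · refine (hrel.of_reg (pc := pe) hj).keep rfl fun j h1 h2 => ?_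
          refine (Function.update_of_ne (by simp only [CT, BD, T]; omega) _ _).trans ?_
          exact Function.update_of_ne (by simp only [CT, BD, T]; omega) _ _
        · intro e' he'
          constructor
          · refine (Function.update_of_ne (by simp only [CT, BD, T]; omega) _ _).trans ?_
            refine (Function.update_of_ne (by simp only [CT, BD, T]; omega) _ _).trans ?_
            exact hj _ (not_isTemp_of_mod (by simp only [CT, BD, T]; omega))
          · refine (Function.update_of_ne (by simp only [CT, BD, T]; omega) _ _).trans ?_
            refine (Function.update_of_ne (by simp only [CT, BD, T]; omega) _ _).trans ?_
            exact hj _ (not_isTemp_of_mod (by simp only [CT, BD, T]; omega))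
        · simp [Config.assign]
        · refine (Function.update_of_ne (by simp only [CT, BD, T]; omega) _ _).trans ?_
          simp [Config.assign, hx]
      | succ j ihj =>
        intro hjN
        obtain ⟨c', t, hrun, hpc, hrel', hk, hct, hbd, ht⟩ := ihj (by omega)
        have hlt : c'.reg (CT d) < c'.reg (BD d) := by
          rw [hct, hbd]; exact_mod_cast (by omega : j < N)
        have e1 := Run.step_pc hrun (i := .jumpLt (CT d) (BD d) (pe + 4)) (pc := pe + 4)
          (by rw [hpc]; exact hl.tail.tail.head) (by simp only [Instr.exec, if_pos hlt])
        have e2 := e1.trans (Run.assign (d := 4 * i) (x := c'.reg (CT d)) hl.tail.tail.tail.tail.head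
          rfl e1.allV (e1.allV _).1)
        have hrel2 : Rel Γ ((loopSt i body.run σ j).setV i j)
            (({ c' with pc := pe + 4 } : Config).assign (4 * i) (c'.reg (CT d))) :=
          (hrel'.keep (c' := { c' with pc := pe + 4 }) rfl (fun _ _ _ => rfl)).setV i hct
        obtain ⟨c'', t', hr', hpc', hrel'', hk', ht'⟩ := ih (d := d + 1) (by
          have := hc.right.right.left
          exact this) hrel2 e2.allV (hbody j (by omega))
        have hadd := hc.right.right.right
        simp only [Cmd.code_length] at hadd
        -- The body is compiled at depth `d + 1`, so it preserves the counter and the bound of this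
        -- loop, even if it assigns to the loop variable.
        have hct' : c''.reg (CT d) = j := by
          rw [(hk' d (Nat.lt_succ_self d)).1, ← hct]
          exact Function.update_of_ne (by simp only [CT, BD, T]; omega) _ _
        have hbd' : c''.reg (BD d) = N := by
          rw [(hk' d (Nat.lt_succ_self d)).2, ← hbd]
          exact Function.update_of_ne (by simp only [CT, BD, T]; omega) _ _
        have hone : c''.reg 11 = 1 := hrel''.one
        have e3 := e2.trans hr'
        have hpc'' : c''.pc = pe + 4 + 1 + body.len := hpc'
        have e4 := e3.trans (Run.assign (i := .add (CT d) (CT d) 11) (d := CT d)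
          (x := ((j + 1 : ℕ) : ℚ)) (by rw [hpc'']; exact hadd.head)
          (by simp [Instr.exec, hct', hone]) e3.allV (hΓ _ (by omega)))
        have e5 := Run.step_pc e4 (i := .jump (pe + 2)) (pc := pe + 2)
          (by simp only [Config.assign, hpc'']; exact hadd.tail.head) rfl
        refine ⟨_, _, e5, rfl, ?_, ?_, ?_, ?_, ?_⟩
        · refine hrel''.keep rfl fun j h1 h2 => ?_
          exact Function.update_of_ne (by simp only [CT, BD, T]; omega) _ _
        · intro e' he'
          constructor
          · refine (Function.update_of_ne (by simp only [CT, BD, T]; omega) _ _).trans ?_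
            rw [(hk' e' (by omega)).1, ← (hk e' he').1]
            exact Function.update_of_ne (by simp only [CT, BD, T]; omega) _ _
          · refine (Function.update_of_ne (by simp only [CT, BD, T]; omega) _ _).trans ?_
            rw [(hk' e' (by omega)).2, ← (hk e' he').2]
            exact Function.update_of_ne (by simp only [CT, BD, T]; omega) _ _
        · simp [Config.assign]
        · refine (Function.update_of_ne (by simp only [CT, BD, T]; omega) _ _).trans hbd'
        · rw [add_mul]; omega
    obtain ⟨c', t, hrun, hpc, hrel', hk, hct, hbd, ht⟩ := key N le_rfl
    have hlt : ¬ c'.reg (CT d) < c'.reg (BD d) := by rw [hct, hbd]; exact lt_irrefl _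
    have e1 := Run.step_pc hrun (i := .jumpLt (CT d) (BD d) (pe + 4)) (pc := pe + 2 + 1)
      (by rw [hpc]; exact hl.tail.tail.head) (by simp only [Instr.exec, if_neg hlt, hpc])
    have e2 := Run.step_pc e1 (i := .jump (pe + 4 + 1 + body.len + 2)) hl.tail.tail.tail.head rfl
    refine ⟨_, _, e2, ?_, ?_, hk, ?_⟩
    · simp only [len]; omega
    · exact hrel'.keep rfl (fun _ _ _ => rfl)
    -- An iteration adds four instructions to the body: the test, the copy of the counter into the
    -- variable, the increment and the jump back.
    · have h2 : N * (body.size * (Γ.B + 1) ^ body.depth + 4) ≤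
          (body.size + 4) * (Γ.B + 1) ^ (body.depth + 1) := by
        calc N * (body.size * (Γ.B + 1) ^ body.depth + 4)
            ≤ (Γ.B + 1) * ((body.size + 4) * (Γ.B + 1) ^ body.depth) :=
              Nat.mul_le_mul (by omega) (size_pow_le le_rfl)
          _ = _ := by ring
      have h3 : (e.code 0).length + 4 ≤ ((e.code 0).length + 4) * (Γ.B + 1) ^ (body.depth + 1) :=
        Nat.le_mul_of_pos_right _ (by positivity)
      have h4 : (size (.loop i e body)) * (Γ.B + 1) ^ (depth (.loop i e body)) =
          ((e.code 0).length + 4) * (Γ.B + 1) ^ (body.depth + 1) +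
          (body.size + 4) * (Γ.B + 1) ^ (body.depth + 1) := by
        simp only [size, depth]; ring
      rw [h4]
      omega

end Simulation

/-! #### Whole programs -/

/-- The compiled program: it first sets up the offset, the stride and the constant one. -/
def Cmd.program (cmd : Cmd) : Program :=
  [.mul 3 0 0, .const 7 32, .const 11 1] ++ cmd.code 0 3

/-- The entry of `A` at position `a` in row-major order. -/
def entry {n : ℕ} (A : Matrix (Fin n) (Fin n) ℚ) (a : ℕ) : ℚ :=
  (RAM.init A).mem a

/-- The initial state. -/
def initSt {n : ℕ} (A : Matrix (Fin n) (Fin n) ℚ) : St where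
  nv := fun i => if i = 0 then n else 0
  na := fun _ _ => 0
  qa := fun r a => if r = 0 then entry A a else 0

theorem entry_of_le {n : ℕ} (A : Matrix (Fin n) (Fin n) ℚ) {a : ℕ} (h : n * n ≤ a) :
    entry A a = 0 := by
  simp [entry, RAM.init, Nat.not_lt.mpr h]

theorem entry_eq {n : ℕ} (A : Matrix (Fin n) (Fin n) ℚ) (i j : Fin n) :
    entry A (i * n + j) = A i j := by
  have hi := i.isLt
  have hj := j.isLt
  have h1 : (i * n + j : ℕ) < n * n := by nlinarith
  have h2 : (i * n + j : ℕ) / n = i := by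
    rw [mul_comm, Nat.mul_add_div (by omega), Nat.div_eq_of_lt hj, add_zero]
  have h3 : (i * n + j : ℕ) % n = j := by rw [Nat.mul_add_mod', Nat.mod_eq_of_lt hj]
  simp only [entry, RAM.init, h1, dite_true]
  congr 1 <;> exact Fin.ext (by simp [h2, h3])

/-- A halted configuration is a fixed point of the step function, so bounds on a finite run hold for
all times. -/
theorem Run.total {P : Program} {ω : ℕ → Bool} {V : ℚ → Prop} {c c' : Config} {t : ℕ}
    (h : Run P ω V c c' t) (hh : Halted P c') (s : ℕ) : AllV V ((step P ω)^[s] c) ∧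
      (t ≤ s → (step P ω)^[s] c = c') := by
  have hfix : step P ω c' = c' := by
    have : P[c'.pc]? = none := List.getElem?_eq_none hh
    simp [step, this]
  have hts : t ≤ s → (step P ω)^[s] c = c' := fun hs => by
    obtain ⟨r, rfl⟩ := Nat.exists_eq_add_of_le hs
    rw [add_comm, Function.iterate_add_apply, h.1]
    exact Function.iterate_fixed hfix r
  refine ⟨?_, hts⟩
  rcases le_total s t with hst | hst
  · exact h.2 s hst
  · rw [hts hst]; exact h.allV

theorem Cmd.program_run (cmd : Cmd) {n : ℕ} (A : Matrix (Fin n) (Fin n) ℚ) (ω : ℕ → Bool)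
    {Γ : Par} (hinp : Γ.inp = n * n) (hΓ : Γ.Wf) (hA : ∀ i j, Γ.V (A i j))
    (hs : cmd.Safe Γ (initSt A)) :
    ∃ c' t, Run cmd.program ω Γ.V (RAM.init A) c' t ∧ Halted cmd.program c' ∧
      Rel Γ (cmd.run (initSt A)) c' ∧ t ≤ 3 + cmd.size * (Γ.B + 1) ^ cmd.depth := by
  have hV : ∀ m : ℕ, m ≤ 64 + Γ.inp → Γ.V m := fun m hm => hΓ m (by omega)
  have h0 : AllV Γ.V (RAM.init A) := by
    intro k
    constructor
    · simp only [RAM.init]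
      split_ifs
      · rcases n with _ | n
        · exact hV _ (by omega)
        · exact hV _ (by rw [hinp]; nlinarith)
      · simpa using hV 0 (by omega)
    · simp only [RAM.init]
      split_ifs
      · exact hA _ _
      · simpa using hV 0 (by omega)
  have hcode : CodeAt cmd.program 0 ([.mul 3 0 0, .const 7 32, .const 11 1] ++ cmd.code 0 3) :=
    fun j hj => by simp [Cmd.program]
  have hl := hcode.left
  -- Register 0 still holds `n`; its square is the size of the input and the offset of all other
  -- arrays.
  have r1 := Run.assign (ω := ω) (c := RAM.init A) (d := 3) (x := ((n * n : ℕ) : ℚ)) hl.head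
    (by simp [Instr.exec, RAM.init]) h0 (hV _ (by omega))
  have r2 := r1.trans (Run.assign (d := 7) (x := 32) hl.tail.head rfl r1.allV
    (by simpa using hV 32 (by omega)))
  have r3 := r2.trans (Run.assign (d := 11) (x := 1) hl.tail.tail.head rfl r2.allV
    (by simpa using hV 1 (by omega)))
  have hrel : Rel Γ (initSt A) ((((RAM.init A).assign 3 ((n * n : ℕ) : ℚ)).assign 7 32).assign
      11 1) := by
    refine ⟨fun i => ?_, ?_, ?_, ?_, fun r a => ?_, fun r a hr => ?_⟩
    · have h1 : 4 * i ≠ 11 := by omega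
      have h2 : 4 * i ≠ 7 := by omega
      have h3 : 4 * i ≠ 3 := by omega
      simp only [Config.assign, Function.update_apply, h1, h2, h3, if_false, RAM.init, initSt]
      by_cases hi : i = 0 <;> simp [hi]
    · simp [Config.assign, Function.update_apply, hinp]
    · simp [Config.assign, Function.update_apply]
    · simp [Config.assign]
    · simp only [initSt]
      have : n * n ≤ locN Γ.inp r a := by simp only [locN]; omega
      exact (entry_of_le A this).trans Nat.cast_zero.symm
    · simp only [initSt]
      by_cases h : r = 0
      · subst h; simp only [locQ, if_true]; rfl
      · rw [if_neg h]
        have : n * n ≤ locQ Γ.inp r a := by simp only [locQ, if_neg h]; omega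
        exact entry_of_le A this
  obtain ⟨c', t, hr, hpc, hrel', -, ht⟩ := Cmd.sim hΓ cmd (d := 0) hcode.right hrel r3.allV hs
  refine ⟨c', _, r3.trans hr, ?_, hrel', by omega⟩
  rw [Halted, hpc]
  simp [Cmd.program, Cmd.code_length, Config.assign, RAM.init]
  omega

end Imp

/-! ### The Grassmann algebra on generators indexed by the naturals -/

namespace Grassmann

/-- Elements are given by their coefficients with respect to the ordered monomials. -/
@[ext] structure Gr where
  /-- the coefficient of a monomial -/
  coeff : Finset ℕ → ℚ

instance : CoeFun Gr (fun _ => Finset ℕ → ℚ) := ⟨Gr.coeff⟩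

instance : Add Gr := ⟨fun f g => ⟨fun z => f z + g z⟩⟩
instance : Zero Gr := ⟨⟨fun _ => 0⟩⟩
instance : Neg Gr := ⟨fun f => ⟨fun z => -f z⟩⟩
instance : SMul ℚ Gr := ⟨fun c f => ⟨fun z => c * f z⟩⟩

theorem add_apply (f g : Gr) (z : Finset ℕ) : (f + g) z = f z + g z := rfl
theorem neg_apply (f : Gr) (z : Finset ℕ) : (-f) z = -f z := rfl
theorem smul_apply (c : ℚ) (f : Gr) (z : Finset ℕ) : (c • f) z = c * f z := rfl
theorem zero_apply (z : Finset ℕ) : (0 : Gr) z = 0 := rfl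

/-- The sign of the product of two generators. -/
def sg (i j : ℕ) : ℚ := if i = j then 0 else if j < i then -1 else 1

/-- The sign of the product of two ordered monomials. -/
def eps (x y : Finset ℕ) : ℚ := ∏ i ∈ x, ∏ j ∈ y, sg i j

theorem sg_symm (i j : ℕ) : sg i j = -sg j i := by
  unfold sg
  rcases lt_trichotomy i j with h | h | h
  · simp [h.ne, h.ne', h, h.not_gt]
  · simp [h]
  · simp [h.ne, h.ne', h, h.not_gt]

theorem eps_union_left {x y : Finset ℕ} (h : Disjoint x y) (z : Finset ℕ) :
    eps (x ∪ y) z = eps x z * eps y z := Finset.prod_union h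

theorem eps_union_right (x : Finset ℕ) {y z : Finset ℕ} (h : Disjoint y z) :
    eps x (y ∪ z) = eps x y * eps x z := by
  simp only [eps, Finset.prod_union h, Finset.prod_mul_distrib]

@[simp] theorem eps_empty_left (x : Finset ℕ) : eps ∅ x = 1 := rfl
@[simp] theorem eps_empty_right (x : Finset ℕ) : eps x ∅ = 1 := by simp [eps]

theorem eps_eq_zero {x y : Finset ℕ} (h : ¬ Disjoint x y) : eps x y = 0 := by
  obtain ⟨i, hx, hy⟩ := Finset.not_disjoint_iff.mp h
  exact Finset.prod_eq_zero hx (Finset.prod_eq_zero hy (by simp [sg]))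

theorem eps_comm (x y : Finset ℕ) : eps x y = (-1) ^ (x.card * y.card) * eps y x := by
  have : eps x y = ∏ i ∈ x, ∏ j ∈ y, (-1) * sg j i :=
    Finset.prod_congr rfl fun i _ => Finset.prod_congr rfl fun j _ => by rw [sg_symm]; ring
  rw [this]
  simp only [Finset.prod_mul_distrib, Finset.prod_const, ← pow_mul]
  rw [Finset.prod_comm, mul_comm x.card]
  rfl

/-- Each coefficient of a product is a finite sum over the splittings of one monomial, so no
finiteness of the support has to be imposed. -/
instance : Mul Gr := ⟨fun f g => ⟨fun z => ∑ x ∈ z.powerset, eps x (z \ x) * f x * g (z \ x)⟩⟩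

theorem mul_apply (f g : Gr) (z : Finset ℕ) :
    (f * g) z = ∑ x ∈ z.powerset, eps x (z \ x) * f x * g (z \ x) := rfl

/-- The ordered monomials. -/
def mono (s : Finset ℕ) : Gr := ⟨fun x => if x = s then 1 else 0⟩

theorem mono_mul_apply (s : Finset ℕ) (f : Gr) (z : Finset ℕ) :
    (mono s * f) z = if s ⊆ z then eps s (z \ s) * f (z \ s) else 0 := by
  rw [mul_apply]
  simp only [mono, mul_ite, mul_one, mul_zero, ite_mul, zero_mul]
  rw [Finset.sum_ite_eq']
  simp

theorem mul_mono_apply (s : Finset ℕ) (f : Gr) (z : Finset ℕ) :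
    (f * mono s) z = if s ⊆ z then eps (z \ s) s * f (z \ s) else 0 := by
  rw [mul_apply]
  by_cases h : s ⊆ z
  · rw [if_pos h, Finset.sum_eq_single (z \ s)]
    · simp [mono, Finset.sdiff_sdiff_eq_self h]
    · intro x hx hne
      have : z \ x ≠ s := by
        rintro rfl
        exact hne (Finset.sdiff_sdiff_eq_self (Finset.mem_powerset.mp hx)).symm
      simp [mono, this]
    · simp
  · rw [if_neg h]
    refine Finset.sum_eq_zero fun x _ => ?_
    have : z \ x ≠ s := by
      rintro rfl
      exact h Finset.sdiff_subset
    simp [mono, this]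

instance : One Gr := ⟨mono ∅⟩

theorem one_def : (1 : Gr) = mono ∅ := rfl

/-- Both sides are sums over the ordered partitions of `z` into three parts, with the sign `eps`
multiplied over the three pairs of parts. -/
protected theorem mul_assoc (f g h : Gr) : f * g * h = f * (g * h) := by
  ext z
  simp only [mul_apply, Finset.mul_sum, Finset.sum_mul]
  rw [Finset.sum_sigma', Finset.sum_sigma']
  refine Finset.sum_bij' (fun t _ => ⟨t.2, t.1 \ t.2⟩) (fun t _ => ⟨t.1 ∪ t.2, t.1⟩) ?_ ?_ ?_ ?_ ?_
  · rintro ⟨w, x⟩ ht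
    simp only [Finset.mem_sigma, Finset.mem_powerset] at ht ⊢
    exact ⟨ht.2.trans ht.1, Finset.sdiff_subset_sdiff ht.1 le_rfl⟩
  · rintro ⟨x, y⟩ ht
    simp only [Finset.mem_sigma, Finset.mem_powerset] at ht ⊢
    exact ⟨Finset.union_subset ht.1 (ht.2.trans Finset.sdiff_subset), Finset.subset_union_left⟩
  · rintro ⟨w, x⟩ ht
    simp only [Finset.mem_sigma, Finset.mem_powerset] at ht
    simp [Finset.union_sdiff_of_subset ht.2]
  · rintro ⟨x, y⟩ ht
    simp only [Finset.mem_sigma, Finset.mem_powerset] at ht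
    have : Disjoint x y := (Finset.disjoint_sdiff (s := x) (t := z)).mono_right ht.2
    simp [Finset.union_sdiff_cancel_left this]
  · rintro ⟨w, x⟩ ht
    simp only [Finset.mem_sigma, Finset.mem_powerset] at ht
    obtain ⟨hw, hx⟩ := ht
    obtain ⟨y, rfl, hxy⟩ : ∃ y, w = x ∪ y ∧ Disjoint x y :=
      ⟨w \ x, (Finset.union_sdiff_of_subset hx).symm, Finset.disjoint_sdiff⟩
    obtain ⟨u, rfl, hu⟩ : ∃ u, z = x ∪ y ∪ u ∧ Disjoint (x ∪ y) u :=
      ⟨z \ (x ∪ y), (Finset.union_sdiff_of_subset hw).symm, Finset.disjoint_sdiff⟩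
    have hyu : Disjoint y u := hu.mono_left Finset.subset_union_right
    have hxyu : Disjoint x (y ∪ u) :=
      Finset.disjoint_union_right.mpr ⟨hxy, hu.mono_left Finset.subset_union_left⟩
    have e1 : (x ∪ y) \ x = y := Finset.union_sdiff_cancel_left hxy
    have e2 : (x ∪ y ∪ u) \ (x ∪ y) = u := Finset.union_sdiff_cancel_left hu
    have e3 : (x ∪ y ∪ u) \ x = y ∪ u := by
      rw [Finset.union_assoc]; exact Finset.union_sdiff_cancel_left hxyu
    have e4 : (y ∪ u) \ y = u := Finset.union_sdiff_cancel_left hyu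
    simp only [e1, e2, e3, e4, eps_union_left hxy, eps_union_right x hyu]
    ring

instance : Ring Gr := Ring.ofMinimalAxioms
  (fun f g h => by ext z; simp only [add_apply, add_assoc])
  (fun f => by ext z; simp only [add_apply, zero_apply, zero_add])
  (fun f => by ext z; simp only [add_apply, neg_apply, zero_apply, neg_add_cancel])
  Grassmann.mul_assoc
  (fun f => by ext z; rw [one_def, mono_mul_apply]; simp)
  (fun f => by ext z; rw [one_def, mul_mono_apply]; simp)
  (fun f g h => by
    ext z; simp only [mul_apply, add_apply, mul_add, Finset.sum_add_distrib])
  (fun f g h => by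
    ext z; simp only [mul_apply, add_apply, mul_add, add_mul, Finset.sum_add_distrib])

instance : Module ℚ Gr := Module.ofMinimalAxioms
  (fun c f g => by ext z; simp only [smul_apply, add_apply, mul_add])
  (fun c d f => by ext z; simp only [smul_apply, add_apply, add_mul])
  (fun c d f => by ext z; simp only [smul_apply, mul_assoc])
  (fun f => by ext z; simp only [smul_apply, one_mul])

instance : Algebra ℚ Gr := Algebra.ofModule
  (fun c f g => by
    ext z
    simp only [mul_apply, smul_apply, Finset.mul_sum]
    exact Finset.sum_congr rfl fun x _ => by ring)
  (fun c f g => by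
    ext z
    simp only [mul_apply, smul_apply, Finset.mul_sum]
    exact Finset.sum_congr rfl fun x _ => by ring)

theorem mono_mul_mono {s t : Finset ℕ} (h : Disjoint s t) :
    mono s * mono t = eps s t • mono (s ∪ t) := by
  ext z
  rw [mono_mul_apply, smul_apply]
  simp only [mono]
  by_cases hz : z = s ∪ t
  · subst hz
    simp [Finset.union_sdiff_cancel_left h]
  · rw [if_neg hz, mul_zero]
    split_ifs with h1 h2
    · exact absurd (by rw [← h2, Finset.union_sdiff_of_subset h1]) hz
    · simp
    · rfl

/-- The generators. -/
def psi (u : ℕ) : Gr := mono {u}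

theorem psi_mul_psi (u v : ℕ) : psi u * psi v = sg u v • mono {u, v} := by
  by_cases h : u = v
  · subst h
    ext z
    rw [psi, mono_mul_apply, smul_apply]
    simp only [sg, if_true, zero_mul, mono]
    split_ifs with h1 h2
    · have : u ∈ z \ {u} := by rw [h2]; simp
      simp at this
    · simp
    · rfl
  · rw [psi, psi, mono_mul_mono (by simpa using h)]
    simp only [eps, Finset.prod_singleton]; rfl

theorem psi_anticomm (u v : ℕ) : psi u * psi v = -(psi v * psi u) := by
  rw [psi_mul_psi, psi_mul_psi, sg_symm, Finset.pair_comm, neg_smul]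

theorem psi_sq (u : ℕ) : psi u * psi u = 0 := by
  rw [psi_mul_psi]; simp [sg]

/-- The centre, which is commutative. -/
abbrev Cen : Type := Subalgebra.center ℚ Gr

/-- Passing a monomial of even degree across another one takes an even number of transpositions. -/
theorem mono_mem_center {s : Finset ℕ} (h : Even s.card) : mono s ∈ Subalgebra.center ℚ Gr := by
  rw [Subalgebra.mem_center_iff]
  intro f
  ext z
  rw [mono_mul_apply, mul_mono_apply, eps_comm (z \ s) s, Even.neg_one_pow (h.mul_left _), one_mul]

theorem psi_mul_psi_mem (u v : ℕ) : psi u * psi v ∈ Subalgebra.center ℚ Gr := by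
  rw [psi_mul_psi]
  by_cases h : u = v
  · simp [sg, h]
  · exact Subalgebra.smul_mem _ (mono_mem_center (by rw [Finset.card_pair h]; exact even_two)) _

/-- The product of two generators. -/
def theta (u v : ℕ) : Cen := ⟨psi u * psi v, psi_mul_psi_mem u v⟩

theorem theta_val (u v : ℕ) : (theta u v : Gr) = psi u * psi v := rfl

/-- Interchanging `ψ_v` and `ψ_v'` is an odd permutation of the four factors. This antisymmetry is
where the determinants come from. -/
theorem theta_exchange (u v u' v' : ℕ) : theta u v * theta u' v' = -(theta u v' * theta u' v) := by
  apply Subtype.ext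
  have h1 : psi v * psi u' = -(psi u' * psi v) := psi_anticomm _ _
  have h2 : psi v * psi v' = -(psi v' * psi v) := psi_anticomm _ _
  have h3 : psi v' * psi u' = -(psi u' * psi v') := psi_anticomm _ _
  change (psi u * psi v) * (psi u' * psi v') = -((psi u * psi v') * (psi u' * psi v))
  calc (psi u * psi v) * (psi u' * psi v') = psi u * (psi v * psi u') * psi v' := by noncomm_ring
    _ = -(psi u * psi u' * (psi v * psi v')) := by rw [h1]; noncomm_ring
    _ = psi u * psi u' * psi v' * psi v := by rw [h2]; noncomm_ring
    _ = -(psi u * (psi v' * psi u') * psi v) := by rw [h3]; noncomm_ring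
    _ = -((psi u * psi v') * (psi u' * psi v)) := by noncomm_ring

theorem theta_mul_same_left (u v v' : ℕ) : theta u v * theta u v' = 0 := by
  apply Subtype.ext
  have h1 : psi v * psi u = -(psi u * psi v) := psi_anticomm _ _
  change (psi u * psi v) * (psi u * psi v') = 0
  calc (psi u * psi v) * (psi u * psi v') = psi u * (psi v * psi u) * psi v' := by noncomm_ring
    _ = -(psi u * psi u * psi v * psi v') := by rw [h1]; noncomm_ring
    _ = 0 := by rw [psi_sq]; noncomm_ring

/-- The exchange rule with equal second generators says that the product is its own negative. -/
theorem theta_mul_same_right (u u' v : ℕ) : theta u v * theta u' v = 0 := by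
  have h := theta_exchange u v u' v
  have h2 : (2 : ℚ) • (theta u v * theta u' v) = 0 := by
    rw [two_smul]; nth_rewrite 1 [h]; simp
  simpa using h2

theorem prod_one_add {ι R : Type*} [DecidableEq ι] [CommRing R] (s : Finset ι) (x : ι → R)
    (h : ∀ i ∈ s, ∀ j ∈ s, i ≠ j → x i * x j = 0) : ∏ i ∈ s, (1 + x i) = 1 + ∑ i ∈ s, x i := by
  induction s using Finset.induction_on with
  | empty => simp
  | insert a s ha ih =>
    rw [Finset.prod_insert ha, Finset.sum_insert ha, ih fun i hi j hj => h i
      (Finset.mem_insert_of_mem hi) j (Finset.mem_insert_of_mem hj)]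
    have : x a * ∑ i ∈ s, x i = 0 := by
      rw [Finset.mul_sum]
      refine Finset.sum_eq_zero fun i hi => h a (Finset.mem_insert_self _ _) i
        (Finset.mem_insert_of_mem hi) ?_
      rintro rfl; exact ha hi
    linear_combination this

end Grassmann

/-! ### Gaussian elements and their integrals -/

namespace Grassmann

section Gauss

variable (k p : ℕ)

/-- The product of the generators of row `b` and column `c` in copy `a`. -/
def th (a b c : ℕ) : Cen := theta (2 * (a * k + b)) (2 * (a * k + c) + 1)

/-- One copy of the Gaussian element of a matrix. -/
def gcopy (a : ℕ) (M : ℕ → ℕ → ℚ) : Cen :=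
  ∏ b ∈ Finset.range k, ∏ c ∈ Finset.range k, (1 + M b c • th k a b c)

/-- The Gaussian element of a matrix, in `p` copies. -/
def gauss (M : ℕ → ℕ → ℚ) : Cen := ∏ a ∈ Finset.range p, gcopy k a M

variable {k p}

theorem gcopy_congr {a : ℕ} {M M' : ℕ → ℕ → ℚ} (h : ∀ b < k, ∀ c < k, M b c = M' b c) :
    gcopy k a M = gcopy k a M' :=
  Finset.prod_congr rfl fun b hb => Finset.prod_congr rfl fun c hc => by
    rw [h b (Finset.mem_range.mp hb) c (Finset.mem_range.mp hc)]

theorem gauss_congr {M M' : ℕ → ℕ → ℚ} (h : ∀ b < k, ∀ c < k, M b c = M' b c) :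
    gauss k p M = gauss k p M' :=
  Finset.prod_congr rfl fun _ _ => gcopy_congr h

theorem one_add_theta_mul (x y : ℚ) (u v : ℕ) :
    (1 + x • theta u v) * (1 + y • theta u v) = 1 + (x + y) • theta u v := by
  have := theta_mul_same_left u v v
  rw [add_smul, mul_add, add_mul, add_mul, smul_mul_smul_comm, this]
  simp [add_assoc]

/-- As `theta` squares to zero, `1 + x θ` is `exp (x θ)`. The Gaussian element is thus an
exponential in a commutative ring, and products become sums of matrices. -/
theorem gcopy_mul (a : ℕ) (M M' : ℕ → ℕ → ℚ) :
    gcopy k a M * gcopy k a M' = gcopy k a (fun b c => M b c + M' b c) := by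
  simp only [gcopy, ← Finset.prod_mul_distrib, th, one_add_theta_mul]

theorem gauss_mul (M M' : ℕ → ℕ → ℚ) :
    gauss k p M * gauss k p M' = gauss k p (fun b c => M b c + M' b c) := by
  simp only [gauss, ← Finset.prod_mul_distrib, gcopy_mul]

theorem gauss_zero : gauss k p (fun _ _ => 0) = 1 := by
  simp [gauss, gcopy]

theorem gauss_single {i j : ℕ} (hi : i < k) (hj : j < k) (x : ℚ) :
    gauss k p (fun b c => if b = i ∧ c = j then x else 0) =
      ∏ a ∈ Finset.range p, (1 + x • th k a i j) := by
  refine Finset.prod_congr rfl fun a _ => ?_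
  rw [gcopy, Finset.prod_eq_single i, Finset.prod_eq_single j]
  · simp
  · intro c _ hc; simp [hc]
  · intro h; exact absurd (Finset.mem_range.mpr hj) h
  · intro b _ hb
    exact Finset.prod_eq_one fun c _ => by simp [hb]
  · intro h; exact absurd (Finset.mem_range.mpr hi) h

/-- The exponential of a matrix of rank one. -/
theorem prod_rank_one (s : Finset ℕ) (a : ℕ) (t r : ℕ → ℚ) :
    ∏ b ∈ s, ∏ c ∈ s, (1 + (t b * r c) • th k a b c) =
      1 + ∑ b ∈ s, ∑ c ∈ s, (t b * r c) • th k a b c := by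
  have h1 : ∀ b, ∏ c ∈ s, (1 + (t b * r c) • th k a b c) =
      1 + ∑ c ∈ s, (t b * r c) • th k a b c := fun b =>
    prod_one_add s _ fun i _ j _ _ => by
      simp only [th, smul_mul_smul_comm, theta_mul_same_left, smul_zero]
  simp only [h1]
  refine prod_one_add s _ fun b _ b' _ _ => ?_
  -- Two rows carry the same coefficients `r` up to a scalar, so exchanging the columns shows that
  -- their product is its own negative.
  have h2 : (∑ c ∈ s, (t b * r c) • th k a b c) * (∑ c ∈ s, (t b' * r c) • th k a b' c) =
      -((∑ c ∈ s, (t b * r c) • th k a b c) * (∑ c ∈ s, (t b' * r c) • th k a b' c)) := by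
    simp only [Finset.sum_mul_sum, smul_mul_smul_comm]
    nth_rewrite 2 [Finset.sum_comm]
    simp only [← Finset.sum_neg_distrib]
    refine Finset.sum_congr rfl fun c _ => Finset.sum_congr rfl fun c' _ => ?_
    simp only [th]
    rw [theta_exchange, smul_neg]
    congr 2
    ring
  have h3 : (2 : ℚ) • ((∑ c ∈ s, (t b * r c) • th k a b c) *
      (∑ c ∈ s, (t b' * r c) • th k a b' c)) = 0 := by
    rw [two_smul]; nth_rewrite 1 [h2]; simp
  simpa using h3

/-- Elements that do not involve the generators `2 m` and `2 m + 1`. -/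
def free (m : ℕ) : Subalgebra ℚ Gr where
  carrier := {f | ∀ x, (2 * m ∈ x ∨ 2 * m + 1 ∈ x) → f x = 0}
  mul_mem' := fun {f g} hf hg x hx => by
    rw [mul_apply]
    refine Finset.sum_eq_zero fun y hy => ?_
    by_cases h : 2 * m ∈ y ∨ 2 * m + 1 ∈ y
    · rw [hf y h]; ring
    · have : 2 * m ∈ x \ y ∨ 2 * m + 1 ∈ x \ y := by
        simp only [Finset.mem_sdiff]; tauto
      rw [hg _ this]; ring
  add_mem' := fun {f g} hf hg x hx => by rw [add_apply, hf x hx, hg x hx, add_zero]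
  algebraMap_mem' := fun r x hx => by
    rw [Algebra.algebraMap_eq_smul_one, smul_apply, one_def]
    have : x ≠ ∅ := by rintro rfl; simp at hx
    simp [mono, this]

/-- The central elements that do not involve the generators `2 m` and `2 m + 1`. -/
def cfree (m : ℕ) : Subalgebra ℚ Cen := (free m).comap (Subalgebra.val _)

theorem mem_cfree {m : ℕ} {f : Cen} : f ∈ cfree m ↔ (f : Gr) ∈ free m := Iff.rfl

theorem theta_mem_cfree {m u v : ℕ} (hu : u ≠ 2 * m) (hu' : u ≠ 2 * m + 1) (hv : v ≠ 2 * m)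
    (hv' : v ≠ 2 * m + 1) : theta u v ∈ cfree m := by
  rw [mem_cfree, theta_val, psi_mul_psi]
  refine Subalgebra.smul_mem _ (fun x hx => ?_) _
  have : x ≠ {u, v} := by
    rintro rfl
    simp only [Finset.mem_insert, Finset.mem_singleton] at hx
    omega
  simp [mono, this]

/-- Integration over the generators `2 m` and `2 m + 1`. -/
def integ (m : ℕ) : Gr →ₗ[ℚ] Gr where
  toFun f := ⟨fun x => if 2 * m ∉ x ∧ 2 * m + 1 ∉ x then f (x ∪ {2 * m, 2 * m + 1}) else 0⟩
  map_add' f g := by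
    ext x
    simp only [add_apply]
    split_ifs <;> simp
  map_smul' c f := by
    ext x
    simp only [smul_apply, RingHom.id_apply]
    split_ifs <;> simp

theorem integ_apply (m : ℕ) (f : Gr) (x : Finset ℕ) : integ m f x =
    if 2 * m ∉ x ∧ 2 * m + 1 ∉ x then f (x ∪ {2 * m, 2 * m + 1}) else 0 := rfl

/-- The generators `2 m` and `2 m + 1` are neighbours in the order, so any other generator lies on
the same side of both, and the two signs cancel. This keeps the integral free of signs. -/
theorem sg_pair {m j : ℕ} (h : j ≠ 2 * m) (h' : j ≠ 2 * m + 1) :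
    sg (2 * m) j * sg (2 * m + 1) j = 1 := by
  unfold sg
  rw [if_neg h.symm, if_neg h'.symm]
  by_cases hj : j < 2 * m
  · rw [if_pos hj, if_pos (by omega)]; norm_num
  · rw [if_neg hj, if_neg (by omega)]; norm_num

/-- In a coefficient that contains the pair, both generators have to come from `f`, since `g` has
neither. Factors that do not involve the pair may therefore leave the integral. -/
theorem integ_mul_free {m : ℕ} {f g : Gr} (hg : g ∈ free m) :
    integ m (f * g) = integ m f * g := by
  ext x
  rw [integ_apply, mul_apply]
  set q : Finset ℕ := {2 * m, 2 * m + 1} with hq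
  split_ifs with h
  · have hxq : Disjoint x q := by simp [hq, h.1, h.2]
    rw [mul_apply, Finset.powerset_union, ]
    symm
    refine Finset.sum_of_injOn (fun y => y ∪ q) ?_ ?_ ?_ ?_
    · intro y hy y' hy' e
      have hy1 : Disjoint y q := hxq.mono_left (Finset.mem_powerset.mp hy)
      have hy2 : Disjoint y' q := hxq.mono_left (Finset.mem_powerset.mp hy')
      rw [← Finset.union_sdiff_cancel_right hy1, ← Finset.union_sdiff_cancel_right hy2]
      exact congrArg (· \ q) e
    · intro y hy
      have hy' := Finset.mem_powerset.mp hy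
      rw [← Finset.powerset_union]
      exact Finset.mem_coe.mpr (Finset.mem_powerset.mpr (Finset.union_subset_union_left hy'))
    · intro y hy hny
      rw [← Finset.powerset_union] at hy
      have hy' := Finset.mem_powerset.mp hy
      have : ¬ q ⊆ y := fun hqy => hny ⟨y \ q, by
        simp only [Finset.coe_powerset, Set.mem_preimage, Set.mem_powerset_iff, Finset.coe_subset]
        intro i hi
        have := hy' (Finset.mem_sdiff.mp hi).1
        rcases Finset.mem_union.mp this with h1 | h1
        · exact h1
        · exact absurd h1 (Finset.mem_sdiff.mp hi).2, Finset.sdiff_union_of_subset hqy⟩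
      rw [hg]
      · ring
      · simp only [hq, Finset.insert_subset_iff, Finset.singleton_subset_iff] at this
        simp only [Finset.mem_sdiff, Finset.mem_union, hq, Finset.mem_insert, Finset.mem_singleton]
        tauto
    · intro y hy
      have hy' := Finset.mem_powerset.mp hy
      have hyq : Disjoint y q := hxq.mono_left hy'
      have e1 : (x ∪ q) \ (y ∪ q) = x \ y := by
        ext i
        have : i ∈ x → i ∉ q := fun h => Finset.disjoint_left.mp hxq h
        simp only [Finset.mem_sdiff, Finset.mem_union]
        tauto
      have e2 : eps q (x \ y) = 1 := by
        rw [hq, eps, Finset.prod_pair (by omega), ← Finset.prod_mul_distrib]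
        refine Finset.prod_eq_one fun j hj => ?_
        have hjx := (Finset.mem_sdiff.mp hj).1
        exact sg_pair (by rintro rfl; exact h.1 hjx) (by rintro rfl; exact h.2 hjx)
      have h3 : 2 * m ∉ y ∧ 2 * m + 1 ∉ y := ⟨fun e => h.1 (hy' e), fun e => h.2 (hy' e)⟩
      rw [integ_apply, if_pos h3, e1, eps_union_left hyq, e2, mul_one]
  · rw [mul_apply]
    refine (Finset.sum_eq_zero fun y hy => ?_).symm
    have hy' := Finset.mem_powerset.mp hy
    rw [integ_apply]
    split_ifs with h3
    · rw [hg]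
      · ring
      · simp only [Finset.mem_sdiff]; tauto
    · ring

theorem integ_one (m : ℕ) : integ m 1 = 0 := by
  ext x
  rw [integ_apply, one_def, zero_apply]
  have : x ∪ {2 * m, 2 * m + 1} ≠ ∅ := by
    intro h
    have := Finset.eq_empty_iff_forall_notMem.mp h (2 * m)
    simp at this
  simp only [mono, if_neg this, ite_self]

theorem integ_theta_self (m : ℕ) : integ m (theta (2 * m) (2 * m + 1)) = 1 := by
  ext x
  rw [integ_apply, theta_val, psi_mul_psi, one_def]
  have hs : sg (2 * m) (2 * m + 1) = 1 := by simp [sg]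
  rw [hs, one_smul]
  simp only [mono]
  by_cases hx : x = ∅
  · subst hx; simp
  · rw [if_neg hx]
    split_ifs with h h'
    · exfalso
      apply hx
      rw [Finset.eq_empty_iff_forall_notMem]
      intro i hi
      have : i ∈ ({2 * m, 2 * m + 1} : Finset ℕ) := h' ▸ Finset.mem_union_left _ hi
      simp only [Finset.mem_insert, Finset.mem_singleton] at this
      rcases this with rfl | rfl
      · exact h.1 hi
      · exact h.2 hi
    · rfl
    · rfl

theorem integ_theta_ne {m u v : ℕ} (h : ¬ (2 * m = u ∨ 2 * m = v) ∨ ¬ (2 * m + 1 = u ∨ 2 * m + 1 = v)) :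
    integ m (theta u v) = 0 := by
  ext x
  rw [integ_apply, theta_val, psi_mul_psi, zero_apply, smul_apply]
  have : x ∪ {2 * m, 2 * m + 1} ≠ {u, v} := by
    intro e
    have h1 : 2 * m ∈ ({u, v} : Finset ℕ) := e ▸ Finset.mem_union_right _ (by simp)
    have h2 : 2 * m + 1 ∈ ({u, v} : Finset ℕ) := e ▸ Finset.mem_union_right _ (by simp)
    simp only [Finset.mem_insert, Finset.mem_singleton] at h1 h2
    tauto
  simp only [mono, if_neg this, mul_zero, ite_self]

/-- Elimination of row and column `i` of a matrix. -/
def schur (i : ℕ) (M : ℕ → ℕ → ℚ) (b c : ℕ) : ℚ :=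
  if b = i ∨ c = i then 0 else M b c - M b i * M i c / M i i

theorem two_mul_ne {k a a' b i : ℕ} (hb : b < k) (hi : i < k) (h : a ≠ a' ∨ b ≠ i) :
    a * k + b ≠ a' * k + i := by
  intro e
  have h1 : a = a' := by
    have := congrArg (· / k) e
    simpa [Nat.mul_add_div (by omega : 0 < k), mul_comm _ k, Nat.div_eq_of_lt hb,
      Nat.div_eq_of_lt hi] using this
  subst h1
  omega

theorem th_mem_cfree {a a' b c i : ℕ} (hb : b < k) (hc : c < k) (hi : i < k)
    (h : a ≠ a' ∨ (b ≠ i ∧ c ≠ i)) : th k a b c ∈ cfree (a' * k + i) := by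
  have h1 := two_mul_ne hb hi (a := a) (a' := a') (h.imp_right And.left)
  have h2 := two_mul_ne hc hi (a := a) (a' := a') (h.imp_right And.right)
  exact theta_mem_cfree (by omega) (by omega) (by omega) (by omega)

theorem expand_aux {R : Type*} [CommRing R] {μ θ₀ β γ Q H : R} (h3 : θ₀ * γ = 0)
    (h4 : β * γ = -(θ₀ * Q)) :
    (1 + (μ * θ₀ + β)) * ((1 + γ) * H) = (1 + β + γ) * H + θ₀ * ((μ - Q) * H) := by
  linear_combination (μ * H) * h3 + H * h4

/-- Only row and column `i` involve the generators integrated over. Row `i` gives `1 + M i i θ₀ +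
β`, the rest of column `i` gives `1 + γ`, and exchange yields `β γ = -θ₀ Q`. The integral reads off
what stands next to `θ₀`. Nothing is divided, so a zero pivot is allowed. -/
theorem integ_gcopy_aux (a : ℕ) {i : ℕ} (hi : i < k) (M : ℕ → ℕ → ℚ) :
    integ (a * k + i) (gcopy k a M) =
      ((((M i i) • (1 : Cen) - ∑ b ∈ (Finset.range k).erase i, ∑ c ∈ (Finset.range k).erase i,
        (M b i * M i c) • th k a b c) *
      ∏ b ∈ (Finset.range k).erase i, ∏ c ∈ (Finset.range k).erase i,
        (1 + M b c • th k a b c) : Cen) : Gr) := by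
  set R := (Finset.range k).erase i with hR
  have hiR : i ∈ Finset.range k := Finset.mem_range.mpr hi
  have hRk : ∀ b ∈ R, b < k ∧ b ≠ i := fun b hb =>
    ⟨Finset.mem_range.mp (Finset.mem_of_mem_erase hb), Finset.ne_of_mem_erase hb⟩
  set H : Cen := ∏ b ∈ R, ∏ c ∈ R, (1 + M b c • th k a b c) with hH
  set β : Cen := ∑ c ∈ R, M i c • th k a i c with hβ
  set γ : Cen := ∑ b ∈ R, M b i • th k a b i with hγ
  set Q : Cen := ∑ b ∈ R, ∑ c ∈ R, (M b i * M i c) • th k a b c with hQ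
  set θ₀ : Cen := th k a i i with hθ
  have h1 : ∏ c ∈ Finset.range k, (1 + M i c • th k a i c) = 1 + (M i i • θ₀ + β) := by
    rw [prod_one_add, ← Finset.add_sum_erase _ _ hiR]
    intro c _ c' _ _
    simp only [th, smul_mul_smul_comm, theta_mul_same_left, smul_zero]
  have h2 : ∏ b ∈ R, (1 + M b i • th k a b i) = 1 + γ := by
    refine prod_one_add _ _ fun b _ b' _ _ => ?_
    simp only [th, smul_mul_smul_comm, theta_mul_same_right, smul_zero]
  have h3 : θ₀ * γ = 0 := by
    rw [hγ, Finset.mul_sum]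
    refine Finset.sum_eq_zero fun b _ => ?_
    simp only [hθ, th, mul_smul_comm, theta_mul_same_right, smul_zero]
  have h4 : β * γ = -(θ₀ * Q) := by
    rw [hβ, hγ, Finset.sum_mul_sum, Finset.sum_comm, hQ, Finset.mul_sum, ← Finset.sum_neg_distrib]
    refine Finset.sum_congr rfl fun b _ => ?_
    rw [Finset.mul_sum, ← Finset.sum_neg_distrib]
    refine Finset.sum_congr rfl fun c _ => ?_
    simp only [hθ, th]
    rw [smul_mul_smul_comm, theta_exchange, mul_smul_comm, smul_neg, mul_comm (M b i)]
  have h5 : gcopy k a M = (1 + β + γ) * H + θ₀ * ((M i i • (1 : Cen) - Q) * H) := by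
    have h6 : gcopy k a M = (1 + (M i i • θ₀ + β)) * ((1 + γ) * H) := by
      rw [gcopy, ← Finset.mul_prod_erase _ _ hiR, h1, ← h2, hH, ← Finset.prod_mul_distrib]
      congr 1
      exact Finset.prod_congr rfl fun b _ => (Finset.mul_prod_erase _ _ hiR).symm
    have h8 : M i i • θ₀ = (M i i • (1 : Cen)) * θ₀ := by rw [smul_mul_assoc, one_mul]
    rw [h6, h8]
    generalize M i i • (1 : Cen) = μ
    exact expand_aux h3 h4
  have hHf : H ∈ cfree (a * k + i) := Subalgebra.prod_mem _ fun b hb => Subalgebra.prod_mem _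
    fun c hc => Subalgebra.add_mem _ (Subalgebra.one_mem _) (Subalgebra.smul_mem _
      (th_mem_cfree (hRk b hb).1 (hRk c hc).1 hi (Or.inr ⟨(hRk b hb).2, (hRk c hc).2⟩)) _)
  have hQf : (M i i • (1 : Cen) - Q) * H ∈ cfree (a * k + i) :=
    Subalgebra.mul_mem _ (Subalgebra.sub_mem _ (Subalgebra.smul_mem _ (Subalgebra.one_mem _) _)
      (Subalgebra.sum_mem _ fun b hb => Subalgebra.sum_mem _ fun c hc => Subalgebra.smul_mem _
        (th_mem_cfree (hRk b hb).1 (hRk c hc).1 hi (Or.inr ⟨(hRk b hb).2, (hRk c hc).2⟩)) _)) hHf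
  have hβ0 : integ (a * k + i) (β : Gr) = 0 := by
    rw [hβ, AddSubmonoidClass.coe_finsetSum, map_sum]
    refine Finset.sum_eq_zero fun c hc => ?_
    have := two_mul_ne (hRk c hc).1 hi (a := a) (a' := a) (Or.inr (hRk c hc).2)
    rw [Subalgebra.coe_smul, map_smul, th, integ_theta_ne (by omega), smul_zero]
  have hγ0 : integ (a * k + i) (γ : Gr) = 0 := by
    rw [hγ, AddSubmonoidClass.coe_finsetSum, map_sum]
    refine Finset.sum_eq_zero fun c hc => ?_
    have := two_mul_ne (hRk c hc).1 hi (a := a) (a' := a) (Or.inr (hRk c hc).2)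
    rw [Subalgebra.coe_smul, map_smul, th, integ_theta_ne (by omega), smul_zero]
  have hθ1 : integ (a * k + i) (θ₀ : Gr) = 1 := integ_theta_self _
  have hsplit : ((θ₀ * ((M i i • (1 : Cen) - Q) * H) : Cen) : Gr) =
      (θ₀ : Gr) * (((M i i • (1 : Cen) - Q) * H : Cen) : Gr) := rfl
  rw [h5, Subalgebra.coe_add, map_add, hsplit, Subalgebra.coe_mul, integ_mul_free
    (mem_cfree.mp hHf), integ_mul_free (mem_cfree.mp hQf), hθ1, one_mul, Subalgebra.coe_add,
    Subalgebra.coe_add, Subalgebra.coe_one, map_add, map_add, integ_one, hβ0, hγ0]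
  simp

/-- With a nonzero pivot the factor `M i i - Q` is `M i i * (1 - Q / M i i)`, and by `prod_rank_one`
the bracket is the Gaussian element of a rank-one matrix. It merges with the remaining factors into
the Schur complement. -/
theorem integ_gcopy (a : ℕ) {i : ℕ} (hi : i < k) {M : ℕ → ℕ → ℚ} (h0 : M i i ≠ 0) :
    integ (a * k + i) (gcopy k a M) = (((M i i) • gcopy k a (schur i M) : Cen) : Gr) := by
  rw [integ_gcopy_aux a hi M]
  congr 1
  set R := (Finset.range k).erase i with hR
  have hiR : i ∈ Finset.range k := Finset.mem_range.mpr hi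
  have h1 : gcopy k a (schur i M) = ∏ b ∈ R, ∏ c ∈ R, (1 + schur i M b c • th k a b c) := by
    rw [gcopy, ← Finset.mul_prod_erase _ _ hiR, Finset.prod_eq_one, one_mul]
    · refine Finset.prod_congr rfl fun b _ => ?_
      rw [← Finset.mul_prod_erase _ _ hiR]
      simp [schur, hR]
    · intro c _; simp [schur]
  have h2 : ∏ b ∈ R, ∏ c ∈ R, (1 + schur i M b c • th k a b c) =
      (∏ b ∈ R, ∏ c ∈ R, (1 + ((-M b i / M i i) * M i c) • th k a b c)) *
        ∏ b ∈ R, ∏ c ∈ R, (1 + M b c • th k a b c) := by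
    rw [← Finset.prod_mul_distrib]
    refine Finset.prod_congr rfl fun b hb => ?_
    rw [← Finset.prod_mul_distrib]
    refine Finset.prod_congr rfl fun c hc => ?_
    rw [th, one_add_theta_mul]
    congr 2
    rw [schur, if_neg (by simp [Finset.ne_of_mem_erase hb, Finset.ne_of_mem_erase hc])]
    ring
  rw [h1, h2, prod_rank_one, ← smul_mul_assoc, smul_add, Finset.smul_sum, sub_eq_add_neg,
    ← Finset.sum_neg_distrib]
  congr 2
  refine Finset.sum_congr rfl fun b _ => ?_
  rw [Finset.smul_sum, ← Finset.sum_neg_distrib]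
  refine Finset.sum_congr rfl fun c _ => ?_
  rw [← neg_smul, smul_smul]
  congr 1
  field_simp

theorem integ_gcopy_zero (a : ℕ) {i : ℕ} (hi : i < k) {M : ℕ → ℕ → ℚ} (h0 : ∀ c < k, M i c = 0) :
    integ (a * k + i) (gcopy k a M) = 0 := by
  rw [integ_gcopy_aux a hi M, h0 i hi, Finset.sum_eq_zero]
  · simp
  · intro b _
    refine Finset.sum_eq_zero fun c hc => ?_
    rw [h0 c (Finset.mem_range.mp (Finset.mem_of_mem_erase hc))]
    simp

/-- The generators of slot `i`, in all copies. -/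
def slot (k p i : ℕ) : Finset ℕ :=
  (Finset.range p).biUnion fun a => {2 * (a * k + i), 2 * (a * k + i) + 1}

/-- Integration over the generators of slot `i`, in all copies. -/
def integs (k p i : ℕ) : Gr →ₗ[ℚ] Gr where
  toFun f := ⟨fun x => if Disjoint x (slot k p i) then f (x ∪ slot k p i) else 0⟩
  map_add' f g := by
    ext x
    simp only [add_apply]
    split_ifs <;> simp
  map_smul' c f := by
    ext x
    simp only [smul_apply, RingHom.id_apply]
    split_ifs <;> simp

theorem integs_apply (k p i : ℕ) (f : Gr) (x : Finset ℕ) : integs k p i f x =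
    if Disjoint x (slot k p i) then f (x ∪ slot k p i) else 0 := rfl

theorem slot_succ (k p i : ℕ) : slot k (p + 1) i =
    slot k p i ∪ {2 * (p * k + i), 2 * (p * k + i) + 1} := by
  rw [slot, Finset.range_add_one, Finset.biUnion_insert, Finset.union_comm]; rfl

theorem mem_slot {k p i u : ℕ} : u ∈ slot k p i ↔ ∃ a < p, u = 2 * (a * k + i) ∨
    u = 2 * (a * k + i) + 1 := by
  simp [slot]

/-- Both integrals read off coefficients without signs, so it is enough that the pair of the last
copy is disjoint from the pairs of the others. -/
theorem integs_succ {i : ℕ} (hi : i < k) (f : Gr) :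
    integs k (p + 1) i f = integs k p i (integ (p * k + i) f) := by
  ext x
  have hne : ∀ a < p, a * k + i ≠ p * k + i := fun a ha =>
    two_mul_ne hi hi (Or.inl (by omega))
  have h1 : 2 * (p * k + i) ∉ slot k p i := by
    rw [mem_slot]; rintro ⟨a, ha, h⟩; have := hne a ha; omega
  have h2 : 2 * (p * k + i) + 1 ∉ slot k p i := by
    rw [mem_slot]; rintro ⟨a, ha, h⟩; have := hne a ha; omega
  rw [integs_apply, integs_apply, integ_apply, slot_succ, ← Finset.union_assoc]
  have h3 : Disjoint x {2 * (p * k + i), 2 * (p * k + i) + 1} ↔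
      2 * (p * k + i) ∉ x ∪ slot k p i ∧ 2 * (p * k + i) + 1 ∉ x ∪ slot k p i := by
    simp [h1, h2]
  simp only [Finset.disjoint_union_right, h3]
  split_ifs <;> tauto

theorem integs_zero (k i : ℕ) (f : Gr) : integs k 0 i f = f := by
  ext x; simp [integs_apply, slot]

theorem integs_mul_free {i : ℕ} (hi : i < k) {g : Gr} (hg : ∀ a < p, g ∈ free (a * k + i)) (f : Gr) :
    integs k p i (f * g) = integs k p i f * g := by
  induction p generalizing f with
  | zero => simp [integs_zero]
  | succ p ih =>
    rw [integs_succ hi, integ_mul_free (hg p (Nat.lt_succ_self p)),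
      ih (fun a ha => hg a (by omega)), integs_succ hi]

theorem gcopy_mem_cfree {a a' i : ℕ} (hi : i < k) (h : a ≠ a') (M : ℕ → ℕ → ℚ) :
    gcopy k a M ∈ cfree (a' * k + i) :=
  Subalgebra.prod_mem _ fun _ hb => Subalgebra.prod_mem _ fun _ hc =>
    Subalgebra.add_mem _ (Subalgebra.one_mem _) (Subalgebra.smul_mem _
      (th_mem_cfree (Finset.mem_range.mp hb) (Finset.mem_range.mp hc) hi (Or.inl h)) _)

theorem gauss_succ (M : ℕ → ℕ → ℚ) : gauss k (p + 1) M = gauss k p M * gcopy k p M :=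
  Finset.prod_range_succ _ _

/-- The copies have disjoint generators: the integral over the last copy sees only its own factor,
and the result is a constant for the other integrals. -/
theorem integs_gauss_succ {i : ℕ} (hi : i < k) (M M' : ℕ → ℕ → ℚ) (c : ℚ)
    (h : integ (p * k + i) (gcopy k p M) = ((c • gcopy k p M' : Cen) : Gr)) :
    integs k (p + 1) i (gauss k (p + 1) M) =
      integs k p i (gauss k p M) * ((c • gcopy k p M' : Cen) : Gr) := by
  have hf : gauss k p M ∈ cfree (p * k + i) := Subalgebra.prod_mem _ fun a ha =>
    gcopy_mem_cfree hi (Finset.mem_range.mp ha).ne M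
  have hcomm : ((gauss k p M * gcopy k p M : Cen) : Gr) = gcopy k p M * gauss k p M := by
    rw [mul_comm]; rfl
  rw [integs_succ hi, gauss_succ, hcomm, integ_mul_free (mem_cfree.mp hf), h,
    ← Subalgebra.coe_mul, mul_comm, Subalgebra.coe_mul, integs_mul_free hi]
  intro a ha
  exact Subalgebra.smul_mem _ (gcopy_mem_cfree hi ha.ne' M') c

/-- Integration of a Gaussian element is elimination. -/
theorem integs_gauss {i : ℕ} (hi : i < k) {M : ℕ → ℕ → ℚ} (h0 : M i i ≠ 0) :
    integs k p i (gauss k p M) = (((M i i ^ p) • gauss k p (schur i M) : Cen) : Gr) := by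
  induction p with
  | zero => simp [integs_zero, gauss]
  | succ p ih =>
    rw [integs_gauss_succ hi M (schur i M) (M i i) (integ_gcopy p hi h0), ih,
      ← Subalgebra.coe_mul, smul_mul_smul_comm, gauss_succ, pow_succ]

theorem integs_gauss_zero {i : ℕ} (hi : i < k) {M : ℕ → ℕ → ℚ} (h0 : ∀ c < k, M i c = 0)
    (hp : p ≠ 0) : integs k p i (gauss k p M) = 0 := by
  obtain ⟨p, rfl⟩ := Nat.exists_eq_succ_of_ne_zero hp
  rw [Nat.succ_eq_add_one, integs_gauss_succ hi M M 0 (by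
    rw [integ_gcopy_zero p hi h0]; simp)]
  simp

/-- The generators of slot `i` are set to zero. -/
def restr (k p i : ℕ) : Gr →ₐ[ℚ] Gr where
  toFun f := ⟨fun x => if Disjoint x (slot k p i) then f x else 0⟩
  map_one' := by
    ext x
    simp only [one_def, mono]
    split_ifs with h h'
    · rfl
    · rfl
    · rename_i h'; subst h'; simp at h
    · rfl
  map_mul' f g := by
    ext x
    simp only [mul_apply]
    split_ifs with h
    · refine Finset.sum_congr rfl fun y hy => ?_
      have hy' := Finset.mem_powerset.mp hy
      rw [if_pos (h.mono_left hy'), if_pos (h.mono_left Finset.sdiff_subset)]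
    · refine (Finset.sum_eq_zero fun y hy => ?_).symm
      have hy' := Finset.mem_powerset.mp hy
      by_cases h1 : Disjoint y (slot k p i)
      · have : ¬ Disjoint (x \ y) (slot k p i) := fun h2 => h (by
          rw [← Finset.union_sdiff_of_subset hy']; exact Finset.disjoint_union_left.mpr ⟨h1, h2⟩)
        simp [this]
      · simp [h1]
  map_zero' := by ext x; simp [zero_apply]
  map_add' f g := by
    ext x
    simp only [add_apply]
    split_ifs <;> simp
  commutes' r := by
    ext x
    rw [Algebra.algebraMap_eq_smul_one]
    simp only [smul_apply, one_def, mono]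
    by_cases hx : x = ∅
    · subst hx; simp
    · simp [hx]

theorem restr_apply (k p i : ℕ) (f : Gr) (x : Finset ℕ) : restr k p i f x =
    if Disjoint x (slot k p i) then f x else 0 := rfl

/-- The products are formed in the centre, but `φ` acts on the whole noncommutative algebra and need
not be given on the centre, so multiplicativity is transferred factor by factor. -/
theorem map_coe_prod (φ : Gr →ₐ[ℚ] Gr) {ι : Type*} (s : Finset ι) (f g : ι → Cen)
    (h : ∀ j ∈ s, φ (f j : Gr) = (g j : Gr)) :
    φ ((∏ j ∈ s, f j : Cen) : Gr) = ((∏ j ∈ s, g j : Cen) : Gr) := by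
  classical
  induction s using Finset.induction_on with
  | empty => simp
  | insert a s ha ih =>
    rw [Finset.prod_insert ha, Finset.prod_insert ha, Subalgebra.coe_mul, map_mul,
      h a (Finset.mem_insert_self _ _), ih fun j hj => h j (Finset.mem_insert_of_mem hj),
      Subalgebra.coe_mul]

theorem restr_theta {i u v : ℕ} : restr k p i (theta u v) =
    if u ∈ slot k p i ∨ v ∈ slot k p i then 0 else (theta u v : Gr) := by
  ext x
  rw [restr_apply, theta_val, psi_mul_psi]
  by_cases hx : x = {u, v}
  · subst hx
    simp only [Finset.disjoint_insert_left, Finset.disjoint_singleton_left]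
    by_cases h1 : u ∈ slot k p i <;> by_cases h2 : v ∈ slot k p i <;> simp [h1, h2, zero_apply]
  · have : mono {u, v} x = 0 := by simp [mono, hx]
    split_ifs <;> simp [smul_apply, this, zero_apply]

theorem restr_gauss {i : ℕ} (hi : i < k) (M : ℕ → ℕ → ℚ) : restr k p i (gauss k p M) =
    (gauss k p (fun b c => if b = i ∨ c = i then 0 else M b c) : Gr) := by
  refine map_coe_prod _ _ _ _ fun a ha => map_coe_prod _ _ _ _ fun b hb => map_coe_prod _ _ _ _
    fun c hc => ?_
  have ha' := Finset.mem_range.mp ha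
  have hb' := Finset.mem_range.mp hb
  have hc' := Finset.mem_range.mp hc
  have h1 : 2 * (a * k + b) ∈ slot k p i ↔ b = i := by
    rw [mem_slot]
    constructor
    · rintro ⟨a', _, h⟩
      by_contra hne
      have := two_mul_ne hb' hi (a := a) (a' := a') (Or.inr hne)
      omega
    · rintro rfl; exact ⟨a, ha', Or.inl rfl⟩
  have h2 : 2 * (a * k + c) + 1 ∈ slot k p i ↔ c = i := by
    rw [mem_slot]
    constructor
    · rintro ⟨a', _, h⟩
      by_contra hne
      have := two_mul_ne hc' hi (a := a) (a' := a') (Or.inr hne)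
      omega
    · rintro rfl; exact ⟨a, ha', Or.inr rfl⟩
  simp only [Subalgebra.coe_add, Subalgebra.coe_one, Subalgebra.coe_smul, map_add, map_one,
    map_smul, th, restr_theta, h1, h2]
  split_ifs <;> simp

theorem gauss_apply_empty (M : ℕ → ℕ → ℚ) : (gauss k p M : Gr) ∅ = 1 := by
  have key : ∀ f g : Gr, (f * g) ∅ = f ∅ * g ∅ := fun f g => by simp [mul_apply]
  have hprod : ∀ (s : Finset ℕ) (f : ℕ → Cen), (∀ j ∈ s, (f j : Gr) ∅ = 1) →
      ((∏ j ∈ s, f j : Cen) : Gr) ∅ = 1 := by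
    intro s f
    induction s using Finset.induction_on with
    | empty => intro _; simp [one_def, mono]
    | insert a s ha ih =>
      intro h
      rw [Finset.prod_insert ha, Subalgebra.coe_mul, key, h a (Finset.mem_insert_self _ _),
        ih fun j hj => h j (Finset.mem_insert_of_mem hj), one_mul]
  refine hprod _ _ fun a _ => hprod _ _ fun b _ => hprod _ _ fun c _ => ?_
  have hne : (∅ : Finset ℕ) ≠ {2 * (a * k + b), 2 * (a * k + c) + 1} :=
    (Finset.insert_ne_empty _ _).symm
  simp [th, theta_val, psi_mul_psi, add_apply, smul_apply, one_def, mono, hne]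

end Gauss

end Grassmann

/-! ### Principal minors and Schur complements -/

namespace Elimination

open Finset

/-- Matrices that behave like positive semidefinite ones. -/
structure Psd (A : ℕ → ℕ → ℚ) (n : ℕ) : Prop where
  symm : ∀ a b, A a b = A b a
  null : ∀ z : ℕ → ℚ, ∑ i ∈ range n, z i * ∑ j ∈ range n, A i j * z j = 0 →
    ∀ i, ∑ j ∈ range n, A i j * z j = 0

variable (A : ℕ → ℕ → ℚ) (n : ℕ)

/-- The matrix that agrees with `A` on `S × S` and with the identity elsewhere. -/
def msk (S : Finset ℕ) : Matrix (Fin n) (Fin n) ℚ :=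
  fun i j => if (i : ℕ) ∈ S ∧ (j : ℕ) ∈ S then A i j else if i = j then 1 else 0

/-- The principal minors. -/
def dt (S : Finset ℕ) : ℚ := (msk A n S).det

/-- `K` is the part of `A` that is removed by the elimination of `S`. -/
def IsElim (S : Finset ℕ) (K : ℕ → ℕ → ℚ) : Prop :=
  ∃ G : ℕ → ℕ → ℚ, (∀ a b, K a b = ∑ s ∈ S, G a s * A s b) ∧ (∀ a, ∀ b ∈ S, K a b = A a b) ∧
    ∀ a, (∀ s ∈ S, A a s = 0) → ∀ b, K a b = 0

variable {A n}

theorem dt_empty : dt A n ∅ = 1 := by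
  have : msk A n ∅ = 1 := by ext i j; simp [msk, Matrix.one_apply]
  rw [dt, this, Matrix.det_one]

theorem isElim_empty : IsElim A ∅ (fun _ _ => 0) := ⟨fun _ _ => 0, by simp, by simp, by simp⟩

theorem IsElim.zero_left {S : Finset ℕ} {K : ℕ → ℕ → ℚ} (h : IsElim A S K) {a : ℕ}
    (ha : ∀ s ∈ S, A a s = 0) (b : ℕ) : K a b = 0 := by
  obtain ⟨G, -, -, h3⟩ := h; exact h3 a ha b

theorem IsElim.zero_right {S : Finset ℕ} {K : ℕ → ℕ → ℚ} (h : IsElim A S K) {b : ℕ}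
    (hb : ∀ s ∈ S, A s b = 0) (a : ℕ) : K a b = 0 := by
  obtain ⟨G, h1, -, -⟩ := h
  rw [h1]
  exact sum_eq_zero fun s hs => by rw [hb s hs, mul_zero]

/-- Substituting the second property into the first gives `K = G A_SS Gᵀ`. -/
theorem IsElim.symm (hA : ∀ a b, A a b = A b a) {S : Finset ℕ} {K : ℕ → ℕ → ℚ} (h : IsElim A S K)
    (a b : ℕ) : K a b = K b a := by
  obtain ⟨G, h1, h2, -⟩ := h
  have key : ∀ a b, K a b = ∑ s ∈ S, ∑ t ∈ S, G a s * (G b t * A t s) := fun a b => by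
    rw [h1]
    refine sum_congr rfl fun s hs => ?_
    rw [hA s b, ← h2 b s hs, h1, mul_sum]
  rw [key, key, sum_comm]
  refine sum_congr rfl fun s _ => sum_congr rfl fun t _ => ?_
  rw [hA]; ring

/-- Without entries between `S` and `T`, each of the two removed parts vanishes on the columns of
the other set, so they can be added. -/
theorem IsElim.union {S T : Finset ℕ} {K K' : ℕ → ℕ → ℚ} (h : IsElim A S K) (h' : IsElim A T K')
    (hA : ∀ a b, A a b = A b a) (hd : Disjoint S T) (h0 : ∀ s ∈ S, ∀ t ∈ T, A s t = 0) :
    IsElim A (S ∪ T) (fun a b => K a b + K' a b) := by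
  have hK' : ∀ a, ∀ b ∈ S, K' a b = 0 := fun a b hb =>
    h'.zero_right (fun t ht => by rw [hA]; exact h0 b hb t ht) a
  have hK : ∀ a, ∀ b ∈ T, K a b = 0 := fun a b hb =>
    h.zero_right (fun t ht => h0 t ht b hb) a
  obtain ⟨G, h1, h2, h3⟩ := h
  obtain ⟨G', h1', h2', h3'⟩ := h'
  refine ⟨fun a s => if s ∈ S then G a s else G' a s, fun a b => ?_, fun a b hb => ?_,
    fun a ha b => ?_⟩
  · dsimp only
    rw [sum_union hd, h1, h1']
    congr 1
    · exact sum_congr rfl fun s hs => by rw [if_pos hs]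
    · exact sum_congr rfl fun s hs => by rw [if_neg (disjoint_right.mp hd hs)]
  · dsimp only
    rcases mem_union.mp hb with hb | hb
    · rw [hK' a b hb, add_zero, h2 a b hb]
    · rw [hK a b hb, zero_add, h2' a b hb]
  · dsimp only
    rw [h3 a fun s hs => ha s (mem_union_left _ hs), h3' a fun s hs => ha s (mem_union_right _ hs),
      add_zero]

/-- One step of Gaussian elimination on the Schur complement `A - K`, with the pivot at `u`: `K`
grows by a rank-one matrix, and the rows of `G` are corrected by multiples of row `u`. -/
theorem IsElim.insert {S : Finset ℕ} {K : ℕ → ℕ → ℚ} (h : IsElim A S K)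
    (hA : ∀ a b, A a b = A b a) {u : ℕ} (hu : u ∉ S) (hπ : A u u - K u u ≠ 0) :
    IsElim A (insert u S) (fun a b => K a b + (A a u - K a u) * (A u b - K u b) / (A u u - K u u)) := by
  have hs := h.symm hA
  obtain ⟨G, h1, h2, h3⟩ := h
  refine ⟨fun a s => if s = u then (A a u - K a u) / (A u u - K u u) else
    G a s - (A a u - K a u) / (A u u - K u u) * G u s, fun a b => ?_, fun a b hb => ?_,
    fun a ha b => ?_⟩
  · dsimp only
    rw [sum_insert hu, if_pos rfl]
    have : ∑ s ∈ S, (if s = u then (A a u - K a u) / (A u u - K u u) else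
        G a s - (A a u - K a u) / (A u u - K u u) * G u s) * A s b =
        K a b - (A a u - K a u) / (A u u - K u u) * K u b := by
      rw [h1 a b, h1 u b, mul_sum, ← sum_sub_distrib]
      refine sum_congr rfl fun s hs => ?_
      rw [if_neg (by rintro rfl; exact hu hs)]
      ring
    rw [this]
    ring
  · dsimp only
    rcases mem_insert.mp hb with rfl | hb
    · field_simp; ring
    · rw [h2 a b hb, h2 u b hb]; simp
  · dsimp only
    have h4 := h3 a fun s hs => ha s (mem_insert_of_mem hs)
    rw [h4, h4, ha u (mem_insert_self _ _)]
    simp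

theorem sum_fin_ite {S : Finset ℕ} (hS : S ⊆ range n) (f : ℕ → ℚ) :
    ∑ i : Fin n, (if (i : ℕ) ∈ S then f i else 0) = ∑ s ∈ S, f s := by
  rw [← Finset.sum_range (fun i => if i ∈ S then f i else 0), ← sum_filter,
    filter_mem_eq_inter, inter_eq_right.mpr hS]

/-- Subtracting `∑ G u s` times row `s` from row `u` clears the columns in `S` and leaves `A u u - K
u u` in column `u`. As `G` is part of `IsElim`, no inverse of `A_SS` is needed. -/
theorem dt_insert {S : Finset ℕ} {K : ℕ → ℕ → ℚ} (h : IsElim A S K) (hS : S ⊆ range n) {u : ℕ}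
    (hu : u ∉ S) (hun : u < n) : dt A n (insert u S) = dt A n S * (A u u - K u u) := by
  obtain ⟨G, h1, h2, -⟩ := h
  set v : Fin n := ⟨u, hun⟩ with hv
  have hiff : ∀ j : Fin n, (j : ℕ) = u ↔ j = v := fun j => by rw [hv, Fin.ext_iff]
  set M := msk A n (insert u S) with hM
  set c : Fin n → ℚ := fun i => if i = v then 1 else if (i : ℕ) ∈ S then -G u i else 0 with hc
  have e1 := Matrix.det_updateRow_sum M v c
  have e2 : ∑ l, c l • M l = (A u u - K u u) • Pi.single v (1 : ℚ) := by
    funext j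
    rw [Finset.sum_apply]
    have hsum : ∑ l, (c l • M l) j = M v j - ∑ s ∈ S, G u s *
        (if (j : ℕ) ∈ insert u S then A s j else 0) := by
      rw [← sum_fin_ite hS, ← add_sum_erase _ _ (mem_univ v), sub_eq_add_neg, ← sum_neg_distrib]
      congr 1
      · simp [hc]
      · rw [← add_sum_erase (univ : Finset (Fin n)) (fun i : Fin n => -(if (i : ℕ) ∈ S then G u i *
          (if (j : ℕ) ∈ insert u S then A i j else 0) else 0)) (mem_univ v)]
        have hvS : (v : ℕ) ∉ S := hu
        rw [if_neg hvS, neg_zero, zero_add]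
        refine sum_congr rfl fun l hl => ?_
        have hlv := ne_of_mem_erase hl
        simp only [hc, if_neg hlv, Pi.smul_apply, smul_eq_mul]
        by_cases hlS : (l : ℕ) ∈ S
        · rw [if_pos hlS, if_pos hlS, hM, msk]
          by_cases hj : (j : ℕ) ∈ insert u S
          · rw [if_pos ⟨mem_insert_of_mem hlS, hj⟩, if_pos hj]; ring
          · rw [if_neg (fun e => hj e.2), if_neg hj, if_neg (by
              rintro rfl; exact hj (mem_insert_of_mem hlS))]; ring
        · rw [if_neg hlS, if_neg hlS]; ring
    rw [hsum, Pi.smul_apply, smul_eq_mul, hM, msk]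
    have hvu : (v : ℕ) ∈ insert u S := mem_insert_self _ _
    by_cases hjv : j = v
    · subst hjv
      rw [if_pos ⟨hvu, hvu⟩, Pi.single_eq_same, mul_one]
      congr 1
      rw [h1]
      exact sum_congr rfl fun s _ => by rw [if_pos hvu]
    · rw [Pi.single_eq_of_ne hjv, mul_zero]
      by_cases hj : (j : ℕ) ∈ insert u S
      · rw [if_pos ⟨hvu, hj⟩]
        have hjS : (j : ℕ) ∈ S := (mem_insert.mp hj).resolve_left fun e => hjv ((hiff j).mp e)
        have := h2 u j hjS
        rw [h1] at this
        simp only [if_pos hj]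
        rw [this]; exact sub_self _
      · rw [if_neg (fun e => hj e.2), if_neg (Ne.symm hjv)]
        simp [hj]
  rw [e2, Matrix.det_updateRow_smul] at e1
  have hcv : c v = 1 := by simp [hc]
  rw [hcv, one_smul] at e1
  -- Row `v` is now a unit vector; multiples of it clear column `v` in the other rows, and the
  -- matrix masked to `S` remains.
  have e3 : (M.updateRow v (Pi.single v (1 : ℚ))).det = dt A n S := by
    refine Matrix.det_eq_of_forall_row_eq_smul_add_const
      (fun i : Fin n => if (i : ℕ) ∈ S then A i u else 0) v (by simp [hv, hu]) fun i j => ?_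
    have hv0 : msk A n S v j = if v = j then 1 else 0 := by
      rw [msk, if_neg (fun e => hu e.1)]
    rw [hv0]
    by_cases hi : i = v
    · subst hi
      rw [Matrix.updateRow_self, if_neg hu, zero_mul, add_zero, hv0, Pi.single_apply]
      simp only [eq_comm]
    · have hiu : (i : ℕ) ≠ u := fun e => hi ((hiff i).mp e)
      rw [Matrix.updateRow_ne hi, hM, msk, msk]
      simp only [mem_insert, hiu, false_or, hiff]
      by_cases hiS : (i : ℕ) ∈ S
      · by_cases hj : j = v
        · subst hj; simp [hiS, hu, hv, (hv ▸ hi : ¬ i = ⟨u, hun⟩)]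
        · simp [hiS, hj, Ne.symm hj]
      · simp [hiS]
  rw [e3] at e1
  rw [dt, ← hM, ← e1, mul_comm]

/-- For `z = e_u - G_u` the vector `A z` is row `u` of the Schur complement, which vanishes on `S`.
Hence `zᵀ A z` is the pivot, and if it is zero, then `A z = 0`. -/
theorem Psd.pivot_zero (hA : Psd A n) {S : Finset ℕ} {K : ℕ → ℕ → ℚ} (h : IsElim A S K)
    (hS : S ⊆ range n) {u : ℕ} (hun : u < n) (h0 : A u u - K u u = 0) (b : ℕ) :
    A u b - K u b = 0 := by
  obtain ⟨G, h1, h2, -⟩ := h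
  set z : ℕ → ℚ := fun i => (if i = u then 1 else 0) - if i ∈ S then G u i else 0 with hz
  have hsum : ∀ f : ℕ → ℚ, ∑ j ∈ range n, f j * z j = f u - ∑ s ∈ S, G u s * f s := fun f => by
    simp only [hz, mul_sub, sum_sub_distrib, mul_ite, mul_one, mul_zero]
    rw [sum_ite_eq', if_pos (mem_range.mpr hun), ← sum_filter, filter_mem_eq_inter,
      inter_eq_right.mpr hS]
    simp only [mul_comm]
  have hrow : ∀ i, ∑ j ∈ range n, A i j * z j = A u i - K u i := fun i => by
    rw [hsum, h1, hA.symm i u]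
    simp only [hA.symm i]
  have := hA.null z (by
    simp only [hrow]
    have := hsum fun i => A u i - K u i
    simp only [mul_comm (z _)]
    rw [this, h0, sum_eq_zero, sub_zero]
    intro s hs
    rw [h2 u s hs]; ring) b
  rwa [hrow] at this

/-- A kernel vector of the matrix masked to `S` is supported on `S` and makes the quadratic form
vanish, so it lies in the kernel of `A` and of every larger mask. Singular sets therefore stay
singular, and `Rep` may ignore them. -/
theorem Psd.dt_insert_eq_zero (hA : Psd A n) {S : Finset ℕ} {u : ℕ}
    (h0 : dt A n S = 0) : dt A n (insert u S) = 0 := by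
  obtain ⟨z, hz0, hz⟩ := Matrix.exists_mulVec_eq_zero_iff.mpr h0
  have hoff : ∀ i : Fin n, (i : ℕ) ∉ S → z i = 0 := fun i hi => by
    have := congrFun hz i
    simpa [Matrix.mulVec, dotProduct, msk, hi] using this
  set y : ℕ → ℚ := fun i => if h : i < n then z ⟨i, h⟩ else 0 with hy
  have hyz : ∀ i : Fin n, y i = z i := fun i => by simp [hy]
  have hrow : ∀ i : Fin n, ∀ T : Finset ℕ, S ⊆ T → (i : ℕ) ∈ T →
      (msk A n T).mulVec z i = ∑ j ∈ range n, A i j * y j := fun i T hST hi => by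
    rw [Finset.sum_range, Matrix.mulVec, dotProduct]
    refine sum_congr rfl fun j _ => ?_
    rw [hyz, msk]
    by_cases hj : (j : ℕ) ∈ T
    · rw [if_pos ⟨hi, hj⟩]
    · rw [hoff j fun e => hj (hST e), mul_zero, mul_zero]
  have hnull := hA.null y (by
    rw [Finset.sum_range]
    refine sum_eq_zero fun i _ => ?_
    by_cases hi : (i : ℕ) ∈ S
    · rw [← hrow i S le_rfl hi, hz]; simp
    · rw [hyz, hoff i hi, zero_mul])
  refine Matrix.exists_mulVec_eq_zero_iff.mp ⟨z, hz0, ?_⟩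
  funext i
  by_cases hi : (i : ℕ) ∈ insert u S
  · rw [hrow i _ (subset_insert _ _) hi, hnull]; rfl
  · have hiS : (i : ℕ) ∉ S := fun e => hi (mem_insert_of_mem e)
    simpa [Matrix.mulVec, dotProduct, msk, hi] using hoff i hiS

/-- If no entry joins `S` and `T`, the matrix masked to `S ∪ T` is the product of the two masked
matrices. -/
theorem dt_union (hA : ∀ a b, A a b = A b a) {S T : Finset ℕ} (hd : Disjoint S T)
    (h0 : ∀ s ∈ S, ∀ t ∈ T, A s t = 0) : dt A n (S ∪ T) = dt A n S * dt A n T := by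
  rw [dt, dt, dt, ← Matrix.det_mul]
  congr 1
  ext i j
  rw [Matrix.mul_apply]
  by_cases hi : (i : ℕ) ∈ S
  · have hiT : (i : ℕ) ∉ T := disjoint_left.mp hd hi
    by_cases hj : (j : ℕ) ∈ T
    · have hjS : (j : ℕ) ∉ S := disjoint_right.mp hd hj
      rw [sum_eq_zero]
      · rw [msk, if_pos ⟨mem_union_left _ hi, mem_union_right _ hj⟩, h0 i hi j hj]
      · intro l _
        simp only [msk, hi, hj, true_and, and_true]
        by_cases hl : (l : ℕ) ∈ S
        · have hlT : (l : ℕ) ∉ T := disjoint_left.mp hd hl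
          have : l ≠ j := by rintro rfl; exact hlT hj
          simp [hlT, this]
        · have : i ≠ l := by rintro rfl; exact hl hi
          simp [hl, this]
    · rw [sum_eq_single j]
      · simp [msk, hi, hj, hiT]
      · intro l _ hl
        have : msk A n T l j = 0 := by simp [msk, hj, hl]
        rw [this, mul_zero]
      · simp
  · rw [sum_eq_single i]
    · simp only [msk, hi, mem_union, false_or, false_and, if_false, if_true, one_mul]
      by_cases hiT : (i : ℕ) ∈ T
      · by_cases hj : (j : ℕ) ∈ S
        · have hjT : (j : ℕ) ∉ T := disjoint_left.mp hd hj
          have : i ≠ j := by rintro rfl; exact hi hj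
          simp [hiT, hj, hjT, this, hA i j, h0 j hj i hiT]
        · simp [hiT, hj]
      · simp [hiT]
    · intro l _ hl
      have : msk A n S i l = 0 := by simp [msk, hi, Ne.symm hl]
      rw [this, zero_mul]
    · simp

/-! ### The elements computed by the algorithm -/

open Grassmann

/-- The weight of a set `S ⊆ D`. -/
def wt (α β : ℕ → ℚ) (D S : Finset ℕ) : ℚ := ∏ v ∈ D, if v ∈ S then β v else α v

/-- `W` is the sum over `S ⊆ D` of the weighted `p`-th powers of the minors, times the Gaussian
elements of the Schur complements on the slots, which hold the indices `X`. -/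
def Rep (A : ℕ → ℕ → ℚ) (n k p : ℕ) (α β : ℕ → ℚ) (X : ℕ → ℕ) (D : Finset ℕ) (W : Gr) : Prop :=
  D ⊆ range n ∧ ∃ K : Finset ℕ → ℕ → ℕ → ℚ, (∀ S ⊆ D, dt A n S ≠ 0 → IsElim A S (K S)) ∧
    W = ∑ S ∈ D.powerset, (wt α β D S * dt A n S ^ p) •
      (gauss k p (fun b c => -K S (X b) (X c)) : Gr)

variable {k p : ℕ} {α β : ℕ → ℚ}

theorem rep_empty (X : ℕ → ℕ) : Rep A n k p α β X ∅ 1 := by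
  refine ⟨empty_subset _, fun _ _ _ => 0, fun S hS _ => ?_, ?_⟩
  · rw [subset_empty.mp hS]; exact isElim_empty
  · simp [wt, dt_empty, gauss_zero]

theorem wt_union {D E S : Finset ℕ} (hd : Disjoint D E) :
    wt α β (D ∪ E) S = wt α β D (S ∩ D) * wt α β E (S ∩ E) := by
  rw [wt, prod_union hd]
  congr 1
  · exact prod_congr rfl fun v hv => by simp [hv]
  · exact prod_congr rfl fun v hv => by simp [hv]

/-- A set in `D ∪ E` splits into its traces on `D` and `E`. Determinants and weights multiply, the
removed parts add, and Gaussian elements turn this sum into a product. -/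
theorem Rep.union (hA : ∀ a b, A a b = A b a) {X : ℕ → ℕ} {D E : Finset ℕ} {W V : Gr}
    (h : Rep A n k p α β X D W) (h' : Rep A n k p α β X E V) (hd : Disjoint D E)
    (h0 : ∀ s ∈ D, ∀ t ∈ E, A s t = 0) : Rep A n k p α β X (D ∪ E) (W * V) := by
  obtain ⟨hD, K, hK, rfl⟩ := h
  obtain ⟨hE, K', hK', rfl⟩ := h'
  have hsplit : ∀ S ⊆ D ∪ E, (S ∩ D) ∪ (S ∩ E) = S := fun S hS => by
    rw [← inter_union_distrib_left, inter_eq_left.mpr hS]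
  have hdis : ∀ S : Finset ℕ, Disjoint (S ∩ D) (S ∩ E) := fun S =>
    hd.mono inter_subset_right inter_subset_right
  have hz : ∀ S : Finset ℕ, ∀ s ∈ S ∩ D, ∀ t ∈ S ∩ E, A s t = 0 := fun S s hs t ht =>
    h0 s (mem_inter.mp hs).2 t (mem_inter.mp ht).2
  have hdt : ∀ S ⊆ D ∪ E, dt A n S = dt A n (S ∩ D) * dt A n (S ∩ E) := fun S hS => by
    rw [← dt_union hA (hdis S) (hz S), hsplit S hS]
  refine ⟨union_subset hD hE, fun S a b => K (S ∩ D) a b + K' (S ∩ E) a b, fun S hS hS0 => ?_, ?_⟩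
  · rw [hdt S hS] at hS0
    have := (hK _ inter_subset_right (left_ne_zero_of_mul hS0)).union
      (hK' _ inter_subset_right (right_ne_zero_of_mul hS0)) hA (hdis S) (hz S)
    rwa [hsplit S hS] at this
  · rw [sum_mul_sum, ← sum_product']
    refine sum_bij' (fun t _ => t.1 ∪ t.2) (fun S _ => (S ∩ D, S ∩ E)) ?_ ?_ ?_ ?_ ?_
    · rintro ⟨S, T⟩ ht
      rw [mem_product, mem_powerset, mem_powerset] at ht
      exact mem_powerset.mpr (union_subset_union ht.1 ht.2)
    · intro S _
      rw [mem_product, mem_powerset, mem_powerset]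
      exact ⟨inter_subset_right, inter_subset_right⟩
    · rintro ⟨S, T⟩ ht
      rw [mem_product, mem_powerset, mem_powerset] at ht
      have h1 : T ∩ D = ∅ := disjoint_iff_inter_eq_empty.mp (hd.symm.mono_left ht.2)
      have h2 : S ∩ E = ∅ := disjoint_iff_inter_eq_empty.mp (hd.mono_left ht.1)
      simp [union_inter_distrib_right, h1, h2, inter_eq_left.mpr ht.1, inter_eq_left.mpr ht.2]
    · intro S hS
      exact hsplit S (mem_powerset.mp hS)
    · rintro ⟨S, T⟩ ht
      rw [mem_product, mem_powerset, mem_powerset] at ht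
      have h1 : T ∩ D = ∅ := disjoint_iff_inter_eq_empty.mp (hd.symm.mono_left ht.2)
      have h2 : S ∩ E = ∅ := disjoint_iff_inter_eq_empty.mp (hd.mono_left ht.1)
      have h3 : (S ∪ T) ∩ D = S := by
        simp [union_inter_distrib_right, h1, inter_eq_left.mpr ht.1]
      have h4 : (S ∪ T) ∩ E = T := by
        simp [union_inter_distrib_right, h2, inter_eq_left.mpr ht.2]
      dsimp only
      rw [wt_union hd, hdt _ (union_subset_union ht.1 ht.2), h3, h4, smul_mul_smul_comm,
        ← Subalgebra.coe_mul, gauss_mul]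
      congr 1
      · ring
      · congr 2; funext b c; ring

/-- The entries between the slot `i`, which holds `u`, and all slots. -/
def edge (A : ℕ → ℕ → ℚ) (X : ℕ → ℕ) (i u b c : ℕ) : ℚ :=
  if b = i then A u (X c) else if c = i then A (X b) u else 0

theorem wt_insert {D S : Finset ℕ} {u : ℕ} (hu : u ∉ D) :
    wt α β (insert u D) S = (if u ∈ S then β u else α u) * wt α β D S :=
  prod_insert hu

/-- Elimination of the index `u` in slot `i`. -/
theorem Rep.elim (hA : Psd A n) (hp : p ≠ 0) {X X' : ℕ → ℕ} {D : Finset ℕ} {W : Gr}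
    (h : Rep A n k p α β X' D W) {i u : ℕ} (hi : i < k) (hun : u < n) (hu : u ∉ D)
    (hXi : X' i = u) (hX : ∀ b, b ≠ i → X' b = X b) (h0 : ∀ v ∈ insert u D, A (X i) v = 0) :
    Rep A n k p α β X (insert u D) (α u • restr k p i W +
      β u • integs k p i (W * (gauss k p (edge A X' i u) : Gr))) := by
  obtain ⟨hD, K, hK, rfl⟩ := h
  have hDS : ∀ S ⊆ D, S ⊆ range n := fun S hS => hS.trans hD
  refine ⟨insert_subset (mem_range.mpr hun) hD, fun S a b => if u ∈ S then
    K (S.erase u) a b + (A a u - K (S.erase u) a u) * (A u b - K (S.erase u) u b) /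
      (A u u - K (S.erase u) u u) else K S a b, fun S hS hS0 => ?_, ?_⟩
  · by_cases huS : u ∈ S
    · simp only [huS, if_true]
      obtain ⟨T, hT, rfl⟩ : ∃ T, u ∉ T ∧ insert u T = S :=
        ⟨S.erase u, notMem_erase u S, insert_erase huS⟩
      rw [erase_insert hT]
      have hTD : T ⊆ D := (insert_subset_insert_iff hT).mp hS
      have hT0 : dt A n T ≠ 0 := fun e => hS0 (hA.dt_insert_eq_zero e)
      have hE := hK T hTD hT0
      rw [dt_insert hE (hDS T hTD) hT hun] at hS0
      exact hE.insert hA.symm hT (right_ne_zero_of_mul hS0)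
    · simp only [huS, if_false]
      exact hK S ((subset_insert_iff_of_notMem huS).mp hS) hS0
  · rw [sum_powerset_insert hu, map_sum, smul_sum, sum_mul, map_sum, smul_sum]
    congr 1
    -- Sets without `u`. Slot `i` passes to its former occupant `X i`, which has no entries with
    -- `D`; its row and column of `K S` are zero, which is what clearing the slot produces.
    · refine sum_congr rfl fun S hS => ?_
      have hSD := mem_powerset.mp hS
      have huS : u ∉ S := fun e => hu (hSD e)
      rw [wt_insert hu, if_neg huS, map_smul, smul_smul, restr_gauss hi]
      by_cases hS0 : dt A n S = 0
      · simp [hS0, hp]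
      have hE := hK S hSD hS0
      have hl := hE.zero_left fun s hs => h0 s (mem_insert_of_mem (hSD hs))
      have hr : ∀ a, K S a (X i) = 0 := hE.zero_right fun s hs => by
        rw [hA.symm]; exact h0 s (mem_insert_of_mem (hSD hs))
      congr 1
      · ring
      · congr 1
        refine gauss_congr fun b _ c _ => ?_
        simp only [huS, if_false]
        by_cases hb : b = i
        · subst hb; simp [hl]
        · by_cases hc : c = i
          · subst hc; simp [hr]
          · rw [if_neg (by simp [hb, hc]), hX b hb, hX c hc]
    · refine sum_congr rfl fun S hS => ?_
      have hSD := mem_powerset.mp hS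
      have huS : u ∉ S := fun e => hu (hSD e)
      have hw : wt α β D (insert u S) = wt α β D S := prod_congr rfl fun v hv => by
        have : v ≠ u := by rintro rfl; exact hu hv
        simp [this]
      rw [wt_insert hu, if_pos (mem_insert_self _ _), hw, smul_mul_assoc, map_smul, smul_smul,
        ← Subalgebra.coe_mul, gauss_mul]
      by_cases hS0 : dt A n S = 0
      · simp [hS0, hp, hA.dt_insert_eq_zero hS0]
      have hE := hK S hSD hS0
      rw [dt_insert hE (hDS S hSD) huS hun]
      -- In row and column `i` this is the Schur complement `A - K`, elsewhere only `-K`: an entry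
      -- of `A` between two slots enters when the first of its ends is eliminated.
      set M : ℕ → ℕ → ℚ := fun b c => -K S (X' b) (X' c) + edge A X' i u b c with hM
      have hMi : ∀ c, M i c = A u (X' c) - K S u (X' c) := fun c => by
        simp only [hM, edge, if_true, hXi]; ring
      have hMi' : ∀ b, M b i = A (X' b) u - K S (X' b) u := fun b => by
        simp only [hM, edge, if_true, hXi]
        split_ifs with hb
        · rw [hb, hXi]; ring
        · ring
      by_cases hπ : A u u - K S u u = 0
      -- A zero pivot: its whole row vanishes, hence the integral does, in agreement with the
      -- determinant of `insert u S`, which is zero as well.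
      · rw [integs_gauss_zero hi (fun c _ => by
          rw [hMi]; exact hA.pivot_zero hE (hDS S hSD) hun hπ _) hp, hπ]
        simp [hp]
      · rw [integs_gauss hi (by rw [hMi, hXi]; exact hπ), Subalgebra.coe_smul, smul_smul, hMi, hXi]
        have hl := hE.zero_left fun s hs => h0 s (mem_insert_of_mem (hSD hs))
        have hr : ∀ a, K S a (X i) = 0 := hE.zero_right fun s hs => by
          rw [hA.symm]; exact h0 s (mem_insert_of_mem (hSD hs))
        have hxu : A (X i) u = 0 := h0 u (mem_insert_self _ _)
        congr 1
        · rw [mul_pow]; ring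
        · congr 1
          refine gauss_congr fun b _ c _ => ?_
          dsimp only
          rw [if_pos (mem_insert_self _ _), erase_insert huS, schur]
          by_cases hb : b = i
          · subst hb; simp [hl, hxu]
          · by_cases hc : c = i
            · subst hc; simp [hr, hA.symm u, hxu]
            · rw [if_neg (by simp [hb, hc]), hMi, hMi', hMi, hXi, hX b hb, hX c hc]
              simp only [hM, edge, hb, hc, if_false, hX b hb, hX c hc]
              ring

/-- The value of a sum of weighted `p`-th powers of principal minors. -/
def powSum (A : ℕ → ℕ → ℚ) (n p : ℕ) (α β : ℕ → ℚ) (D : Finset ℕ) : ℚ :=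
  ∑ S ∈ D.powerset, wt α β D S * dt A n S ^ p

theorem coeff_sum {ι : Type*} (s : Finset ι) (f : ι → Gr) (z : Finset ℕ) :
    (∑ j ∈ s, f j) z = ∑ j ∈ s, f j z := by
  classical
  induction s using Finset.induction_on with
  | empty => simp [zero_apply]
  | insert a s ha ih => rw [sum_insert ha, sum_insert ha, add_apply, ih]

/-- Gaussian elements have constant coefficient 1, so the constant coefficient of `W` forgets the
separator and keeps the weighted sum of minors. -/
theorem Rep.apply_empty {X : ℕ → ℕ} {D : Finset ℕ} {W : Gr} (h : Rep A n k p α β X D W) :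
    W ∅ = powSum A n p α β D := by
  obtain ⟨-, K, -, rfl⟩ := h
  rw [coeff_sum, powSum]
  exact sum_congr rfl fun S _ => by rw [smul_apply, gauss_apply_empty, mul_one]

theorem mul_apply_empty (f g : Gr) : (f * g) ∅ = f ∅ * g ∅ := by simp [mul_apply]

end Elimination

/-! ### Tree decompositions and the elimination game -/

namespace Elimination

open Finset

section Tree

variable {T : Type*} {G : SimpleGraph T}

/-- Shortest paths from the root through `a` and through `b` both extend to paths to `s`. A tree has
only one such path, and its penultimate vertex is unique. -/
theorem parent_unique (hG : G.IsTree) {r s a b : T} (ha : G.Adj a s) (hb : G.Adj b s)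
    (hda : G.dist r s = G.dist r a + 1) (hdb : G.dist r s = G.dist r b + 1) : a = b := by
  classical
  obtain ⟨p, -, hpl⟩ := hG.connected.exists_path_of_dist r a
  obtain ⟨q, -, hql⟩ := hG.connected.exists_path_of_dist r b
  have hp' : (p.concat ha).IsPath := SimpleGraph.Walk.isPath_of_length_eq_dist _ (by
    rw [SimpleGraph.Walk.length_concat, hpl, hda])
  have hq' : (q.concat hb).IsPath := SimpleGraph.Walk.isPath_of_length_eq_dist _ (by
    rw [SimpleGraph.Walk.length_concat, hql, hdb])
  have := congrArg Subtype.val ((hG.isAcyclic.subsingleton_path _ _).elim ⟨_, hp'⟩ ⟨_, hq'⟩)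
  have h2 := congrArg SimpleGraph.Walk.penultimate this
  simpa using h2

/-- `s` lies below `t` in the tree rooted at `r`. -/
def Below (G : SimpleGraph T) (r t s : T) : Prop := G.dist r s = G.dist r t + G.dist t s

/-- A neighbour of `s` is a child of `s`, which is below `t` too, or the parent of `s`. As `s ≠ t`,
the parent is the penultimate vertex of the path from `t` to `s`. -/
theorem below_of_adj (hG : G.IsTree) {r t s s' : T} (h : Below G r t s) (hst : s ≠ t)
    (ha : G.Adj s' s) : Below G r t s' := by
  unfold Below at *
  have hc := hG.connected
  have tri : G.dist r s' ≤ G.dist r t + G.dist t s' := hc.dist_triangle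
  obtain ⟨q, hq⟩ := hc.exists_walk_length_eq_dist t s
  have hnil : ¬ q.Nil := fun h' => hst h'.eq.symm
  have hadj := q.adj_penultimate hnil
  have hl : q.dropLast.length + 1 = q.length := by
    have := congrArg SimpleGraph.Walk.length (q.concat_dropLast hadj)
    rwa [SimpleGraph.Walk.length_concat] at this
  have h1 := SimpleGraph.dist_le q.dropLast
  have h2 : G.dist r q.penultimate ≤ G.dist r t + G.dist t q.penultimate := hc.dist_triangle
  rcases hG.dist_eq_dist_add_one_of_adj r ha with h3 | h3
  · rcases hG.dist_eq_dist_add_one_of_adj t ha with h4 | h4 <;> omega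
  · have : s' = q.penultimate := by
      rcases hG.dist_eq_dist_add_one_of_adj r hadj with h5 | h5
      · omega
      · exact parent_unique hG ha hadj h3 h5
    subst this
    omega

/-- A walk can leave the part of the tree below `t` only through `t` itself. -/
theorem below_of_connected (hG : G.IsTree) {r t : T} {K : Set T} (hK : (G.induce K).Connected)
    {a b : T} (ha : a ∈ K) (hb : b ∈ K) (hab : Below G r t a) : Below G r t b ∨ t ∈ K := by
  by_contra! hn
  obtain ⟨w⟩ := hK.preconnected ⟨a, ha⟩ ⟨b, hb⟩
  have key : ∀ (x y : K) (w : (G.induce K).Walk x y), Below G r t x → Below G r t y := by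
    intro x y w
    induction w with
    | nil => exact id
    | @cons u v w hadj p ih =>
      intro hu
      refine ih (below_of_adj hG hu (fun h => hn.2 (h ▸ u.2)) ?_)
      exact (SimpleGraph.induce_adj.mp hadj).symm
  exact hn.1 (key _ _ w hab)

/-- Here the walk may pass through `t`, but as no node of `K` is closer to the root than `t`, it
continues from `t` to a child. -/
theorem below_of_dist_le (hG : G.IsTree) {r t : T} {K : Set T} (hK : (G.induce K).Connected)
    (hd : ∀ s ∈ K, G.dist r t ≤ G.dist r s) {a b : T} (ha : a ∈ K) (hb : b ∈ K)
    (hab : Below G r t a) : Below G r t b := by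
  by_contra hn
  obtain ⟨w⟩ := hK.preconnected ⟨a, ha⟩ ⟨b, hb⟩
  have key : ∀ (x y : K) (w : (G.induce K).Walk x y), Below G r t x → Below G r t y := by
    intro x y w
    induction w with
    | nil => exact id
    | @cons u v w hadj p ih =>
      intro hu
      refine ih ?_
      have hadj' : G.Adj u v := SimpleGraph.induce_adj.mp hadj
      by_cases hut : (u : T) = t
      · have h1 := hd v v.2
        have h2 : G.dist t v = 1 := SimpleGraph.dist_eq_one_iff_adj.mpr (hut ▸ hadj')
        rw [hut] at hadj'
        unfold Below
        rcases hG.dist_eq_dist_add_one_of_adj r hadj' with h3 | h3 <;> omega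
      · exact below_of_adj hG hu hut hadj'.symm
  exact hn (key _ _ w hab)

end Tree

/-- The neighbours of a connected set that come before it in the order of the depths of the top
bags lie in a single bag. -/
theorem mem_bag_of_adj {V : Type*} {G : SimpleGraph V} (D : TreeDecomposition G) (r : Fin D.size)
    (h : V → Fin D.size) (hh : ∀ v, v ∈ D.bag (h v))
    (hmin : ∀ v t, v ∈ D.bag t → D.tree.dist r (h v) ≤ D.tree.dist r t) {C : V → Prop} {v : V}
    (hC : ∀ c, C c → Relation.ReflTransGen (fun a b => C b ∧ G.Adj a b) v c)
    (hv : ∀ c, C c → D.tree.dist r (h v) ≤ D.tree.dist r (h c)) {x c : V} (hc : C c)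
    (hcx : G.Adj c x) (hx : D.tree.dist r (h x) ≤ D.tree.dist r (h v)) : x ∈ D.bag (h v) := by
  have base : ∀ s, v ∈ D.bag s → Below D.tree r (h v) s := fun s hs =>
    below_of_dist_le D.isTree (D.connected v) (fun s hs => hmin v s hs) (hh v) hs (by
      simp [Below])
  have key : ∀ c, Relation.ReflTransGen (fun a b => C b ∧ G.Adj a b) v c →
      ∀ s, c ∈ D.bag s → Below D.tree r (h v) s := by
    intro c hc
    induction hc with
    | refl => exact base
    | tail _ hbc ih =>
      intro s hs
      obtain ⟨t, hbt, hct⟩ := D.edge_cover _ _ hbc.2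
      exact below_of_dist_le D.isTree (D.connected _)
        (fun s hs => (hv _ hbc.1).trans (hmin _ s hs)) hct hs (ih t hbt)
  obtain ⟨t, hct, hxt⟩ := D.edge_cover _ _ hcx
  -- The bags of `x` contain one that lies below `h v`. Either `h x` is below `h v` too, and the
  -- comparison of depths gives `h x = h v`, or the bags of `x` pass through `h v`.
  rcases below_of_connected D.isTree (D.connected x) hxt (hh x) (key c (hC c hc) t hct) with h1 | h1
  · unfold Below at h1
    have h2 : D.tree.dist (h v) (h x) = 0 := by omega
    rw [D.isTree.connected.dist_eq_zero_iff] at h2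
    rw [h2]; exact hh x
  · exact h1

section Game

variable (A : ℕ → ℕ → ℚ) (n k : ℕ)

/-- `z` is a vertex that is not occupied. -/
def Free (X : ℕ → ℕ) (z : ℕ) : Prop := z < n ∧ ∀ j < k, X j ≠ z

/-- Connectedness by unoccupied vertices. -/
def Conn (X : ℕ → ℕ) : ℕ → ℕ → Prop :=
  Relation.ReflTransGen fun a b => Free n k X a ∧ Free n k X b ∧ A a b ≠ 0

open Classical in
/-- The component of `y` in the graph of unoccupied vertices. -/
noncomputable def comp (X : ℕ → ℕ) (y : ℕ) : Finset ℕ :=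
  (range n).filter fun z => Free n k X z ∧ Conn A n k X y z

/-- A legal move: slot `i` does not touch the component of `y` and moves to its vertex `u`. -/
def Move (X : ℕ → ℕ) (y i u : ℕ) : Prop :=
  i < k ∧ u ∈ comp A n k X y ∧ ∀ z ∈ comp A n k X y, A (X i) z = 0

/-- The component of `y` can be eliminated in at most `r` rounds. -/
def Win : ℕ → (ℕ → ℕ) → ℕ → Prop
  | 0, _, _ => False
  | r + 1, X, y => ∃ i u, Move A n k X y i u ∧ ∀ y' ∈ comp A n k X y, y' ≠ u →
      Win r (Function.update X i u) y'

variable {A n k}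

theorem mem_comp {X : ℕ → ℕ} {y z : ℕ} :
    z ∈ comp A n k X y ↔ Free n k X z ∧ Conn A n k X y z := by
  simp only [comp, mem_filter, mem_range, and_iff_right_iff_imp]
  exact fun h => h.1.1

theorem Conn.symm (hA : ∀ a b, A a b = A b a) {X : ℕ → ℕ} {a b : ℕ} (h : Conn A n k X a b) :
    Conn A n k X b a := by
  induction h with
  | refl => exact .refl
  | tail _ h ih => exact .head ⟨h.2.1, h.1, hA _ _ ▸ h.2.2⟩ ih

theorem Conn.free {X : ℕ → ℕ} {a b : ℕ} (h : Conn A n k X a b) (ha : Free n k X a) :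
    Free n k X b := by
  induction h with
  | refl => exact ha
  | tail _ h _ => exact h.2.1

/-- The vertex released by slot `i` is not adjacent to the component, so releasing it joins nothing
to the component, and occupying `u` only removes vertices. Hence the game never loses ground. -/
theorem Move.comp_subset (hA : ∀ a b, A a b = A b a) {X : ℕ → ℕ} {y i u : ℕ}
    (h : Move A n k X y i u) {y' : ℕ} (hy : y' ∈ comp A n k X y) :
    comp A n k (Function.update X i u) y' ⊆ (comp A n k X y).erase u := by
  obtain ⟨hi, -, h0⟩ := h
  intro z hz
  rw [mem_comp] at hz
  obtain ⟨hz, hc⟩ := hz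
  have hne : z ≠ u := fun h' => hz.2 i hi (by simp [h'])
  rw [mem_erase]
  refine ⟨hne, ?_⟩
  clear hne hz
  induction hc with
  | refl => exact hy
  | @tail b c _ hbc ih =>
    have hX : ∀ j < k, X j ≠ c := by
      intro j hj hjc
      by_cases hji : j = i
      · subst hji
        apply hbc.2.2; rw [hA, ← hjc]; exact h0 b ih
      · exact hbc.2.1.2 j hj (by rw [Function.update_of_ne hji]; exact hjc)
    have hb := mem_comp.mp ih
    exact mem_comp.mpr ⟨⟨hbc.2.1.1, hX⟩, hb.2.tail ⟨hb.1, ⟨hbc.2.1.1, hX⟩, hbc.2.2⟩⟩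

theorem Move.free {X : ℕ → ℕ} {y i u : ℕ} (h : Move A n k X y i u) {y' : ℕ} (hy : y' ∈ comp A n k X y) (hu : y' ≠ u) :
    Free n k (Function.update X i u) y' := by
  have := (mem_comp.mp hy).1
  refine ⟨this.1, fun j hj => ?_⟩
  by_cases hji : j = i
  · subst hji; simpa using hu.symm
  · rw [Function.update_of_ne hji]; exact this.2 j hj

/-- The strategy is to occupy the vertex with the smallest key. The invariant is that occupants
adjacent to the component precede all its vertices; `hkey` allows at most `w` of them, so one of the
`w + 1` slots may move. Each move shrinks the component, so its size bounds the number of rounds. -/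
theorem win_of_key {w : ℕ} (hA : ∀ a b, A a b = A b a) (key : ℕ → ℕ)
    (hinj : ∀ a < n, ∀ b < n, key a = key b → a = b)
    (hkey : ∀ C : Finset ℕ, C ⊆ range n → ∀ v ∈ C,
      (∀ c ∈ C, Relation.ReflTransGen (fun a b => b ∈ C ∧ A a b ≠ 0) v c) →
      (∀ c ∈ C, key v ≤ key c) → ∀ N : Finset ℕ,
      (∀ x ∈ N, x < n ∧ key x < key v ∧ ∃ c ∈ C, A c x ≠ 0) → N.card ≤ w) :
    ∀ (r : ℕ) (X : ℕ → ℕ) (y : ℕ), Free n (w + 1) X y → (comp A n (w + 1) X y).card ≤ r →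
      (∀ i ≤ w, ∀ j ≤ w, X i = X j → X i < n → i = j) →
      (∀ c ∈ comp A n (w + 1) X y, ∀ j ≤ w, A c (X j) ≠ 0 → X j < n ∧
        ∀ d ∈ comp A n (w + 1) X y, key (X j) < key d) → Win A n (w + 1) r X y := by
  intro r
  induction r with
  | zero =>
    intro X y hy hc
    have : y ∈ comp A n (w + 1) X y := mem_comp.mpr ⟨hy, .refl⟩
    rw [card_eq_zero.mp (Nat.le_zero.mp hc)] at this
    simp at this
  | succ r ih =>
    intro X y hy hc hX hN
    have hyC : y ∈ comp A n (w + 1) X y := mem_comp.mpr ⟨hy, .refl⟩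
    obtain ⟨v, hv, hmin⟩ := exists_min_image (comp A n (w + 1) X y) key ⟨y, hyC⟩
    have hvC := mem_comp.mp hv
    have hsub : comp A n (w + 1) X y ⊆ range n := fun z hz => mem_range.mpr (mem_comp.mp hz).1.1
    have hconn : ∀ c ∈ comp A n (w + 1) X y,
        Relation.ReflTransGen (fun a b => b ∈ comp A n (w + 1) X y ∧ A a b ≠ 0) v c := by
      intro c hc
      have h1 : Conn A n (w + 1) X v c := (hvC.2.symm hA).trans (mem_comp.mp hc).2
      clear hc
      induction h1 with
      | refl => exact .refl
      | tail h1 h2 ih => exact ih.tail ⟨mem_comp.mpr ⟨h2.2.1, hvC.2.trans (h1.tail h2)⟩, h2.2.2⟩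
    -- Pigeonhole: slots that touch the component hold genuine vertices, and these are distinct by
    -- `hX`, so `w + 1` of them would contradict the bound `w`.
    obtain ⟨i, hi, h0⟩ : ∃ i ≤ w, ∀ z ∈ comp A n (w + 1) X y, A (X i) z = 0 := by
      by_contra! hcon
      have := hkey _ hsub v hv hconn hmin ((range (w + 1)).image X) (by
        intro x hx
        obtain ⟨i, hi, rfl⟩ := mem_image.mp hx
        obtain ⟨z, hz, hz'⟩ := hcon i (by simpa [Nat.lt_succ_iff] using hi)
        rw [hA] at hz'
        have := hN z hz i (by simpa [Nat.lt_succ_iff] using hi) hz'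
        exact ⟨this.1, this.2 v hv, z, hz, hz'⟩)
      rw [card_image_of_injOn, card_range] at this
      · omega
      · intro a ha b hb hab
        have ha' : a ≤ w := by simpa [Nat.lt_succ_iff] using ha
        have hb' : b ≤ w := by simpa [Nat.lt_succ_iff] using hb
        obtain ⟨z, hz, hz'⟩ := hcon a ha'
        rw [hA] at hz'
        exact hX a ha' b hb' hab (hN z hz a ha' hz').1
    have hm : Move A n (w + 1) X y i v := ⟨by omega, hv, h0⟩
    refine ⟨i, v, hm, fun y' hy' hne => ?_⟩
    have hs := hm.comp_subset hA hy'
    refine ih _ _ (hm.free hy' hne) ?_ ?_ ?_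
    · have := card_le_card hs
      rw [card_erase_of_mem hv] at this
      omega
    · intro a ha b hb hab hlt
      by_cases hai : a = i <;> by_cases hbi : b = i
      · rw [hai, hbi]
      · subst hai
        rw [Function.update_self, Function.update_of_ne hbi] at hab
        exact absurd hab.symm (hvC.1.2 b (by omega))
      · subst hbi
        rw [Function.update_self, Function.update_of_ne hai] at hab
        exact absurd hab (hvC.1.2 a (by omega))
      · rw [Function.update_of_ne hai, Function.update_of_ne hbi] at hab
        rw [Function.update_of_ne hai] at hlt
        exact hX a ha b hb hab hlt
    · intro c hc j hj hcj
      have hc' := mem_of_mem_erase (hs hc)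
      by_cases hji : j = i
      · subst hji
        rw [Function.update_self] at hcj ⊢
        refine ⟨hvC.1.1, fun d hd => ?_⟩
        have hd' := mem_erase.mp (hs hd)
        refine lt_of_le_of_ne (hmin d hd'.2) fun h => hd'.1 ?_
        exact (hinj v hvC.1.1 d (mem_comp.mp hd'.2).1.1 h).symm
      · rw [Function.update_of_ne hji] at hcj ⊢
        have := hN c hc' j hj hcj
        exact ⟨this.1, fun d hd => this.2 d (mem_of_mem_erase (hs hd))⟩

/-- Vertices are ordered by the depth of their topmost bag. For a connected set whose first vertex
is `v`, the earlier neighbours all lie in the topmost bag of `v` by `mem_bag_of_adj`. Empty slots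
hold `n`, where the padded matrix is zero, so they touch nothing. -/
theorem win_of_treeDecomposition {w : ℕ} (hA : ∀ a b, A a b = A b a)
    (hpad : ∀ a b, n ≤ a → A a b = 0) {G : SimpleGraph (Fin n)}
    (hG : ∀ i j : Fin n, i ≠ j → A i j ≠ 0 → G.Adj i j) (D : TreeDecomposition G)
    (hD : D.width ≤ w) {X : ℕ → ℕ} (hX : ∀ j ≤ w, X j = n) {y : ℕ} (hy : y < n) :
    Win A n (w + 1) n X y := by
  classical
  obtain ⟨r, -⟩ := D.bag_cover ⟨y, hy⟩
  have htop : ∀ v, ∃ t, v ∈ D.bag t ∧ ∀ s, v ∈ D.bag s → D.tree.dist r t ≤ D.tree.dist r s := by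
    intro v
    obtain ⟨t, ht⟩ := D.bag_cover v
    obtain ⟨t, ht, hm⟩ := exists_min_image (univ.filter fun t => v ∈ D.bag t)
      (fun t => D.tree.dist r t) ⟨t, by simpa using ht⟩
    exact ⟨t, by simpa using ht, fun s hs => hm s (by simpa using hs)⟩
  choose h hh hmin using htop
  -- The vertex number, which is below `n`, breaks ties between equal depths and makes the key
  -- injective.
  let key : ℕ → ℕ := fun v => if hv : v < n then D.tree.dist r (h ⟨v, hv⟩) * n + v else 0
  have keyv : ∀ v : Fin n, key v = D.tree.dist r (h v) * n + v := fun v => by simp [key]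
  have key_lt : ∀ a b : Fin n, key a ≤ key b → D.tree.dist r (h a) ≤ D.tree.dist r (h b) := by
    intro a b hab
    rw [keyv, keyv] at hab
    by_contra! hlt
    have h1 := Nat.mul_le_mul_right n hlt
    have := b.2
    rw [Nat.succ_mul] at h1
    omega
  refine win_of_key hA key ?_ ?_ n _ y ⟨hy, fun j hj => (hX j (by omega)).trans_ne hy.ne'⟩ ?_ ?_ ?_
  · intro a ha b hb hab
    have h1 := key_lt ⟨a, ha⟩ ⟨b, hb⟩ hab.le
    have h2 := key_lt ⟨b, hb⟩ ⟨a, ha⟩ hab.ge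
    have h3 := keyv ⟨a, ha⟩
    have h4 := keyv ⟨b, hb⟩
    simp only at h3 h4
    rw [h3, h4, le_antisymm h1 h2] at hab
    omega
  · intro C hC v hv hconn hm N hN
    have hvn := mem_range.mp (hC hv)
    have hsub : insert v N ⊆ (D.bag (h ⟨v, hvn⟩)).map Fin.valEmbedding := by
      intro x hx
      rw [mem_map]
      rcases mem_insert.mp hx with rfl | hx
      · exact ⟨⟨x, hvn⟩, hh _, rfl⟩
      · obtain ⟨hxn, hxv, c, hc, hcx⟩ := hN x hx
        have hcn := mem_range.mp (hC hc)
        refine ⟨⟨x, hxn⟩, ?_, rfl⟩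
        refine mem_bag_of_adj D r h hh hmin (C := fun z => (z : ℕ) ∈ C) (v := ⟨v, hvn⟩)
          (c := ⟨c, hcn⟩) ?_ ?_ hc ?_ (key_lt ⟨x, hxn⟩ ⟨v, hvn⟩ hxv.le)
        · intro d hd
          have h1 := hconn d hd
          obtain ⟨d, hdn⟩ := d
          simp only at h1 hd
          clear hd
          induction h1 with
          | refl => exact .refl
          | @tail a b h1 h2 ih =>
            have han : a < n := by
              by_contra! hna; exact h2.2 (hpad a b hna)
            by_cases hab : a = b
            · subst hab; exact ih han
            · exact (ih han).tail ⟨h2.1, hG ⟨a, han⟩ ⟨b, hdn⟩ (by simpa using hab) h2.2⟩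
        · intro d hd
          exact key_lt ⟨v, hvn⟩ d (hm d hd)
        · refine hG _ _ ?_ hcx
          intro heq
          have : c = x := by simpa using heq
          subst this
          exact absurd (hm c hc) (by omega)
    have h1 := card_le_card hsub
    -- The bag has at most `w + 1` elements, and `v` is one of them outside `N`; this is where `w +
    -- 1` drops to `w`.
    rw [card_map, card_insert_of_notMem] at h1
    · have h2 : (D.bag (h ⟨v, hvn⟩)).card ≤ univ.sup fun t => (D.bag t).card :=
        le_sup (f := fun t => (D.bag t).card) (mem_univ _)
      unfold TreeDecomposition.width at hD
      omega
    · intro hvN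
      exact absurd (hN v hvN).2.1 (lt_irrefl _)
  · calc _ ≤ (range n).card := card_le_card fun z hz => mem_range.mpr (mem_comp.mp hz).1.1
      _ = n := card_range n
  · intro i hi j _ _ hlt
    exact absurd (hX i hi) hlt.ne
  · intro c _ j hj hcj
    rw [hA, hX j hj] at hcj
    exact absurd (hpad _ _ le_rfl) hcj

end Game

end Elimination

/-! ### Correctness and safety of programs -/

namespace Imp

instance (m : ℕ) : OfNat NE m := ⟨.lit m⟩
instance : Add NE := ⟨.add⟩
instance : Mul NE := ⟨.mul⟩
instance : Sub NE := ⟨.sub⟩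
instance (m : ℕ) : OfNat QE m := ⟨.nat (.lit m)⟩
instance : Add QE := ⟨.add⟩
instance : Mul QE := ⟨.mul⟩
instance : Sub QE := ⟨.sub⟩

infixr:40 " ;; " => Cmd.seq
prefix:max "♯" => NE.var
notation "ℓ" => NE.rd
notation "ρ" => QE.rd
infix:50 " =ₙ " => fun a b => BE.eq (QE.nat a) (QE.nat b)
infix:50 " <ₙ " => fun a b => BE.lt (QE.nat a) (QE.nat b)

section Simp

variable {σ : St} {Γ : Par}

@[simp] theorem NE.eval_zero : (0 : NE).eval σ = 0 := rfl
@[simp] theorem NE.eval_one : (1 : NE).eval σ = 1 := rfl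
@[simp] theorem NE.eval_two : (2 : NE).eval σ = 2 := rfl
@[simp] theorem NE.eval_add (a b : NE) : (a + b).eval σ = a.eval σ + b.eval σ := rfl
@[simp] theorem NE.eval_mul (a b : NE) : (a * b).eval σ = a.eval σ * b.eval σ := rfl
@[simp] theorem NE.eval_sub (a b : NE) : (a - b).eval σ = a.eval σ - b.eval σ := rfl
@[simp] theorem NE.eval_var (i : ℕ) : (NE.var i).eval σ = σ.nv i := rfl
@[simp] theorem NE.eval_rd (r : Fin 16) (a : NE) : (NE.rd r a).eval σ = σ.na r (a.eval σ) := rfl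
@[simp] theorem QE.eval_zero : (0 : QE).eval σ = 0 := Nat.cast_zero
@[simp] theorem QE.eval_one : (1 : QE).eval σ = 1 := Nat.cast_one
@[simp] theorem QE.eval_add (a b : QE) : (a + b).eval σ = a.eval σ + b.eval σ := rfl
@[simp] theorem QE.eval_mul (a b : QE) : (a * b).eval σ = a.eval σ * b.eval σ := rfl
@[simp] theorem QE.eval_sub (a b : QE) : (a - b).eval σ = a.eval σ - b.eval σ := rfl
@[simp] theorem QE.eval_nat (a : NE) : (QE.nat a).eval σ = a.eval σ := rfl
@[simp] theorem QE.eval_rd (r : Fin 16) (a : NE) : (QE.rd r a).eval σ = σ.qa r (a.eval σ) := rfl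
@[simp] theorem BE.eval_eq (a b : QE) : (BE.eq a b).eval σ ↔ a.eval σ = b.eval σ := Iff.rfl
@[simp] theorem BE.eval_lt (a b : QE) : (BE.lt a b).eval σ ↔ a.eval σ < b.eval σ := Iff.rfl
@[simp] theorem NE.ok_zero : ((0 : NE).Ok Γ σ) ↔ 0 ≤ Γ.NB := Iff.rfl
@[simp] theorem NE.ok_one : ((1 : NE).Ok Γ σ) ↔ 1 ≤ Γ.NB := Iff.rfl
@[simp] theorem NE.ok_two : ((2 : NE).Ok Γ σ) ↔ 2 ≤ Γ.NB := Iff.rfl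
@[simp] theorem NE.ok_var (i : ℕ) : NE.Ok Γ σ (.var i) ↔ True := Iff.rfl
@[simp] theorem NE.ok_rd (r : Fin 16) (e : NE) :
    NE.Ok Γ σ (.rd r e) ↔ e.Ok Γ σ ∧ e.eval σ ≤ Γ.NB := Iff.rfl
@[simp] theorem NE.ok_add (a b : NE) : (a + b).Ok Γ σ ↔
    a.Ok Γ σ ∧ b.Ok Γ σ ∧ a.eval σ + b.eval σ ≤ Γ.NB := Iff.rfl
@[simp] theorem NE.ok_mul (a b : NE) : (a * b).Ok Γ σ ↔
    a.Ok Γ σ ∧ b.Ok Γ σ ∧ a.eval σ * b.eval σ ≤ Γ.NB := Iff.rfl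
@[simp] theorem NE.ok_sub (a b : NE) : (a - b).Ok Γ σ ↔
    a.Ok Γ σ ∧ b.Ok Γ σ ∧ b.eval σ ≤ a.eval σ ∧ a.eval σ ≤ Γ.NB := Iff.rfl
@[simp] theorem QE.ok_nat (a : NE) : (QE.nat a).Ok Γ σ ↔ a.Ok Γ σ := Iff.rfl
@[simp] theorem QE.ok_zero : ((0 : QE).Ok Γ σ) ↔ 0 ≤ Γ.NB := Iff.rfl
@[simp] theorem QE.ok_one : ((1 : QE).Ok Γ σ) ↔ 1 ≤ Γ.NB := Iff.rfl
@[simp] theorem QE.ok_rd (r : Fin 16) (e : NE) : (QE.rd r e).Ok Γ σ ↔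
    e.Ok Γ σ ∧ e.eval σ ≤ Γ.NB ∧ (r = 0 → e.eval σ < Γ.inp) := Iff.rfl
@[simp] theorem QE.ok_add (a b : QE) : (a + b).Ok Γ σ ↔
    a.Ok Γ σ ∧ b.Ok Γ σ ∧ Γ.V (a.eval σ + b.eval σ) := Iff.rfl
@[simp] theorem QE.ok_mul (a b : QE) : (a * b).Ok Γ σ ↔
    a.Ok Γ σ ∧ b.Ok Γ σ ∧ Γ.V (a.eval σ * b.eval σ) := Iff.rfl
@[simp] theorem QE.ok_sub (a b : QE) : (a - b).Ok Γ σ ↔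
    a.Ok Γ σ ∧ b.Ok Γ σ ∧ Γ.V (a.eval σ - b.eval σ) := Iff.rfl
@[simp] theorem BE.ok_lt (a b : QE) : (BE.lt a b).Ok Γ σ ↔ a.Ok Γ σ ∧ b.Ok Γ σ := Iff.rfl
@[simp] theorem BE.ok_eq (a b : QE) : (BE.eq a b).Ok Γ σ ↔ a.Ok Γ σ ∧ b.Ok Γ σ := Iff.rfl

@[simp] theorem St.setV_nv (i m j : ℕ) : (σ.setV i m).nv j = if j = i then m else σ.nv j := by
  simp [St.setV, Function.update_apply]
@[simp] theorem St.setV_na (i m : ℕ) : (σ.setV i m).na = σ.na := rfl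
@[simp] theorem St.setV_qa (i m : ℕ) : (σ.setV i m).qa = σ.qa := rfl
@[simp] theorem St.setN_nv (r : Fin 16) (a m : ℕ) : (σ.setN r a m).nv = σ.nv := rfl
@[simp] theorem St.setN_qa (r : Fin 16) (a m : ℕ) : (σ.setN r a m).qa = σ.qa := rfl
@[simp] theorem St.setN_na (r : Fin 16) (a m : ℕ) (r' : Fin 16) : (σ.setN r a m).na r' =
    if r' = r then Function.update (σ.na r) a m else σ.na r' := by
  simp [St.setN, Function.update_apply]
@[simp] theorem St.setQ_nv (r : Fin 16) (a : ℕ) (x : ℚ) : (σ.setQ r a x).nv = σ.nv := rfl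
@[simp] theorem St.setQ_na (r : Fin 16) (a : ℕ) (x : ℚ) : (σ.setQ r a x).na = σ.na := rfl
@[simp] theorem St.setQ_qa (r : Fin 16) (a : ℕ) (x : ℚ) (r' : Fin 16) : (σ.setQ r a x).qa r' =
    if r' = r then Function.update (σ.qa r) a x else σ.qa r' := by
  simp [St.setQ, Function.update_apply]

end Simp

/-! #### Frames -/

/-- The command may change the variable `v`. -/
def Cmd.wv : Cmd → ℕ → Bool
  | .skip, _ => false
  | .set i _, v => i == v
  | .nwr _ _ _, _ => false
  | .qwr _ _ _, _ => false
  | .seq c₁ c₂, v => c₁.wv v || c₂.wv v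
  | .ite _ c₁ c₂, v => c₁.wv v || c₂.wv v
  | .loop i _ c, v => i == v || c.wv v

/-- The command may change the array `r` of naturals. -/
def Cmd.wn : Cmd → Fin 16 → Bool
  | .skip, _ => false
  | .set _ _, _ => false
  | .nwr s _ _, r => s == r
  | .qwr _ _ _, _ => false
  | .seq c₁ c₂, v => c₁.wn v || c₂.wn v
  | .ite _ c₁ c₂, v => c₁.wn v || c₂.wn v
  | .loop _ _ c, v => c.wn v

/-- The command may change the array `r` of rationals. -/
def Cmd.wq : Cmd → Fin 16 → Bool
  | .skip, _ => false
  | .set _ _, _ => false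
  | .nwr _ _ _, _ => false
  | .qwr s _ _, r => s == r
  | .seq c₁ c₂, v => c₁.wq v || c₂.wq v
  | .ite _ c₁ c₂, v => c₁.wq v || c₂.wq v
  | .loop _ _ c, v => c.wq v

/-- Everything that the command does not change is as before. -/
structure Frame (c : Cmd) (σ τ : St) : Prop where
  nv : ∀ v, c.wv v = false → τ.nv v = σ.nv v
  na : ∀ r, c.wn r = false → τ.na r = σ.na r
  qa : ∀ r, c.wq r = false → τ.qa r = σ.qa r

theorem Frame.refl (c : Cmd) (σ : St) : Frame c σ σ :=
  ⟨fun _ _ => rfl, fun _ _ => rfl, fun _ _ => rfl⟩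

theorem Frame.trans {c : Cmd} {σ τ υ : St} (h : Frame c σ τ) (h' : Frame c τ υ) : Frame c σ υ :=
  ⟨fun v hv => (h'.nv v hv).trans (h.nv v hv), fun v hv => (h'.na v hv).trans (h.na v hv),
    fun v hv => (h'.qa v hv).trans (h.qa v hv)⟩

theorem Frame.mono {c c' : Cmd} {σ τ : St} (h : Frame c σ τ)
    (hv : ∀ v, c'.wv v = false → c.wv v = false) (hn : ∀ v, c'.wn v = false → c.wn v = false)
    (hq : ∀ v, c'.wq v = false → c.wq v = false) : Frame c' σ τ :=
  ⟨fun v h' => h.nv v (hv v h'), fun v h' => h.na v (hn v h'), fun v h' => h.qa v (hq v h')⟩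

theorem Frame.setV_loop (i : ℕ) (e : NE) (c : Cmd) (σ : St) (m : ℕ) :
    Frame (.loop i e c) σ (σ.setV i m) := by
  refine ⟨fun v hv => ?_, fun _ _ => rfl, fun _ _ => rfl⟩
  simp only [Cmd.wv, Bool.or_eq_false_iff, beq_eq_false_iff_ne] at hv
  simp [Ne.symm hv.1]

theorem frame_run (c : Cmd) : ∀ σ : St, Frame c σ (c.run σ) := by
  induction c with
  | skip => exact fun σ => Frame.refl _ _
  | set i e =>
    refine fun σ => ⟨fun v hv => ?_, fun _ _ => rfl, fun _ _ => rfl⟩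
    simp only [Cmd.wv, beq_eq_false_iff_ne] at hv
    simp [Cmd.run, Ne.symm hv]
  | nwr r a e =>
    refine fun σ => ⟨fun _ _ => rfl, fun v hv => ?_, fun _ _ => rfl⟩
    simp only [Cmd.wn, beq_eq_false_iff_ne] at hv
    simp [Cmd.run, Ne.symm hv]
  | qwr r a e =>
    refine fun σ => ⟨fun _ _ => rfl, fun _ _ => rfl, fun v hv => ?_⟩
    simp only [Cmd.wq, beq_eq_false_iff_ne] at hv
    simp [Cmd.run, Ne.symm hv]
  | seq c₁ c₂ ih₁ ih₂ =>
    intro σ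
    refine ((ih₁ σ).mono ?_ ?_ ?_).trans ((ih₂ _).mono ?_ ?_ ?_) <;> intro v hv <;>
      simp only [Cmd.wv, Cmd.wn, Cmd.wq, Bool.or_eq_false_iff] at hv <;> first | exact hv.1 | exact hv.2
  | ite b c₁ c₂ ih₁ ih₂ =>
    intro σ
    simp only [Cmd.run]
    split_ifs
    · refine (ih₁ σ).mono ?_ ?_ ?_ <;> intro v hv <;>
      simp only [Cmd.wv, Cmd.wn, Cmd.wq, Bool.or_eq_false_iff] at hv <;> exact hv.1
    · refine (ih₂ σ).mono ?_ ?_ ?_ <;> intro v hv <;>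
      simp only [Cmd.wv, Cmd.wn, Cmd.wq, Bool.or_eq_false_iff] at hv <;> exact hv.2
  | loop i e c ih =>
    intro σ
    simp only [Cmd.run]
    generalize e.eval σ = m
    induction m with
    | zero => exact Frame.refl _ _
    | succ m ihm =>
      refine (ihm.trans (Frame.setV_loop i e c _ m)).trans ((ih _).mono ?_ ?_ ?_) <;> intro v hv <;>
        simp only [Cmd.wv, Cmd.wn, Cmd.wq, Bool.or_eq_false_iff] at hv <;>
        first | exact hv.2 | exact hv

/-! #### Specifications -/

/-- The command runs safely from `σ`, and the resulting state satisfies `Q`. -/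
def Spec (Γ : Par) (c : Cmd) (σ : St) (Q : St → Prop) : Prop := c.Safe Γ σ ∧ Q (c.run σ)

variable {Γ : Par} {σ : St} {Q : St → Prop}

theorem Spec.mono {c : Cmd} {P : St → Prop} (h : Spec Γ c σ P)
    (hQ : ∀ τ, Frame c σ τ → P τ → Q τ) : Spec Γ c σ Q :=
  ⟨h.1, hQ _ (frame_run c σ) h.2⟩

theorem Spec.skip (h : Q σ) : Spec Γ .skip σ Q := ⟨trivial, h⟩

theorem Spec.set {i : ℕ} {e : NE} (he : e.Ok Γ σ) (h : Q (σ.setV i (e.eval σ))) :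
    Spec Γ (.set i e) σ Q := ⟨he, h⟩

theorem Spec.nwr {r : Fin 16} {a e : NE} (ha : a.Ok Γ σ) (ha' : a.eval σ ≤ Γ.NB) (he : e.Ok Γ σ)
    (h : Q (σ.setN r (a.eval σ) (e.eval σ))) : Spec Γ (.nwr r a e) σ Q := ⟨⟨ha, ha', he⟩, h⟩

theorem Spec.qwr {r : Fin 16} {a : NE} {e : QE} (ha : a.Ok Γ σ) (ha' : a.eval σ ≤ Γ.NB)
    (hr : r = 0 → a.eval σ < Γ.inp) (he : e.Ok Γ σ)
    (h : Q (σ.setQ r (a.eval σ) (e.eval σ))) : Spec Γ (.qwr r a e) σ Q := ⟨⟨ha, ha', hr, he⟩, h⟩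

theorem Spec.seq {c₁ c₂ : Cmd} (h : Spec Γ c₁ σ fun τ => Spec Γ c₂ τ Q) :
    Spec Γ (c₁ ;; c₂) σ Q := ⟨⟨h.1, h.2.1⟩, h.2.2⟩

/-- What the first command cannot change reaches the second through the frame, so `P` needs to
mention only what is new. -/
theorem Spec.then {c₁ c₂ : Cmd} {P : St → Prop} (h : Spec Γ c₁ σ P)
    (h' : ∀ τ, Frame c₁ σ τ → P τ → Spec Γ c₂ τ Q) : Spec Γ (c₁ ;; c₂) σ Q :=
  Spec.seq (h.mono h')

theorem Spec.ite {b : BE} {c₁ c₂ : Cmd} (hb : b.Ok Γ σ) (h₁ : b.eval σ → Spec Γ c₁ σ Q)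
    (h₂ : ¬ b.eval σ → Spec Γ c₂ σ Q) : Spec Γ (.ite b c₁ c₂) σ Q := by
  refine ⟨⟨hb, fun h => (h₁ h).1, fun h => (h₂ h).1⟩, ?_⟩
  simp only [Cmd.run]
  split_ifs with h
  exacts [(h₁ h).2, (h₂ h).2]

/-- The invariant refers to the moment before the loop variable receives its value, so it must not
depend on that variable (`hI`). The frame offered to each iteration reaches back to the state before
the loop. -/
theorem Spec.loop {i : ℕ} {e : NE} {c : Cmd} (m : ℕ) (I : ℕ → St → Prop) (hm : e.eval σ = m)
    (he : e.Ok Γ σ) (hB : m ≤ Γ.B) (h0 : I 0 σ)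
    (hI : ∀ j τ a, I j τ → I j (τ.setV i a))
    (hstep : ∀ j < m, ∀ τ, Frame (.loop i e c) σ τ → τ.nv i = j → I j τ → Spec Γ c τ (I (j + 1)))
    (hQ : ∀ τ, Frame (.loop i e c) σ τ → I m τ → Q τ) : Spec Γ (.loop i e c) σ Q := by
  subst hm
  have hc : ∀ υ τ, Frame c υ τ → Frame (.loop i e c) υ τ := fun υ τ h => by
    refine h.mono ?_ ?_ ?_ <;> intro v hv <;>
        simp only [Cmd.wv, Cmd.wn, Cmd.wq, Bool.or_eq_false_iff] at hv <;>
        first | exact hv.2 | exact hv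
  have key : ∀ j ≤ e.eval σ, I j (loopSt i c.run σ j) ∧ Frame (.loop i e c) σ (loopSt i c.run σ j) ∧
      ∀ j' < j, c.Safe Γ ((loopSt i c.run σ j').setV i j') := by
    intro j
    induction j with
    | zero => exact fun _ => ⟨h0, Frame.refl _ _, fun _ h => absurd h (Nat.not_lt_zero _)⟩
    | succ j ih =>
      intro hj
      obtain ⟨h1, h2, h3⟩ := ih (by omega)
      have h4 := h2.trans (Frame.setV_loop i e c _ j)
      have h5 := hstep j (by omega) _ h4 (by simp) (hI j _ j h1)
      refine ⟨h5.2, h4.trans (hc _ _ (frame_run c _)), fun j' hj' => ?_⟩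
      rcases Nat.lt_succ_iff_lt_or_eq.mp hj' with h | rfl
      exacts [h3 j' h, h5.1]
  obtain ⟨h1, h2, h3⟩ := key _ le_rfl
  exact ⟨⟨he, hB, h3⟩, hQ _ h2 h1⟩

/-- Loops that fill an interval of an array of rationals. -/
theorem Spec.fillQ {i : ℕ} {e a : NE} {q : QE} {r : Fin 16} (m base : ℕ) (g : ℕ → ℚ)
    (hm : e.eval σ = m) (he : e.Ok Γ σ) (hB : m ≤ Γ.B) (hr : r ≠ 0)
    (hstep : ∀ j < m, ∀ τ, Frame (.loop i e (.qwr r a q)) σ τ → τ.nv i = j →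
      (∀ z, (z < base ∨ base + j ≤ z) → τ.qa r z = σ.qa r z) →
      (∀ z < j, τ.qa r (base + z) = g z) →
      a.Ok Γ τ ∧ a.eval τ = base + j ∧ base + j ≤ Γ.NB ∧ q.Ok Γ τ ∧ q.eval τ = g j)
    (hQ : ∀ τ, Frame (.loop i e (.qwr r a q)) σ τ →
      (∀ z, (z < base ∨ base + m ≤ z) → τ.qa r z = σ.qa r z) →
      (∀ z < m, τ.qa r (base + z) = g z) → Q τ) : Spec Γ (.loop i e (.qwr r a q)) σ Q := by
  refine Spec.loop m (fun j τ => (∀ z, (z < base ∨ base + j ≤ z) → τ.qa r z = σ.qa r z) ∧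
    ∀ z < j, τ.qa r (base + z) = g z) hm he hB ⟨fun _ _ => rfl, fun _ h => absurd h
    (Nat.not_lt_zero _)⟩ (fun j τ a h => h) ?_ (fun τ hF h => hQ τ hF h.1 h.2)
  rintro j hj τ hF hi ⟨h1, h2⟩
  obtain ⟨ha, ha', hb, hq, hq'⟩ := hstep j hj τ hF hi h1 h2
  refine Spec.qwr ha (by omega) (fun h => absurd h hr) hq ⟨fun z hz => ?_, fun z hz => ?_⟩
  · rw [ha']
    simp only [St.setQ_qa, if_true]
    rw [Function.update_of_ne (by omega)]
    exact h1 z (by omega)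
  · rw [ha', hq']
    simp only [St.setQ_qa, if_true]
    rcases Nat.lt_succ_iff_lt_or_eq.mp hz with h | rfl
    · rw [Function.update_of_ne (by omega)]; exact h2 z h
    · rw [Function.update_self]

/-- Loops that fill an interval of an array of naturals. -/
theorem Spec.fillN {i : ℕ} {e a : NE} {q : NE} {r : Fin 16} (m base : ℕ) (g : ℕ → ℕ)
    (hm : e.eval σ = m) (he : e.Ok Γ σ) (hB : m ≤ Γ.B)
    (hstep : ∀ j < m, ∀ τ, Frame (.loop i e (.nwr r a q)) σ τ → τ.nv i = j →
      (∀ z, (z < base ∨ base + j ≤ z) → τ.na r z = σ.na r z) →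
      (∀ z < j, τ.na r (base + z) = g z) →
      a.Ok Γ τ ∧ a.eval τ = base + j ∧ base + j ≤ Γ.NB ∧ q.Ok Γ τ ∧ q.eval τ = g j)
    (hQ : ∀ τ, Frame (.loop i e (.nwr r a q)) σ τ →
      (∀ z, (z < base ∨ base + m ≤ z) → τ.na r z = σ.na r z) →
      (∀ z < m, τ.na r (base + z) = g z) → Q τ) : Spec Γ (.loop i e (.nwr r a q)) σ Q := by
  refine Spec.loop m (fun j τ => (∀ z, (z < base ∨ base + j ≤ z) → τ.na r z = σ.na r z) ∧
    ∀ z < j, τ.na r (base + z) = g z) hm he hB ⟨fun _ _ => rfl, fun _ h => absurd h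
    (Nat.not_lt_zero _)⟩ (fun j τ a h => h) ?_ (fun τ hF h => hQ τ hF h.1 h.2)
  rintro j hj τ hF hi ⟨h1, h2⟩
  obtain ⟨ha, ha', hb, hq, hq'⟩ := hstep j hj τ hF hi h1 h2
  refine Spec.nwr ha (by omega) hq ⟨fun z hz => ?_, fun z hz => ?_⟩
  · rw [ha']
    simp only [St.setN_na, if_true]
    rw [Function.update_of_ne (by omega)]
    exact h1 z (by omega)
  · rw [ha', hq']
    simp only [St.setN_na, if_true]
    rcases Nat.lt_succ_iff_lt_or_eq.mp hz with h | rfl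
    · rw [Function.update_of_ne (by omega)]; exact h2 z h
    · rw [Function.update_self]

end Imp

/-! ### Digits, tables of coefficients, and bounds on numbers -/

namespace Table

open Finset Grassmann

/-- The digits of `X` in base `b`. -/
def dig (b X j : ℕ) : ℕ := X / b ^ j % b

theorem dig_lt {b : ℕ} (hb : 0 < b) (X j : ℕ) : dig b X j < b := Nat.mod_lt _ hb

theorem dig_zero (b j : ℕ) : dig b 0 j = 0 := by simp [dig]

theorem dig_mul_le (b X i : ℕ) : dig b X i * b ^ i ≤ X :=
  (Nat.mul_le_mul_right _ (Nat.mod_le _ _)).trans (Nat.div_mul_le_self _ _)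

/-- Counting like an odometer: the carry reaches digit `j` if and only if `b ^ j ∣ X + 1`. -/
theorem dig_succ (b X j : ℕ) : dig b (X + 1) j =
    if b ^ j ∣ X + 1 then (if dig b X j + 1 = b then 0 else dig b X j + 1) else dig b X j := by
  unfold dig
  rw [Nat.succ_div]
  split_ifs with h1 h2
  · rw [Nat.add_mod, Nat.mod_eq_zero_of_dvd]
    rcases Nat.eq_zero_or_pos b with rfl | hb
    · omega
    · rcases Nat.lt_or_ge 1 b with hb1 | hb1
      · rw [Nat.mod_eq_of_lt hb1, h2]
      · have : b = 1 := by omega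
        subst this; simp
  · rcases Nat.eq_zero_or_pos b with rfl | hb
    · simp
    · have := Nat.mod_lt (X / b ^ j) hb
      rw [Nat.add_mod]
      rw [Nat.mod_eq_of_lt (show 1 < b by omega), Nat.mod_eq_of_lt (by omega)]
  · rfl

theorem dvd_succ_iff (b X j : ℕ) : b ^ (j + 1) ∣ X + 1 ↔ b ^ j ∣ X + 1 ∧ dig b X j + 1 = b := by
  rcases Nat.eq_zero_or_pos b with rfl | hb
  · simp [dig]
  have hd : b ^ j ∣ X + 1 → (dig b X j + 1 = b ↔ b ∣ (X + 1) / b ^ j) := by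
    intro h
    rw [Nat.succ_div, if_pos h, Nat.dvd_iff_mod_eq_zero, dig]
    have := Nat.mod_lt (X / b ^ j) hb
    rw [Nat.add_mod]
    rcases Nat.lt_or_ge 1 b with hb1 | hb1
    · rw [Nat.mod_eq_of_lt hb1]
      constructor
      · intro h'; rw [h', Nat.mod_self]
      · intro h'
        by_contra hne
        rw [Nat.mod_eq_of_lt (by omega)] at h'
        omega
    · have : b = 1 := by omega
      subst this; simp [Nat.mod_one]
  constructor
  · intro h
    have h1 := (pow_dvd_pow b (Nat.le_succ j)).trans h
    refine ⟨h1, (hd h1).mpr ?_⟩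
    rw [pow_succ] at h
    exact (Nat.dvd_div_iff_mul_dvd h1).mpr h
  · rintro ⟨h1, h2⟩
    rw [pow_succ]
    exact (Nat.dvd_div_iff_mul_dvd h1).mp ((hd h1).mp h2)

theorem dig_mod {b X i j : ℕ} (h : j < i) : dig b (X % b ^ i) j = dig b X j := by
  obtain ⟨d, rfl⟩ : ∃ d, i = j + (d + 1) := ⟨i - j - 1, by omega⟩
  unfold dig
  rw [pow_add, Nat.mod_mul_right_div_self, pow_succ', Nat.mod_mul_right_mod]

theorem dig_add (b X i j : ℕ) : dig b X (i + j) = dig b (X / b ^ i) j := by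
  unfold dig; rw [pow_add, Nat.div_div_eq_div_mul]

/-- The number obtained from `X` by replacing the digit with index `i` by `u`. -/
def setDig (b X i u : ℕ) : ℕ := X + u * b ^ i - dig b X i * b ^ i

/-- This separates the lower digits, the new digit and the higher digits. In the definition the
subtraction comes last, so it never truncates. -/
theorem setDig_eq (b X i u : ℕ) :
    setDig b X i u = X % b ^ i + b ^ i * (u + b * (X / b ^ (i + 1))) := by
  have h1 : b ^ i * (X / b ^ i) + X % b ^ i = X := Nat.div_add_mod _ _
  have h2 : b * (X / b ^ i / b) + X / b ^ i % b = X / b ^ i := Nat.div_add_mod _ _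
  rw [Nat.div_div_eq_div_mul, ← pow_succ] at h2
  unfold setDig
  rw [show dig b X i = X / b ^ i % b from rfl]
  have : X + u * b ^ i = X % b ^ i + b ^ i * (u + b * (X / b ^ (i + 1))) +
      X / b ^ i % b * b ^ i := by
    conv_lhs => rw [← h1, ← h2]
    ring
  rw [this, Nat.add_sub_cancel]

theorem setDig_dig {b X i u : ℕ} (hu : u < b) :
    dig b (setDig b X i u) = Function.update (dig b X) i u := by
  have hb : 0 < b := by omega
  have hp : 0 < b ^ i := Nat.pow_pos hb
  funext j
  rw [setDig_eq]
  set H := X / b ^ (i + 1) with hH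
  rcases lt_trichotomy j i with h | rfl | h
  · rw [Function.update_of_ne h.ne, ← dig_mod h, Nat.add_mul_mod_self_left, Nat.mod_mod, dig_mod h]
  · rw [Function.update_self, dig, Nat.add_mul_div_left _ _ hp,
      Nat.div_eq_of_lt (Nat.mod_lt _ hp), zero_add, Nat.add_mul_mod_self_left, Nat.mod_eq_of_lt hu]
  · obtain ⟨d, rfl⟩ : ∃ d, j = i + 1 + d := ⟨j - i - 1, by omega⟩
    rw [Function.update_of_ne (by omega), dig_add b X, ← hH, dig_add, pow_succ,
      ← Nat.div_div_eq_div_mul, Nat.add_mul_div_left _ _ hp, Nat.div_eq_of_lt (Nat.mod_lt _ hp),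
      zero_add, Nat.add_mul_div_left _ _ hb, Nat.div_eq_of_lt hu, zero_add]

theorem setDig_lt {b X i u k : ℕ} (hu : u < b) (hX : X < b ^ k) (hi : i < k) :
    setDig b X i u < b ^ k := by
  have hb : 0 < b := by omega
  have hp : 0 < b ^ i := Nat.pow_pos hb
  obtain ⟨d, rfl⟩ : ∃ d, k = i + 1 + d := ⟨k - i - 1, by omega⟩
  rw [setDig_eq]
  have h1 : X / b ^ (i + 1) < b ^ d := by
    rw [Nat.div_lt_iff_lt_mul (Nat.pow_pos hb), mul_comm, ← pow_add]; exact hX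
  have h2 := Nat.mod_lt X hp
  calc X % b ^ i + b ^ i * (u + b * (X / b ^ (i + 1)))
      < b ^ i * (u + b * (X / b ^ (i + 1)) + 1) := by rw [mul_add_one]; omega
    _ ≤ b ^ i * (b * b ^ d) := by
        refine Nat.mul_le_mul_left _ ?_
        calc u + b * (X / b ^ (i + 1)) + 1 ≤ b * (X / b ^ (i + 1) + 1) := by rw [mul_add_one]; omega
          _ ≤ _ := Nat.mul_le_mul_left _ h1
    _ = b ^ (i + 1 + d) := by ring

/-- Adding 1 gives a multiple of `b ^ (j + 1)`, so the carry passes digit `j`, which must have been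
maximal. In base `n + 1` this number is the position with all slots empty. -/
theorem dig_pred_pow {b k j : ℕ} (hb : 0 < b) (hj : j < k) : dig b (b ^ k - 1) j = b - 1 := by
  have h1 := dig_succ b (b ^ k - 1) j
  have h2 := dvd_succ_iff b (b ^ k - 1) j
  rw [Nat.sub_add_cancel (Nat.pow_pos hb)] at h1 h2
  have := (h2.mp (pow_dvd_pow b hj)).2
  omega

/-! #### Sets as numbers -/

/-- The number with the set `s` of binary digits. -/
def bin (s : Finset ℕ) : ℕ := ∑ i ∈ s, 2 ^ i

theorem bin_injective : Function.Injective bin := Finset.equivBitIndices.symm.injective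

theorem bin_union {s t : Finset ℕ} (h : Disjoint s t) : bin (s ∪ t) = bin s + bin t := sum_union h

theorem bin_range (L : ℕ) : bin (range L) + 1 = 2 ^ L := by
  have := Nat.geomSum_eq (m := 2) le_rfl L
  rw [bin, this]
  have := Nat.one_le_two_pow (n := L)
  simp; omega

theorem bin_lt {s : Finset ℕ} {L : ℕ} (h : s ⊆ range L) : bin s < 2 ^ L := by
  rw [← bin_range, Nat.lt_succ_iff]
  exact sum_le_sum_of_subset h

theorem exists_bin {L x : ℕ} (h : x < 2 ^ L) : ∃ s ⊆ range L, bin s = x := by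
  refine ⟨Finset.equivBitIndices x, fun i hi => ?_, Finset.equivBitIndices.symm_apply_apply x⟩
  rw [mem_range]
  by_contra! hL
  have h1 : 2 ^ i ≤ bin (Finset.equivBitIndices x) :=
    single_le_sum (f := fun i => 2 ^ i) (fun _ _ => Nat.zero_le _) hi
  rw [show bin (Finset.equivBitIndices x) = x from Finset.equivBitIndices.symm_apply_apply x] at h1
  have := Nat.pow_le_pow_right (n := 2) (by norm_num) hL
  omega

/-- Elements below `j` sum to less than `2 ^ j`, and elements above `j` contribute an even multiple
of `2 ^ j`. -/
theorem dig_bin (s : Finset ℕ) (j : ℕ) : dig 2 (bin s) j = if j ∈ s then 1 else 0 := by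
  have h1 : bin s = bin (s.filter (· < j)) + bin (s.filter (¬ · < j)) := by
    rw [← bin_union (disjoint_filter_filter_not _ _ _), filter_union_filter_not_eq]
  have h2 : bin (s.filter (· < j)) < 2 ^ j := bin_lt fun i hi => by
    simpa using (mem_filter.mp hi).2
  have h3 : bin (s.filter (¬ · < j)) = 2 ^ j * ((if j ∈ s then 1 else 0) +
      2 * ∑ i ∈ s.filter (j < ·), 2 ^ (i - (j + 1))) := by
    have : s.filter (¬ · < j) = s.filter (j < ·) ∪ s.filter (· = j) := by
      ext i; simp only [mem_filter, mem_union]; constructor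
      · rintro ⟨a, b⟩; rcases Nat.lt_or_ge j i with h | h
        · exact .inl ⟨a, h⟩
        · exact .inr ⟨a, by omega⟩
      · rintro (⟨a, b⟩ | ⟨a, b⟩) <;> exact ⟨a, by omega⟩
    rw [this, bin_union, mul_add, add_comm, filter_eq']
    · congr 1
      · split_ifs <;> simp [bin]
      · rw [mul_sum, mul_sum, bin]
        refine sum_congr rfl fun i hi => ?_
        have := (mem_filter.mp hi).2
        rw [← mul_assoc, ← pow_succ, ← pow_add]
        congr 1; omega
    · rw [disjoint_filter]; intro i _ h; omega
  rw [dig, h1, h3, Nat.add_mul_div_left _ _ (Nat.two_pow_pos j), Nat.div_eq_of_lt h2, zero_add,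
    Nat.add_mul_mod_self_left]
  split_ifs <;> rfl

theorem sum_bin (L : ℕ) {M : Type*} [AddCommMonoid M] (F : ℕ → M) :
    ∑ x ∈ range (2 ^ L), F x = ∑ s ∈ (range L).powerset, F (bin s) := by
  have : range (2 ^ L) = (range L).powerset.image bin := by
    ext x
    simp only [mem_range, mem_image, mem_powerset]
    exact ⟨fun h => exists_bin h, fun ⟨s, hs, h⟩ => h ▸ bin_lt hs⟩
  rw [this, sum_image fun _ _ _ _ h => bin_injective h]

/-! #### Tables -/

/-- `t` is the table of the coefficients of an element on the generators below `L`. -/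
structure Tab (L : ℕ) (t : ℕ → ℚ) (f : Gr) : Prop where
  val : ∀ s ⊆ range L, t (bin s) = f s
  supp : ∀ s, ¬ s ⊆ range L → f s = 0

/-- The sign of the product of two monomials given by numbers. -/
def sgn (L x y : ℕ) : ℚ := ∏ a ∈ range L, ∏ b ∈ range L,
  if dig 2 x a = 1 ∧ dig 2 y b = 1 then sg a b else 1

theorem sgn_bin {L : ℕ} {s t : Finset ℕ} (hs : s ⊆ range L) (ht : t ⊆ range L) :
    sgn L (bin s) (bin t) = eps s t := by
  unfold sgn eps
  rw [← prod_subset hs]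
  · refine prod_congr rfl fun a ha => ?_
    rw [← prod_subset ht]
    · refine prod_congr rfl fun b hb => ?_
      simp [dig_bin, ha, hb]
    · intro b _ hb; simp [dig_bin, hb]
  · intro a _ ha; simp [dig_bin, ha]

theorem sg_cases (a b : ℕ) : sg a b = 0 ∨ sg a b = 1 ∨ sg a b = -1 := by
  unfold sg; split_ifs <;> simp

theorem prod_sign {ι : Type*} (s : Finset ι) (f : ι → ℚ) (h : ∀ i ∈ s, f i = 0 ∨ f i = 1 ∨ f i = -1) :
    ∏ i ∈ s, f i = 0 ∨ ∏ i ∈ s, f i = 1 ∨ ∏ i ∈ s, f i = -1 := by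
  classical
  induction s using Finset.induction_on with
  | empty => simp
  | insert a s ha ih =>
    rw [prod_insert ha]
    rcases h a (mem_insert_self _ _) with h1 | h1 | h1 <;>
      rcases ih fun i hi => h i (mem_insert_of_mem hi) with h2 | h2 | h2 <;> simp [h1, h2]

theorem sgn_cases (L x y : ℕ) : sgn L x y = 0 ∨ sgn L x y = 1 ∨ sgn L x y = -1 :=
  prod_sign _ _ fun a _ => prod_sign _ _ fun b _ => by
    split_ifs
    exacts [sg_cases _ _, .inr (.inl rfl)]

/-- The product of tables. -/
def tmul (L : ℕ) (t t' : ℕ → ℚ) (z : ℕ) : ℚ :=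
  ∑ x ∈ range (2 ^ L), ∑ y ∈ range (2 ^ L), if x + y = z then sgn L x y * t x * t' y else 0

/-- For disjoint sets the sum of the numbers is the number of the union. For overlapping sets `x + y
= z` may hold by accident, but the sign is then zero, so plain addition replaces disjoint union. -/
theorem Tab.mul {L : ℕ} {t t' r : ℕ → ℚ} {f g : Gr} (hf : Tab L t f) (hg : Tab L t' g)
    (hr : ∀ z < 2 ^ L, r z = tmul L t t' z) : Tab L r (f * g) := by
  refine ⟨fun u hu => ?_, fun u hu => ?_⟩
  · rw [hr _ (bin_lt hu), tmul, sum_bin, mul_apply]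
    rw [← sum_subset (powerset_mono.mpr hu)]
    · refine sum_congr rfl fun s hs => ?_
      rw [mem_powerset] at hs
      rw [sum_bin, sum_eq_single (u \ s)]
      · rw [if_pos, sgn_bin (hs.trans hu) (sdiff_subset.trans hu), hf.val s (hs.trans hu),
          hg.val _ (sdiff_subset.trans hu)]
        rw [← bin_union disjoint_sdiff, union_sdiff_of_subset hs]
      · intro s' hs' hne
        rw [mem_powerset] at hs'
        split_ifs with h
        · rw [sgn_bin (hs.trans hu) hs']
          by_cases hd : Disjoint s s'
          · exfalso
            rw [← bin_union hd] at h
            have := bin_injective h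
            apply hne
            rw [← this, union_sdiff_left, sdiff_eq_self_of_disjoint hd.symm]
          · rw [eps_eq_zero hd, zero_mul, zero_mul]
        · rfl
      · intro h; exact absurd (mem_powerset.mpr (sdiff_subset.trans hu)) h
    · intro s hs hsu
      rw [mem_powerset] at hs hsu
      rw [sum_bin]
      refine sum_eq_zero fun s' hs' => ?_
      rw [mem_powerset] at hs'
      split_ifs with h
      · rw [sgn_bin hs hs']
        by_cases hd : Disjoint s s'
        · exfalso
          rw [← bin_union hd] at h
          exact hsu (bin_injective h ▸ subset_union_left)
        · rw [eps_eq_zero hd, zero_mul, zero_mul]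
      · rfl
  · rw [mul_apply]
    refine sum_eq_zero fun s hs => ?_
    rw [mem_powerset] at hs
    by_cases h1 : s ⊆ range L
    · have h2 : ¬ u \ s ⊆ range L := fun h2 => hu (by
        rw [← union_sdiff_of_subset hs]; exact union_subset h1 h2)
      rw [hg.supp _ h2, mul_zero]
    · rw [hf.supp _ h1, mul_zero, zero_mul]

theorem Tab.congr {L : ℕ} {t t' : ℕ → ℚ} {f : Gr} (h : Tab L t f) (ht : ∀ x < 2 ^ L, t' x = t x) :
    Tab L t' f := ⟨fun s hs => by rw [ht _ (bin_lt hs), h.val s hs], h.supp⟩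

theorem Tab.one {L : ℕ} {t : ℕ → ℚ} (h : ∀ x < 2 ^ L, t x = if x = 0 then 1 else 0) :
    Tab L t 1 := by
  refine ⟨fun s hs => ?_, fun s hs => ?_⟩
  · rw [h _ (bin_lt hs), one_def]
    change _ = if s = ∅ then 1 else 0
    have : bin s = 0 ↔ s = ∅ := by
      rw [← bin_injective.eq_iff]; rfl
    simp only [this]
  · rw [one_def]
    change (if s = ∅ then (1 : ℚ) else 0) = 0
    rw [if_neg]; rintro rfl; exact hs (empty_subset _)

theorem Tab.one_add {L : ℕ} {t : ℕ → ℚ} {u v : ℕ} {c : ℚ} (hu : u < L) (hv : v < L) (huv : u ≠ v)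
    (h : ∀ x < 2 ^ L, t x = if x = 2 ^ u + 2 ^ v then sg u v * c else if x = 0 then 1 else 0) :
    Tab L t (1 + c • (theta u v : Gr)) := by
  have hb : bin {u, v} = 2 ^ u + 2 ^ v := by rw [bin, sum_pair huv]
  have hm : ∀ s, (1 + c • (theta u v : Gr)) s =
      (if s = ∅ then 1 else 0) + c * (sg u v * if s = {u, v} then 1 else 0) := by
    intro s
    rw [add_apply, smul_apply, theta_val, psi_mul_psi, smul_apply, one_def]
    rfl
  have hne : ({u, v} : Finset ℕ) ≠ ∅ := by simp
  refine ⟨fun s hs => ?_, fun s hs => ?_⟩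
  · rw [h _ (bin_lt hs), hm, ← hb]
    have h0 : bin s = 0 ↔ s = ∅ := by rw [← bin_injective.eq_iff]; rfl
    simp only [h0, bin_injective.eq_iff]
    by_cases h1 : s = {u, v}
    · subst h1; simp [hne, mul_comm]
    · simp [h1]
  · rw [hm, if_neg, if_neg, mul_zero, mul_zero, add_zero]
    · rintro rfl; exact hs (by intro i; simp; rintro (rfl | rfl) <;> assumption)
    · rintro rfl; exact hs (empty_subset _)

/-! #### Bounds -/

/-- `x` has numerator and denominator bounded by `U ^ e` and `Q ^ e`. -/
def Bd (Q U e : ℕ) (x : ℚ) : Prop := (∃ m : ℤ, x * Q ^ e = m) ∧ |x| * Q ^ e ≤ U ^ e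

/-- The same for the sum of the absolute values of the entries of a table. -/
def Bt (Q U N e : ℕ) (t : ℕ → ℚ) : Prop :=
  (∀ x < N, ∃ m : ℤ, t x * Q ^ e = m) ∧ (∑ x ∈ range N, |t x|) * Q ^ e ≤ U ^ e

variable {Q U N : ℕ}

theorem Bt.bd {e : ℕ} {t : ℕ → ℚ} (h : Bt Q U N e t) {x : ℕ} (hx : x < N) : Bd Q U e (t x) :=
  ⟨h.1 x hx, le_trans (mul_le_mul_of_nonneg_right
    (single_le_sum (f := fun x => |t x|) (fun _ _ => abs_nonneg _) (mem_range.mpr hx))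
    (by positivity)) h.2⟩

theorem Bt.of_le {e : ℕ} {t t' : ℕ → ℚ} (h : Bt Q U N e t) (hi : ∀ x < N, ∃ m : ℤ, t' x * Q ^ e = m)
    (hle : ∑ x ∈ range N, |t' x| ≤ ∑ x ∈ range N, |t x|) : Bt Q U N e t' :=
  ⟨hi, le_trans (mul_le_mul_of_nonneg_right hle (by positivity)) h.2⟩

theorem Bt.congr {e : ℕ} {t t' : ℕ → ℚ} (h : Bt Q U N e t) (ht : ∀ x < N, t' x = t x) :
    Bt Q U N e t' := by
  refine h.of_le (fun x hx => by rw [ht x hx]; exact h.1 x hx) (le_of_eq ?_)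
  exact sum_congr rfl fun x hx => by rw [ht x (mem_range.mp hx)]

/-- Only `Q ≤ U` is used here; the factor 2 in the hypothesis pays for additions of two tables, in
`bt_elim`. -/
theorem Bt.mono (hQU : 2 * Q ≤ U) {e e' : ℕ} (he : e ≤ e') {t : ℕ → ℚ} (h : Bt Q U N e t) :
    Bt Q U N e' t := by
  obtain ⟨d, rfl⟩ := Nat.exists_eq_add_of_le he
  refine ⟨fun x hx => ?_, ?_⟩
  · obtain ⟨m, hm⟩ := h.1 x hx
    exact ⟨m * Q ^ d, by rw [pow_add, ← mul_assoc, hm]; push_cast; rfl⟩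
  · have hQ : (Q : ℚ) ≤ U := by exact_mod_cast (show Q ≤ U by omega)
    rw [pow_add, pow_add, ← mul_assoc]
    exact mul_le_mul h.2 (pow_le_pow_left₀ (by positivity) hQ d) (by positivity) (by positivity)

theorem bd_iff_bt {e : ℕ} {x : ℚ} : Bd Q U e x ↔ Bt Q U 1 e (fun _ => x) := by
  simp [Bd, Bt]

theorem Bd.mono (hQU : 2 * Q ≤ U) {e e' : ℕ} (he : e ≤ e') {x : ℚ} (h : Bd Q U e x) :
    Bd Q U e' x := bd_iff_bt.mpr ((bd_iff_bt.mp h).mono hQU he)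

theorem Bd.mul {e e' : ℕ} {x y : ℚ} (h : Bd Q U e x) (h' : Bd Q U e' y) :
    Bd Q U (e + e') (x * y) := by
  obtain ⟨⟨m, hm⟩, h2⟩ := h
  obtain ⟨⟨m', hm'⟩, h2'⟩ := h'
  refine ⟨⟨m * m', ?_⟩, ?_⟩
  · push_cast; rw [← hm, ← hm', pow_add]; ring
  · rw [abs_mul, pow_add, pow_add]
    calc |x| * |y| * ((Q : ℚ) ^ e * Q ^ e') = (|x| * Q ^ e) * (|y| * Q ^ e') := by ring
      _ ≤ _ := mul_le_mul h2 h2' (by positivity) (by positivity)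

/-- Partial sums of signed products are bounded. -/
theorem bd_tmul {e e' : ℕ} {t t' : ℕ → ℚ} (h : Bt Q U N e t) (h' : Bt Q U N e' t')
    (s : ℕ → ℕ → ℚ) (hs : ∀ x y, s x y = 0 ∨ s x y = 1 ∨ s x y = -1) :
    Bd Q U (e + e') (∑ x ∈ range N, ∑ y ∈ range N, s x y * t x * t' y) := by
  refine ⟨?_, ?_⟩
  · choose! m hm using h.1
    choose! m' hm' using h'.1
    have : ∀ x y, ∃ z : ℤ, s x y = z := fun x y => by
      rcases hs x y with h | h | h
      exacts [⟨0, by simp [h]⟩, ⟨1, by simp [h]⟩, ⟨-1, by simp [h]⟩]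
    choose z hz using this
    refine ⟨∑ x ∈ range N, ∑ y ∈ range N, z x y * m x * m' y, ?_⟩
    push_cast
    rw [sum_mul]
    refine sum_congr rfl fun x hx => ?_
    rw [sum_mul]
    refine sum_congr rfl fun y hy => ?_
    rw [← hm x (mem_range.mp hx), ← hm' y (mem_range.mp hy), hz, pow_add]; ring
  · have h1 : |∑ x ∈ range N, ∑ y ∈ range N, s x y * t x * t' y| ≤
        (∑ x ∈ range N, |t x|) * ∑ y ∈ range N, |t' y| := by
      rw [sum_mul_sum]
      refine (abs_sum_le_sum_abs _ _).trans (sum_le_sum fun x _ => ?_)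
      refine (abs_sum_le_sum_abs _ _).trans (sum_le_sum fun y _ => ?_)
      rw [abs_mul, abs_mul]
      have : |s x y| ≤ 1 := by rcases hs x y with h | h | h <;> simp [h]
      nlinarith [mul_nonneg (abs_nonneg (t x)) (abs_nonneg (t' y))]
    calc _ ≤ ((∑ x ∈ range N, |t x|) * ∑ y ∈ range N, |t' y|) * Q ^ (e + e') :=
          mul_le_mul_of_nonneg_right h1 (by positivity)
      _ = ((∑ x ∈ range N, |t x|) * Q ^ e) * ((∑ y ∈ range N, |t' y|) * Q ^ e') := by ring
      _ ≤ U ^ e * U ^ e' := mul_le_mul h.2 h'.2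
          (mul_nonneg (sum_nonneg fun _ _ => abs_nonneg _) (by positivity)) (by positivity)
      _ = _ := (pow_add _ _ _).symm

/-- Summed over all `z`, every pair `(x, y)` is counted at most once. So the ℓ¹ norm is
submultiplicative and the exponents just add, without a factor for the exponential number of
entries. -/
theorem Bt.tmul {L e e' : ℕ} {t t' : ℕ → ℚ} (h : Bt Q U (2 ^ L) e t) (h' : Bt Q U (2 ^ L) e' t') :
    Bt Q U (2 ^ L) (e + e') (tmul L t t') := by
  have hN := fun z => bd_tmul h h' (fun x y => if x + y = z then sgn L x y else 0)
    (fun x y => by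
      split_ifs
      exacts [sgn_cases _ _ _, .inl rfl])
  have heq : ∀ z, ∑ x ∈ range (2 ^ L), ∑ y ∈ range (2 ^ L),
      (if x + y = z then sgn L x y else 0) * t x * t' y = Table.tmul L t t' z := fun z => by
    simp only [Table.tmul, ite_mul, zero_mul]
  refine ⟨fun z _ => heq z ▸ (hN z).1, ?_⟩
  have h1 : ∑ z ∈ range (2 ^ L), |Table.tmul L t t' z| ≤
      (∑ x ∈ range (2 ^ L), |t x|) * ∑ y ∈ range (2 ^ L), |t' y| := by
    calc _ ≤ ∑ z ∈ range (2 ^ L), ∑ x ∈ range (2 ^ L), ∑ y ∈ range (2 ^ L),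
          if x + y = z then |t x| * |t' y| else 0 := by
            refine sum_le_sum fun z _ => ?_
            refine (abs_sum_le_sum_abs _ _).trans (sum_le_sum fun x _ => ?_)
            refine (abs_sum_le_sum_abs _ _).trans (sum_le_sum fun y _ => ?_)
            split_ifs
            · rw [abs_mul, abs_mul]
              have : |sgn L x y| ≤ 1 := by rcases sgn_cases L x y with h | h | h <;> simp [h]
              nlinarith [mul_nonneg (abs_nonneg (t x)) (abs_nonneg (t' y))]
            · simp
      _ ≤ _ := by
            rw [sum_comm, sum_mul_sum]
            refine sum_le_sum fun x _ => ?_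
            rw [sum_comm]
            refine sum_le_sum fun y _ => ?_
            rw [sum_ite_eq]
            split_ifs
            exacts [le_rfl, by positivity]
  calc _ ≤ ((∑ x ∈ range (2 ^ L), |t x|) * ∑ y ∈ range (2 ^ L), |t' y|) * Q ^ (e + e') :=
        mul_le_mul_of_nonneg_right h1 (by positivity)
    _ = ((∑ x ∈ range (2 ^ L), |t x|) * Q ^ e) * ((∑ y ∈ range (2 ^ L), |t' y|) * Q ^ e') := by ring
    _ ≤ U ^ e * U ^ e' := mul_le_mul h.2 h'.2
        (mul_nonneg (sum_nonneg fun _ _ => abs_nonneg _) (by positivity)) (by positivity)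
    _ = _ := (pow_add _ _ _).symm

end Table

/-! ### The algorithm -/

namespace Algo

open Imp Cmd Table Grassmann Elimination

/-! Variables: the parameters `n`, `p`, `k`, `L = 2pk`, `N = 2 ^ L`, `M = (n + 1) ^ k`; a position
`X`, a vertex `y`, a slot `i`, a vertex `u`, the next position `Y`; indices and flags. -/

notation "vn" => (0 : ℕ)
notation "vp" => (1 : ℕ)
notation "vk" => (2 : ℕ)
notation "vL" => (3 : ℕ)
notation "vN" => (4 : ℕ)
notation "vM" => (5 : ℕ)
notation "vX" => (6 : ℕ)
notation "vy" => (7 : ℕ)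
notation "vi" => (8 : ℕ)
notation "vu" => (9 : ℕ)
notation "vY" => (10 : ℕ)
notation "vx" => (11 : ℕ)
notation "vz" => (12 : ℕ)
notation "va" => (13 : ℕ)
notation "vb" => (14 : ℕ)
notation "ve" => (15 : ℕ)
notation "vt" => (16 : ℕ)
notation "vj" => (17 : ℕ)
notation "vm" => (18 : ℕ)
notation "vf" => (19 : ℕ)
notation "vo" => (20 : ℕ)
notation "vs" => (21 : ℕ)
notation "vd" => (22 : ℕ)
notation "vq" => (23 : ℕ)
notation "vl" => (24 : ℕ)
notation "vr" => (25 : ℕ)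
notation "vc" => (26 : ℕ)
notation "vg" => (27 : ℕ)
notation "vh" => (28 : ℕ)

/-! Arrays of naturals: powers of `2`, powers of `n + 1`, digits of positions, labels of components,
good pairs, binary digits, scratch. -/

notation "nPw2" => (0 : Fin 16)
notation "nPwn" => (1 : Fin 16)
notation "nDig" => (2 : Fin 16)
notation "nLab" => (3 : Fin 16)
notation "nGood" => (4 : Fin 16)
notation "nBit" => (5 : Fin 16)
notation "nTmp" => (6 : Fin 16)

/-! Arrays of rationals: input and output, the padded matrix, the weights, the tables of all pairs,
three tables, and cells for a sign, an entry, the value of the sum and its saved value. -/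

notation "qIn" => (0 : Fin 16)
notation "qA" => (1 : Fin 16)
notation "qAl" => (2 : Fin 16)
notation "qBe" => (3 : Fin 16)
notation "qT" => (4 : Fin 16)
notation "qW" => (5 : Fin 16)
notation "qV" => (6 : Fin 16)
notation "qR" => (7 : Fin 16)
notation "qS" => (8 : Fin 16)
notation "qC" => (9 : Fin 16)
notation "qZ" => (10 : Fin 16)
notation "qZ'" => (11 : Fin 16)

/-- The sign of the product of the monomials `x` and `z`. -/
def sgnC : Cmd :=
  qwr qS 0 1 ;;
  loop va ♯vL (loop vb ♯vL
    (ite (ℓ nBit (♯vx * ♯vL + ♯va) =ₙ 1)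
      (ite (ℓ nBit (♯vz * ♯vL + ♯vb) =ₙ 1)
        (ite (♯va =ₙ ♯vb) (qwr qS 0 0) (ite (♯vb <ₙ ♯va) (qwr qS 0 (0 - ρ qS 0)) skip))
        skip)
      skip))

/-- Multiply the table `W` by the table `V`. -/
def mulC : Cmd :=
  loop vx (♯vN + ♯vN) (qwr qR ♯vx 0) ;;
  loop vx ♯vN (loop vz ♯vN (sgnC ;;
    qwr qR (♯vx + ♯vz) (ρ qR (♯vx + ♯vz) + ρ qS 0 * ρ qW ♯vx * ρ qV ♯vz))) ;;
  loop vx ♯vN (qwr qW ♯vx (ρ qR ♯vx))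

/-- The table of `1`. -/
def unitC (r : Fin 16) : Cmd := loop vx ♯vN (qwr r ♯vx 0) ;; qwr r 0 1

/-- Multiply `W` by the element of the matrix with a single entry, at `(I, J)`. -/
def edgeC (I J : ℕ) : Cmd :=
  loop ve ♯vp (unitC qV ;;
    ite (♯J <ₙ ♯I)
      (qwr qV (ℓ nPw2 (2 * (♯ve * ♯vk + ♯I)) + ℓ nPw2 (2 * (♯ve * ♯vk + ♯J) + 1)) (0 - ρ qC 0))
      (qwr qV (ℓ nPw2 (2 * (♯ve * ♯vk + ♯I)) + ℓ nPw2 (2 * (♯ve * ♯vk + ♯J) + 1)) (ρ qC 0)) ;;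
    mulC)

/-- Multiply `W` by the element of the edges between slot `i`, which holds `u`, and all slots. -/
def edgesC : Cmd :=
  loop vg ♯vk (
    ite (♯vg =ₙ ♯vi) (set vt ♯vu) (set vt (ℓ nDig (♯vX * ♯vk + ♯vg))) ;;
    qwr qC 0 (ρ qA (♯vu * (♯vn + 1) + ♯vt)) ;;
    edgeC vi vg ;;
    ite (♯vg =ₙ ♯vi) skip (edgeC vg vi))

/-- The product of the tables of the components that the component of `y` decomposes into. -/
def joinC : Cmd :=
  unitC qW ;;
  loop vt ♯vn (
    ite (ℓ nLab (♯vX * ♯vn + ♯vt) =ₙ ♯vy)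
      (ite (ℓ nLab (♯vY * ♯vn + ♯vt) =ₙ ♯vt)
        (loop vx ♯vN (qwr qV ♯vx (ρ qT ((♯vY * ♯vn + ♯vt) * ♯vN + ♯vx))) ;; mulC)
        skip)
      skip)

/-- The monomial `m` of slot `i`, and whether it is disjoint from the monomial `x`. -/
def maskC : Cmd :=
  set vm 0 ;; set vf 1 ;;
  loop va ♯vp (
    ite (ℓ nBit (♯vx * ♯vL + 2 * (♯va * ♯vk + ♯vi)) =ₙ 1) (set vf 0) skip ;;
    ite (ℓ nBit (♯vx * ♯vL + (2 * (♯va * ♯vk + ♯vi) + 1)) =ₙ 1) (set vf 0) skip ;;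
    set vm (♯vm + (ℓ nPw2 (2 * (♯va * ♯vk + ♯vi)) + ℓ nPw2 (2 * (♯va * ♯vk + ♯vi) + 1))))

/-- The part of the table of `(X, y)` without `u`. -/
def dropC : Cmd :=
  loop vx ♯vN (maskC ;;
    ite (♯vf =ₙ 1)
      (qwr qT ((♯vX * ♯vn + ♯vy) * ♯vN + ♯vx) (ρ qAl ♯vu * ρ qW ♯vx))
      (qwr qT ((♯vX * ♯vn + ♯vy) * ♯vN + ♯vx) 0))

/-- Add the part of the table of `(X, y)` with `u`. -/
def takeC : Cmd :=
  loop vx ♯vN (maskC ;;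
    ite (♯vf =ₙ 1)
      (qwr qT ((♯vX * ♯vn + ♯vy) * ♯vN + ♯vx)
        (ρ qT ((♯vX * ♯vn + ♯vy) * ♯vN + ♯vx) + ρ qBe ♯vu * ρ qW (♯vx + ♯vm)))
      skip)

/-- The table of `(X, y)`, from the move of slot `i` to `u`, which leads to `Y`. -/
def tableC : Cmd := joinC ;; dropC ;; edgesC ;; takeC

/-- Is the move of slot `i` to `u` legal, and does it lead to good pairs only? -/
def checkC : Cmd :=
  set vo 1 ;;
  ite (ℓ nLab (♯vX * ♯vn + ♯vu) =ₙ ♯vy) skip (set vo 0) ;;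
  loop vt ♯vn (
    ite (ℓ nLab (♯vX * ♯vn + ♯vt) =ₙ ♯vy)
      (ite (.eq (ρ qA (ℓ nDig (♯vX * ♯vk + ♯vi) * (♯vn + 1) + ♯vt)) 0) skip (set vo 0) ;;
        ite (ℓ nLab (♯vY * ♯vn + ♯vt) =ₙ ♯vt)
          (ite (ℓ nGood (♯vY * ♯vn + ♯vt) =ₙ 1) skip (set vo 0)) skip)
      skip)

/-- Try to make `(X, y)` good by the move of slot `i` to `u`. -/
def tryC : Cmd :=
  set vY (♯vX + ♯vu * ℓ nPwn ♯vi - ℓ nDig (♯vX * ♯vk + ♯vi) * ℓ nPwn ♯vi) ;;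
  checkC ;;
  ite (♯vo =ₙ 1)
    (ite (ℓ nGood (♯vX * ♯vn + ♯vy) =ₙ 1) skip (tableC ;; nwr nGood (♯vX * ♯vn + ♯vy) 1)) skip

/-- Find all good pairs, and their tables. -/
def goodC : Cmd :=
  loop vs ♯vn (loop vX ♯vM (loop vy ♯vn
    (ite (ℓ nLab (♯vX * ♯vn + ♯vy) =ₙ ♯vy) (loop vi ♯vk (loop vu ♯vn tryC)) skip)))

/-- The components of all positions. -/
def labC : Cmd :=
  loop vX ♯vM (
    loop vt ♯vn (nwr nTmp ♯vt ♯vt) ;;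
    loop vj ♯vk (nwr nTmp (ℓ nDig (♯vX * ♯vk + ♯vj)) ♯vn) ;;
    loop vy ♯vn (loop vz ♯vn (
      ite (ℓ nTmp ♯vy <ₙ ♯vn)
        (ite (ℓ nTmp ♯vz <ₙ ♯vn)
          (ite (.eq (ρ qA (♯vy * (♯vn + 1) + ♯vz)) 0) skip
            (set vl (ℓ nTmp ♯vy) ;; set vr (ℓ nTmp ♯vz) ;;
              loop vt ♯vn (ite (ℓ nTmp ♯vt =ₙ ♯vl) (nwr nTmp ♯vt ♯vr) skip)))
          skip)
        skip)) ;;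
    loop vt ♯vn (nwr nLab (♯vX * ♯vn + ♯vt) (ℓ nTmp ♯vt)) ;;
    loop vt ♯vn (nwr nGood (♯vX * ♯vn + ♯vt) 0))

/-- Powers. -/
def powC (r : Fin 16) (b m : NE) : Cmd :=
  nwr r 0 1 ;; loop vj m (nwr r (♯vj + 1) (ℓ r ♯vj * b))

/-- The digits of all numbers, by counting. -/
def digC (r : Fin 16) (b m c : NE) : Cmd :=
  loop vj m (nwr nTmp ♯vj 0) ;;
  loop vx c (
    loop vj m (nwr r (♯vx * m + ♯vj) (ℓ nTmp ♯vj)) ;;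
    set vc 1 ;;
    loop vj m (
      ite (♯vc =ₙ 1)
        (ite (ℓ nTmp ♯vj + 1 =ₙ b) (nwr nTmp ♯vj 0) (nwr nTmp ♯vj (ℓ nTmp ♯vj + 1) ;; set vc 0))
        skip))

/-- Everything that depends only on the number of slots. -/
def setupC : Cmd :=
  set vL (2 * (♯vp * ♯vk)) ;; powC nPw2 2 ♯vL ;; set vN (ℓ nPw2 ♯vL) ;;
  powC nPwn (♯vn + 1) ♯vk ;; set vM (ℓ nPwn ♯vk) ;;
  digC nDig (♯vn + 1) ♯vk ♯vM ;; digC nBit 2 ♯vL ♯vN ;; labC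

/-- If the whole graph is solved, compute the sum. -/
def finC : Cmd :=
  set vX (♯vM - 1) ;; set vo 1 ;;
  loop vy ♯vn (ite (ℓ nLab (♯vX * ♯vn + ♯vy) =ₙ ♯vy)
    (ite (ℓ nGood (♯vX * ♯vn + ♯vy) =ₙ 1) skip (set vo 0)) skip) ;;
  ite (♯vo =ₙ 1)
    (set vd 1 ;; qwr qZ 0 1 ;;
      loop vy ♯vn (ite (ℓ nLab (♯vX * ♯vn + ♯vy) =ₙ ♯vy)
        (qwr qZ 0 (ρ qZ 0 * ρ qT ((♯vX * ♯vn + ♯vy) * ♯vN))) skip)) skip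

/-- The weighted sum of powers of principal minors, with as few slots as possible. -/
def sumC : Cmd :=
  set vd 0 ;;
  loop vq (♯vn + 1) (ite (♯vd =ₙ 0) (set vk (♯vq + 1) ;; setupC ;; goodC ;; finC) skip)

/-! #### The data of the problem -/

/-- The data: `k` slots, the matrix, the exponent, the weights, and bounds on all numbers. -/
structure Dat where
  n : ℕ
  p : ℕ
  k : ℕ
  A : ℕ → ℕ → ℚ
  al : ℕ → ℚ
  be : ℕ → ℚ
  Q : ℕ
  U : ℕ
  E : ℕ

def Dat.L (d : Dat) : ℕ := 2 * (d.p * d.k)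
def Dat.N (d : Dat) : ℕ := 2 ^ d.L
def Dat.M (d : Dat) : ℕ := (d.n + 1) ^ d.k

/-- The exponent that bounds the table of a component is this number times its size. -/
def Dat.η (d : Dat) : ℕ := 2 * d.k * d.p + 1

/-- Assumptions on the data and the bounds. -/
structure Lim (Γ : Par) (d : Dat) : Prop where
  psd : Psd d.A d.n
  hp : d.p ≠ 0
  hk : d.k ≠ 0
  bN : 2 * d.N ≤ Γ.B
  bM : d.M ≤ Γ.B
  bL : d.L ≤ Γ.B
  bn : d.n ≤ Γ.B
  bp : d.p ≤ Γ.B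
  bk : d.k ≤ Γ.B
  nbT : d.M * d.n * d.N ≤ Γ.NB
  nbM : d.M * (d.n + 1) ≤ Γ.NB
  nbK : d.M * d.k ≤ Γ.NB
  nbL : d.N * d.L ≤ Γ.NB
  nbA : (d.n + 1) * (d.n + 1) ≤ Γ.NB
  nbN : 2 * d.N ≤ Γ.NB
  nbl : d.L + d.k ≤ Γ.NB
  nbp : d.p + 2 ≤ Γ.NB
  V : ∀ x, Bd d.Q d.U d.E x → Γ.V x
  hU : 2 * d.Q ≤ d.U
  entZ : ∀ a b, ∃ m : ℤ, d.A a b * d.Q = m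
  entU : ∀ a b, (1 + |d.A a b|) * d.Q ≤ d.U
  al01 : ∀ v, d.al v = 0 ∨ d.al v = 1
  be01 : ∀ v, d.be v = 0 ∨ d.be v = 1
  hE : d.η * d.n + d.η + 1 ≤ d.E

/-- The state holds the data that do not depend on the number of slots. -/
structure Base (d : Dat) (σ : St) : Prop where
  n : σ.nv vn = d.n
  p : σ.nv vp = d.p
  A : ∀ a ≤ d.n, ∀ b ≤ d.n, σ.qa qA (a * (d.n + 1) + b) = d.A a b
  al : ∀ v < d.n, σ.qa qAl v = d.al v
  be : ∀ v < d.n, σ.qa qBe v = d.be v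

/-- The state holds the data. -/
structure Env (d : Dat) (σ : St) : Prop extends Base d σ where
  k : σ.nv vk = d.k
  L : σ.nv vL = d.L
  N : σ.nv vN = d.N
  M : σ.nv vM = d.M
  pw2 : ∀ j ≤ d.L, σ.na nPw2 j = 2 ^ j
  pwn : ∀ j ≤ d.k, σ.na nPwn j = (d.n + 1) ^ j
  dig : ∀ X < d.M, ∀ j < d.k, σ.na nDig (X * d.k + j) = dig (d.n + 1) X j
  bit : ∀ x < d.N, ∀ j < d.L, σ.na nBit (x * d.L + j) = Table.dig 2 x j

/-- The command does not touch the data. -/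
def keepsBase (c : Cmd) : Bool :=
  !(c.wv vn || c.wv vp || c.wq qA || c.wq qAl || c.wq qBe)

def keeps (c : Cmd) : Bool :=
  keepsBase c && !(c.wv vk || c.wv vL || c.wv vN || c.wv vM ||
    c.wn nPw2 || c.wn nPwn || c.wn nDig || c.wn nBit)

theorem Base.frame {d : Dat} {σ τ : St} {c : Cmd} (h : Base d σ) (hF : Frame c σ τ)
    (hc : keepsBase c = true) : Base d τ := by
  simp only [keepsBase, Bool.not_eq_true', Bool.or_eq_false_iff] at hc
  obtain ⟨⟨⟨⟨h0, h1⟩, h2⟩, h3⟩, h4⟩ := hc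
  exact ⟨(hF.nv _ h0).trans h.n, (hF.nv _ h1).trans h.p, by rw [hF.qa _ h2]; exact h.A,
    by rw [hF.qa _ h3]; exact h.al, by rw [hF.qa _ h4]; exact h.be⟩

theorem Env.frame {d : Dat} {σ τ : St} {c : Cmd} (h : Env d σ) (hF : Frame c σ τ)
    (hc : keeps c = true) : Env d τ := by
  simp only [keeps, Bool.and_eq_true, Bool.not_eq_true', Bool.or_eq_false_iff] at hc
  obtain ⟨hb, ⟨⟨⟨⟨⟨⟨⟨h0, h1⟩, h2⟩, h3⟩, h4⟩, h5⟩, h6⟩, h7⟩⟩ := hc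
  exact ⟨h.toBase.frame hF hb, (hF.nv _ h0).trans h.k, (hF.nv _ h1).trans h.L,
    (hF.nv _ h2).trans h.N, (hF.nv _ h3).trans h.M, by rw [hF.na _ h4]; exact h.pw2,
    by rw [hF.na _ h5]; exact h.pwn, by rw [hF.na _ h6]; exact h.dig, by rw [hF.na _ h7]; exact h.bit⟩

theorem ix_lt {a b m n : ℕ} (ha : a < m) (hb : b < n) : a * n + b < m * n := by
  calc a * n + b < (a + 1) * n := by rw [Nat.succ_mul]; omega
    _ ≤ m * n := Nat.mul_le_mul_right _ ha

end Algo

/-! ### Multiplication of tables -/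

namespace Algo

open Imp Cmd Table Grassmann Elimination

variable {Γ : Par} {d : Dat} {σ : St}

section V

theorem bd_sign (Q U : ℕ) {x : ℚ} (hx : x = 0 ∨ x = 1 ∨ x = -1) : Bd Q U 0 x := by
  rcases hx with rfl | rfl | rfl
  exacts [⟨⟨0, by simp⟩, by simp⟩, ⟨⟨1, by simp⟩, by simp⟩, ⟨⟨-1, by simp⟩, by simp⟩]

theorem Lim.V_int (h : Lim Γ d) {x : ℚ} (hx : x = 0 ∨ x = 1 ∨ x = -1) : Γ.V x := by
  refine h.V x (Bd.mono h.hU (Nat.zero_le _) ?_)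
  exact bd_sign _ _ hx

theorem Lim.V_le (h : Lim Γ d) {e : ℕ} {x : ℚ} (hx : Bd d.Q d.U e x) (he : e ≤ d.E) : Γ.V x :=
  h.V x (hx.mono h.hU he)

end V

/-- The factor of the sign that comes from two digits. -/
def fac (x z a b : ℕ) : ℚ := if Table.dig 2 x a = 1 ∧ Table.dig 2 z b = 1 then sg a b else 1

theorem fac_cases (x z a b : ℕ) : fac x z a b = 0 ∨ fac x z a b = 1 ∨ fac x z a b = -1 := by
  unfold fac; split_ifs
  exacts [sg_cases _ _, .inr (.inl rfl)]

theorem spec_sgn (hl : Lim Γ d) (hE : Env d σ) {x z : ℕ} (hx : σ.nv vx = x) (hz : σ.nv vz = z)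
    (hxN : x < d.N) (hzN : z < d.N) : Spec Γ sgnC σ fun τ => τ.qa qS 0 = sgn d.L x z := by
  have hnb := hl.nbp
  refine Spec.then (P := fun τ => τ.qa qS 0 = 1) (Spec.qwr (by simp) (by simp) (by simp)
    (by simp; omega) (by simp)) fun σ₁ hF h1 => ?_
  replace hE := hE.frame hF rfl
  rw [← hF.nv _ rfl] at hx hz
  clear hF
  refine Spec.loop d.L (fun j τ => τ.qa qS 0 = ∏ a ∈ Finset.range j, ∏ b ∈ Finset.range d.L,
    fac x z a b) hE.L (by simp) hl.bL (by simpa using h1) (fun j τ a h => h) ?_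
    (fun τ _ h => h)
  intro a ha τ hF hva h2
  replace hE := hE.frame hF rfl
  rw [← hF.nv _ rfl] at hx hz
  clear hF h1
  refine Spec.loop d.L (fun j τ => τ.qa qS 0 = (∏ a ∈ Finset.range a, ∏ b ∈ Finset.range d.L,
    fac x z a b) * ∏ b ∈ Finset.range j, fac x z a b) hE.L (by simp) hl.bL (by simpa using h2)
    (fun j τ a h => h) ?_ (fun τ _ h => by rw [Finset.prod_range_succ]; exact h)
  intro b hb τ hF hvb h3
  replace hE := hE.frame hF rfl
  rw [← hF.nv _ rfl] at hx hz hva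
  clear hF h2
  -- Partial products of signs stay in `{0, 1, -1}`, so the negation below is a bounded number.
  have hs : τ.qa qS 0 = 0 ∨ τ.qa qS 0 = 1 ∨ τ.qa qS 0 = -1 := by
    rw [h3]
    have h5 := prod_sign (Finset.range a) (fun a => ∏ b ∈ Finset.range d.L, fac x z a b)
      fun a _ => prod_sign _ _ fun b _ => fac_cases _ _ _ _
    have h6 := prod_sign (Finset.range b) (fac x z a) fun b _ => fac_cases _ _ _ _
    rcases h5 with h5 | h5 | h5 <;> rcases h6 with h6 | h6 | h6 <;> simp [h5, h6]
  have e1 := ix_lt hxN ha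
  have e2 := ix_lt hzN hb
  have hnbL := hl.nbL
  have d1 := hE.bit x hxN a ha
  have d2 := hE.bit z hzN b hb
  have hneg : Γ.V (-(τ.qa qS 0)) := hl.V_int (by rcases hs with h | h | h <;> simp [h])
  rw [Finset.prod_range_succ, ← mul_assoc, ← h3]
  have hf : fac x z a b = if Table.dig 2 x a = 1 ∧ Table.dig 2 z b = 1 then sg a b else 1 := rfl
  refine Spec.ite (by simp [hx, hE.L, hva]; omega) (fun t1 => ?_) (fun t1 => ?_)
  all_goals
    simp only [BE.eval_eq, QE.eval_nat, NE.eval_rd, NE.eval_add, NE.eval_mul, NE.eval_var, hx, hE.L,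
      hva, d1, NE.eval_one, Nat.cast_inj] at t1
  · refine Spec.ite (by simp [hz, hE.L, hvb]; omega) (fun t2 => ?_) (fun t2 => ?_)
    all_goals
      simp only [BE.eval_eq, QE.eval_nat, NE.eval_rd, NE.eval_add, NE.eval_mul, NE.eval_var, hz, hE.L,
        hvb, d2, NE.eval_one, Nat.cast_inj] at t2
    · rw [if_pos ⟨t1, t2⟩, sg] at hf
      refine Spec.ite (by simp) (fun t3 => ?_) (fun t3 => ?_)
      all_goals
        simp only [BE.eval_eq, QE.eval_nat, NE.eval_var, hva, hvb, Nat.cast_inj] at t3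
      · refine Spec.qwr (by simp) (by simp) (by simp) (by simp) ?_
        rw [hf, if_pos t3]; simp
      · refine Spec.ite (by simp) (fun t4 => ?_) (fun t4 => ?_)
        all_goals
          simp only [BE.eval_lt, QE.eval_nat, NE.eval_var, hva, hvb, Nat.cast_lt] at t4
        · refine Spec.qwr (by simp) (by simp) (by simp) (by simpa using hneg) ?_
          simp [hf, t3, t4]
        · refine Spec.skip ?_
          simp [hf, t3, t4]
    · rw [if_neg (fun h => t2 h.2)] at hf
      refine Spec.skip ?_
      simp [hf]
  · rw [if_neg (fun h => t1 h.1)] at hf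
    refine Spec.skip ?_
    simp [hf]

theorem sum_range_trunc {m N : ℕ} (h : m ≤ N) (g : ℕ → ℚ) (hg : ∀ z, m ≤ z → g z = 0) :
    ∑ z ∈ Finset.range N, g z = ∑ z ∈ Finset.range m, g z :=
  (Finset.sum_subset (Finset.range_subset_range.mpr h) fun z _ hz => hg z (by
    rw [Finset.mem_range] at hz; omega)).symm

/-- A partial double sum is the full double sum with some terms switched off. As `bd_tmul` admits
any pattern of signs 0, 1, -1, it bounds all intermediate values of the multiplication loops. -/
theorem sum_partial {x y N : ℕ} (hx : x < N) (hy : y < N) (f : ℕ → ℕ → ℚ) :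
    ∑ x' ∈ Finset.range x, ∑ y' ∈ Finset.range N, f x' y' + ∑ y' ∈ Finset.range (y + 1), f x y' =
      ∑ x' ∈ Finset.range N, ∑ y' ∈ Finset.range N,
        if x' < x ∨ x' = x ∧ y' < y + 1 then f x' y' else 0 := by
  rw [sum_range_trunc (show x + 1 ≤ N from hx) _ (fun z hz => by
    exact Finset.sum_eq_zero fun y' _ => if_neg (by omega)), Finset.sum_range_succ _ x]
  refine congrArg₂ (fun a b : ℚ => a + b) (Finset.sum_congr rfl fun x' hx' => ?_) ?_
  · refine Finset.sum_congr rfl fun y' _ => ?_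
    rw [if_pos (.inl (Finset.mem_range.mp hx'))]
  · rw [sum_range_trunc (show y + 1 ≤ N from hy) _ (fun z hz => by
      exact if_neg (by omega))]
    refine Finset.sum_congr rfl fun y' hy' => ?_
    rw [if_pos (.inr ⟨rfl, Finset.mem_range.mp hy'⟩)]

theorem spec_mul (hl : Lim Γ d) (hE : Env d σ) {e e' : ℕ} (hw : Bt d.Q d.U d.N e (σ.qa qW))
    (hv : Bt d.Q d.U d.N e' (σ.qa qV)) (he : e + e' ≤ d.E) :
    Spec Γ mulC σ fun τ => ∀ z < d.N, τ.qa qW z = tmul d.L (σ.qa qW) (σ.qa qV) z := by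
  have hnb := hl.nbp
  have hnN := hl.nbN
  have hbN := hl.bN
  obtain ⟨w, hw'⟩ : ∃ w, σ.qa qW = w := ⟨_, rfl⟩
  obtain ⟨v, hv'⟩ : ∃ v, σ.qa qV = v := ⟨_, rfl⟩
  rw [hw'] at hw ⊢
  rw [hv'] at hv ⊢
  refine Spec.then (P := fun τ => ∀ z < 2 * d.N, τ.qa qR z = 0) ?_ fun σ₁ hF h1 => ?_
  -- The loops write to the cell `x + z` for all pairs, overlapping ones included, so the
  -- accumulator has `2 N` cells; only the first `N` are copied back.
  · refine Spec.fillQ (2 * d.N) 0 (fun _ => 0) (by simp [hE.N]; omega) (by simp [hE.N]; omega)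
      hbN (by simp) ?_ (fun τ _ _ h z hz => by simpa using h z hz)
    intro j hj τ _ hvj _ _
    simp [hvj]; omega
  replace hE := hE.frame hF rfl
  rw [← hF.qa _ rfl] at hw' hv'
  clear hF
  refine Spec.then (P := fun τ => ∀ z < d.N, τ.qa qR z = tmul d.L w v z) ?_ fun σ₂ hF h2 => ?_
  · refine Spec.loop d.N (fun j τ => ∀ z < 2 * d.N, τ.qa qR z = ∑ x ∈ Finset.range j,
      ∑ y ∈ Finset.range d.N, if x + y = z then sgn d.L x y * w x * v y else 0) hE.N (by simp)
      (by omega) (by simpa using h1) (fun j τ a h => h) ?_ (fun τ _ h z hz => h z (by omega))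
    intro x hx τ hF hvx h3
    replace hE := hE.frame hF rfl
    rw [← hF.qa _ rfl] at hw' hv'
    clear hF h1
    refine Spec.loop d.N (fun j τ => ∀ z < 2 * d.N, τ.qa qR z = ∑ x ∈ Finset.range x,
      ∑ y ∈ Finset.range d.N, (if x + y = z then sgn d.L x y * w x * v y else 0) +
      ∑ y ∈ Finset.range j, if x + y = z then sgn d.L x y * w x * v y else 0) hE.N (by simp)
      (by omega) (by simpa using h3) (fun j τ a h => h) ?_
      (fun τ _ h z hz => by rw [Finset.sum_range_succ]; exact h z hz)
    intro y hy τ hF hvy h4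
    replace hE := hE.frame hF rfl
    rw [← hF.qa _ rfl] at hw' hv'
    rw [← hF.nv _ rfl] at hvx
    clear hF h3
    refine (spec_sgn hl hE hvx hvy hx hy).then fun τ' hF hs => ?_
    replace hE := hE.frame hF rfl
    rw [← hF.qa _ rfl] at hw' hv'
    rw [← hF.nv _ rfl] at hvx hvy
    rw [← hF.qa _ rfl] at h4
    clear hF
    have hV : Γ.V (τ'.qa qR (x + y) + sgn d.L x y * w x * v y) := by
      rw [h4 _ (by omega), add_assoc]
      refine hl.V_le ?_ he
      have h5 := sum_partial hx hy fun a b => if a + b = x + y then sgn d.L a b * w a * v b else 0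
      rw [Finset.sum_range_succ _ y, if_pos rfl] at h5
      rw [h5]
      have h6 := bd_tmul hw hv (fun a b => if a < x ∨ a = x ∧ b < y + 1 then
        if a + b = x + y then sgn d.L a b else 0 else 0) (fun a b => by
          split_ifs
          exacts [sgn_cases _ _ _, .inl rfl, .inl rfl])
      simpa only [ite_mul, zero_mul] using h6
    have hV1 : Bd d.Q d.U e (sgn d.L x y * w x) := by
      have := (bd_sign d.Q d.U (sgn_cases d.L x y)).mul (hw.bd hx)
      rwa [zero_add] at this
    refine Spec.qwr (by simp [hvx, hvy]; omega) (by simp [hvx, hvy]; omega) (by simp) ?_ ?_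
    · have a1 := hl.V_le hV1 (by omega)
      have a2 := hl.V_le (hV1.mul (hv.bd hy)) he
      simp [hvx, hvy, hs, hw', hv', a1, a2, hV]; omega
    · intro z hz
      simp only [NE.eval_add, NE.eval_var, hvx, hvy, QE.eval_add, QE.eval_mul, QE.eval_rd,
        NE.eval_zero, hs, hw', hv', St.setQ_qa, if_true]
      rw [Finset.sum_range_succ _ y, ← add_assoc, ← h4 z hz]
      by_cases hzz : x + y = z
      · subst hzz; simp
      · rw [Function.update_of_ne (Ne.symm hzz), if_neg hzz, add_zero]
  · replace hE := hE.frame hF rfl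
    refine Spec.fillQ d.N 0 (tmul d.L w v) (by simp [hE.N]) (by simp) (by omega) (by simp) ?_
      (fun τ _ _ h z hz => by simpa using h z hz)
    intro j hj τ hF hvj _ _
    have := hF.qa qR rfl
    simp [hvj, this, h2 j hj]; omega

theorem spec_unit (hl : Lim Γ d) (hE : Env d σ) (r : Fin 16) (hr : r ≠ 0) :
    Spec Γ (unitC r) σ fun τ => ∀ z < d.N, τ.qa r z = if z = 0 then 1 else 0 := by
  have hnN := hl.nbN
  have hbN := hl.bN
  have hnb := hl.nbp
  refine Spec.then (P := fun τ => ∀ z < d.N, τ.qa r z = 0) ?_ fun σ₁ hF h1 => ?_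
  · refine Spec.fillQ d.N 0 (fun _ => 0) (by simp [hE.N]) (by simp)
      (by omega) hr ?_ (fun τ _ _ h z hz => by simpa using h z hz)
    intro j hj τ _ hvj _ _
    simp [hvj]; omega
  · refine Spec.qwr (by simp) (by simp) (by simp [hr]) (by simp; omega) ?_
    intro z hz
    simp only [NE.eval_zero, QE.eval_one, St.setQ_qa, if_true]
    split_ifs with h
    · subst h; simp
    · rw [Function.update_of_ne h, h1 z hz]

end Algo

/-! ### Multiplication by the elements of edges -/

namespace Algo

open Imp Cmd Table Grassmann Elimination

variable {Γ : Par} {d : Dat} {σ : St}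

theorem Dat.gen_lt (d : Dat) {a i : ℕ} (ha : a < d.p) (hi : i < d.k) :
    2 * (a * d.k + i) + 1 < d.L := by
  have := ix_lt ha hi
  unfold Dat.L; omega

/-- Elements that commute with everything, for a matrix with a single entry. -/
theorem bt_edge {Q U N q : ℕ} {c c' : ℚ} {t : ℕ → ℚ} (hz : ∃ m : ℤ, c * Q = m)
    (hu : (1 + |c|) * Q ≤ U) (hc : c' = c ∨ c' = -c)
    (ht : ∀ x < N, t x = if x = q then c' else if x = 0 then 1 else 0) : Bt Q U N 1 t := by
  have hcc : |c'| = |c| := by rcases hc with rfl | rfl <;> simp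
  refine ⟨fun x hx => ?_, ?_⟩
  · rw [ht x hx, pow_one]
    obtain ⟨m, hm⟩ := hz
    split_ifs
    · rcases hc with rfl | rfl
      exacts [⟨m, hm⟩, ⟨-m, by rw [neg_mul, hm]; simp⟩]
    · exact ⟨Q, by simp⟩
    · exact ⟨0, by simp⟩
  · rw [pow_one, pow_one]
    refine le_trans (mul_le_mul_of_nonneg_right ?_ (by positivity)) hu
    calc ∑ x ∈ Finset.range N, |t x|
        ≤ ∑ x ∈ Finset.range N, ((if x = q then |c| else 0) + if x = 0 then 1 else 0) := by
          refine Finset.sum_le_sum fun x hx => ?_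
          rw [ht x (Finset.mem_range.mp hx)]
          split_ifs <;> simp [hcc]
      _ ≤ 1 + |c| := by
          rw [Finset.sum_add_distrib, Finset.sum_ite_eq', Finset.sum_ite_eq']
          split_ifs <;> linarith [abs_nonneg c]

theorem spec_edge (hl : Lim Γ d) (hE : Env d σ) {I J i j e : ℕ} (hI : I = vi ∨ I = vg)
    (hJ : J = vi ∨ J = vg) (hi : σ.nv I = i) (hj : σ.nv J = j) (hik : i < d.k) (hjk : j < d.k)
    {c : ℚ} (hc : σ.qa qC 0 = c) (hz : ∃ m : ℤ, c * d.Q = m) (hu : (1 + |c|) * d.Q ≤ d.U)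
    {W : Gr} (hW : Tab d.L (σ.qa qW) W) (hb : Bt d.Q d.U d.N e (σ.qa qW)) (he : e + d.p ≤ d.E) :
    Spec Γ (edgeC I J) σ fun τ => Tab d.L (τ.qa qW)
      (W * (gauss d.k d.p (fun b b' => if b = i ∧ b' = j then c else 0) : Gr)) ∧
      Bt d.Q d.U d.N (e + d.p) (τ.qa qW) := by
  have fI : ∀ c : Cmd, c.wv vi = false → c.wv vg = false → c.wv I = false := by
    intro c h1 h2; rcases hI with rfl | rfl <;> assumption
  have fJ : ∀ c : Cmd, c.wv vi = false → c.wv vg = false → c.wv J = false := by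
    intro c h1 h2; rcases hJ with rfl | rfl <;> assumption
  rw [gauss_single hik hjk]
  refine Spec.loop d.p (fun a τ => Tab d.L (τ.qa qW)
    (W * (∏ a ∈ Finset.range a, (1 + c • th d.k a i j) : Cen)) ∧
    Bt d.Q d.U d.N (e + a) (τ.qa qW)) hE.p (by simp) hl.bp (by simpa using ⟨hW, hb⟩)
    (fun j τ a h => h) ?_ (fun τ _ h => h)
  rintro a ha τ hF hva ⟨h1, h2⟩
  replace hE := hE.frame hF rfl
  rw [← hF.nv _ (fI _ rfl rfl)] at hi
  rw [← hF.nv _ (fJ _ rfl rfl)] at hj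
  rw [← hF.qa _ rfl] at hc
  clear hF
  refine (spec_unit hl hE qV (by simp)).then fun τ₁ hF h3 => ?_
  replace hE := hE.frame hF rfl
  rw [← hF.nv _ (fI _ rfl rfl)] at hi
  rw [← hF.nv _ (fJ _ rfl rfl)] at hj
  rw [← hF.nv _ rfl] at hva
  rw [← hF.qa _ rfl] at hc h1 h2
  clear hF
  have g1 := d.gen_lt ha hik
  have g2 := d.gen_lt ha hjk
  have n1 := hl.nbl
  have n2 := hl.nbp
  have n3 := hl.nbN
  have p1 := hE.pw2 (2 * (a * d.k + i)) (by omega)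
  have p2 := hE.pw2 (2 * (a * d.k + j) + 1) (by omega)
  have q1 : 2 ^ (2 * (a * d.k + i)) < d.N := Nat.pow_lt_pow_right (by norm_num) (by omega)
  have q2 : 2 ^ (2 * (a * d.k + j) + 1) < d.N := Nat.pow_lt_pow_right (by norm_num) (by omega)
  -- Row generators are even and column generators odd, with the row generator of a slot just before
  -- its column generator. The two are out of order exactly if `j < i`.
  have hsgn : sg (2 * (a * d.k + i)) (2 * (a * d.k + j) + 1) = if j < i then -1 else 1 := by
    unfold sg
    rw [if_neg (by omega)]
    by_cases hji : j < i
    · rw [if_pos (by omega), if_pos hji]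
    · rw [if_neg (by omega), if_neg hji]
  refine Spec.then (P := fun τ' => ∀ x < d.N, τ'.qa qV x =
    if x = 2 ^ (2 * (a * d.k + i)) + 2 ^ (2 * (a * d.k + j) + 1) then
    sg (2 * (a * d.k + i)) (2 * (a * d.k + j) + 1) * c else if x = 0 then 1 else 0) ?_
    fun τ₂ hF h4 => ?_
  · have hbc : Bd d.Q d.U 1 c := ⟨by simpa using hz, by
      have : (0 : ℚ) ≤ d.Q := by positivity
      rw [pow_one, pow_one]; linarith⟩
    have hbn : Bd d.Q d.U 1 (-c) := ⟨by
      obtain ⟨m, hm⟩ := hz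
      exact ⟨-m, by rw [pow_one, neg_mul, hm]; simp⟩, by simpa using hbc.2⟩
    have v2 := hl.V_le hbn (by omega)
    refine Spec.ite (by simp) (fun t => ?_) (fun t => ?_)
    all_goals
      simp only [BE.eval_lt, QE.eval_nat, NE.eval_var, hi, hj, Nat.cast_lt] at t
    · rw [if_pos t] at hsgn
      refine Spec.qwr (by simp [hi, hj, hva, hE.k, p1, p2]; omega)
        (by simp [hi, hj, hva, hE.k, p1, p2]; omega) (by simp) (by simp [hc, v2]) ?_
      intro x hx
      simp only [NE.eval_add, NE.eval_mul, NE.eval_var, NE.eval_two, NE.eval_rd, NE.eval_one, hi, hj,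
        hva, hE.k, p1, p2, St.setQ_qa, if_true, QE.eval_sub, QE.eval_zero, QE.eval_rd, NE.eval_zero,
        hc, hsgn, Function.update_apply, h3 x hx]
      split_ifs <;> simp
    · rw [if_neg t] at hsgn
      refine Spec.qwr (by simp [hi, hj, hva, hE.k, p1, p2]; omega)
        (by simp [hi, hj, hva, hE.k, p1, p2]; omega) (by simp) (by simp) ?_
      intro x hx
      simp only [NE.eval_add, NE.eval_mul, NE.eval_var, NE.eval_two, NE.eval_rd, NE.eval_one, hi, hj,
        hva, hE.k, p1, p2, St.setQ_qa, if_true, QE.eval_rd, NE.eval_zero,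
        hc, hsgn, Function.update_apply, h3 x hx]
      split_ifs <;> simp
  replace hE := hE.frame hF rfl
  rw [← hF.qa _ rfl] at h1 h2
  have hv1 : Tab d.L (τ₂.qa qV) (1 + c • (th d.k a i j : Gr)) :=
    Tab.one_add (by omega) (by omega) (by omega) h4
  have hv2 : Bt d.Q d.U d.N 1 (τ₂.qa qV) := bt_edge hz hu (by
    rw [hsgn]; split_ifs
    exacts [.inr (by ring), .inl (by ring)]) h4
  refine (spec_mul hl hE h2 hv2 (by omega)).mono fun τ₃ _ h5 => ?_
  refine ⟨?_, (h2.tmul hv2).congr h5⟩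
  have := h1.mul hv1 h5
  rw [Finset.prod_range_succ]
  push_cast
  rw [← mul_assoc]
  convert this using 2

/-- The matrix of the edges between slot `i` and the slots below `m`. -/
def edgeUpTo (x : ℕ → ℚ) (i m b c : ℕ) : ℚ :=
  if b = i then (if c < m then x c else 0) else if c = i then (if b < m then x b else 0) else 0

/-- Slot `m` brings the entries `(i, m)` and `(m, i)`. For `m = i` they are the same diagonal entry,
which must be multiplied in only once. -/
theorem gauss_edgeUpTo (k p : ℕ) (x : ℕ → ℚ) (i m : ℕ) :
    gauss k p (edgeUpTo x i (m + 1)) =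
      gauss k p (edgeUpTo x i m) * gauss k p (fun b c => if b = i ∧ c = m then x m else 0) *
        if m = i then 1 else gauss k p (fun b c => if b = m ∧ c = i then x m else 0) := by
  split_ifs with h
  · rw [mul_one, gauss_mul]
    refine gauss_congr fun b _ c _ => ?_
    unfold edgeUpTo
    split_ifs <;> first | omega | simp
    all_goals (have : c = m := by omega); subst this; simp
  · rw [gauss_mul, gauss_mul]
    refine gauss_congr fun b _ c _ => ?_
    unfold edgeUpTo
    split_ifs <;> first | omega | simp
    all_goals first
      | (have : c = m := by omega); subst this; simp
      | (have : b = m := by omega); subst this; simp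

/-- Each of the `k` slots has at most two entries, and each entry costs one factor per copy, so the
exponent grows by `2 k p`. -/
theorem spec_edges (hl : Lim Γ d) (hE : Env d σ) {X i u e : ℕ} (hX : σ.nv vX = X)
    (hi : σ.nv vi = i) (hu : σ.nv vu = u) (hXM : X < d.M) (hik : i < d.k) (hun : u < d.n)
    {W : Gr} (hW : Tab d.L (σ.qa qW) W) (hb : Bt d.Q d.U d.N e (σ.qa qW))
    (he : e + 2 * d.k * d.p ≤ d.E) :
    Spec Γ edgesC σ fun τ => Tab d.L (τ.qa qW)
      (W * (gauss d.k d.p (edge d.A (Function.update (dig (d.n + 1) X) i u) i u) : Gr)) ∧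
      Bt d.Q d.U d.N (e + 2 * d.k * d.p) (τ.qa qW) := by
  set X' := Function.update (dig (d.n + 1) X) i u with hX'
  have hend : gauss d.k d.p (edge d.A X' i u) =
      gauss d.k d.p (edgeUpTo (fun b => d.A u (X' b)) i d.k) := by
    refine gauss_congr fun b hb c hc => ?_
    unfold edge edgeUpTo
    rw [if_pos hc, if_pos hb, hl.psd.symm (X' b) u]
  have h0 : gauss d.k d.p (edgeUpTo (fun b => d.A u (X' b)) i 0) = 1 := by
    rw [← gauss_zero (k := d.k) (p := d.p)]
    exact gauss_congr fun b _ c _ => by simp [edgeUpTo]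
  rw [hend]
  refine Spec.loop d.k (fun b τ => Tab d.L (τ.qa qW)
    (W * (gauss d.k d.p (edgeUpTo (fun b => d.A u (X' b)) i b) : Gr)) ∧
    Bt d.Q d.U d.N (e + 2 * b * d.p) (τ.qa qW)) hE.k (by simp) hl.bk
    (by rw [h0]; simpa using ⟨hW, hb⟩) (fun j τ a h => h) ?_ (fun τ _ h => h)
  rintro b hbk τ hF hvb ⟨h1, h2⟩
  replace hE := hE.frame hF rfl
  rw [← hF.nv _ rfl] at hX hi hu
  clear hF hb
  have n1 := hl.nbK
  have n2 := ix_lt hXM hbk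
  have n3 := hl.nbA
  have hdig := hE.dig X hXM b hbk
  have hXb : X' b ≤ d.n := by
    rw [hX', Function.update_apply]
    split_ifs
    · omega
    · exact Nat.lt_succ_iff.mp (dig_lt (Nat.succ_pos _) _ _)
  have n4 := ix_lt (show u < d.n + 1 by omega) (show X' b < d.n + 1 by omega)
  refine Spec.then (P := fun τ' => τ'.nv vt = X' b) ?_ fun τ₁ hF h3 => ?_
  · refine Spec.ite (by simp) (fun t => ?_) (fun t => ?_)
    all_goals
      simp only [BE.eval_eq, QE.eval_nat, NE.eval_var, hi, hvb, Nat.cast_inj] at t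
    · refine Spec.set (by simp) ?_
      simp [hX', t, hu]
    · refine Spec.set (by simp [hX, hE.k, hvb]; omega) ?_
      simp [hX', t, hX, hE.k, hvb, hdig]
  replace hE := hE.frame hF rfl
  rw [← hF.nv _ rfl] at hX hi hu hvb
  rw [← hF.qa _ rfl] at h1 h2
  clear hF
  have hA := hE.A u hun.le _ hXb
  refine Spec.then (P := fun τ' => τ'.qa qC 0 = d.A u (X' b)) ?_ fun τ₂ hF h4 => ?_
  · refine Spec.qwr (by simp) (by simp) (by simp) ?_ ?_
    · have : u * (d.n + 1) + X' b ≤ Γ.NB := by omega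
      have h' : u * (d.n + 1) ≤ Γ.NB := by omega
      have h'' : d.n + 1 ≤ Γ.NB := by nlinarith
      simp [hu, hE.n, h3, this, h', h'']; omega
    · simp [hu, hE.n, h3, hA]
  replace hE := hE.frame hF rfl
  rw [← hF.nv _ rfl] at hX hi hu hvb
  rw [← hF.qa _ rfl] at h1 h2
  clear hF
  have hEb : 2 * (b + 1) * d.p ≤ 2 * d.k * d.p := Nat.mul_le_mul_right _ (by omega)
  have hring : 2 * (b + 1) * d.p = 2 * b * d.p + d.p + d.p := by ring
  refine (spec_edge hl hE (.inl rfl) (.inr rfl) hi hvb hik hbk h4 (hl.entZ _ _) (hl.entU _ _) h1 h2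
    (by omega)).then fun τ₃ hF h5 => ?_
  obtain ⟨h5, h6⟩ := h5
  replace hE := hE.frame hF rfl
  rw [← hF.nv _ rfl] at hX hi hu hvb
  rw [← hF.qa _ rfl] at h4
  clear hF h1 h2
  have hg := gauss_edgeUpTo d.k d.p (fun b => d.A u (X' b)) i b
  refine Spec.ite (by simp) (fun t => ?_) (fun t => ?_)
  all_goals
    simp only [BE.eval_eq, QE.eval_nat, NE.eval_var, hi, hvb, Nat.cast_inj] at t
  · refine Spec.skip ⟨?_, h6.mono hl.hU (by omega)⟩
    rw [if_pos t, mul_one] at hg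
    rw [hg]; push_cast; rw [← mul_assoc]; exact h5
  · rw [if_neg t] at hg
    refine (spec_edge hl hE (.inr rfl) (.inl rfl) hvb hi hbk hik h4 (hl.entZ _ _) (hl.entU _ _) h5 h6
      (by omega)).mono fun τ₄ _ h7 => ⟨?_, h7.2.mono hl.hU (by omega)⟩
    rw [hg]; push_cast; rw [← mul_assoc, ← mul_assoc]; exact h7.1

end Algo

/-! ### Components and the product over the components left by a move -/

namespace Algo

open Imp Cmd Table Grassmann Elimination

variable {Γ : Par} {d : Dat} {σ : St}

/-- The occupants of the slots in position `X`. -/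
abbrev Dat.D (d : Dat) (X : ℕ) : ℕ → ℕ := dig (d.n + 1) X

/-- The component of `y` in position `X`. -/
noncomputable abbrev Dat.cmp (d : Dat) (X y : ℕ) : Finset ℕ := comp d.A d.n d.k (d.D X) y

/-- `lab` labels the unoccupied vertices by representatives of their components. -/
structure LabOk (d : Dat) (X : ℕ) (lab : ℕ → ℕ) : Prop where
  free : ∀ y < d.n, lab y < d.n ↔ Free d.n d.k (d.D X) y
  conn : ∀ y < d.n, lab y < d.n → Conn d.A d.n d.k (d.D X) y (lab y)
  eq : ∀ y z, Free d.n d.k (d.D X) y → Conn d.A d.n d.k (d.D X) y z → lab y = lab z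

theorem LabOk.lab_lab {X : ℕ} {lab : ℕ → ℕ} (h : LabOk d X lab) {y : ℕ} (hy : y < d.n)
    (hl : lab y < d.n) : lab (lab y) = lab y :=
  (h.eq _ _ ((h.free y hy).mp hl) (h.conn y hy hl)).symm

theorem LabOk.mem (hA : ∀ a b, d.A a b = d.A b a) {X : ℕ} {lab : ℕ → ℕ} (h : LabOk d X lab)
    {y : ℕ} (hy : y < d.n) (hl : lab y = y) {z : ℕ} : z ∈ d.cmp X y ↔ z < d.n ∧ lab z = y := by
  have hf : Free d.n d.k (d.D X) y := (h.free y hy).mp (hl.symm ▸ hy)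
  rw [mem_comp]
  constructor
  · rintro ⟨h1, h2⟩
    exact ⟨h1.1, by rw [← h.eq _ _ hf h2, hl]⟩
  · rintro ⟨h1, h2⟩
    have h3 : lab z < d.n := h2.symm ▸ hy
    exact ⟨(h.free z h1).mp h3, Conn.symm hA (h2 ▸ h.conn z h1 h3)⟩

/-- The table of `(X, y)` is correct. -/
def TabOk (d : Dat) (σ : St) (X y : ℕ) : Prop :=
  ∃ W, Rep d.A d.n d.k d.p d.al d.be (d.D X) (d.cmp X y) W ∧
    Tab d.L (fun x => σ.qa qT ((X * d.n + y) * d.N + x)) W ∧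
    Bt d.Q d.U d.N (d.η * (d.cmp X y).card) (fun x => σ.qa qT ((X * d.n + y) * d.N + x))

theorem cmp_card_le (X y : ℕ) : (d.cmp X y).card ≤ d.n := by
  calc _ ≤ (Finset.range d.n).card :=
        Finset.card_le_card fun z hz => Finset.mem_range.mpr (mem_comp.mp hz).1.1
    _ = d.n := Finset.card_range _

section Parts

variable {X Y y i u : ℕ} {labX labY : ℕ → ℕ}

/-- The part of the component that consists of the new components with labels below `j`. -/
def part (d : Dat) (labX labY : ℕ → ℕ) (y u j : ℕ) : Finset ℕ :=
  (Finset.range d.n).filter fun z => labX z = y ∧ z ≠ u ∧ labY z < j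

variable (hA : ∀ a b, d.A a b = d.A b a) (hX : LabOk d X labX) (hY : LabOk d Y labY)
  (hy : y < d.n) (hly : labX y = y) (hD : d.D Y = Function.update (d.D X) i u)
  (hm : Move d.A d.n d.k (d.D X) y i u)

include hA hX hY hy hly hD hm

/-- Vertices of the component other than `u` are unoccupied after the move, so their new labels are
all below `n`. -/
theorem part_last : part d labX labY y u d.n = (d.cmp X y).erase u := by
  ext z
  rw [part, Finset.mem_filter, Finset.mem_range, Finset.mem_erase, hX.mem hA hy hly]
  constructor
  · rintro ⟨h1, h2, h3, -⟩; exact ⟨h3, h1, h2⟩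
  · rintro ⟨h1, h2, h3⟩
    refine ⟨h2, h3, h1, (hY.free z h2).mpr ?_⟩
    rw [hD]
    exact hm.free ((hX.mem hA hy hly).mpr ⟨h2, h3⟩) h1

/-- If `j` represents a new component inside the old one, that component is what is added. It has no
edges to the earlier ones, as adjacent unoccupied vertices share a label; this is the hypothesis of
`Rep.union`. -/
theorem part_succ_pos {j : ℕ} (hj : j < d.n) (h1 : labX j = y) (h2 : labY j = j) :
    part d labX labY y u (j + 1) = part d labX labY y u j ∪ d.cmp Y j ∧
      Disjoint (part d labX labY y u j) (d.cmp Y j) ∧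
      ∀ s ∈ part d labX labY y u j, ∀ t ∈ d.cmp Y j, d.A s t = 0 := by
  have hsub : d.cmp Y j ⊆ (d.cmp X y).erase u := by
    have := hm.comp_subset hA ((hX.mem hA hy hly).mpr ⟨hj, h1⟩)
    rwa [← hD] at this
  refine ⟨?_, ?_, ?_⟩
  · ext z
    rw [Finset.mem_union, part, part, Finset.mem_filter, Finset.mem_filter, Finset.mem_range]
    constructor
    · rintro ⟨a, b, c, e⟩
      rcases Nat.lt_succ_iff_lt_or_eq.mp e with e | e
      · exact .inl ⟨a, b, c, e⟩
      · exact .inr ((hY.mem hA hj h2).mpr ⟨a, e⟩)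
    · rintro (⟨a, b, c, e⟩ | h)
      · exact ⟨a, b, c, by omega⟩
      · have h3 := Finset.mem_erase.mp (hsub h)
        have h4 := (hX.mem hA hy hly).mp h3.2
        have h5 := (hY.mem hA hj h2).mp h
        exact ⟨h4.1, h4.2, h3.1, by omega⟩
  · rw [Finset.disjoint_left]
    intro z hz hz'
    have h5 := (hY.mem hA hj h2).mp hz'
    have := (Finset.mem_filter.mp hz).2.2.2
    omega
  · intro s hs t ht
    by_contra hne
    obtain ⟨h3, h4, h5, h6⟩ := Finset.mem_filter.mp hs
    rw [Finset.mem_range] at h3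
    have h7 := (hY.free s h3).mp (by omega)
    have h8 := (mem_comp.mp ht).1
    have h9 := hY.eq s t h7 (.single ⟨h7, h8, hne⟩)
    have h10 := (hY.mem hA hj h2).mp ht
    omega

/-- If some vertex of the part had the new label `j`, then `j` would be connected to it, would lie
in the old component and would be its own label. -/
theorem part_succ_neg {j : ℕ} (hj : j < d.n) (h : ¬ (labX j = y ∧ labY j = j)) :
    part d labX labY y u (j + 1) = part d labX labY y u j := by
  ext z
  rw [part, part, Finset.mem_filter, Finset.mem_filter, Finset.mem_range]
  constructor
  · rintro ⟨a, b, c, e⟩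
    refine ⟨a, b, c, ?_⟩
    by_contra hlt
    have hzj : labY z = j := by omega
    apply h
    have hc := hY.conn z a (by omega)
    rw [hzj] at hc
    have hf := (hY.free z a).mp (by omega)
    have hsub := hm.comp_subset hA ((hX.mem hA hy hly).mpr ⟨a, b⟩)
    rw [← hD] at hsub
    have hjm : j ∈ d.cmp Y z := mem_comp.mpr ⟨hc.free hf, hc⟩
    have h3 := (hX.mem hA hy hly).mp (Finset.mem_of_mem_erase (hsub hjm))
    exact ⟨h3.2, by rw [← hY.eq z j hf hc, hzj]⟩
  · rintro ⟨a, b, c, e⟩; exact ⟨a, b, c, by omega⟩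

end Parts

/-- Every new component is found exactly once, through the vertex that is its own label. The
invariant is that the table represents `part`, with exponent `η` times the number of vertices
covered. -/
theorem spec_join (hl : Lim Γ d) (hE : Env d σ) {X Y y i u : ℕ} (hvX : σ.nv vX = X)
    (hvY : σ.nv vY = Y) (hvy : σ.nv vy = y) (hXM : X < d.M) (hYM : Y < d.M) (hy : y < d.n)
    {labX labY : ℕ → ℕ} (hX : LabOk d X labX) (hY : LabOk d Y labY)
    (hσX : ∀ z < d.n, σ.na nLab (X * d.n + z) = labX z)
    (hσY : ∀ z < d.n, σ.na nLab (Y * d.n + z) = labY z)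
    (hly : labX y = y) (hD : d.D Y = Function.update (d.D X) i u)
    (hm : Move d.A d.n d.k (d.D X) y i u)
    (hT : ∀ z < d.n, labX z = y → labY z = z → TabOk d σ Y z) :
    Spec Γ joinC σ fun τ => ∃ W,
      Rep d.A d.n d.k d.p d.al d.be (d.D Y) ((d.cmp X y).erase u) W ∧ Tab d.L (τ.qa qW) W ∧
        Bt d.Q d.U d.N (d.η * ((d.cmp X y).card - 1)) (τ.qa qW) := by
  have hA := hl.psd.symm
  refine (spec_unit hl hE qW (by simp)).then fun σ₁ hF h1 => ?_
  have hσT := hF.qa qT rfl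
  have hσL := hF.na nLab rfl
  replace hE := hE.frame hF rfl
  rw [← hF.nv _ rfl] at hvX hvY hvy
  clear hF
  refine Spec.loop d.n (fun j τ => ∃ W,
      Rep d.A d.n d.k d.p d.al d.be (d.D Y) (part d labX labY y u j) W ∧ Tab d.L (τ.qa qW) W ∧
        Bt d.Q d.U d.N (d.η * (part d labX labY y u j).card) (τ.qa qW)) hE.n (by simp) hl.bn
    ⟨1, ?_, Tab.one h1, ?_⟩ (fun j τ a h => h) ?_ ?_
  · have : part d labX labY y u 0 = ∅ := by simp [part]
    rw [this]; exact rep_empty _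
  · have : part d labX labY y u 0 = ∅ := by simp [part]
    rw [this, Finset.card_empty, mul_zero]
    refine ⟨fun x hx => ?_, ?_⟩
    · rw [h1 x hx]; split_ifs
      exacts [⟨1, by simp⟩, ⟨0, by simp⟩]
    · rw [Finset.sum_congr rfl fun x hx => by rw [h1 x (Finset.mem_range.mp hx)]]
      have : ∀ x : ℕ, |(if x = 0 then 1 else 0 : ℚ)| = if x = 0 then 1 else 0 := fun x => by
        split_ifs <;> simp
      simp only [this, Finset.sum_ite_eq', pow_zero, mul_one]
      split_ifs <;> norm_num
  · rintro j hj τ hF hvt ⟨W, hR, hW, hb⟩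
    replace hE := hE.frame hF rfl
    rw [← hF.nv _ rfl] at hvX hvY hvy
    rw [← hF.qa _ rfl] at hσT
    rw [← hF.na _ rfl] at hσL
    clear hF
    have n1 := hl.nbM
    have n2 := ix_lt hXM (show j < d.n + 1 by omega)
    have n3 := ix_lt hYM (show j < d.n + 1 by omega)
    have n4 : X * d.n ≤ X * (d.n + 1) := Nat.mul_le_mul_left _ (by omega)
    have n5 : Y * d.n ≤ Y * (d.n + 1) := Nat.mul_le_mul_left _ (by omega)
    have n6 := hl.nbp
    have n7 := hl.bN
    have l1 := hσX j hj
    have l2 := hσY j hj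
    rw [← hσL] at l1 l2
    refine Spec.ite (by simp [hvX, hE.n, hvt]; omega) (fun t => ?_) (fun t => ?_)
    all_goals
      simp only [BE.eval_eq, QE.eval_nat, NE.eval_var, NE.eval_rd, NE.eval_add, NE.eval_mul, hvX,
        hE.n, hvt, hvy, Nat.cast_inj, l1] at t
    · refine Spec.ite (by simp [hvY, hE.n, hvt]; omega) (fun t' => ?_) (fun t' => ?_)
      all_goals
        simp only [BE.eval_eq, QE.eval_nat, NE.eval_var, NE.eval_rd, NE.eval_add, NE.eval_mul, hvY,
          hE.n, hvt, Nat.cast_inj, l2] at t'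
      · obtain ⟨W', hR', hW', hb'⟩ := hT j hj t t'
        have hYj := ix_lt hYM hj
        refine Spec.then (P := fun τ' => ∀ x < d.N, τ'.qa qV x =
          σ.qa qT ((Y * d.n + j) * d.N + x)) ?_ fun τ' hF h3 => ?_
        · refine Spec.fillQ d.N 0 (fun x => σ.qa qT ((Y * d.n + j) * d.N + x)) hE.N (by simp)
            (by omega) (by simp) ?_ (fun τ _ _ h z hz => by simpa using h z hz)
          intro x hx τ' hF hvx _ _
          replace hE := hE.frame hF rfl
          rw [← hF.nv _ rfl] at hvX hvY hvy hvt
          rw [← hF.qa _ rfl] at hσT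
          have m1 := ix_lt hYj hx
          have m2 := hl.nbT
          have m3 := hl.nbN
          simp only [NE.ok_var, NE.eval_var, hvx, QE.ok_rd, NE.ok_add, NE.ok_mul, NE.eval_add,
            NE.eval_mul, hvY, hE.n, hvt, hE.N, QE.eval_rd, hσT]
          have m4 : Y * d.n + j ≤ (Y * d.n + j) * d.N :=
            Nat.le_mul_of_pos_right _ (Nat.two_pow_pos _)
          refine ⟨trivial, by omega, by omega, ?_, by simp⟩
          simp; omega
        replace hE := hE.frame hF rfl
        rw [← hF.qa _ rfl] at hW hb
        clear hF
        obtain ⟨e1, e2, e3⟩ := part_succ_pos hA hX hY hy hly hD hm hj t t'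
        have hcard := Finset.card_union_of_disjoint e2
        have hle : (part d labX labY y u (j + 1)).card ≤ d.n := by
          calc _ ≤ (Finset.range d.n).card := Finset.card_filter_le _ _
            _ = d.n := Finset.card_range _
        have hη : d.η * (part d labX labY y u j).card + d.η * (d.cmp Y j).card =
            d.η * (part d labX labY y u (j + 1)).card := by rw [e1, hcard, mul_add]
        have hηn := Nat.mul_le_mul_left d.η hle
        have hEE := hl.hE
        have hV := hW'.congr h3
        have hbV := hb'.congr h3
        refine (spec_mul hl hE hb hbV (by omega)).mono fun τ'' _ h4 => ?_
        refine ⟨W * W', ?_, hW.mul hV h4, ?_⟩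
        · rw [e1]; exact hR.union hA hR' e2 e3
        · rw [← hη]; exact (hb.tmul hbV).congr h4
      · have := part_succ_neg hA hX hY hy hly hD hm hj (fun h => t' h.2)
        exact Spec.skip (by rw [this]; exact ⟨W, hR, hW, hb⟩)
    · have := part_succ_neg hA hX hY hy hly hD hm hj (fun h => t h.1)
      exact Spec.skip (by rw [this]; exact ⟨W, hR, hW, hb⟩)
  · rintro τ _ ⟨W, hR, hW, hb⟩
    have h2 := part_last hA hX hY hy hly hD hm
    rw [h2] at hR hb
    rw [Finset.card_erase_of_mem hm.2.1] at hb
    exact ⟨W, hR, hW, hb⟩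

end Algo

/-! ### The elimination step on tables -/

namespace Algo

open Imp Cmd Table Grassmann Elimination

variable {Γ : Par} {d : Dat} {σ : St}

theorem Dat.slot_subset (d : Dat) {i : ℕ} (hi : i < d.k) {a : ℕ} (ha : a ≤ d.p) :
    slot d.k a i ⊆ Finset.range d.L := by
  intro g hg
  obtain ⟨b, hb, h⟩ := mem_slot.mp hg
  have := d.gen_lt (show b < d.p by omega) hi
  rw [Finset.mem_range]; omega

theorem spec_mask (hl : Lim Γ d) (hE : Env d σ) {s : Finset ℕ} {i : ℕ}
    (hs : s ⊆ Finset.range d.L) (hx : σ.nv vx = bin s) (hi : σ.nv vi = i) (hik : i < d.k) :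
    Spec Γ maskC σ fun τ => τ.nv vm = bin (slot d.k d.p i) ∧
      τ.nv vf = if Disjoint s (slot d.k d.p i) then 1 else 0 := by
  have hnb := hl.nbp
  refine Spec.then (P := fun τ => τ.nv vm = 0) (Spec.set (by simp) (by simp)) fun σ₁ hF h1 => ?_
  replace hE := hE.frame hF rfl
  rw [← hF.nv _ rfl] at hx hi
  clear hF
  refine Spec.then (P := fun τ => τ.nv vf = 1) (Spec.set (by simp; omega) (by simp))
    fun σ₂ hF h2 => ?_
  replace hE := hE.frame hF rfl
  rw [← hF.nv _ rfl] at hx hi h1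
  clear hF
  refine Spec.loop d.p (fun a τ => τ.nv vm = bin (slot d.k a i) ∧
      τ.nv vf = if Disjoint s (slot d.k a i) then 1 else 0) hE.p (by simp) hl.bp ?_
    (fun j τ a h => by simpa using h) ?_ (fun τ _ h => h)
  · simp [h1, h2, slot, bin]
  rintro a ha τ hF hva ⟨h3, h4⟩
  replace hE := hE.frame hF rfl
  rw [← hF.nv _ rfl] at hx hi
  clear hF h1 h2
  have g := d.gen_lt ha hik
  have n1 := hl.nbl
  have n2 := hl.nbL
  have n3 := hl.nbN
  have hxN : bin s < d.N := bin_lt hs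
  have n4 := ix_lt hxN g
  have b1 := hE.bit _ hxN (2 * (a * d.k + i)) (by omega)
  have b2 := hE.bit _ hxN _ g
  have p1 := hE.pw2 (2 * (a * d.k + i)) (by omega)
  have p2 := hE.pw2 (2 * (a * d.k + i) + 1) (by omega)
  rw [dig_bin] at b1 b2
  refine Spec.then (P := fun τ' => τ'.nv vf =
    if Disjoint s (slot d.k a i) ∧ 2 * (a * d.k + i) ∉ s then 1 else 0) ?_ fun τ₁ hF h5 => ?_
  · refine Spec.ite (by simp [hx, hE.L, hva, hE.k, hi]; omega) (fun t => ?_) (fun t => ?_)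
    all_goals
      simp only [BE.eval_eq, QE.eval_nat, NE.eval_var, NE.eval_rd, NE.eval_add, NE.eval_mul, NE.eval_two,
        NE.eval_one, hx, hE.L, hva, hE.k, hi, Nat.cast_inj, b1, ite_eq_left_iff, zero_ne_one, imp_false,
        not_not] at t
    · exact Spec.set (by simp) (by simp [t])
    · exact Spec.skip (by simp [t, h4])
  replace hE := hE.frame hF rfl
  rw [← hF.nv _ rfl] at hx hi h3 hva
  rw [← hF.na _ rfl] at b2 p1 p2
  clear hF h4
  refine Spec.then (P := fun τ' => τ'.nv vf =
    if Disjoint s (slot d.k (a + 1) i) then 1 else 0) ?_ fun τ₂ hF h6 => ?_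
  · have hdis : Disjoint s (slot d.k (a + 1) i) ↔ (Disjoint s (slot d.k a i) ∧
        2 * (a * d.k + i) ∉ s) ∧ 2 * (a * d.k + i) + 1 ∉ s := by
      rw [slot_succ, Finset.disjoint_union_right]
      simp [Finset.disjoint_right, and_assoc]
    refine Spec.ite (by simp [hx, hE.L, hva, hE.k, hi]; omega) (fun t => ?_) (fun t => ?_)
    all_goals
      simp only [BE.eval_eq, QE.eval_nat, NE.eval_var, NE.eval_rd, NE.eval_add, NE.eval_mul, NE.eval_two,
        NE.eval_one, hx, hE.L, hva, hE.k, hi, Nat.cast_inj, b2, ite_eq_left_iff, zero_ne_one, imp_false,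
        not_not] at t
    · exact Spec.set (by simp) (by simp [t, hdis])
    · exact Spec.skip (by simp [t, h5, hdis])
  replace hE := hE.frame hF rfl
  rw [← hF.nv _ rfl] at hx hi h3 hva
  rw [← hF.na _ rfl] at p1 p2
  clear hF
  have hsum : bin (slot d.k (a + 1) i) = bin (slot d.k a i) +
      (2 ^ (2 * (a * d.k + i)) + 2 ^ (2 * (a * d.k + i) + 1)) := by
    rw [slot_succ, bin_union]
    · congr 1
      rw [bin, Finset.sum_pair (by omega)]
    · rw [Finset.disjoint_left]
      intro g hg hg'
      obtain ⟨b, hb, h⟩ := mem_slot.mp hg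
      have := ix_lt hb hik
      simp only [Finset.mem_insert, Finset.mem_singleton] at hg'
      omega
  have hlt : bin (slot d.k (a + 1) i) < d.N := bin_lt (d.slot_subset hik ha)
  refine Spec.set (by simp [h3, hva, hE.k, hi, p1, p2]; omega) ?_
  simp [h3, hva, hE.k, hi, p1, p2, hsum, h6]

/-- The set of binary digits. -/
abbrev bts (x : ℕ) : Finset ℕ := Finset.equivBitIndices x

theorem bin_bts (x : ℕ) : bin (bts x) = x := Finset.equivBitIndices.symm_apply_apply x

theorem bts_bin (s : Finset ℕ) : bts (bin s) = s := Finset.equivBitIndices.apply_symm_apply s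

theorem bts_subset {x L : ℕ} (h : x < 2 ^ L) : bts x ⊆ Finset.range L := by
  obtain ⟨s, hs, rfl⟩ := exists_bin h
  rwa [bts_bin]

/-- The table after an elimination. -/
def elimTab (m : Finset ℕ) (a b : ℚ) (w w' : ℕ → ℚ) (z : ℕ) : ℚ :=
  if Disjoint (bts z) m then a * w z + b * w' (z + bin m) else 0

theorem add_bin_lt {L z : ℕ} {m : Finset ℕ} (hm : m ⊆ Finset.range L) (hz : z < 2 ^ L)
    (h : Disjoint (bts z) m) : z + bin m < 2 ^ L := by
  rw [← bin_bts z, ← bin_union h]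
  exact bin_lt (Finset.union_subset (bts_subset hz) hm)

/-- Restriction keeps the coefficients of sets disjoint from the slot, and integration reads the
coefficient of their union with the slot, whose number is a sum. -/
theorem tab_elim {k p L i : ℕ} (hm : slot k p i ⊆ Finset.range L) {w w' : ℕ → ℚ} {W W' : Gr}
    (hw : Tab L w W) (hw' : Tab L w' W') (a b : ℚ) :
    Tab L (elimTab (slot k p i) a b w w') (a • restr k p i W + b • integs k p i W') := by
  refine ⟨fun s hs => ?_, fun s hs => ?_⟩
  · rw [add_apply, smul_apply, smul_apply, restr_apply, integs_apply, elimTab, bts_bin]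
    split_ifs with h
    · rw [hw.val s hs, ← bin_union h, hw'.val _ (Finset.union_subset hs hm)]
    · simp
  · rw [add_apply, smul_apply, smul_apply, restr_apply, integs_apply, hw.supp s hs,
      hw'.supp _ fun h => hs (Finset.subset_union_left.trans h)]
    simp

/-- The shift `z ↦ z + bin m` is injective, so both parts have at most the norm of their table. The
sum of two such bounds is covered by one more factor `U / Q ≥ 2`, that is, by exponent `e + 1`. -/
theorem bt_elim {Q U L e : ℕ} (hQU : 2 * Q ≤ U) {m : Finset ℕ} (hm : m ⊆ Finset.range L) {a b : ℚ}
    (ha : a = 0 ∨ a = 1) (hb : b = 0 ∨ b = 1) {w w' : ℕ → ℚ} (hw : Bt Q U (2 ^ L) e w)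
    (hw' : Bt Q U (2 ^ L) e w') : Bt Q U (2 ^ L) (e + 1) (elimTab m a b w w') := by
  refine ⟨fun z hz => ?_, ?_⟩
  · unfold elimTab
    split_ifs with h
    · obtain ⟨x, hx⟩ := hw.1 z hz
      obtain ⟨y, hy⟩ := hw'.1 _ (add_bin_lt hm hz h)
      have : (a * w z + b * w' (z + bin m)) * (Q : ℚ) ^ (e + 1) = (a * x + b * y) * Q := by
        rw [← hx, ← hy, pow_succ]; ring
      rw [this]
      rcases ha with rfl | rfl <;> rcases hb with rfl | rfl
      exacts [⟨0, by simp⟩, ⟨y * Q, by simp⟩, ⟨x * Q, by simp⟩, ⟨(x + y) * Q, by simp⟩]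
    · exact ⟨0, by simp⟩
  · have h1 : ∑ z ∈ Finset.range (2 ^ L), |elimTab m a b w w' z| ≤
        ∑ z ∈ Finset.range (2 ^ L), |w z| + ∑ z ∈ Finset.range (2 ^ L), |w' z| := by
      have h2 : ∑ z ∈ (Finset.range (2 ^ L)).filter (fun z => Disjoint (bts z) m),
          |w' (z + bin m)| ≤ ∑ z ∈ Finset.range (2 ^ L), |w' z| := by
        rw [← Finset.sum_image (f := fun z => |w' z|) (g := fun z => z + bin m)
          (fun _ _ _ _ h => Nat.add_right_cancel h)]
        refine Finset.sum_le_sum_of_subset_of_nonneg ?_ fun _ _ _ => abs_nonneg _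
        intro z hz
        obtain ⟨x, hx, rfl⟩ := Finset.mem_image.mp hz
        obtain ⟨hx, h⟩ := Finset.mem_filter.mp hx
        exact Finset.mem_range.mpr (add_bin_lt hm (Finset.mem_range.mp hx) h)
      refine le_trans ?_ (add_le_add_right h2 _)
      rw [Finset.sum_filter, ← Finset.sum_add_distrib]
      refine Finset.sum_le_sum fun z _ => ?_
      have ha' : |a| ≤ 1 := by rcases ha with rfl | rfl <;> simp
      have hb' : |b| ≤ 1 := by rcases hb with rfl | rfl <;> simp
      unfold elimTab
      split_ifs
      · refine (abs_add_le _ _).trans ?_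
        rw [abs_mul, abs_mul]
        nlinarith [abs_nonneg (w z), abs_nonneg (w' (z + bin m))]
      · simp
    have hQU' : 2 * (Q : ℚ) ≤ U := by exact_mod_cast hQU
    calc _ ≤ (∑ z ∈ Finset.range (2 ^ L), |w z| + ∑ z ∈ Finset.range (2 ^ L), |w' z|) *
          (Q : ℚ) ^ (e + 1) := mul_le_mul_of_nonneg_right h1 (by positivity)
      _ = ((∑ z ∈ Finset.range (2 ^ L), |w z|) * Q ^ e +
          (∑ z ∈ Finset.range (2 ^ L), |w' z|) * Q ^ e) * Q := by ring
      _ ≤ ((U : ℚ) ^ e + U ^ e) * Q := mul_le_mul_of_nonneg_right (add_le_add hw.2 hw'.2)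
          (by positivity)
      _ = U ^ e * (2 * Q) := by ring
      _ ≤ U ^ e * U := mul_le_mul_of_nonneg_left hQU' (by positivity)
      _ = _ := (pow_succ _ _).symm

theorem Lim.bd_bit {e : ℕ} {a x : ℚ} (ha : a = 0 ∨ a = 1) (hx : Bd d.Q d.U e x) :
    Bd d.Q d.U e (a * x) := by
  have := (bd_sign d.Q d.U (x := a) (by tauto)).mul hx
  rwa [zero_add] at this

section Block

variable {X y i u e : ℕ} (hl : Lim Γ d) (hE : Env d σ) (hvX : σ.nv vX = X) (hvy : σ.nv vy = y)
  (hvi : σ.nv vi = i) (hvu : σ.nv vu = u) (hXM : X < d.M) (hy : y < d.n) (hik : i < d.k)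
  (hun : u < d.n)

include hl hXM hy in
theorem block_le {x : ℕ} (hx : x < d.N) : (X * d.n + y) * d.N + x ≤ Γ.NB ∧
    X * d.n + y ≤ (X * d.n + y) * d.N := by
  have h1 := ix_lt (ix_lt hXM hy) hx
  have h2 := hl.nbT
  exact ⟨by omega, Nat.le_mul_of_pos_right _ (Nat.two_pow_pos _)⟩

include hl hE hvX hvy hvi hvu hXM hy hik hun

theorem spec_drop (hb : Bt d.Q d.U d.N e (σ.qa qW)) (he : e ≤ d.E) :
    Spec Γ dropC σ fun τ =>
      (∀ z, (z < (X * d.n + y) * d.N ∨ (X * d.n + y) * d.N + d.N ≤ z) → τ.qa qT z = σ.qa qT z) ∧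
      ∀ x < d.N, τ.qa qT ((X * d.n + y) * d.N + x) =
        elimTab (slot d.k d.p i) (d.al u) 0 (σ.qa qW) 0 x := by
  obtain ⟨w, hw⟩ : ∃ w, σ.qa qW = w := ⟨_, rfl⟩
  obtain ⟨t₀, ht₀⟩ : ∃ t, σ.qa qT = t := ⟨_, rfl⟩
  rw [hw] at hb ⊢
  rw [ht₀]
  have n0 := hl.bN
  refine Spec.loop d.N (fun j τ =>
      (∀ z, (z < (X * d.n + y) * d.N ∨ (X * d.n + y) * d.N + j ≤ z) → τ.qa qT z = t₀ z) ∧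
      ∀ x < j, τ.qa qT ((X * d.n + y) * d.N + x) =
        elimTab (slot d.k d.p i) (d.al u) 0 w 0 x) hE.N (by simp) (by omega)
    ⟨fun z _ => by rw [ht₀], by simp⟩ (fun j τ a h => h) ?_ (fun τ _ h => h)
  rintro x hx τ hF hvx ⟨h1, h2⟩
  replace hE := hE.frame hF rfl
  rw [← hF.nv _ rfl] at hvX hvy hvi hvu
  rw [← hF.qa _ rfl] at hw
  clear hF ht₀
  obtain ⟨s, hs, rfl⟩ := exists_bin hx
  refine (spec_mask hl hE hs hvx hvi hik).then fun τ₁ hF h3 => ?_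
  obtain ⟨-, h3⟩ := h3
  replace hE := hE.frame hF rfl
  rw [← hF.nv _ rfl] at hvX hvy hvi hvu hvx
  rw [← hF.qa _ rfl] at hw h1 h2
  clear hF
  obtain ⟨n1, n2⟩ := block_le hl hXM hy hx
  have n3 := hl.nbp
  have n4 := hl.nbN
  have n5 := hl.nbM
  have n6 := ix_lt hXM (show u < d.n + 1 by omega)
  have hu := hE.al u hun
  have hV := hl.V_le (Lim.bd_bit (hl.al01 u) (hb.bd hx)) he
  have key : ∀ v : ℚ, v = elimTab (slot d.k d.p i) (d.al u) 0 w 0 (bin s) →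
      (∀ z, (z < (X * d.n + y) * d.N ∨ (X * d.n + y) * d.N + (bin s + 1) ≤ z) →
        (τ₁.setQ qT ((X * d.n + y) * d.N + bin s) v).qa qT z = t₀ z) ∧
      ∀ x < bin s + 1, (τ₁.setQ qT ((X * d.n + y) * d.N + bin s) v).qa qT
        ((X * d.n + y) * d.N + x) = elimTab (slot d.k d.p i) (d.al u) 0 w 0 x := by
    rintro v rfl
    refine ⟨fun z hz => ?_, fun x hx => ?_⟩ <;> simp only [St.setQ_qa, if_true]
    · rw [Function.update_of_ne (by omega)]; exact h1 z (by omega)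
    · rcases Nat.lt_succ_iff_lt_or_eq.mp hx with h | rfl
      · rw [Function.update_of_ne (by omega)]; exact h2 x h
      · rw [Function.update_self]
  refine Spec.ite (by simp; omega) (fun t => ?_) (fun t => ?_)
  all_goals
    simp only [BE.eval_eq, QE.eval_nat, NE.eval_var, NE.eval_one, h3, Nat.cast_inj,
      ite_eq_left_iff, zero_ne_one, imp_false, not_not] at t
  · refine Spec.qwr (by simp [hvX, hE.n, hvy, hE.N, hvx]; omega)
      (by simp [hvX, hE.n, hvy, hE.N, hvx]; omega) (by simp)
      (by simp [hvu, hw, hvx, hu, hV]; omega) ?_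
    simp only [NE.eval_add, NE.eval_mul, NE.eval_var, hvX, hE.n, hvy, hE.N, hvx, QE.eval_mul,
      QE.eval_rd, hvu, hw, hu]
    exact key _ (by rw [elimTab, bts_bin, if_pos t]; simp)
  · refine Spec.qwr (by simp [hvX, hE.n, hvy, hE.N, hvx]; omega)
      (by simp [hvX, hE.n, hvy, hE.N, hvx]; omega) (by simp) (by simp) ?_
    simp only [NE.eval_add, NE.eval_mul, NE.eval_var, hvX, hE.n, hvy, hE.N, hvx, QE.eval_zero]
    exact key _ (by rw [elimTab, bts_bin, if_neg t])

theorem spec_take {w₀ : ℕ → ℚ} (hb₀ : Bt d.Q d.U d.N e w₀) (hb : Bt d.Q d.U d.N e (σ.qa qW))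
    (he : e + 1 ≤ d.E) (hT : ∀ x < d.N, σ.qa qT ((X * d.n + y) * d.N + x) =
        elimTab (slot d.k d.p i) (d.al u) 0 w₀ 0 x) :
    Spec Γ takeC σ fun τ =>
      (∀ z, (z < (X * d.n + y) * d.N ∨ (X * d.n + y) * d.N + d.N ≤ z) → τ.qa qT z = σ.qa qT z) ∧
      ∀ x < d.N, τ.qa qT ((X * d.n + y) * d.N + x) =
        elimTab (slot d.k d.p i) (d.al u) (d.be u) w₀ (σ.qa qW) x := by
  obtain ⟨w, hw⟩ : ∃ w, σ.qa qW = w := ⟨_, rfl⟩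
  obtain ⟨t₀, ht₀⟩ : ∃ t, σ.qa qT = t := ⟨_, rfl⟩
  rw [hw] at hb ⊢
  rw [ht₀] at hT ⊢
  have n0 := hl.bN
  refine Spec.loop d.N (fun j τ =>
      (∀ z, (z < (X * d.n + y) * d.N ∨ (X * d.n + y) * d.N + j ≤ z) → τ.qa qT z = t₀ z) ∧
      ∀ x < j, τ.qa qT ((X * d.n + y) * d.N + x) =
        elimTab (slot d.k d.p i) (d.al u) (d.be u) w₀ w x) hE.N (by simp) (by omega)
    ⟨fun z _ => by rw [ht₀], by simp⟩ (fun j τ a h => h) ?_ (fun τ _ h => h)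
  rintro x hx τ hF hvx ⟨h1, h2⟩
  replace hE := hE.frame hF rfl
  rw [← hF.nv _ rfl] at hvX hvy hvi hvu
  rw [← hF.qa _ rfl] at hw
  clear hF ht₀
  obtain ⟨s, hs, rfl⟩ := exists_bin hx
  refine (spec_mask hl hE hs hvx hvi hik).then fun τ₁ hF h3 => ?_
  obtain ⟨h4, h3⟩ := h3
  replace hE := hE.frame hF rfl
  rw [← hF.nv _ rfl] at hvX hvy hvi hvu hvx
  rw [← hF.qa _ rfl] at hw h1 h2
  clear hF
  obtain ⟨n1, n2⟩ := block_le hl hXM hy hx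
  have n3 := hl.nbp
  have n4 := hl.nbN
  have n5 := hl.nbM
  have n6 := ix_lt hXM (show u < d.n + 1 by omega)
  have hu := hE.be u hun
  have hm := d.slot_subset hik le_rfl
  have key : ∀ v : ℚ, v = elimTab (slot d.k d.p i) (d.al u) (d.be u) w₀ w (bin s) →
      (∀ z, (z < (X * d.n + y) * d.N ∨ (X * d.n + y) * d.N + (bin s + 1) ≤ z) →
        (Function.update (τ₁.qa qT) ((X * d.n + y) * d.N + bin s) v) z = t₀ z) ∧
      ∀ x < bin s + 1, (Function.update (τ₁.qa qT) ((X * d.n + y) * d.N + bin s) v)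
        ((X * d.n + y) * d.N + x) = elimTab (slot d.k d.p i) (d.al u) (d.be u) w₀ w x := by
    rintro v rfl
    refine ⟨fun z hz => ?_, fun x hx => ?_⟩
    · rw [Function.update_of_ne (by omega)]; exact h1 z (by omega)
    · rcases Nat.lt_succ_iff_lt_or_eq.mp hx with h | rfl
      · rw [Function.update_of_ne (by omega)]; exact h2 x h
      · rw [Function.update_self]
  have hold := (h1 ((X * d.n + y) * d.N + bin s) (by omega)).trans (hT _ hx)
  refine Spec.ite (by simp; omega) (fun t => ?_) (fun t => ?_)
  all_goals
    simp only [BE.eval_eq, QE.eval_nat, NE.eval_var, NE.eval_one, h3, Nat.cast_inj,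
      ite_eq_left_iff, zero_ne_one, imp_false, not_not] at t
  · have hlt := add_bin_lt hm hx (by rw [bts_bin]; exact t)
    have hV := hl.V_le (Lim.bd_bit (hl.be01 u) (hb.bd hlt)) (by omega)
    have hsum : τ₁.qa qT ((X * d.n + y) * d.N + bin s) +
        d.be u * w (bin s + bin (slot d.k d.p i)) =
        elimTab (slot d.k d.p i) (d.al u) (d.be u) w₀ w (bin s) := by
      rw [hold, elimTab, elimTab, bts_bin, if_pos t, if_pos t]; simp
    have hV' := hl.V_le ((bt_elim hl.hU hm (hl.al01 u) (hl.be01 u) hb₀ hb).bd hx) he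
    rw [← hsum] at hV'
    have hlt' : bin s + bin (slot d.k d.p i) < d.N := hlt
    refine Spec.qwr (by simp [hvX, hE.n, hvy, hE.N, hvx]; omega)
      (by simp [hvX, hE.n, hvy, hE.N, hvx]; omega) (by simp)
      (by simp [hvX, hE.n, hvy, hE.N, hvu, hw, hvx, hu, h4, hV, hV']; omega) ?_
    simp only [NE.eval_add, NE.eval_mul, NE.eval_var, hvX, hE.n, hvy, hE.N, hvx, QE.eval_mul,
      QE.eval_add, QE.eval_rd, hvu, hw, hu, h4, hsum, St.setQ_qa, if_true]
    exact key _ rfl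
  · refine Spec.skip ?_
    have h5 : elimTab (slot d.k d.p i) (d.al u) (d.be u) w₀ w (bin s) =
        τ₁.qa qT ((X * d.n + y) * d.N + bin s) := by
      rw [hold, elimTab, elimTab, bts_bin, if_neg t, if_neg t]
    have := key _ h5.symm
    rwa [Function.update_eq_self] at this

end Block

/-- The part without `u` is stored first, because multiplying in the edges overwrites the joined
table. The exponents add up: `η` for each of the other vertices, `2 k p` for the edges of `u` and 1
for the final sum, which makes `η` for `u` as well. -/
theorem spec_table (hl : Lim Γ d) (hE : Env d σ) {X Y y i u : ℕ} (hvX : σ.nv vX = X)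
    (hvY : σ.nv vY = Y) (hvy : σ.nv vy = y) (hvi : σ.nv vi = i) (hvu : σ.nv vu = u)
    (hXM : X < d.M) (hYM : Y < d.M) (hy : y < d.n) (hun : u < d.n)
    {labX labY : ℕ → ℕ} (hX : LabOk d X labX) (hY : LabOk d Y labY)
    (hσX : ∀ z < d.n, σ.na nLab (X * d.n + z) = labX z)
    (hσY : ∀ z < d.n, σ.na nLab (Y * d.n + z) = labY z)
    (hly : labX y = y) (hD : d.D Y = Function.update (d.D X) i u)
    (hm : Move d.A d.n d.k (d.D X) y i u)
    (hT : ∀ z < d.n, labX z = y → labY z = z → TabOk d σ Y z) :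
    Spec Γ tableC σ fun τ => TabOk d τ X y ∧
      ∀ z, (z < (X * d.n + y) * d.N ∨ (X * d.n + y) * d.N + d.N ≤ z) → τ.qa qT z = σ.qa qT z := by
  have hik := hm.1
  have hcard := cmp_card_le (d := d) X y
  have hpos : 0 < (d.cmp X y).card := Finset.card_pos.mpr ⟨u, hm.2.1⟩
  have hη : d.η = 2 * d.k * d.p + 1 := rfl
  have hEE := hl.hE
  have h1 := Nat.mul_le_mul_left d.η hcard
  have h2 : d.η * ((d.cmp X y).card - 1) + d.η = d.η * (d.cmp X y).card := by
    rw [← Nat.mul_succ]; congr 1; omega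
  refine (spec_join hl hE hvX hvY hvy hXM hYM hy hX hY hσX hσY hly hD hm hT).then fun σ₁ hF h => ?_
  obtain ⟨W, hR, hW, hb⟩ := h
  have hT₁ := hF.qa qT rfl
  replace hE := hE.frame hF rfl
  rw [← hF.nv _ rfl] at hvX hvy hvi hvu
  clear hF hT
  refine (spec_drop hl hE hvX hvy hvi hvu hXM hy hik hun hb (by omega)).then fun σ₂ hF h => ?_
  obtain ⟨h3, h4⟩ := h
  replace hE := hE.frame hF rfl
  rw [← hF.nv _ rfl] at hvX hvy hvi hvu
  rw [← hF.qa _ rfl] at hW hb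
  rw [← hF.qa qW rfl] at h4
  clear hF
  obtain ⟨w₀, hw₀⟩ : ∃ w₀, σ₂.qa qW = w₀ := ⟨_, rfl⟩
  rw [hw₀] at h4
  refine (spec_edges hl hE hvX hvi hvu hXM hik hun hW hb (by omega)).then fun σ₃ hF h => ?_
  obtain ⟨h5, h6⟩ := h
  replace hE := hE.frame hF rfl
  rw [← hF.nv _ rfl] at hvX hvy hvi hvu
  rw [← hF.qa qT rfl] at h3 h4
  rw [hw₀] at hW hb
  clear hF
  replace hb := hb.mono hl.hU (Nat.le_add_right _ (2 * d.k * d.p))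
  refine (spec_take hl hE hvX hvy hvi hvu hXM hy hik hun hb h6 (by omega) h4).mono fun τ _ h => ?_
  obtain ⟨h7, h8⟩ := h
  refine ⟨⟨_, ?_, (tab_elim (d.slot_subset hik le_rfl) hW h5 (d.al u) (d.be u)).congr h8, ?_⟩,
    fun z hz => by rw [h7 z hz, h3 z hz, hT₁]⟩
  · have hins : insert u ((d.cmp X y).erase u) = d.cmp X y := Finset.insert_erase hm.2.1
    have := Rep.elim hl.psd hl.hp hR hik hun (Finset.notMem_erase _ _) (X := d.D X)
      (by rw [hD, Function.update_self]) (fun b hb => by rw [hD, Function.update_of_ne hb])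
      (by rw [hins]; exact hm.2.2)
    rw [hins, hD] at this
    exact this
  · have := (bt_elim hl.hU (d.slot_subset hik le_rfl) (hl.al01 u) (hl.be01 u) hb h6).congr h8
    rw [← h2, hη, ← add_assoc]
    exact this

end Algo

/-! ### Legal moves and the search for good pairs -/

namespace Algo

open Imp Cmd Table Grassmann Elimination

variable {Γ : Par} {d : Dat} {σ : St}

/-- The labels of position `X`. -/
abbrev lab (d : Dat) (σ : St) (X y : ℕ) : ℕ := σ.na nLab (X * d.n + y)

/-- All labels are correct. -/
def LabsOk (d : Dat) (σ : St) : Prop := ∀ X < d.M, LabOk d X (lab d σ X)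

/-- All good pairs have correct tables. -/
def Sound (d : Dat) (σ : St) : Prop :=
  ∀ X < d.M, ∀ y < d.n, σ.na nGood (X * d.n + y) = 1 → TabOk d σ X y

/-- The test of `checkC`. -/
def Cond (d : Dat) (σ : St) (X Y y i u : ℕ) (j : ℕ) : Prop :=
  lab d σ X u = y ∧ ∀ z < j, lab d σ X z = y → d.A (d.D X i) z = 0 ∧
    (lab d σ Y z = z → σ.na nGood (Y * d.n + z) = 1)

theorem dig_le (d : Dat) (X i : ℕ) : d.D X i ≤ d.n :=
  Nat.lt_succ_iff.mp (dig_lt (Nat.succ_pos _) _ _)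

theorem Lim.lab_ix (hl : Lim Γ d) {X y : ℕ} (hX : X < d.M) (hy : y < d.n) :
    X * d.n + y ≤ Γ.NB := by
  have h1 := hl.nbM
  have h2 := ix_lt hX (show y < d.n + 1 by omega)
  have h3 : X * d.n ≤ X * (d.n + 1) := Nat.mul_le_mul_left _ (by omega)
  omega

theorem spec_check (hl : Lim Γ d) (hE : Env d σ) {X Y y i u : ℕ} (hvX : σ.nv vX = X)
    (hvY : σ.nv vY = Y) (hvy : σ.nv vy = y) (hvi : σ.nv vi = i) (hvu : σ.nv vu = u)
    (hXM : X < d.M) (hYM : Y < d.M) (hik : i < d.k) (hun : u < d.n) :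
    Spec Γ checkC σ fun τ => τ.nv vo = 1 ↔ Cond d σ X Y y i u d.n := by
  have n1 := hl.nbp
  have hlab := hl.lab_ix hXM hun
  refine Spec.then (P := fun τ => τ.nv vo = 1) (Spec.set (by simp; omega) (by simp))
    fun σ₁ hF h1 => ?_
  have e1 := hF.na nLab rfl
  have e2 := hF.na nGood rfl
  replace hE := hE.frame hF rfl
  rw [← hF.nv _ rfl] at hvX hvY hvy hvi hvu
  clear hF
  refine Spec.then (P := fun τ => τ.nv vo = 1 ↔ Cond d σ X Y y i u 0) ?_ fun σ₂ hF h2 => ?_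
  · refine Spec.ite (by simp [hvX, hE.n, hvu]; omega) (fun t => ?_) (fun t => ?_)
    all_goals
      simp only [BE.eval_eq, QE.eval_nat, NE.eval_var, NE.eval_rd, NE.eval_add, NE.eval_mul, hvX,
        hE.n, hvu, hvy, Nat.cast_inj, e1] at t
    · exact Spec.skip (by simp [Cond, h1, t])
    · exact Spec.set (by simp) (by simp [Cond, t])
  rw [← hF.na _ rfl] at e1 e2
  replace hE := hE.frame hF rfl
  rw [← hF.nv _ rfl] at hvX hvY hvy hvi hvu
  clear hF h1
  refine Spec.loop d.n (fun j τ => τ.nv vo = 1 ↔ Cond d σ X Y y i u j) hE.n (by simp) hl.bn h2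
    (fun j τ a h => by simpa using h) ?_ (fun τ _ h => h)
  intro j hj τ hF hvt h3
  rw [← hF.na _ rfl] at e1 e2
  replace hE := hE.frame hF rfl
  rw [← hF.nv _ rfl] at hvX hvY hvy hvi hvu
  clear hF h2
  have n2 := hl.lab_ix hXM hj
  have n3 := hl.lab_ix hYM hj
  have n4 := ix_lt hXM hik
  have n5 := hl.nbK
  have n6 := hl.nbA
  have hdig : _ = d.D X i := hE.dig X hXM i hik
  have hdn := dig_le d X i
  have n7 := ix_lt (show d.D X i < d.n + 1 by omega) (show j < d.n + 1 by omega)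
  have hA := hE.A _ hdn j hj.le
  have n8 : d.n + 1 ≤ Γ.NB := by nlinarith
  have hsucc : ∀ z : ℕ, z < j + 1 ↔ z < j ∨ z = j := fun z => Nat.lt_succ_iff_lt_or_eq
  have hstep : Cond d σ X Y y i u (j + 1) ↔ Cond d σ X Y y i u j ∧ (lab d σ X j = y →
      d.A (d.D X i) j = 0 ∧ (lab d σ Y j = j → σ.na nGood (Y * d.n + j) = 1)) := by
    simp only [Cond, hsucc, or_imp, forall_and, forall_eq, and_assoc]
    tauto
  rw [hstep, ← h3]
  refine Spec.ite (by simp [hvX, hE.n, hvt]; omega) (fun t => ?_) (fun t => ?_)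
  all_goals
    simp only [BE.eval_eq, QE.eval_nat, NE.eval_var, NE.eval_rd, NE.eval_add, NE.eval_mul, hvX,
      hE.n, hvt, hvy, Nat.cast_inj, e1] at t
  · refine Spec.then (P := fun τ' => τ'.nv vo = 1 ↔ τ.nv vo = 1 ∧ d.A (d.D X i) j = 0) ?_
      fun τ₁ hF h4 => ?_
    · refine Spec.ite ?_ (fun t' => ?_) (fun t' => ?_)
      · simp [hvX, hE.k, hvi, hE.n, hvt, hdig]; omega
      all_goals
        simp only [BE.eval_eq, QE.eval_rd, NE.eval_var, NE.eval_rd, NE.eval_add, NE.eval_mul, hvX,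
          hE.n, hvt, hE.k, hvi, hdig, NE.eval_one, hA, QE.eval_zero] at t'
      · exact Spec.skip (by simp [t'])
      · exact Spec.set (by simp) (by simp [t'])
    rw [← hF.na _ rfl] at e1 e2
    replace hE := hE.frame hF rfl
    rw [← hF.nv _ rfl] at hvX hvY hvy hvi hvu hvt
    clear hF h3
    refine Spec.ite (by simp [hvY, hE.n, hvt]; omega) (fun t' => ?_) (fun t' => ?_)
    all_goals
      simp only [BE.eval_eq, QE.eval_nat, NE.eval_var, NE.eval_rd, NE.eval_add, NE.eval_mul, hvY,
        hE.n, hvt, Nat.cast_inj, e1] at t'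
    · refine Spec.ite (by simp [hvY, hE.n, hvt]; omega) (fun t'' => ?_) (fun t'' => ?_)
      all_goals
        simp only [BE.eval_eq, QE.eval_nat, NE.eval_var, NE.eval_rd, NE.eval_add, NE.eval_mul, hvY,
          hE.n, hvt, Nat.cast_inj, e2, NE.eval_one] at t''
      · exact Spec.skip (by simp [t, t', t'', h4])
      · exact Spec.set (by simp) (by simp [t, t', t''])
    · exact Spec.skip (by simp [t, t', h4])
  · exact Spec.skip (by simp [t])

theorem TabOk.congr {τ : St} {X y : ℕ} (h : TabOk d σ X y)
    (ht : ∀ x < d.N, τ.qa qT ((X * d.n + y) * d.N + x) = σ.qa qT ((X * d.n + y) * d.N + x)) :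
    TabOk d τ X y := by
  obtain ⟨W, h1, h2, h3⟩ := h
  exact ⟨W, h1, h2.congr ht, h3.congr ht⟩

/-- The next position. -/
abbrev Dat.next (d : Dat) (X i u : ℕ) : ℕ := setDig (d.n + 1) X i u

theorem Cond.move {X Y y i u : ℕ} (hA : ∀ a b, d.A a b = d.A b a) (hX : LabOk d X (lab d σ X))
    (hy : y < d.n) (hly : lab d σ X y = y) (hik : i < d.k) (hun : u < d.n)
    (h : Cond d σ X Y y i u d.n) : Move d.A d.n d.k (d.D X) y i u :=
  ⟨hik, (hX.mem hA hy hly).mpr ⟨hun, h.1⟩, fun z hz => by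
    have := (hX.mem hA hy hly).mp hz
    exact (h.2 z this.1 this.2).1⟩

theorem spec_try (hl : Lim Γ d) (hE : Env d σ) {X y i u : ℕ} (hvX : σ.nv vX = X)
    (hvy : σ.nv vy = y) (hvi : σ.nv vi = i) (hvu : σ.nv vu = u)
    (hXM : X < d.M) (hy : y < d.n) (hik : i < d.k) (hun : u < d.n) (hL : LabsOk d σ)
    (hly : lab d σ X y = y) (hS : Sound d σ) :
    Spec Γ tryC σ fun τ => Sound d τ ∧ (∀ a, σ.na nGood a = 1 → τ.na nGood a = 1) ∧
      (Cond d σ X (d.next X i u) y i u d.n → τ.na nGood (X * d.n + y) = 1) := by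
  have hA := hl.psd.symm
  have hYM : d.next X i u < d.M := setDig_lt (by omega) hXM hik
  have n1 := ix_lt hXM hik
  have n2 := hl.nbK
  have n3 := hl.nbM
  have n4 := hl.nbl
  have n5 := hl.lab_ix hXM hy
  have n6 := hl.nbp
  refine Spec.then (P := fun τ => τ.nv vY = d.next X i u) ?_ fun σ₁ hF h1 => ?_
  · have m1 : (d.n + 1) ^ i ≤ d.M := Nat.pow_le_pow_right (by omega) hik.le
    have m2 : u * (d.n + 1) ^ i ≤ d.n * d.M := Nat.mul_le_mul hun.le m1
    have m3 := dig_mul_le (d.n + 1) X i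
    have m4 : d.M * (d.n + 1) = d.M + d.n * d.M := by ring
    have hp := hE.pwn i hik.le
    have hdig := hE.dig X hXM i hik
    refine Spec.set (by simp [hvX, hvu, hvi, hE.k, hp, hdig]; omega) ?_
    simp [hvX, hvu, hvi, hE.k, hp, hdig, setDig]
  have e1 := hF.na nLab rfl
  have e2 := hF.na nGood rfl
  have e3 := hF.qa qT rfl
  replace hE := hE.frame hF rfl
  rw [← hF.nv _ rfl] at hvX hvy hvi hvu
  clear hF
  refine (spec_check hl hE hvX h1 hvy hvi hvu hXM hYM hik hun).then fun σ₂ hF h2 => ?_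
  have h2' : σ₂.nv vo = 1 ↔ Cond d σ X (d.next X i u) y i u d.n := by
    rw [h2]; simp only [Cond, lab, e1, e2]
  rw [← hF.na _ rfl] at e1 e2
  rw [← hF.qa _ rfl] at e3
  replace hE := hE.frame hF rfl
  rw [← hF.nv _ rfl] at hvX hvy hvi hvu h1
  clear hF h2
  have hSt : ∀ τ : St, τ.qa qT = σ.qa qT → ∀ X y, TabOk d σ X y → TabOk d τ X y :=
    fun τ h X y h' => h'.congr fun x _ => by rw [h]
  have hS₂ : Sound d σ₂ := fun X hX y hy h => hSt _ e3 _ _ (hS X hX y hy (by rwa [e2] at h))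
  refine Spec.ite (by simp; omega) (fun t => ?_) (fun t => ?_)
  all_goals
    simp only [BE.eval_eq, QE.eval_nat, NE.eval_var, NE.eval_one, Nat.cast_inj] at t
    rw [h2'] at t
  · refine Spec.ite (by simp [hvX, hE.n, hvy]; omega) (fun t' => ?_) (fun t' => ?_)
    all_goals
      simp only [BE.eval_eq, QE.eval_nat, NE.eval_var, NE.eval_rd, NE.eval_add, NE.eval_mul, hvX,
        hE.n, hvy, Nat.cast_inj, NE.eval_one] at t'
    · exact Spec.skip ⟨hS₂, fun a h => by rwa [e2], fun _ => t'⟩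
    · have hm := t.move hA (hL X hXM) hy hly hik hun
      refine (spec_table hl hE hvX h1 hvy hvi hvu hXM hYM hy hun (hL X hXM) (hL _ hYM)
        (fun z _ => by rw [e1]) (fun z _ => by rw [e1]) hly (setDig_dig (by omega)) hm
        (fun z hz h3 h4 => hSt _ e3 _ _ (hS _ hYM z hz ((t.2 z hz h3).2 h4)))).then
        fun σ₃ hF h5 => ?_
      obtain ⟨h5, h6⟩ := h5
      replace hE := hE.frame hF rfl
      rw [← hF.nv _ rfl] at hvX hvy
      rw [← hF.na nGood rfl] at e2
      rw [Sound, ← hF.na nGood rfl] at hS₂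
      refine Spec.nwr (by simp [hvX, hE.n, hvy]; omega) (by simp [hvX, hE.n, hvy]; omega)
        (by simp; omega) ?_
      simp only [NE.eval_add, NE.eval_mul, NE.eval_var, hvX, hE.n, hvy, NE.eval_one]
      refine ⟨fun X' hX' y' hy' hg => ?_, fun a ha => ?_, fun _ => by simp⟩
      -- The blocks of different pairs are disjoint, so the new table leaves the tables of the pairs
      -- that were good before untouched.
      · by_cases hq : X' * d.n + y' = X * d.n + y
        · have hXX : X' = X := by
            have := congrArg (· / d.n) hq
            simpa [Nat.add_div_of_dvd_right, Nat.mul_div_cancel _ (show 0 < d.n by omega),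
              Nat.div_eq_of_lt hy, Nat.div_eq_of_lt hy'] using this
          subst hXX
          have : y' = y := by omega
          subst this
          exact h5.congr fun x _ => rfl
        · simp only [St.setN_na, if_true] at hg
          rw [Function.update_of_ne hq] at hg
          refine (hS₂ X' hX' y' hy' hg).congr fun x hx => h6 _ ?_
          rcases Nat.lt_or_gt_of_ne hq with h | h
          · left
            have := Nat.mul_le_mul_right d.N h
            rw [Nat.succ_mul] at this
            omega
          · right
            have := Nat.mul_le_mul_right d.N h
            rw [Nat.succ_mul] at this
            omega
      · simp only [St.setN_na, if_true, Function.update_apply]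
        split_ifs
        · rfl
        · rw [e2]; exact ha
  · exact Spec.skip ⟨hS₂, fun a h => by rwa [e2], fun h => absurd h t⟩

/-- All pairs that can be eliminated in `r` rounds are good. -/
def Solved (d : Dat) (σ : St) (r : ℕ) : Prop := ∀ X < d.M, ∀ y < d.n, lab d σ X y = y →
  Win d.A d.n d.k r (d.D X) y → σ.na nGood (X * d.n + y) = 1

/-- Winning refers to all vertices of the component other than `u`, the test only to the
representatives after the move. Since `u` is then occupied, it is not a representative. -/
theorem cond_of_win (hA : ∀ a b, d.A a b = d.A b a) {X y i u r : ℕ} (hXM : X < d.M) (hy : y < d.n)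
    (hL : LabsOk d σ) (hly : lab d σ X y = y) (hr : Solved d σ r)
    (hm : Move d.A d.n d.k (d.D X) y i u) (hw : ∀ y' ∈ d.cmp X y, y' ≠ u →
      Win d.A d.n d.k r (Function.update (d.D X) i u) y') :
    Cond d σ X (d.next X i u) y i u d.n := by
  have hmem := fun z => (hL X hXM).mem (z := z) hA hy hly
  have hu := (hmem u).mp hm.2.1
  have hYM : d.next X i u < d.M := setDig_lt (by omega) hXM hm.1
  have hD : d.D (d.next X i u) = Function.update (d.D X) i u := setDig_dig (by omega)
  refine ⟨hu.2, fun z hz h => ⟨hm.2.2 z ((hmem z).mpr ⟨hz, h⟩), fun h' => ?_⟩⟩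
  -- A vertex that is its own label is unoccupied, whereas `u` now sits in slot `i`.
  have hzu : z ≠ u := by
    rintro rfl
    have := ((hL _ hYM).free z hz).mp (h'.trans_lt hz)
    rw [hD] at this
    exact this.2 i hm.1 (by simp)
  exact hr _ hYM z hz h' (by rw [hD]; exact hw z ((hmem z).mpr ⟨hz, h⟩) hzu)

theorem spec_pair (hl : Lim Γ d) (hE : Env d σ) {X y r : ℕ} (hvX : σ.nv vX = X)
    (hvy : σ.nv vy = y) (hXM : X < d.M) (hy : y < d.n) (hL : LabsOk d σ)
    (hly : lab d σ X y = y) (hS : Sound d σ) (hr : Solved d σ r) :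
    Spec Γ (loop vi ♯vk (loop vu ♯vn tryC)) σ fun τ => Sound d τ ∧
      (∀ a, σ.na nGood a = 1 → τ.na nGood a = 1) ∧
      (Win d.A d.n d.k (r + 1) (d.D X) y → τ.na nGood (X * d.n + y) = 1) := by
  have hA := hl.psd.symm
  obtain ⟨g₀, hg₀⟩ : ∃ g, σ.na nGood = g := ⟨_, rfl⟩
  obtain ⟨l₀, hl₀⟩ : ∃ g, σ.na nLab = g := ⟨_, rfl⟩
  let C : ℕ → ℕ → Prop := fun i u => Cond d σ X (d.next X i u) y i u d.n
  have hC : ∀ τ : St, τ.na nLab = σ.na nLab → (∀ a, σ.na nGood a = 1 → τ.na nGood a = 1) →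
      ∀ i u, C i u → Cond d τ X (d.next X i u) y i u d.n := by
    intro τ h1 h2 i u h
    refine ⟨by rw [lab, h1]; exact h.1, fun z hz h3 => ?_⟩
    rw [lab, h1] at h3
    refine ⟨(h.2 z hz h3).1, fun h4 => h2 _ ((h.2 z hz h3).2 ?_)⟩
    rwa [lab, h1] at h4
  refine Spec.loop d.k (fun i τ => Sound d τ ∧ (∀ a, σ.na nGood a = 1 → τ.na nGood a = 1) ∧
    ((∃ i' < i, ∃ u < d.n, C i' u) → τ.na nGood (X * d.n + y) = 1)) hE.k (by simp) hl.bk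
    ⟨hS, fun _ h => h, by simp⟩ (fun j τ a h => h) ?_ ?_
  · rintro i hi τ hF hvi ⟨h1, h2, h3⟩
    refine Spec.loop d.n (fun j τ => Sound d τ ∧ (∀ a, σ.na nGood a = 1 → τ.na nGood a = 1) ∧
      (((∃ i' < i, ∃ u < d.n, C i' u) ∨ ∃ u < j, C i u) → τ.na nGood (X * d.n + y) = 1))
      (hE.frame hF rfl).n (by simp) hl.bn
      ⟨h1, h2, by simpa using h3⟩ (fun j τ a h => h) ?_ ?_
    · rintro u hu τ' hF' hvu ⟨h4, h5, h6⟩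
      have hEt := (hE.frame hF rfl).frame hF' rfl
      have hlab : τ'.na nLab = σ.na nLab := (hF'.na _ rfl).trans (hF.na _ rfl)
      refine (spec_try hl hEt (((hF'.nv _ rfl).trans (hF.nv _ rfl)).trans hvX)
        (((hF'.nv _ rfl).trans (hF.nv _ rfl)).trans hvy) ((hF'.nv _ rfl).trans hvi) hvu hXM hy hi hu
        (by unfold LabsOk lab; rw [hlab]; exact hL) (by rw [lab, hlab]; exact hly) h4).mono ?_
      rintro τ'' - ⟨h7, h8, h9⟩
      refine ⟨h7, fun a ha => h8 a (h5 a ha), ?_⟩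
      rintro (h | ⟨u', hu', h⟩)
      · exact h8 _ (h6 (.inl h))
      · rcases Nat.lt_succ_iff_lt_or_eq.mp hu' with h' | rfl
        · exact h8 _ (h6 (.inr ⟨u', h', h⟩))
        · exact h9 (hC _ hlab h5 _ _ h)
    · rintro τ' - ⟨h4, h5, h6⟩
      refine ⟨h4, h5, ?_⟩
      rintro ⟨i', hi', u, hu, h⟩
      rcases Nat.lt_succ_iff_lt_or_eq.mp hi' with h' | rfl
      · exact h6 (.inl ⟨i', h', u, hu, h⟩)
      · exact h6 (.inr ⟨u, hu, h⟩)
  · rintro τ - ⟨h1, h2, h3⟩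
    refine ⟨h1, h2, ?_⟩
    rintro ⟨i, u, hm, hw⟩
    have hu := ((hL X hXM).mem hA hy hly).mp hm.2.1
    exact h3 ⟨i, hm.1, u, hu.1, cond_of_win hA hXM hy hL hly hr hm hw⟩

/-- Sweep `r` turns pairs won in `r + 1` rounds good, because the pairs they lead to were good
before the sweep. Good marks are never removed, so the order within a sweep does not matter. -/
theorem spec_good (hl : Lim Γ d) (hE : Env d σ) (hL : LabsOk d σ)
    (h0 : ∀ X < d.M, ∀ y < d.n, σ.na nGood (X * d.n + y) = 0) :
    Spec Γ goodC σ fun τ => Sound d τ ∧ Solved d τ d.n := by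
  refine Spec.loop d.n (fun r τ => Sound d τ ∧ Solved d τ r) hE.n (by simp) hl.bn
    ⟨fun X hX y hy h => by rw [h0 X hX y hy] at h; omega, fun X hX y hy _ h => h.elim⟩
    (fun j τ a h => h) ?_ (fun τ _ h => h)
  rintro r hr τ hF - ⟨h1, h2⟩
  replace hE := hE.frame hF rfl
  replace hL : LabsOk d τ := by unfold LabsOk lab; rw [hF.na _ rfl]; exact hL
  clear hF h0
  refine Spec.loop d.M (fun j τ' => Sound d τ' ∧ (∀ a, τ.na nGood a = 1 → τ'.na nGood a = 1) ∧
    ∀ X < j, ∀ y < d.n, lab d τ X y = y → Win d.A d.n d.k (r + 1) (d.D X) y →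
      τ'.na nGood (X * d.n + y) = 1) hE.M (by simp) hl.bM ⟨h1, fun _ h => h, by simp⟩
    (fun j τ a h => h) ?_ (fun τ' hF h => ⟨h.1, fun X hX y hy h' => h.2.2 X hX y hy (by
      rwa [lab, hF.na _ rfl] at h')⟩)
  rintro X hX τ₁ hF hvX ⟨h3, h4, h5⟩
  replace hE := hE.frame hF rfl
  have e1 := hF.na nLab rfl
  clear hF h1
  refine Spec.loop d.n (fun j τ' => Sound d τ' ∧ (∀ a, τ₁.na nGood a = 1 → τ'.na nGood a = 1) ∧
    ∀ y < j, lab d τ X y = y → Win d.A d.n d.k (r + 1) (d.D X) y →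
      τ'.na nGood (X * d.n + y) = 1) hE.n (by simp) hl.bn ⟨h3, fun _ h => h, by simp⟩
    (fun j τ a h => h) ?_ ?_
  · rintro y hy τ₂ hF hvy ⟨h6, h7, h8⟩
    replace hE := hE.frame hF rfl
    have e2 := (hF.na nLab rfl).trans e1
    rw [← hF.nv _ rfl] at hvX
    have n1 := hl.lab_ix hX hy
    clear hF h3
    refine Spec.ite (by simp [hvX, hE.n, hvy]; omega) (fun t => ?_) (fun t => ?_)
    all_goals
      simp only [BE.eval_eq, QE.eval_nat, NE.eval_var, NE.eval_rd, NE.eval_add, NE.eval_mul, hvX,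
        hE.n, hvy, Nat.cast_inj] at t
    · refine (spec_pair hl hE hvX hvy hX hy (by unfold LabsOk lab; rw [e2]; exact hL) t h6
        (r := r) (fun X' hX' y' hy' h' hw => h7 _ (h4 _ (h2 X' hX' y' hy' (by
          rwa [lab, e2] at h') hw)))).mono ?_
      rintro τ₃ - ⟨h9, h10, h11⟩
      refine ⟨h9, fun a ha => h10 a (h7 a ha), fun y' hy' h' hw => ?_⟩
      rcases Nat.lt_succ_iff_lt_or_eq.mp hy' with h | rfl
      · exact h10 _ (h8 y' h h' hw)
      · exact h11 hw
    · refine Spec.skip ⟨h6, h7, fun y' hy' h' hw => ?_⟩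
      rcases Nat.lt_succ_iff_lt_or_eq.mp hy' with h | rfl
      · exact h8 y' h h' hw
      · rw [e2] at t; exact absurd h' t
  · rintro τ₂ - ⟨h6, h7, h8⟩
    refine ⟨h6, fun a ha => h7 a (h4 a ha), fun X' hX' y hy h' hw => ?_⟩
    rcases Nat.lt_succ_iff_lt_or_eq.mp hX' with h | rfl
    · exact h7 _ (h5 X' h y hy h' hw)
    · exact h8 y hy h' hw

end Algo

/-! ### Powers, digits and labels -/

namespace Algo

open Imp Cmd Table Grassmann Elimination

variable {Γ : Par} {d : Dat} {σ : St}

/-- The expression has a fixed value as long as only the scratch variables change. -/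
def Fixed (Γ : Par) (σ : St) (e : NE) (m : ℕ) : Prop :=
  ∀ τ : St, (∀ v, v ≠ vj → v ≠ vx → v ≠ vc → τ.nv v = σ.nv v) → e.Ok Γ τ ∧ e.eval τ = m

theorem Fixed.frame {e : NE} {m : ℕ} (h : Fixed Γ σ e m) {τ : St}
    (hF : ∀ v, v ≠ vj → v ≠ vx → v ≠ vc → τ.nv v = σ.nv v) : Fixed Γ τ e m :=
  fun υ hυ => h υ fun v h1 h2 h3 => (hυ v h1 h2 h3).trans (hF v h1 h2 h3)

theorem Fixed.self {e : NE} {m : ℕ} (h : Fixed Γ σ e m) : e.Ok Γ σ ∧ e.eval σ = m :=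
  h σ fun _ _ _ _ => rfl

theorem Frame.scratch {c : Cmd} {τ : St} (hF : Frame c σ τ)
    (hc : ∀ v, v ≠ vj → v ≠ vx → v ≠ vc → c.wv v = false) :
    ∀ v, v ≠ vj → v ≠ vx → v ≠ vc → τ.nv v = σ.nv v :=
  fun v h1 h2 h3 => hF.nv v (hc v h1 h2 h3)

theorem spec_pow {r : Fin 16} {b m : NE} {bv mv : ℕ} (hb : Fixed Γ σ b bv) (hm : Fixed Γ σ m mv)
    (h1 : 1 ≤ bv) (hB : mv ≤ Γ.B) (hN : bv ^ mv ≤ Γ.NB) (hM : mv + 1 ≤ Γ.NB) :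
    Spec Γ (powC r b m) σ fun τ => ∀ j ≤ mv, τ.na r j = bv ^ j := by
  refine Spec.then (P := fun τ => τ.na r 0 = 1) (Spec.nwr (by simp) (by simp)
    (by simp; omega) (by simp)) fun σ₁ hF h0 => ?_
  have hw := Frame.scratch hF fun _ _ _ _ => rfl
  replace hb := hb.frame hw
  replace hm := hm.frame hw
  clear hF hw
  refine Spec.loop mv (fun j τ => ∀ i ≤ j, τ.na r i = bv ^ i) hm.self.2 hm.self.1 hB
    (by simpa using h0) (fun j τ a h => h) ?_ (fun τ _ h => h)
  intro j hj τ hF hvj h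
  obtain ⟨b1, b2⟩ := (hb.frame (Frame.scratch hF fun v h _ _ => by simpa [Cmd.wv] using h.symm)).self
  have hp : bv ^ (j + 1) ≤ Γ.NB := (Nat.pow_le_pow_right h1 hj).trans hN
  have hj' := h j le_rfl
  refine Spec.nwr (by simp [hvj]; omega) (by simp [hvj]; omega) ?_ ?_
  · simp only [NE.ok_mul, NE.ok_rd, NE.ok_var, NE.eval_rd, NE.eval_var, hvj, hj', b2, ← pow_succ]
    exact ⟨⟨trivial, by omega⟩, b1, hp⟩
  · intro i hi
    simp only [NE.eval_mul, NE.eval_add, NE.eval_rd, NE.eval_var, NE.eval_one, hvj, hj', b2,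
      ← pow_succ, St.setN_na, if_true, Function.update_apply]
    split_ifs with hij
    · rw [hij]
    · exact h i (by omega)

/-- The scratch array is an odometer. The flag `vc` is the carry: when digit `j` is treated, it is 1
if and only if `b ^ j ∣ X + 1`. Thus no division is needed. -/
theorem spec_dig {r : Fin 16} (hr : r ≠ nTmp) {b m c : NE} {bv mv cv : ℕ} (hb : Fixed Γ σ b bv)
    (hm : Fixed Γ σ m mv) (hc : Fixed Γ σ c cv) (h1 : 1 ≤ bv) (hB : mv ≤ Γ.B) (hcB : cv ≤ Γ.B)
    (hN : cv * mv ≤ Γ.NB) (hM : mv + 1 ≤ Γ.NB) (hbN : bv ≤ Γ.NB) :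
    Spec Γ (digC r b m c) σ fun τ =>
      ∀ X < cv, ∀ j < mv, τ.na r (X * mv + j) = Table.dig bv X j := by
  refine Spec.then (P := fun τ => ∀ j < mv, τ.na nTmp j = 0) ?_ fun σ₁ hF h0 => ?_
  · refine Spec.fillN mv 0 (fun _ => 0) hm.self.2 hm.self.1 hB ?_ (fun τ _ _ h j hj => by
      simpa using h j hj)
    intro j hj τ _ hvj _ _
    simp [hvj]; omega
  have hw := Frame.scratch hF fun v h _ _ => by simpa [Cmd.wv] using h.symm
  replace hb := hb.frame hw
  replace hm := hm.frame hw
  replace hc := hc.frame hw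
  clear hF hw
  refine Spec.loop cv (fun X τ => (∀ X' < X, ∀ j < mv, τ.na r (X' * mv + j) = Table.dig bv X' j) ∧
    ∀ j < mv, τ.na nTmp j = Table.dig bv X j) hc.self.2 hc.self.1 hcB
    ⟨by simp, fun j hj => by rw [h0 j hj, dig_zero]⟩ (fun j τ a h => h) ?_ (fun τ _ h => h.1)
  rintro X hX τ hF hvx ⟨h2, h3⟩
  have hw := Frame.scratch hF fun v h h' h'' => by
    simp [Cmd.wv, h.symm, h'.symm, h''.symm]
  replace hb := hb.frame hw
  replace hm := hm.frame hw
  clear hF hw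
  refine Spec.then (P := fun τ => (∀ X' < X + 1, ∀ j < mv, τ.na r (X' * mv + j) =
    Table.dig bv X' j) ∧ ∀ j < mv, τ.na nTmp j = Table.dig bv X j) ?_ fun τ₁ hF h => ?_
  · refine Spec.fillN mv (X * mv) (Table.dig bv X) hm.self.2 hm.self.1 hB ?_ ?_
    · intro j hj τ' hF hvj h4 h5
      have hw := Frame.scratch hF fun v h _ _ => by simpa [Cmd.wv] using h.symm
      obtain ⟨m1, m2⟩ := (hm.frame hw).self
      have e1 : τ'.nv vx = X := (hF.nv _ rfl).trans hvx
      have e2 : τ'.na nTmp = τ.na nTmp := hF.na _ (by simpa [Cmd.wn] using hr)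
      have n1 := ix_lt hX hj
      have n2 : X * mv ≤ cv * mv := Nat.mul_le_mul_right _ hX.le
      simp only [NE.ok_add, NE.ok_mul, NE.ok_var, m1, m2, NE.eval_add, NE.eval_mul, NE.eval_var, e1,
        hvj, NE.ok_rd, NE.eval_rd, e2, h3 j hj]
      simp; omega
    · intro τ' hF h4 h5
      have e2 : τ'.na nTmp = τ.na nTmp := hF.na _ (by simpa [Cmd.wn] using hr)
      refine ⟨fun X' hX' j hj => ?_, fun j hj => by rw [e2, h3 j hj]⟩
      rcases Nat.lt_succ_iff_lt_or_eq.mp hX' with h | rfl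
      · rw [h4 _ (.inl (ix_lt h hj)), h2 X' h j hj]
      · exact h5 j hj
  obtain ⟨h4, h5⟩ := h
  have hw := Frame.scratch hF fun v h _ _ => by simpa [Cmd.wv] using h.symm
  replace hb := hb.frame hw
  replace hm := hm.frame hw
  clear hF hw h2 h3
  refine Spec.then (P := fun τ => τ.nv vc = 1) (Spec.set (by simp; omega) (by simp))
    fun τ₂ hF h6 => ?_
  have hw := Frame.scratch hF fun v _ _ h => by simpa [Cmd.wv] using h.symm
  replace hb := hb.frame hw
  replace hm := hm.frame hw
  rw [← hF.na _ rfl] at h5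
  rw [← hF.na _ rfl] at h4
  clear hF hw
  refine Spec.loop mv (fun j τ => (τ.nv vc = 1 ↔ bv ^ j ∣ X + 1) ∧
    (∀ i < mv, τ.na nTmp i = if i < j then Table.dig bv (X + 1) i else Table.dig bv X i))
    hm.self.2 hm.self.1 hB ?_ (fun j τ a h => by simpa using h) ?_ ?_
  · exact ⟨by simp [h6], fun i hi => by simp [h5 i hi]⟩
  · rintro j hj τ₃ hF hvj ⟨h7, h8⟩
    have hw := Frame.scratch hF fun v h h' h'' => by
      simp [Cmd.wv, h.symm, h''.symm]
    obtain ⟨b1, b2⟩ := (hb.frame hw).self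
    have hd := h8 j hj
    rw [if_neg (lt_irrefl _)] at hd
    have hs := dig_succ bv X j
    have hv := dvd_succ_iff bv X j
    have hlt := dig_lt h1 X j
    have upd : ∀ v, v = Table.dig bv (X + 1) j → ∀ i < mv,
        Function.update (τ₃.na nTmp) j v i =
          if i < j + 1 then Table.dig bv (X + 1) i else Table.dig bv X i := by
      rintro v rfl i hi
      rw [Function.update_apply]
      split_ifs with h' h'' h''
      · rw [h']
      · omega
      · rw [h8 i hi, if_pos (by omega)]
      · rw [h8 i hi, if_neg (by omega)]
    refine Spec.ite (by simp; omega) (fun t => ?_) (fun t => ?_)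
    all_goals
      simp only [BE.eval_eq, QE.eval_nat, NE.eval_var, NE.eval_one, Nat.cast_inj] at t
      rw [h7] at t
    · rw [if_pos t] at hs
      refine Spec.ite (by simp [hvj, hd, b1]; omega) (fun t' => ?_) (fun t' => ?_)
      all_goals
        simp only [BE.eval_eq, QE.eval_nat, NE.eval_var, NE.eval_one, NE.eval_add, NE.eval_rd, hvj,
          hd, b2, Nat.cast_inj] at t'
      · rw [if_pos t'] at hs
        refine Spec.nwr (by simp) (by simp [hvj]; omega) (by simp) ?_
        simp only [NE.eval_var, hvj, NE.eval_zero, St.setN_na, St.setN_nv, if_true]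
        exact ⟨by rw [h7, hv]; simp [t, t'], upd _ hs.symm⟩
      · rw [if_neg t'] at hs
        refine Spec.seq (Spec.nwr (by simp) (by simp [hvj]; omega)
          (by simp [hvj, hd]; omega) (Spec.set (by simp) ?_))
        simp only [NE.eval_var, hvj, NE.eval_zero, NE.eval_add, NE.eval_rd, NE.eval_one, St.setN_na,
          St.setV_nv, St.setV_na, if_true, hd]
        exact ⟨by rw [hv]; simp [t'], upd _ hs.symm⟩
    · rw [if_neg t] at hs
      refine Spec.skip ⟨by rw [h7, hv]; simp [t], fun i hi => ?_⟩
      have := upd (τ₃.na nTmp j) (by rw [hd, hs]) i hi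
      rwa [Function.update_eq_self] at this
  · rintro τ₃ hF ⟨-, h8⟩
    refine ⟨fun X' hX' j hj => ?_, fun j hj => by rw [h8 j hj, if_pos hj]⟩
    rw [hF.na r (by simpa [Cmd.wn] using hr.symm)]
    exact h4 X' hX' j hj

/-! #### Labels -/

/-- The labels respect components, and they agree on the adjacent pairs in `P`. -/
structure LabPre (d : Dat) (X : ℕ) (lb : ℕ → ℕ) (P : ℕ → ℕ → Prop) : Prop where
  free : ∀ y < d.n, lb y < d.n ↔ Free d.n d.k (d.D X) y
  conn : ∀ y < d.n, lb y < d.n → Conn d.A d.n d.k (d.D X) y (lb y)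
  eq : ∀ y z, Free d.n d.k (d.D X) y → Free d.n d.k (d.D X) z → d.A y z ≠ 0 → P y z → lb y = lb z

theorem LabPre.ok {X : ℕ} {lb : ℕ → ℕ} {P : ℕ → ℕ → Prop} (h : LabPre d X lb P)
    (hP : ∀ y < d.n, ∀ z < d.n, P y z) : LabOk d X lb := by
  refine ⟨h.free, h.conn, fun y z _ hc => ?_⟩
  induction hc with
  | refl => rfl
  | tail _ hs ih => exact ih.trans (h.eq _ _ hs.1 hs.2.1 hs.2.2 (hP _ hs.1.1 _ hs.2.1.1))

/-- Renaming the class of `y` to the label of `z` keeps equal labels equal, so pairs treated earlier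
stay settled, and the new label is reached through the edge from `y` to `z`. -/
theorem LabPre.merge (hA : ∀ a b, d.A a b = d.A b a) {X : ℕ} {lb lb' : ℕ → ℕ} {P : ℕ → ℕ → Prop}
    (h : LabPre d X lb P) {y z : ℕ} (hy : y < d.n) (hz : z < d.n) (hly : lb y < d.n)
    (hlz : lb z < d.n) (hyz : d.A y z ≠ 0)
    (h' : ∀ t < d.n, lb' t = if lb t = lb y then lb z else lb t) :
    LabPre d X lb' (fun a b => P a b ∨ a = y ∧ b = z) := by
  have hfy := (h.free y hy).mp hly
  have hfz := (h.free z hz).mp hlz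
  refine ⟨fun t ht => ?_, fun t ht hl => ?_, fun a b ha hb hab hP => ?_⟩
  · rw [h' t ht, ← h.free t ht]
    split_ifs with h1
    · rw [h1]; exact ⟨fun _ => hly, fun _ => hlz⟩
    · rfl
  · rw [h' t ht] at hl ⊢
    split_ifs with h1
    · have c1 := h.conn t ht (h1 ▸ hly)
      rw [h1] at c1
      exact (c1.trans ((h.conn y hy hly).symm hA)).trans
        (.trans (.single ⟨hfy, hfz, hyz⟩) (h.conn z hz hlz))
    · rw [if_neg h1] at hl
      exact h.conn t ht hl
  · rw [h' a ha.1, h' b hb.1]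
    rcases hP with hP | ⟨rfl, rfl⟩
    · rw [h.eq a b ha hb hab hP]
    · rw [if_pos rfl]; split_ifs <;> rfl

theorem spec_lab (hl : Lim Γ d) (hE : Env d σ) :
    Spec Γ labC σ fun τ => LabsOk d τ ∧ ∀ X < d.M, ∀ y < d.n, τ.na nGood (X * d.n + y) = 0 := by
  have hA := hl.psd.symm
  have n6 := hl.nbA
  have n8 : d.n + 1 ≤ Γ.NB := by nlinarith
  refine Spec.loop d.M (fun j τ => ∀ X < j, LabOk d X (lab d τ X) ∧
    ∀ y < d.n, τ.na nGood (X * d.n + y) = 0) hE.M (by simp) hl.bM (by simp) (fun j τ a h => h) ?_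
    (fun τ _ h => ⟨fun X hX => (h X hX).1, fun X hX => (h X hX).2⟩)
  intro X hX τ hF hvX h0
  replace hE := hE.frame hF rfl
  clear hF
  refine Spec.then (P := fun τ => ∀ y < d.n, τ.na nTmp y = y) ?_ fun τ₁ hF h1 => ?_
  · refine Spec.fillN d.n 0 id hE.n (by simp) hl.bn ?_ (fun τ _ _ h j hj => by
      simpa using h j hj)
    intro j hj τ _ hvj _ _
    simp [hvj]; omega
  have e1 := hF.na nLab rfl
  have e2 := hF.na nGood rfl
  replace hE := hE.frame hF rfl
  rw [← hF.nv _ rfl] at hvX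
  clear hF
  open Classical in
  refine Spec.then (P := fun τ => ∀ y < d.n, τ.na nTmp y =
    if ∃ j < d.k, d.D X j = y then d.n else y) ?_ fun τ₂ hF h2 => ?_
  · refine Spec.loop d.k (fun j τ => ∀ y < d.n, τ.na nTmp y =
      if ∃ i < j, d.D X i = y then d.n else y) hE.k (by simp) hl.bk (by simpa using h1)
      (fun j τ a h => h) ?_ (fun τ _ h => h)
    intro j hj τ hF hvj h
    replace hE := hE.frame hF rfl
    rw [← hF.nv _ rfl] at hvX
    have hdig : _ = d.D X j := hE.dig X hX j hj
    have n1 := ix_lt hX hj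
    have n2 := hl.nbK
    have n3 := dig_le d X j
    -- Occupied vertices receive the label `n`. An empty slot has the digit `n` and writes to cell
    -- `n`, which belongs to no vertex.
    refine Spec.nwr (by simp [hvX, hE.k, hvj]; omega) (by simp [hvX, hE.k, hvj, hdig]; omega)
      (by simp) ?_
    intro y hy
    simp only [NE.eval_rd, NE.eval_add, NE.eval_mul, NE.eval_var, hvX, hE.k, hvj, hdig, hE.n,
      St.setN_na, if_true, Function.update_apply, h y hy]
    by_cases hjy : y = d.D X j
    · rw [if_pos hjy, if_pos ⟨j, by omega, hjy.symm⟩]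
    · rw [if_neg hjy]
      refine if_congr ?_ rfl rfl
      constructor
      · rintro ⟨i, hi, h⟩; exact ⟨i, by omega, h⟩
      · rintro ⟨i, hi, hh⟩
        rcases Nat.lt_succ_iff_lt_or_eq.mp hi with h' | h'
        exacts [⟨i, h', hh⟩, absurd (h' ▸ hh.symm) hjy]
  rw [← hF.na _ rfl] at e1 e2
  replace hE := hE.frame hF rfl
  rw [← hF.nv _ rfl] at hvX
  clear hF h1
  have hpre : LabPre d X (τ₂.na nTmp) (fun _ _ => False) := by
    refine ⟨fun y hy => ?_, fun y hy hlt => ?_, fun _ _ _ _ _ h => h.elim⟩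
    · rw [h2 y hy, Free]
      split_ifs with h
      · obtain ⟨j, hj, h⟩ := h
        exact ⟨fun h' => absurd h' (lt_irrefl _), fun h' => absurd h (h'.2 j hj)⟩
      · push Not at h
        exact ⟨fun h' => ⟨hy, h⟩, fun _ => hy⟩
    · rw [h2 y hy] at hlt ⊢
      split_ifs at hlt ⊢
      · exact absurd hlt (lt_irrefl _)
      · exact .refl
  clear h2
  refine Spec.then (P := fun τ => LabOk d X (τ.na nTmp)) ?_ fun τ₃ hF h3 => ?_
  · refine Spec.loop d.n (fun j τ => LabPre d X (τ.na nTmp) fun a _ => a < j) hE.n (by simp) hl.bn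
      ⟨hpre.free, hpre.conn, fun _ _ _ _ _ h => absurd h (Nat.not_lt_zero _)⟩
      (fun j τ a h => h) ?_ (fun τ _ h => h.ok fun y hy _ _ => hy)
    intro y hy τ hF hvy h3
    replace hE := hE.frame hF rfl
    clear hF hpre
    refine Spec.loop d.n (fun j τ => LabPre d X (τ.na nTmp) fun a b => a < y ∨ a = y ∧ b < j) hE.n
      (by simp) hl.bn ⟨h3.free, h3.conn, fun a b ha hb hab h => h3.eq a b ha hb hab (by omega)⟩
      (fun j τ a h => h) ?_
      (fun τ _ h => ⟨h.free, h.conn, fun a b ha hb hab h' => h.eq a b ha hb hab (by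
        have := hb.1; omega)⟩)
    intro z hz τ hF hvz h4
    replace hE := hE.frame hF rfl
    rw [← hF.nv _ rfl] at hvy
    clear hF h3
    have hAyz := hE.A y hy.le z hz.le
    have n1 := ix_lt (show y < d.n + 1 by omega) (show z < d.n + 1 by omega)
    -- In the branches that change nothing, the pair `(y, z)` is settled because it is not an edge
    -- between unoccupied vertices.
    have hsk : (τ.na nTmp y < d.n → τ.na nTmp z < d.n → d.A y z ≠ 0 → τ.na nTmp y = τ.na nTmp z) →
        LabPre d X (τ.na nTmp) fun a b => a < y ∨ a = y ∧ b < z + 1 := fun h =>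
      ⟨h4.free, h4.conn, fun a b ha hb hab h' => by
        by_cases hc : a = y ∧ b = z
        · obtain ⟨rfl, rfl⟩ := hc
          exact h ((h4.free _ ha.1).mpr ha) ((h4.free _ hb.1).mpr hb) hab
        · exact h4.eq a b ha hb hab (by omega)⟩
    refine Spec.ite (by simp [hvy]; omega) (fun t => ?_) (fun t => ?_)
    all_goals
      simp only [BE.eval_lt, QE.eval_nat, NE.eval_var, NE.eval_rd, hvy, hE.n, Nat.cast_lt] at t
    on_goal 2 => exact Spec.skip (hsk fun h => absurd h t)
    refine Spec.ite (by simp [hvz]; omega) (fun t' => ?_) (fun t' => ?_)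
    all_goals
      simp only [BE.eval_lt, QE.eval_nat, NE.eval_var, NE.eval_rd, hvz, hE.n, Nat.cast_lt] at t'
    on_goal 2 => exact Spec.skip (hsk fun _ h => absurd h t')
    refine Spec.ite (by simp [hvy, hvz, hE.n]; omega) (fun t'' => ?_) (fun t'' => ?_)
    all_goals
      simp only [BE.eval_eq, QE.eval_rd, NE.eval_var, NE.eval_add, NE.eval_mul, NE.eval_one, hvz,
        hvy, hE.n, hAyz, QE.eval_zero] at t''
    · exact Spec.skip (hsk fun _ _ h => absurd t'' h)
    obtain ⟨lb, hlb⟩ : ∃ lb, τ.na nTmp = lb := ⟨_, rfl⟩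
    rw [hlb] at t t' h4
    -- Both labels are saved before the relabelling, which overwrites the label of `y` itself.
    refine Spec.then (P := fun τ => τ.nv vl = lb y) (Spec.set (by simp [hvy]; omega)
      (by simp [hvy, hlb])) fun τ₄ hF h5 => ?_
    replace hE := hE.frame hF rfl
    rw [← hF.nv _ rfl] at hvz
    rw [← hF.na _ rfl] at hlb
    clear hF
    refine Spec.then (P := fun τ => τ.nv vr = lb z) (Spec.set (by simp [hvz]; omega)
      (by simp [hvz, hlb])) fun τ₅ hF h6 => ?_
    replace hE := hE.frame hF rfl
    rw [← hF.nv _ rfl] at h5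
    rw [← hF.na _ rfl] at hlb
    clear hF
    refine Spec.loop d.n (fun j τ => ∀ t < d.n, τ.na nTmp t =
      if t < j ∧ lb t = lb y then lb z else lb t) hE.n (by simp) hl.bn (by simp [hlb])
      (fun j τ a h => h) ?_ ?_
    · intro j hj τ hF hvt h7
      rw [← hF.nv _ rfl] at h5 h6
      have hj' := h7 j hj
      simp only [lt_irrefl, false_and, if_false] at hj'
      refine Spec.ite (by simp [hvt]; omega) (fun c => ?_) (fun c => ?_)
      all_goals
        simp only [BE.eval_eq, QE.eval_nat, NE.eval_var, NE.eval_rd, hvt, hj', h5, Nat.cast_inj] at c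
      · refine Spec.nwr (by simp) (by simp [hvt]; omega) (by simp) ?_
        intro t ht
        simp only [NE.eval_var, hvt, h6, St.setN_na, if_true, Function.update_apply]
        split_ifs with a b b
        · rfl
        · subst a; exact absurd ⟨by omega, c⟩ b
        · rw [h7 t ht, if_pos ⟨by omega, b.2⟩]
        · rw [h7 t ht, if_neg (fun h => b ⟨by omega, h.2⟩)]
      · refine Spec.skip fun t ht => ?_
        rw [h7 t ht]
        refine if_congr ⟨fun h => ⟨by omega, h.2⟩, fun h => ⟨?_, h.2⟩⟩ rfl rfl
        rcases Nat.lt_succ_iff_lt_or_eq.mp h.1 with h' | rfl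
        exacts [h', absurd h.2 c]
    · intro τ _ h7
      have hm := h4.merge hA hy hz t t' t'' (lb' := τ.na nTmp) fun t ht => by
        rw [h7 t ht]; simp [ht]
      exact ⟨hm.free, hm.conn, fun a b ha hb hab h => hm.eq a b ha hb hab (by omega)⟩
  rw [← hF.na _ rfl] at e1 e2
  replace hE := hE.frame hF rfl
  rw [← hF.nv _ rfl] at hvX
  clear hF hpre
  have hix : ∀ j < d.n, X * d.n ≤ Γ.NB ∧ X * d.n + j ≤ Γ.NB := fun j hj => by
    have := hl.lab_ix hX hj; omega
  have hlt : ∀ X' < X, ∀ y < d.n, X' * d.n + y < X * d.n := fun X' h y hy => ix_lt h hy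
  refine Spec.then (P := fun τ => ∀ X' < X + 1, LabOk d X' (lab d τ X')) ?_ fun τ₄ hF h4 => ?_
  · refine Spec.fillN d.n (X * d.n) (τ₃.na nTmp) hE.n (by simp) hl.bn ?_ ?_
    · intro j hj τ hF hvt _ _
      replace hE := hE.frame hF rfl
      rw [← hF.nv _ rfl] at hvX
      have e3 := hF.na nTmp rfl
      have := hix j hj
      simp [hvX, hE.n, hvt, e3]; omega
    · intro τ hF h5 h6 X' hX'
      have hcong : ∀ lb : ℕ → ℕ, LabOk d X' lb → (∀ y < d.n, lab d τ X' y = lb y) →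
          LabOk d X' (lab d τ X') := fun lb h hlb =>
        ⟨fun y hy => by rw [hlb y hy]; exact h.free y hy, fun y hy h' => by
          rw [hlb y hy] at h' ⊢; exact h.conn y hy h', fun y z hy hc => by
          rw [hlb y hy.1, hlb z (hc.free hy).1]; exact h.eq y z hy hc⟩
      rcases Nat.lt_succ_iff_lt_or_eq.mp hX' with h | rfl
      · refine hcong _ (h0 X' h).1 fun y hy => ?_
        rw [lab, h5 _ (.inl (hlt X' h y hy)), e1]
      · exact hcong _ h3 h6
  rw [← hF.na _ rfl] at e2
  replace hE := hE.frame hF rfl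
  rw [← hF.nv _ rfl] at hvX
  clear hF
  refine Spec.fillN d.n (X * d.n) (fun _ => 0) hE.n (by simp) hl.bn ?_ ?_
  · intro j hj τ hF hvt _ _
    replace hE := hE.frame hF rfl
    rw [← hF.nv _ rfl] at hvX
    have := hix j hj
    simp [hvX, hE.n, hvt]; omega
  · intro τ hF h5 h6 X' hX'
    refine ⟨?_, fun y hy => ?_⟩
    · have := h4 X' hX'
      unfold lab at this ⊢
      rwa [hF.na _ rfl]
    · rcases Nat.lt_succ_iff_lt_or_eq.mp hX' with h | rfl
      · rw [h5 _ (.inl (hlt X' h y hy)), e2]; exact (h0 X' h).2 y hy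
      · exact h6 y hy

end Algo

namespace Algo

open Imp Cmd Table Grassmann Elimination

variable {Γ : Par} {d : Dat} {σ : St}

/-! #### The sum -/

theorem fixed_var {v m : ℕ} (h : σ.nv v = m) (h1 : v ≠ vj) (h2 : v ≠ vx) (h3 : v ≠ vc) :
    Fixed Γ σ ♯v m := fun _ hτ => ⟨trivial, (hτ v h1 h2 h3).trans h⟩

theorem spec_setup (hl : Lim Γ d) (hB : Base d σ) (hk : σ.nv vk = d.k) :
    Spec Γ setupC σ fun τ => Env d τ ∧ LabsOk d τ ∧
      ∀ X < d.M, ∀ y < d.n, τ.na nGood (X * d.n + y) = 0 := by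
  have n1 := hl.nbp
  have n2 := hl.nbl
  have n3 := hl.nbN
  have n4 : d.n + 1 ≤ Γ.NB := by nlinarith [hl.nbA]
  have n5 : d.M ≤ Γ.NB := by nlinarith [hl.nbM]
  have hk0 := Nat.pos_of_ne_zero hl.hk
  have hp0 := Nat.pos_of_ne_zero hl.hp
  have hL : d.L = 2 * (d.p * d.k) := rfl
  have hpk : d.k ≤ d.p * d.k := Nat.le_mul_of_pos_left _ hp0
  have h2 : ∀ {σ}, Fixed Γ σ 2 2 := fun _ _ => ⟨by simp; omega, rfl⟩
  have hn1 : ∀ {σ}, Base d σ → Fixed Γ σ (♯vn + 1) (d.n + 1) := fun h _ hτ => by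
    simp [hτ vn (by decide) (by decide) (by decide), h.n]; omega
  refine Spec.then (P := fun τ => τ.nv vL = d.L) (Spec.set (by simp [hB.p, hk]; omega)
    (by simp [hB.p, hk, hL])) fun σ₁ hF h1 => ?_
  replace hB := hB.frame hF rfl
  rw [← hF.nv _ rfl] at hk
  clear hF
  refine (spec_pow h2 (fixed_var h1 (by decide) (by decide) (by decide)) (by omega) hl.bL
    (show d.N ≤ Γ.NB by omega) (by omega)).then fun σ₂ hF p2 => ?_
  replace hB := hB.frame hF rfl
  rw [← hF.nv _ rfl] at hk h1
  clear hF
  refine Spec.then (P := fun τ => τ.nv vN = d.N) (Spec.set (by simp [h1]; omega)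
    (by simp [h1, p2 d.L le_rfl, Dat.N])) fun σ₃ hF h3 => ?_
  replace hB := hB.frame hF rfl
  rw [← hF.nv _ rfl] at hk h1
  rw [← hF.na _ rfl] at p2
  clear hF
  refine (spec_pow (hn1 hB) (fixed_var hk (by decide) (by decide) (by decide)) (by omega) hl.bk
    (show d.M ≤ Γ.NB by omega) (by omega)).then fun σ₄ hF pn => ?_
  replace hB := hB.frame hF rfl
  rw [← hF.nv _ rfl] at hk h1 h3
  rw [← hF.na _ rfl] at p2
  clear hF
  refine Spec.then (P := fun τ => τ.nv vM = d.M) (Spec.set (by simp [hk]; omega)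
    (by simp [hk, pn d.k le_rfl, Dat.M])) fun σ₅ hF h4 => ?_
  replace hB := hB.frame hF rfl
  rw [← hF.nv _ rfl] at hk h1 h3
  rw [← hF.na _ rfl] at p2 pn
  clear hF
  refine (spec_dig (by decide) (hn1 hB) (fixed_var hk (by decide) (by decide) (by decide))
    (fixed_var h4 (by decide) (by decide) (by decide)) (by omega) hl.bk hl.bM hl.nbK
    (by omega) n4).then fun σ₆ hF hd => ?_
  replace hB := hB.frame hF rfl
  rw [← hF.nv _ rfl] at hk h1 h3 h4
  rw [← hF.na _ rfl] at p2 pn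
  clear hF
  refine (spec_dig (by decide) h2 (fixed_var h1 (by decide) (by decide) (by decide))
    (fixed_var h3 (by decide) (by decide) (by decide)) (by omega) hl.bL
    (by have := hl.bN; omega) hl.nbL (by omega) (by omega)).then fun σ₇ hF hb => ?_
  replace hB := hB.frame hF rfl
  rw [← hF.nv _ rfl] at hk h1 h3 h4
  rw [← hF.na _ rfl] at p2 pn hd
  have hE : Env d σ₇ := ⟨hB, hk, h1, h3, h4, p2, pn, hd, hb⟩
  exact (spec_lab hl hE).mono fun τ hF h => ⟨hE.frame hF rfl, h⟩

theorem LabsOk.congr {τ : St} (h : LabsOk d σ) (h1 : τ.na nLab = σ.na nLab) : LabsOk d τ := by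
  unfold LabsOk lab at h ⊢
  rwa [h1]

theorem Sound.congr {τ : St} (h : Sound d σ) (h1 : τ.na nGood = σ.na nGood)
    (h2 : τ.qa qT = σ.qa qT) : Sound d τ := by
  unfold Sound TabOk at h ⊢
  rwa [h1, h2]

theorem Solved.congr {τ : St} {r : ℕ} (h : Solved d σ r) (h1 : τ.na nGood = σ.na nGood)
    (h2 : τ.na nLab = σ.na nLab) : Solved d τ r := by
  unfold Solved lab at h ⊢
  rwa [h1, h2]

/-- The last position, in which all slots are empty. -/
abbrev Dat.top (d : Dat) : ℕ := d.M - 1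

theorem Dat.D_top {j : ℕ} (hj : j < d.k) : d.D d.top j = d.n := dig_pred_pow (Nat.succ_pos _) hj

/-- At the last position all slots are empty, and the components are those of the whole graph. The
constant coefficient is multiplicative, so one entry of each table suffices. -/
theorem spec_prod (hl : Lim Γ d) (hE : Env d σ) (hvX : σ.nv vX = d.top) (hXM : d.top < d.M)
    (hL : LabsOk d σ) (hS : ∀ y < d.n, lab d σ d.top y = y → TabOk d σ d.top y)
    (hZ : σ.qa qZ 0 = 1) :
    Spec Γ (loop vy ♯vn (ite (ℓ nLab (♯vX * ♯vn + ♯vy) =ₙ ♯vy)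
        (qwr qZ 0 (ρ qZ 0 * ρ qT ((♯vX * ♯vn + ♯vy) * ♯vN))) skip)) σ fun τ =>
      τ.qa qZ 0 = powSum d.A d.n d.p d.al d.be (Finset.range d.n) := by
  have hA := hl.psd.symm
  have hlab := hL _ hXM
  have hfree : ∀ y < d.n, Free d.n d.k (d.D d.top) y := fun y hy =>
    ⟨hy, fun j hj => by rw [d.D_top hj]; omega⟩
  let P : ℕ → Finset ℕ := fun j => (Finset.range d.n).filter fun z => lab d σ d.top z < j
  have hPc : ∀ j, (P j).card ≤ d.n := fun j =>
    (Finset.card_filter_le _ _).trans (Finset.card_range _).le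
  refine Spec.loop d.n (fun j τ => ∃ W, Rep d.A d.n d.k d.p d.al d.be (d.D d.top) (P j) W ∧
    τ.qa qZ 0 = W ∅ ∧ Bd d.Q d.U (d.η * (P j).card) (W ∅)) hE.n (by simp) hl.bn ?_
    (fun j τ a h => h) ?_ ?_
  · have : P 0 = ∅ := Finset.filter_false_of_mem (by simp)
    rw [this]
    have h1 : (1 : Gr) ∅ = 1 := (rep_empty (A := d.A) (n := d.n) (k := 0) (p := 0) (α := d.al)
      (β := d.be) id).apply_empty.trans (by simp [powSum, wt])
    exact ⟨1, rep_empty _, by rw [hZ, h1], by rw [h1]; exact ⟨⟨1, by simp⟩, by simp⟩⟩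
  · rintro j hj τ hF hvj ⟨W, h1, h2, h3⟩
    replace hE := hE.frame hF rfl
    have e1 := hF.na nLab rfl
    have e2 := hF.qa qT rfl
    rw [← hF.nv _ rfl] at hvX
    have n1 := hl.lab_ix hXM hj
    refine Spec.ite (by simp [hvX, hE.n, hvj]; omega) (fun t => ?_) (fun t => ?_)
    all_goals
      simp only [BE.eval_eq, QE.eval_nat, NE.eval_var, NE.eval_rd, NE.eval_add, NE.eval_mul, hvX,
        hE.n, hvj, Nat.cast_inj, e1] at t
    · obtain ⟨V, h4, h5, h6⟩ := hS j hj t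
      have hmem := fun z => hlab.mem (z := z) hA hj t
      have hd : Disjoint (P j) (d.cmp d.top j) := Finset.disjoint_left.mpr fun z hz hz' => by
        have := (Finset.mem_filter.mp hz).2
        have := ((hmem z).mp hz').2
        omega
      have hP : P (j + 1) = P j ∪ d.cmp d.top j := by
        ext z
        simp only [P, Finset.mem_union, Finset.mem_filter, Finset.mem_range, hmem z,
          Nat.lt_succ_iff_lt_or_eq]
        tauto
      have h0 : ∀ s ∈ P j, ∀ t ∈ d.cmp d.top j, d.A s t = 0 := fun s hs z hz => by
        by_contra hne
        have hs' := Finset.mem_filter.mp hs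
        have hz' := (hmem z).mp hz
        have hs1 := Finset.mem_range.mp hs'.1
        have := hlab.eq s z (hfree s hs1) (.single ⟨hfree s hs1, hfree z hz'.1, hne⟩)
        omega
      have hV : σ.qa qT ((d.top * d.n + j) * d.N) = V ∅ := by
        have := h5.val ∅ (Finset.empty_subset _)
        simpa [bin] using this
      have hbV : Bd d.Q d.U (d.η * (d.cmp d.top j).card) (V ∅) := by
        have := h6.bd (x := 0) (Nat.two_pow_pos _)
        rwa [Nat.add_zero, hV] at this
      have hb := h3.mul hbV
      rw [← mul_add, ← Finset.card_union_of_disjoint hd, ← hP] at hb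
      have hix : (d.top * d.n + j) * d.N ≤ Γ.NB := by
        have a1 := ix_lt hXM hj
        have a2 := Nat.mul_le_mul_right d.N a1.le
        have := hl.nbT
        omega
      have hv : Γ.V (W ∅ * V ∅) := by
        refine hl.V _ (hb.mono hl.hU (le_trans (Nat.mul_le_mul_left _ (hPc _)) ?_))
        have := hl.hE
        omega
      refine Spec.qwr (by simp) (by simp) (by simp) ?_ ?_
      · simp [hvX, hE.n, hvj, hE.N, h2, e2, hV, hv]; omega
      · refine ⟨W * V, hP ▸ h1.union hA h4 hd h0, ?_, by rwa [mul_apply_empty]⟩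
        simp [hvX, hE.n, hvj, hE.N, h2, e2, hV, mul_apply_empty]
    · have hP : P (j + 1) = P j := by
        ext z
        simp only [P, Finset.mem_filter, Finset.mem_range, Nat.lt_succ_iff_lt_or_eq]
        refine and_congr_right fun hz => or_iff_left fun h => t ?_
        have := hlab.lab_lab hz (by omega)
        rwa [h] at this
      exact Spec.skip ⟨W, hP ▸ h1, h2, hP ▸ h3⟩
  · rintro τ - ⟨W, h1, h2, -⟩
    have hP : P d.n = Finset.range d.n := Finset.filter_true_of_mem fun z hz =>
      (hlab.free z (Finset.mem_range.mp hz)).mpr (hfree z (Finset.mem_range.mp hz))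
    rw [h2, h1.apply_empty, hP]

/-- Either nothing has been found, or the sum has been computed. -/
def Found (d : Dat) (τ : St) : Prop :=
  τ.nv vd = 0 ∨ τ.nv vd = 1 ∧ τ.qa qZ 0 = powSum d.A d.n d.p d.al d.be (Finset.range d.n)

theorem spec_fin (hl : Lim Γ d) (hE : Env d σ) (hL : LabsOk d σ) (hS : Sound d σ)
    (hr : Solved d σ d.n) (hd : σ.nv vd = 0) :
    Spec Γ finC σ fun τ => Found d τ ∧
      ((∀ y < d.n, Win d.A d.n d.k d.n (d.D d.top) y) → τ.nv vd = 1) := by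
  have hM : 0 < d.M := Nat.pow_pos (Nat.succ_pos _)
  have hXM : d.top < d.M := Nat.sub_lt hM one_pos
  have n1 := hl.nbp
  have n2 : d.M ≤ Γ.NB := by nlinarith [hl.nbM]
  refine Spec.then (P := fun τ => τ.nv vX = d.top) (Spec.set (by simp [hE.M]; omega)
    (by simp [hE.M])) fun σ₁ hF hvX => ?_
  replace hE := hE.frame hF rfl
  rw [← hF.nv _ rfl] at hd
  replace hL := hL.congr (hF.na _ rfl)
  replace hS := hS.congr (hF.na _ rfl) (hF.qa _ rfl)
  replace hr := hr.congr (hF.na _ rfl) (hF.na _ rfl)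
  clear hF
  refine Spec.then (P := fun τ => τ.nv vo = 1) (Spec.set (by simp; omega) (by simp))
    fun σ₂ hF h1 => ?_
  replace hE := hE.frame hF rfl
  rw [← hF.nv _ rfl] at hd hvX
  replace hL := hL.congr (hF.na _ rfl)
  replace hS := hS.congr (hF.na _ rfl) (hF.qa _ rfl)
  replace hr := hr.congr (hF.na _ rfl) (hF.na _ rfl)
  clear hF
  let C : ℕ → Prop := fun j => ∀ y < j, lab d σ₂ d.top y = y → σ₂.na nGood (d.top * d.n + y) = 1
  refine Spec.then (P := fun τ => τ.nv vo = 1 ↔ C d.n) ?_ fun σ₃ hF h2 => ?_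
  · refine Spec.loop d.n (fun j τ => τ.nv vo = 1 ↔ C j) hE.n (by simp) hl.bn (by simp [C, h1])
      (fun j τ a h => by simpa using h) ?_ (fun τ _ h => h)
    intro j hj τ hF hvj h2
    replace hE := hE.frame hF rfl
    have e1 := hF.na nLab rfl
    have e2 := hF.na nGood rfl
    rw [← hF.nv _ rfl] at hvX
    have n3 := hl.lab_ix hXM hj
    have hC : C (j + 1) ↔ C j ∧ (lab d σ₂ d.top j = j → σ₂.na nGood (d.top * d.n + j) = 1) := by
      simp only [C, Nat.lt_succ_iff_lt_or_eq, or_imp, forall_and, forall_eq]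
    rw [hC, ← h2]
    refine Spec.ite (by simp [hvX, hE.n, hvj]; omega) (fun t => ?_) (fun t => ?_)
    all_goals
      simp only [BE.eval_eq, QE.eval_nat, NE.eval_var, NE.eval_rd, NE.eval_add, NE.eval_mul, hvX,
        hE.n, hvj, Nat.cast_inj, e1] at t
    · refine Spec.ite (by simp [hvX, hE.n, hvj]; omega) (fun t' => ?_) (fun t' => ?_)
      all_goals
        simp only [BE.eval_eq, QE.eval_nat, NE.eval_var, NE.eval_rd, NE.eval_add, NE.eval_mul, hvX,
          hE.n, hvj, Nat.cast_inj, e2, NE.eval_one] at t'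
      · exact Spec.skip (by simp [t'])
      · exact Spec.set (by simp) (by simp [t, t'])
    · exact Spec.skip (by simp [t])
  replace hE := hE.frame hF rfl
  rw [← hF.nv _ rfl] at hd hvX
  have e1 := hF.na nLab rfl
  have e2 := hF.qa qT rfl
  clear hF h1
  have hC : (∀ y < d.n, Win d.A d.n d.k d.n (d.D d.top) y) → C d.n := fun h y hy hly =>
    hr _ hXM y hy hly (h y hy)
  refine Spec.ite (by simp; omega) (fun t => ?_) (fun t => ?_)
  all_goals
    simp only [BE.eval_eq, QE.eval_nat, NE.eval_var, NE.eval_one, Nat.cast_inj] at t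
    rw [h2] at t
  · refine Spec.then (P := fun τ => τ.nv vd = 1) (Spec.set (by simp; omega) (by simp))
      fun σ₄ hF h3 => ?_
    replace hE := hE.frame hF rfl
    rw [← hF.nv _ rfl] at hvX
    rw [← hF.na _ rfl] at e1
    rw [← hF.qa _ rfl] at e2
    refine Spec.then (P := fun τ => τ.qa qZ 0 = 1) (Spec.qwr (by simp) (by simp)
      (by simp) (by simp; omega) (by simp)) fun σ₅ hF h4 => ?_
    replace hE := hE.frame hF rfl
    rw [← hF.nv _ rfl] at hvX h3
    rw [← hF.na _ rfl] at e1
    rw [← hF.qa _ rfl] at e2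
    refine (spec_prod hl hE hvX hXM (hL.congr e1) (fun y hy hly => ?_)
      h4).mono fun τ hF h5 => ?_
    · rw [lab, e1] at hly
      have := hS _ hXM y hy (t y hy hly)
      unfold TabOk at this ⊢
      rwa [e2]
    · rw [← hF.nv _ rfl] at h3
      exact ⟨.inr ⟨h3, h5⟩, fun _ => h3⟩
  · exact Spec.skip ⟨.inl hd, fun h => absurd (hC h) t⟩

/-- A win is certain with `w + 1` slots, and after a success the remaining iterations do nothing.
Hence the resource bounds are needed only for at most `w + 1` slots, although the program does not
know `w`. -/
theorem spec_sum {w : ℕ} (hw : w ≤ d.n) (hl : ∀ k ≠ 0, k ≤ w + 1 → Lim Γ { d with k := k })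
    (hwin : ∀ X : ℕ → ℕ, (∀ j ≤ w, X j = d.n) → ∀ y < d.n, Win d.A d.n (w + 1) d.n X y)
    (hB : Base d σ) (hn : d.n + 1 ≤ Γ.B) :
    Spec Γ sumC σ fun τ => τ.qa qZ 0 = powSum d.A d.n d.p d.al d.be (Finset.range d.n) := by
  have n1 : d.n + 1 ≤ Γ.NB := by
    have : (d.n + 1) * (d.n + 1) ≤ Γ.NB := (hl 1 one_ne_zero (by omega)).nbA
    nlinarith
  refine Spec.then (P := fun τ => τ.nv vd = 0) (Spec.set (by simp) (by simp)) fun σ₁ hF h1 => ?_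
  replace hB := hB.frame hF rfl
  clear hF
  refine Spec.loop (d.n + 1) (fun j τ => Found d τ ∧ (w + 1 ≤ j → τ.nv vd = 1)) (by simp [hB.n])
    (by simp [hB.n]; omega) hn ⟨.inl h1, fun h => by omega⟩
    (fun j τ a h => by simpa [Found] using h) ?_ ?_
  · rintro j hj τ hF hvj ⟨h2, h3⟩
    replace hB := hB.frame hF rfl
    clear hF h1
    refine Spec.ite (by simp) (fun t => ?_) (fun t => ?_)
    all_goals
      simp only [BE.eval_eq, QE.eval_nat, NE.eval_var, NE.eval_zero, Nat.cast_inj] at t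
    · have hjw : j + 1 ≤ w + 1 := by
        by_contra h
        have := h3 (by omega)
        omega
      have hl' := hl (j + 1) (by omega) hjw
      obtain ⟨d', hd'⟩ : ∃ d' : Dat, d' = { d with k := j + 1 } := ⟨_, rfl⟩
      rw [← hd'] at hl'
      have hB' : Base d' τ := hd' ▸ ⟨hB.n, hB.p, hB.A, hB.al, hB.be⟩
      refine Spec.then (P := fun τ => τ.nv vk = d'.k) (Spec.set (by simp [hvj]; omega)
        (by simp [hvj, hd'])) fun σ₂ hF hk => ?_
      replace hB' := hB'.frame hF rfl
      rw [← hF.nv _ rfl] at t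
      clear hF
      refine (spec_setup hl' hB' hk).then fun σ₃ hF h => ?_
      obtain ⟨hE, hL, h0⟩ := h
      rw [← hF.nv _ rfl] at t
      clear hF
      refine (spec_good hl' hE hL h0).then fun σ₄ hF h => ?_
      obtain ⟨hS, hr⟩ := h
      rw [← hF.nv _ rfl] at t
      replace hL := hL.congr (hF.na _ rfl)
      replace hE := hE.frame hF rfl
      refine (spec_fin hl' hE hL hS hr t).mono fun τ' _ h => ⟨?_, fun hjw' => h.2 ?_⟩
      · have := h.1
        rwa [hd'] at this
      · have hjw : j = w := by omega
        subst hjw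
        intro y hy
        rw [hd'] at hy ⊢
        exact hwin _ (fun i hi => Dat.D_top (d := { d with k := j + 1 }) (by simp; omega)) y hy
    · have h2' := h2
      rcases h2 with h | h
      · exact absurd h t
      · exact Spec.skip ⟨h2', fun _ => h.1⟩
  · rintro τ - ⟨h2, h3⟩
    have := h3 (by omega)
    rcases h2 with h | h
    · omega
    · exact h.2

end Algo

namespace Elimination

open Finset

variable {A : ℕ → ℕ → ℚ} {n p : ℕ} {α β : ℕ → ℚ} {D : Finset ℕ} {j : ℕ}

/-! ### Rounding by conditional sums -/

/-- Setting `β j = 0` removes the sets that contain `j`, setting `α j = 0` those that do not. -/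
theorem powSum_split (hj : j ∈ D) : powSum A n p α β D =
    powSum A n p α (Function.update β j 0) D + powSum A n p (Function.update α j 0) β D := by
  unfold powSum
  rw [← sum_add_distrib]
  refine sum_congr rfl fun S _ => ?_
  rw [← add_mul]
  congr 1
  unfold wt
  by_cases h : j ∈ S
  · rw [prod_eq_zero (f := fun v => if v ∈ S then Function.update β j 0 v else α v) hj (by simp [h]),
      zero_add]
    refine prod_congr rfl fun v _ => ?_
    split_ifs with hv
    · rfl
    · rw [Function.update_of_ne (by rintro rfl; exact hv h)]
  · rw [prod_eq_zero (f := fun v => if v ∈ S then β v else Function.update α j 0 v) hj (by simp [h]),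
      add_zero]
    refine prod_congr rfl fun v _ => ?_
    split_ifs with hv
    · rw [Function.update_of_ne (by rintro rfl; exact h hv)]
    · rfl

/-- The weights select one choice for every index below `j`, and the selection is good. -/
structure Rounded (A : ℕ → ℕ → ℚ) (n p : ℕ) (α β : ℕ → ℚ) (j : ℕ) : Prop where
  al01 : ∀ v, α v = 0 ∨ α v = 1
  be01 : ∀ v, β v = 0 ∨ β v = 1
  fix : ∀ v < j, α v + β v = 1
  rest : ∀ v, j ≤ v → v < n → α v = 1 ∧ β v = 1
  le : ∀ T ⊆ range n, dt A n T ^ p ≤ 2 ^ j * powSum A n p α β (range n)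

/-- With all weights 1 the sum runs over all sets, and a sum of nonnegative terms dominates each of
them. -/
theorem rounded_zero (h0 : ∀ T, 0 ≤ dt A n T) (al01 : ∀ v, α v = 0 ∨ α v = 1)
    (be01 : ∀ v, β v = 0 ∨ β v = 1) (h1 : ∀ v < n, α v = 1 ∧ β v = 1) : Rounded A n p α β 0 := by
  refine ⟨al01, be01, by simp, fun v _ hv => h1 v hv, fun T hT => ?_⟩
  have hw : ∀ S ∈ (range n).powerset, wt α β (range n) S * dt A n S ^ p = dt A n S ^ p := fun S _ => by
    rw [wt, prod_eq_one, one_mul]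
    intro v hv
    obtain ⟨h1, h2⟩ := h1 v (mem_range.mp hv)
    rw [h1, h2, ite_self]
  rw [pow_zero, one_mul, powSum, sum_congr rfl hw]
  exact single_le_sum (f := fun S => dt A n S ^ p) (fun S _ => pow_nonneg (h0 S) p)
    (mem_powerset.mpr hT)

theorem Rounded.update {c : ℚ} (hc : c = 0 ∨ c = 1) {f : ℕ → ℚ} (hf : ∀ v, f v = 0 ∨ f v = 1)
    (v : ℕ) : Function.update f j c v = 0 ∨ Function.update f j c v = 1 := by
  rw [Function.update_apply]; split_ifs; exacts [hc, hf v]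

/-- The larger of the two parts is at least half of the sum, which costs one more factor 2. -/
theorem Rounded.step (h : Rounded A n p α β j) (hj : j < n) {α' β' : ℕ → ℚ}
    (h' : α' = α ∧ β' = Function.update β j 0 ∨ α' = Function.update α j 0 ∧ β' = β)
    (hle : ∀ α'' β'', (α'' = α ∧ β'' = Function.update β j 0 ∨
      α'' = Function.update α j 0 ∧ β'' = β) →
      powSum A n p α'' β'' (range n) ≤ powSum A n p α' β' (range n)) :
    Rounded A n p α' β' (j + 1) := by
  have h1 := h.rest j le_rfl hj
  refine ⟨?_, ?_, fun v hv => ?_, fun v hv hvn => ?_, fun T hT => (h.le T hT).trans ?_⟩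
  · rcases h' with ⟨rfl, rfl⟩ | ⟨rfl, rfl⟩
    exacts [h.al01, Rounded.update (.inl rfl) h.al01]
  · rcases h' with ⟨rfl, rfl⟩ | ⟨rfl, rfl⟩
    exacts [Rounded.update (.inl rfl) h.be01, h.be01]
  · rcases Nat.lt_succ_iff_lt_or_eq.mp hv with hv | rfl
    · rcases h' with ⟨rfl, rfl⟩ | ⟨rfl, rfl⟩ <;> rw [Function.update_of_ne hv.ne] <;> exact h.fix v hv
    · rcases h' with ⟨rfl, rfl⟩ | ⟨rfl, rfl⟩ <;> simp [h1]
  · have hne : v ≠ j := by omega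
    rcases h' with ⟨rfl, rfl⟩ | ⟨rfl, rfl⟩ <;> rw [Function.update_of_ne hne] <;>
      exact h.rest v (by omega) hvn
  · rw [powSum_split (mem_range.mpr hj), pow_succ, mul_assoc]
    have h2 := hle _ _ (.inl ⟨rfl, rfl⟩)
    have h3 := hle _ _ (.inr ⟨rfl, rfl⟩)
    exact mul_le_mul_of_nonneg_left (by linarith) (by positivity)

/-- Exactly one of `α v` and `β v` is 1 for every `v`, so all sets except one have weight zero and
the sum is a single power of a minor. -/
theorem Rounded.last (h : Rounded A n p α β n) {T : Finset ℕ} (hT : T ⊆ range n) :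
    dt A n T ^ p ≤ 2 ^ n * dt A n ((range n).filter fun v => β v = 1) ^ p := by
  refine (h.le T hT).trans (le_of_eq ?_)
  congr 1
  have hb : ∀ v ∈ range n, (β v = 1 ∧ α v = 0) ∨ (β v = 0 ∧ α v = 1) := fun v hv => by
    have h1 := h.fix v (mem_range.mp hv)
    rcases h.be01 v with h2 | h2
    · exact .inr ⟨h2, by linarith⟩
    · exact .inl ⟨h2, by linarith⟩
  rw [powSum, sum_eq_single_of_mem _ (mem_powerset.mpr (filter_subset (fun v => β v = 1) _))]
  · rw [wt, prod_eq_one, one_mul]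
    intro v hv
    rcases hb v hv with ⟨h1, h2⟩ | ⟨h1, h2⟩ <;> simp_all
  · intro S hS hne
    rw [mem_powerset] at hS
    obtain ⟨v, hv, hv'⟩ : ∃ v ∈ range n, ¬ (v ∈ S ↔ β v = 1) := by
      by_contra! hcon
      refine hne (ext fun v => ?_)
      rw [mem_filter]
      exact ⟨fun hv => ⟨hS hv, (hcon v (hS hv)).mp hv⟩, fun hv => (hcon v hv.1).mpr hv.2⟩
    rw [wt, prod_eq_zero hv, zero_mul]
    rcases hb v hv with ⟨h1, h2⟩ | ⟨h1, h2⟩ <;> simp_all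

end Elimination

namespace Algo

open Imp Cmd Table Grassmann Elimination

variable {Γ : Par} {d : Dat} {σ : St}

/-! #### The main program -/

notation "vw" => (29 : ℕ)

/-- Choose for every vertex whether it belongs to the output. -/
def greedyC : Cmd :=
  loop vy ♯vn (qwr qAl ♯vy 1) ;; loop vy ♯vn (qwr qBe ♯vy 1) ;;
  loop vw ♯vn (
    qwr qBe ♯vw 0 ;; sumC ;; qwr qZ' 0 (ρ qZ 0) ;;
    qwr qBe ♯vw 1 ;; qwr qAl ♯vw 0 ;; sumC ;;
    ite (.lt (ρ qZ 0) (ρ qZ' 0)) (qwr qBe ♯vw 0 ;; qwr qAl ♯vw 1) skip)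

/-- Copy the matrix, with a row and a column of zeros added. -/
def copyC : Cmd :=
  loop vy ♯vn (loop vz ♯vn (qwr qA (♯vy * (♯vn + 1) + ♯vz) (ρ qIn (♯vy * ♯vn + ♯vz))))

/-- Is there a nonzero entry off the diagonal? -/
def flagC : Cmd :=
  set vh 0 ;; loop vy ♯vn (loop vz ♯vn (ite (♯vy =ₙ ♯vz) skip
    (ite (.eq (ρ qA (♯vy * (♯vn + 1) + ♯vz)) 0) skip (set vh 1))))

/-- The square root of `n`, rounded up. -/
def rootC : Cmd :=
  set vp 0 ;; loop vq ♯vn (ite (♯vp * ♯vp <ₙ ♯vn) (set vp (♯vp + 1)) skip)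

/-- The optimum for diagonal matrices. -/
def diagC : Cmd :=
  loop vy ♯vn (ite (.lt (ρ qA (♯vy * (♯vn + 1) + ♯vy)) 1) (qwr qBe ♯vy 0) (qwr qBe ♯vy 1))

def outC : Cmd := loop vy ♯vn (qwr qIn ♯vy (ρ qBe ♯vy))

def mainC : Cmd :=
  copyC ;; flagC ;; rootC ;; ite (♯vh =ₙ 0) diagC greedyC ;; outC

/-- The assumptions hold for all numbers of slots up to `w + 1` and all weights. -/
def Lims (Γ : Par) (d : Dat) (w : ℕ) : Prop := ∀ k ≠ 0, k ≤ w + 1 → ∀ al be : ℕ → ℚ,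
  (∀ v, al v = 0 ∨ al v = 1) → (∀ v, be v = 0 ∨ be v = 1) →
    Lim Γ { d with k := k, al := al, be := be }

/-- The state holds the data except for the weights. -/
structure Core (d : Dat) (σ : St) : Prop where
  n : σ.nv vn = d.n
  p : σ.nv vp = d.p
  A : ∀ a ≤ d.n, ∀ b ≤ d.n, σ.qa qA (a * (d.n + 1) + b) = d.A a b

theorem Core.frame {τ : St} {c : Cmd} (h : Core d σ) (hF : Frame c σ τ)
    (hc : (c.wv vn || c.wv vp || c.wq qA) = false) : Core d τ := by
  simp only [Bool.or_eq_false_iff] at hc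
  exact ⟨(hF.nv _ hc.1.1).trans h.n, (hF.nv _ hc.1.2).trans h.p, by rw [hF.qa _ hc.2]; exact h.A⟩

variable {w : ℕ}

theorem spec_sum_core (hw : w ≤ d.n) (hl : Lims Γ d w)
    (hwin : ∀ X : ℕ → ℕ, (∀ j ≤ w, X j = d.n) → ∀ y < d.n, Win d.A d.n (w + 1) d.n X y)
    (hn : d.n + 1 ≤ Γ.B) (hC : Core d σ) {al be : ℕ → ℚ} (h1 : σ.qa qAl = al) (h2 : σ.qa qBe = be)
    (al01 : ∀ v, al v = 0 ∨ al v = 1) (be01 : ∀ v, be v = 0 ∨ be v = 1) :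
    Spec Γ sumC σ fun τ => τ.qa qZ 0 = powSum d.A d.n d.p al be (Finset.range d.n) :=
  spec_sum (d := { d with al := al, be := be }) hw (fun k hk hkw => hl k hk hkw al be al01 be01) hwin
    ⟨hC.n, hC.p, hC.A, fun v _ => by rw [h1], fun v _ => by rw [h2]⟩ hn

theorem spec_greedy (hw : w ≤ d.n) (hl : Lims Γ d w)
    (hwin : ∀ X : ℕ → ℕ, (∀ j ≤ w, X j = d.n) → ∀ y < d.n, Win d.A d.n (w + 1) d.n X y)
    (hn : d.n + 1 ≤ Γ.B) (hnb : d.n + 1 ≤ Γ.NB) (hC : Core d σ) (h0 : ∀ T, 0 ≤ dt d.A d.n T)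
    (hal : ∀ v, σ.qa qAl v = 0) (hbe : ∀ v, σ.qa qBe v = 0) :
    Spec Γ greedyC σ fun τ => Rounded d.A d.n d.p (τ.qa qAl) (τ.qa qBe) d.n := by
  have fill : ∀ {σ : St} (r : Fin 16), r ≠ 0 → Core d σ → Spec Γ (loop vy ♯vn (qwr r ♯vy 1)) σ
      fun τ => (∀ v < d.n, τ.qa r v = 1) ∧ ∀ v, d.n ≤ v → τ.qa r v = σ.qa r v := fun r hr hC => by
    refine Spec.fillQ d.n 0 (fun _ => 1) hC.n (by simp) (by omega) hr ?_ (fun τ _ h2 h =>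
      ⟨fun j hj => by simpa using h j hj, fun v hv => h2 v (.inr (by omega))⟩)
    intro j hj τ _ hvj _ _
    simp [hvj]; omega
  refine (fill qAl (by decide) hC).then fun σ₁ hF h1 => ?_
  replace hC := hC.frame hF rfl
  replace h1 : (∀ v < d.n, σ₁.qa qAl v = 1) ∧ ∀ v, d.n ≤ v → σ₁.qa qAl v = 0 :=
    ⟨h1.1, fun v hv => (h1.2 v hv).trans (hal v)⟩
  rw [← hF.qa _ rfl] at hbe
  clear hF
  refine (fill qBe (by decide) hC).then fun σ₂ hF h2 => ?_
  replace hC := hC.frame hF rfl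
  replace h2 : (∀ v < d.n, σ₂.qa qBe v = 1) ∧ ∀ v, d.n ≤ v → σ₂.qa qBe v = 0 :=
    ⟨h2.1, fun v hv => (h2.2 v hv).trans (hbe v)⟩
  rw [← hF.qa _ rfl] at h1
  clear hF
  have b01 : ∀ f : ℕ → ℚ, ((∀ v < d.n, f v = 1) ∧ ∀ v, d.n ≤ v → f v = 0) →
      ∀ v, f v = 0 ∨ f v = 1 := fun f h v => (lt_or_ge v d.n).elim (fun hv => .inr (h.1 v hv))
    fun hv => .inl (h.2 v hv)
  refine Spec.loop d.n (fun j τ => Rounded d.A d.n d.p (τ.qa qAl) (τ.qa qBe) j) hC.n (by simp)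
    (by omega) (rounded_zero h0 (b01 _ h1) (b01 _ h2) fun v hv => ⟨h1.1 v hv, h2.1 v hv⟩)
    (fun j τ a h => h) ?_ (fun τ _ h => h)
  clear h1 h2 hal hbe
  intro j hj τ hF hvj hR
  replace hC := hC.frame hF rfl
  clear hF
  obtain ⟨al, hal⟩ : ∃ al, τ.qa qAl = al := ⟨_, rfl⟩
  obtain ⟨be, hbe⟩ : ∃ be, τ.qa qBe = be := ⟨_, rfl⟩
  rw [hal, hbe] at hR
  have hj1 := hR.rest j le_rfl hj
  refine Spec.then (P := fun τ => τ.qa qBe = Function.update be j 0) (Spec.qwr (by simp)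
    (by simp [hvj]; omega) (by simp) (by simp) (by simp [hvj, hbe])) fun σ₁ hF h1 => ?_
  replace hC := hC.frame hF rfl
  rw [← hF.nv _ rfl] at hvj
  rw [← hF.qa _ rfl] at hal
  clear hF hbe
  refine (spec_sum_core hw hl hwin hn hC hal h1 hR.al01 (Rounded.update (.inl rfl) hR.be01)).then
    fun σ₂ hF hZ => ?_
  replace hC := hC.frame hF rfl
  rw [← hF.nv _ rfl] at hvj
  rw [← hF.qa _ rfl] at hal h1
  clear hF
  refine Spec.then (P := fun τ => τ.qa qZ' 0 = powSum d.A d.n d.p al (Function.update be j 0)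
    (Finset.range d.n)) (Spec.qwr (by simp) (by simp) (by simp) (by simp)
    (by simp [hZ])) fun σ₃ hF hZ' => ?_
  replace hC := hC.frame hF rfl
  rw [← hF.nv _ rfl] at hvj
  rw [← hF.qa _ rfl] at hal h1
  clear hF hZ
  -- Undecided entries of both weights are 1, so writing 1 back restores the previous weights.
  have hup : ∀ f : ℕ → ℚ, ∀ c, f j = 1 → Function.update (Function.update f j c) j 1 = f :=
    fun f c h => by rw [Function.update_idem, ← h, Function.update_eq_self]
  refine Spec.then (P := fun τ => τ.qa qBe = be) (Spec.qwr (by simp)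
    (by simp [hvj]; omega) (by simp) (by simp; omega) (by simp [hvj, h1, hup _ _ hj1.2]))
    fun σ₄ hF h2 => ?_
  replace hC := hC.frame hF rfl
  rw [← hF.nv _ rfl] at hvj
  rw [← hF.qa _ rfl] at hal hZ'
  clear hF h1
  refine Spec.then (P := fun τ => τ.qa qAl = Function.update al j 0) (Spec.qwr (by simp)
    (by simp [hvj]; omega) (by simp) (by simp) (by simp [hvj, hal])) fun σ₅ hF h3 => ?_
  replace hC := hC.frame hF rfl
  rw [← hF.nv _ rfl] at hvj
  rw [← hF.qa _ rfl] at h2 hZ'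
  clear hF hal
  refine (spec_sum_core hw hl hwin hn hC h3 h2 (Rounded.update (.inl rfl) hR.al01) hR.be01).then
    fun σ₆ hF hZ => ?_
  rw [← hF.nv _ rfl] at hvj
  rw [← hF.qa _ rfl] at h2 hZ'
  rw [← hF.qa _ rfl] at h3
  clear hF
  refine Spec.ite (by simp) (fun t => ?_) (fun t => ?_)
  all_goals
    simp only [BE.eval_lt, QE.eval_rd, NE.eval_zero, hZ, hZ'] at t
  · refine Spec.seq (Spec.qwr (by simp) (by simp [hvj]; omega) (by simp) (by simp)
      (Spec.qwr (by simp) (by simp [hvj]; omega) (by simp) (by simp; omega) ?_))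
    simp only [St.setQ_qa, NE.eval_var, hvj, QE.eval_zero, QE.eval_one, h2, h3, if_true,
      St.setQ_nv, hup _ _ hj1.1, if_neg (show ¬ (qBe : Fin 16) = qAl by decide),
      if_neg (show ¬ (qAl : Fin 16) = qBe by decide)]
    refine hR.step hj (.inl ⟨rfl, rfl⟩) ?_
    rintro _ _ (⟨rfl, rfl⟩ | ⟨rfl, rfl⟩)
    exacts [le_rfl, t.le]
  · refine Spec.skip ?_
    rw [h2, h3]
    refine hR.step hj (.inr ⟨rfl, rfl⟩) ?_
    rintro _ _ (⟨rfl, rfl⟩ | ⟨rfl, rfl⟩)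
    exacts [not_lt.mp t, le_rfl]

/-! #### Preparations -/

variable {n : ℕ} {a : ℕ → ℕ → ℚ}

theorem spec_copy (hn : σ.nv vn = n) (hB : n ≤ Γ.B) (hNB : (n + 1) * (n + 1) ≤ Γ.NB)
    (hinp : Γ.inp = n * n) (h1 : ∀ y < n, ∀ z < n, σ.qa qIn (y * n + z) = a y z)
    (h2 : ∀ i, σ.qa qA i = 0) (h3 : ∀ y z, n ≤ y ∨ n ≤ z → a y z = 0) :
    Spec Γ copyC σ fun τ => ∀ y ≤ n, ∀ z ≤ n, τ.qa qA (y * (n + 1) + z) = a y z := by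
  refine Spec.loop n (fun j τ => ∀ y ≤ n, ∀ z ≤ n, τ.qa qA (y * (n + 1) + z) =
    if y < j then a y z else 0) hn (by simp) hB (by simp [h2]) (fun j τ a h => h) ?_ ?_
  · intro y hy τ hF hvy h4
    rw [← hF.nv _ rfl] at hn
    rw [← hF.qa _ rfl] at h1
    clear hF
    refine Spec.fillQ n (y * (n + 1)) (a y) hn (by simp) hB (by decide) ?_ ?_
    · intro z hz τ' hF hvz _ _
      rw [← hF.nv _ rfl] at hn hvy
      rw [← hF.qa _ rfl] at h1
      have n1 := ix_lt hy hz
      have n2 : y * (n + 1) = y * n + y := by ring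
      have n3 : (n + 1) * (n + 1) = n * n + 2 * n + 1 := by ring
      simp [hn, hvy, hvz, h1 y hy z hz, hinp]
      omega
    · intro τ' hF h5 h6 y' hy' z hz
      rcases lt_trichotomy y' y with h | rfl | h
      · have := ix_lt h (show z < n + 1 by omega)
        rw [h5 _ (.inl this), h4 y' hy' z hz, if_pos h, if_pos (by omega)]
      · rw [if_pos (by omega)]
        rcases hz.lt_or_eq with hz | rfl
        · exact h6 z hz
        · rw [h5 _ (.inr le_rfl), h4 y' hy' z le_rfl, if_neg (lt_irrefl _), h3 y' z (.inr le_rfl)]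
      · have := Nat.mul_le_mul_right (n + 1) (show y + 1 ≤ y' from h)
        rw [Nat.succ_mul] at this
        rw [h5 _ (.inr (by omega)), h4 y' hy' z hz, if_neg (by omega), if_neg (by omega)]
  · intro τ _ h4 y hy z hz
    rw [h4 y hy z hz]
    split_ifs with h
    · rfl
    · exact (h3 y z (.inl (by omega))).symm

theorem spec_flag (hn : σ.nv vn = n) (hB : n ≤ Γ.B) (hNB : (n + 1) * (n + 1) ≤ Γ.NB)
    (h1 : ∀ y ≤ n, ∀ z ≤ n, σ.qa qA (y * (n + 1) + z) = a y z) :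
    Spec Γ flagC σ fun τ => τ.nv vh = 0 ↔ ∀ y < n, ∀ z < n, y ≠ z → a y z = 0 := by
  have n0 : n + 1 ≤ Γ.NB := by nlinarith
  refine Spec.then (P := fun τ => τ.nv vh = 0) (Spec.set (by simp) (by simp)) fun σ₁ hF h0 => ?_
  rw [← hF.nv _ rfl] at hn
  rw [← hF.qa _ rfl] at h1
  clear hF
  refine Spec.loop n (fun j τ => τ.nv vh = 0 ↔ ∀ y < j, ∀ z < n, y ≠ z → a y z = 0) hn (by simp) hB
    (by simp [h0]) (fun j τ a h => by simpa using h) ?_ (fun τ _ h => h)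
  intro y hy τ hF hvy h2
  rw [← hF.nv _ rfl] at hn
  rw [← hF.qa _ rfl] at h1
  clear hF h0
  refine Spec.loop n (fun j τ => τ.nv vh = 0 ↔ (∀ y' < y, ∀ z < n, y' ≠ z → a y' z = 0) ∧
    ∀ z < j, y ≠ z → a y z = 0) hn (by simp) hB
    (by simp [h2]) (fun j τ a h => by simpa using h) ?_ (fun τ _ h => ?_)
  · intro z hz τ' hF hvz h3
    rw [← hF.nv _ rfl] at hn hvy
    rw [← hF.qa _ rfl] at h1
    clear hF h2
    have n1 := ix_lt (show y < n + 1 by omega) (show z < n + 1 by omega)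
    have hs : (∀ z' < z + 1, y ≠ z' → a y z' = 0) ↔
        (∀ z' < z, y ≠ z' → a y z' = 0) ∧ (y ≠ z → a y z = 0) := by
      simp only [Nat.lt_succ_iff_lt_or_eq, or_imp, forall_and, forall_eq]
    rw [hs, ← and_assoc, ← h3]
    refine Spec.ite (by simp) (fun t => ?_) (fun t => ?_)
    all_goals simp only [BE.eval_eq, QE.eval_nat, NE.eval_var, hvy, hvz, Nat.cast_inj] at t
    · exact Spec.skip (by simp [t])
    · refine Spec.ite (by simp [hvy, hvz, hn]; omega) (fun t' => ?_) (fun t' => ?_)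
      all_goals
        simp only [BE.eval_eq, QE.eval_rd, NE.eval_add, NE.eval_mul, NE.eval_var, NE.eval_one, hvy,
          hvz, hn, h1 y hy.le z hz.le, QE.eval_zero] at t'
      · exact Spec.skip (by simp [t'])
      · exact Spec.set (by simp; omega) (by simp [t, t'])
  · rw [h]
    simp only [Nat.lt_succ_iff_lt_or_eq, or_imp, forall_and, forall_eq]

/-- The number `p` is `√n`, rounded up. -/
def IsRoot (n p : ℕ) : Prop := n ≤ p * p ∧ ∀ q < p, q * q < n

/-- The value grows by one in every round until its square reaches `n`; `n` rounds suffice since `n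
≤ n * n`. -/
theorem spec_root (hn : σ.nv vn = n) (hB : n ≤ Γ.B) (hNB : (n + 1) * (n + 1) ≤ Γ.NB) :
    Spec Γ rootC σ fun τ => IsRoot n (τ.nv vp) := by
  have n0 : n * n + 1 ≤ Γ.NB := by nlinarith
  refine Spec.then (P := fun τ => τ.nv vp = 0) (Spec.set (by simp) (by simp)) fun σ₁ hF h0 => ?_
  rw [← hF.nv _ rfl] at hn
  clear hF
  refine Spec.loop n (fun j τ => (∀ q < τ.nv vp, q * q < n) ∧ τ.nv vp ≤ j ∧
    (j ≤ τ.nv vp ∨ n ≤ τ.nv vp * τ.nv vp)) hn (by simp) hB (by simp [h0])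
    (fun j τ a h => by simpa using h) ?_ (fun τ _ h => ⟨?_, h.1⟩)
  · rintro j hj τ hF hvj ⟨h1, h2, h3⟩
    rw [← hF.nv _ rfl] at hn
    have h4 : τ.nv vp * τ.nv vp ≤ n * n := Nat.mul_le_mul (by omega) (by omega)
    have h5 : n ≤ n * n := Nat.le_mul_self n
    refine Spec.ite (by simp; omega) (fun t => ?_) (fun t => ?_)
    all_goals simp only [BE.eval_lt, QE.eval_nat, NE.eval_mul, NE.eval_var, hn, Nat.cast_lt] at t
    · refine Spec.set (by simp; omega) ?_
      simp only [NE.eval_add, NE.eval_var, NE.eval_one, St.setV_nv, if_true]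
      refine ⟨fun q hq => ?_, by omega, .inl (by omega)⟩
      rcases Nat.lt_succ_iff_lt_or_eq.mp hq with h | rfl
      exacts [h1 q h, t]
    · exact Spec.skip ⟨h1, by omega, .inr (not_lt.mp t)⟩
  · rcases h.2.2 with h' | h'
    · exact (Nat.le_mul_self n).trans (Nat.mul_le_mul h' h')
    · exact h'

theorem spec_diag (hn : σ.nv vn = n) (hB : n ≤ Γ.B) (hNB : (n + 1) * (n + 1) ≤ Γ.NB)
    (h1 : ∀ y ≤ n, ∀ z ≤ n, σ.qa qA (y * (n + 1) + z) = a y z) :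
    Spec Γ diagC σ fun τ => ∀ y < n, τ.qa qBe y = if a y y < 1 then 0 else 1 := by
  have n0 : n + 1 ≤ Γ.NB := by nlinarith
  refine Spec.loop n (fun j τ => ∀ y < j, τ.qa qBe y = if a y y < 1 then 0 else 1) hn (by simp) hB
    (by simp) (fun j τ a h => h) ?_ (fun τ _ h => h)
  intro y hy τ hF hvy h2
  rw [← hF.nv _ rfl] at hn
  rw [← hF.qa _ rfl] at h1
  have n1 := ix_lt (show y < n + 1 by omega) (show y < n + 1 by omega)
  have upd : ∀ c : ℚ, c = (if a y y < 1 then 0 else 1) → ∀ z < y + 1,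
      Function.update (τ.qa qBe) y c z = if a z z < 1 then 0 else 1 := by
    rintro c rfl z hz
    rw [Function.update_apply]
    by_cases h : z = y
    · rw [if_pos h, h]
    · rw [if_neg h]; exact h2 z (by omega)
  refine Spec.ite (by simp [hvy, hn]; omega) (fun t => ?_) (fun t => ?_)
  all_goals
    simp only [BE.eval_lt, QE.eval_rd, NE.eval_add, NE.eval_mul, NE.eval_var, NE.eval_one, hvy,
      hn, h1 y hy.le y hy.le, QE.eval_one] at t
    refine Spec.qwr (by simp) (by simp [hvy]; omega) (by simp) (by simp; try omega) ?_
    simp only [NE.eval_var, hvy, St.setQ_qa, if_true]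
    exact upd _ (by simp [t])

theorem spec_out (hn : σ.nv vn = n) (hB : n ≤ Γ.B) (hNB : (n + 1) * (n + 1) ≤ Γ.NB)
    (hinp : Γ.inp = n * n) :
    Spec Γ outC σ fun τ => ∀ y < n, τ.qa qIn y = σ.qa qBe y := by
  have n0 : n + 1 ≤ Γ.NB := by nlinarith
  refine Spec.loop n (fun j τ => ∀ y < j, τ.qa qIn y = σ.qa qBe y) hn (by simp) hB
    (by simp) (fun j τ a h => h) ?_ (fun τ _ h => h)
  intro y hy τ hF hvy h2
  have e := hF.qa qBe rfl
  have : y < n * n := lt_of_lt_of_le hy (Nat.le_mul_self n)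
  refine Spec.qwr (by simp) (by simp [hvy]; omega) (by simp [hvy, hinp, this])
    (by simp [hvy]; omega) ?_
  intro z hz
  simp only [NE.eval_var, QE.eval_rd, hvy, St.setQ_qa, if_true, Function.update_apply, e]
  split_ifs with h
  · rw [h]
  · exact h2 z (by omega)

end Algo

namespace Elimination

open Finset Matrix

variable {n : ℕ} (A : Matrix (Fin n) (Fin n) ℚ)

/-! ### Positive semidefinite matrices -/

/-- The matrix, padded with zeros. -/
def pad (a b : ℕ) : ℚ := if h : a < n ∧ b < n then A ⟨a, h.1⟩ ⟨b, h.2⟩ else 0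

variable {A}

theorem pad_fin (i j : Fin n) : pad A i j = A i j := by simp [pad]

theorem pad_of_le {a b : ℕ} (h : n ≤ a ∨ n ≤ b) : pad A a b = 0 :=
  dif_neg fun h' => by omega

theorem pad_symm (hA : (A.map (fun x : ℚ => (x : ℝ))).PosSemidef) (a b : ℕ) :
    pad A a b = pad A b a := by
  by_cases h : a < n ∧ b < n
  · have := congrFun (congrFun hA.1 ⟨a, h.1⟩) ⟨b, h.2⟩
    simp only [conjTranspose_apply, map_apply, star_trivial, Rat.cast_inj] at this
    rw [pad, dif_pos h, pad, dif_pos h.symm, this]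
  · rw [pad_of_le (by omega), pad_of_le (by omega)]

/-- Over the reals `zᵀ A z = 0` forces `A z = 0`; casting brings this back to the rationals, and the
padding contributes only zeros. -/
theorem psd_pad (hA : (A.map (fun x : ℚ => (x : ℝ))).PosSemidef) : Psd (pad A) n := by
  refine ⟨pad_symm hA, fun z hz i => ?_⟩
  rcases lt_or_ge i n with hi | hi
  · simp only [Finset.sum_range, pad_fin] at hz
    have h := (hA.dotProduct_mulVec_zero_iff fun i => (z i : ℝ)).mp (by
      rw [← Rat.cast_inj (α := ℝ)] at hz
      push_cast at hz
      simpa [dotProduct, mulVec] using hz)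
    obtain ⟨i, rfl⟩ : ∃ i' : Fin n, (i' : ℕ) = i := ⟨⟨i, hi⟩, rfl⟩
    have h' := congrFun h i
    rw [Finset.sum_range, ← Rat.cast_inj (α := ℝ)]
    push_cast
    simpa [dotProduct, mulVec, pad_fin] using h'
  · exact sum_eq_zero fun j _ => by rw [pad_of_le (.inl hi), zero_mul]

/-- Rows outside `S` are unit vectors, so the matrix is block triangular with an identity block. -/
theorem det_eq_submatrix {ι : Type*} [Fintype ι] [DecidableEq ι] (M : Matrix ι ι ℚ) (S : Finset ι)
    (h : ∀ i ∉ S, ∀ j, M i j = if i = j then 1 else 0) :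
    M.det = (M.submatrix (fun i : S => (i : ι)) fun i : S => (i : ι)).det := by
  have h1 : toSquareBlockProp M (fun i => ¬ i ∈ S) = 1 := by
    ext i j
    simp [toSquareBlockProp, h i.1 i.2, Matrix.one_apply, Subtype.ext_iff]
  rw [twoBlockTriangular_det M (fun i => i ∈ S), h1, det_one, mul_one]
  · congr!
  · intro i hi j hj
    rw [h i hi, if_neg]
    rintro rfl
    exact hi hj

theorem dt_pad {T : Finset ℕ} {S : Finset (Fin n)} (h : ∀ i : Fin n, i ∈ S ↔ (i : ℕ) ∈ T) :
    dt (pad A) n T = A.principalMinor S := by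
  rw [dt, det_eq_submatrix _ S, Matrix.principalMinor]
  · refine congrArg Matrix.det (Matrix.ext fun i j => ?_)
    have hi := (h _).mp i.2
    have hj := (h _).mp j.2
    simp [msk, hi, hj, pad_fin]
  · intro i hi j
    rw [h] at hi
    simp [msk, hi]

theorem principalMinor_nonneg (hA : (A.map (fun x : ℚ => (x : ℝ))).PosSemidef)
    (S : Finset (Fin n)) : 0 ≤ A.principalMinor S := by
  have h := (hA.submatrix fun i : S => (i : Fin n)).det_nonneg
  have e : ((A.map (fun x : ℚ => (x : ℝ))).submatrix (fun i : S => (i : Fin n)) fun i : S =>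
      (i : Fin n)) = (A.submatrix (fun i : S => (i : Fin n)) (fun i : S => (i : Fin n))).map
        (Rat.castHom ℝ) := rfl
  rw [e, ← RingHom.mapMatrix_apply, ← RingHom.map_det] at h
  exact Rat.cast_nonneg.mp h

theorem principalMinor_diag (h : ∀ i j, i ≠ j → A i j = 0) (S : Finset (Fin n)) :
    A.principalMinor S = ∏ i, if i ∈ S then A i i else 1 := by
  have : A.submatrix (fun i : S => (i : Fin n)) (fun i : S => (i : Fin n)) =
      diagonal fun i : S => A i i := by
    ext i j
    rw [diagonal_apply]
    split_ifs with hij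
    · rw [hij]; rfl
    · exact h _ _ fun h' => hij (Subtype.ext h')
  rw [Matrix.principalMinor, this, det_diagonal, prod_ite_mem, univ_inter]
  exact prod_coe_sort S fun i => A i i

theorem isMapApprox_iff {c : ℝ} (hc : 0 < c) (S : Finset (Fin n))
    (h : ∀ T, (A.principalMinor T : ℝ) ≤ c * A.principalMinor S) : A.IsMapApprox c S := by
  obtain ⟨T, -, hT⟩ := exists_mem_eq_sup' (univ_nonempty (α := Finset (Fin n))) A.principalMinor
  rw [Matrix.IsMapApprox, Matrix.mapOpt, hT, one_div, inv_mul_le_iff₀ hc]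
  exact h T

/-- The minors are products of nonnegative diagonal entries, and taking exactly the entries that are
at least 1 maximizes every factor. -/
theorem isMapApprox_diag (hA : (A.map (fun x : ℚ => (x : ℝ))).PosSemidef)
    (h : ∀ i j, i ≠ j → A i j = 0) {c : ℝ} (hc : 1 ≤ c) {S : Finset (Fin n)}
    (hS : ∀ i, i ∈ S ↔ 1 ≤ A i i) : A.IsMapApprox c S := by
  refine isMapApprox_iff (by linarith) S fun T => ?_
  have h1 : A.principalMinor T ≤ A.principalMinor S := by
    rw [principalMinor_diag h, principalMinor_diag h]
    refine prod_le_prod (fun i _ => ?_) fun i _ => ?_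
    · have := hA.diag_nonneg (i := i)
      simp only [map_apply] at this
      split_ifs
      exacts [by exact_mod_cast this, zero_le_one]
    · have := hS i
      split_ifs with h1 h2 h2
      exacts [le_rfl, (not_le.mp fun h => h2 (this.mpr h)).le, this.mp h2, le_rfl]
  have h2 := principalMinor_nonneg hA S
  have h1' : (A.principalMinor T : ℝ) ≤ A.principalMinor S := by exact_mod_cast h1
  have h2' : (0 : ℝ) ≤ A.principalMinor S := by exact_mod_cast h2
  nlinarith

/-- After raising to the power `p` the claim needs `2^n ≤ (2^√n)^p`, which holds because `n = √n *
√n` and `√n ≤ p`. -/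
theorem isMapApprox_rounded (hA : (A.map (fun x : ℚ => (x : ℝ))).PosSemidef) {p : ℕ} (hp : p ≠ 0)
    (hnp : n ≤ p * p) {α β : ℕ → ℚ} (h : Rounded (pad A) n p α β n) {S : Finset (Fin n)}
    (hS : ∀ i : Fin n, i ∈ S ↔ β i = 1) : A.IsMapApprox ((2 : ℝ) ^ √(n : ℝ)) S := by
  refine isMapApprox_iff (by positivity) S fun T => ?_
  have hT : T.map Fin.valEmbedding ⊆ range n := fun x hx => by
    obtain ⟨i, -, rfl⟩ := mem_map.mp hx
    exact mem_range.mpr i.2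
  have h1 := h.last hT
  rw [dt_pad (S := T) (fun i => by simp [← Fin.ext_iff]), dt_pad (S := S) (by simp [hS])] at h1
  have h1' : (A.principalMinor T : ℝ) ^ p ≤ 2 ^ n * (A.principalMinor S : ℝ) ^ p := by
    exact_mod_cast h1
  have hT0 : (0 : ℝ) ≤ A.principalMinor T := by exact_mod_cast principalMinor_nonneg hA T
  have hS0 : (0 : ℝ) ≤ A.principalMinor S := by exact_mod_cast principalMinor_nonneg hA S
  rw [← pow_le_pow_iff_left₀ hT0 (by positivity) hp, mul_pow]
  refine h1'.trans (mul_le_mul_of_nonneg_right ?_ (by positivity))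
  rw [← Real.rpow_natCast, ← Real.rpow_natCast, ← Real.rpow_mul (by norm_num)]
  refine Real.rpow_le_rpow_of_exponent_le (by norm_num) ?_
  have hs : √(n : ℝ) ≤ p := by
    rw [Real.sqrt_le_left (by positivity), sq]
    exact_mod_cast hnp
  calc (n : ℝ) = √(n : ℝ) * √(n : ℝ) := (Real.mul_self_sqrt (by positivity)).symm
    _ ≤ _ := mul_le_mul_of_nonneg_left hs (by positivity)

/-! ### Treewidth -/

theorem treewidth_le : A.treewidth ≤ n := by
  have h : A.treewidth ≤ (TreeDecomposition.trivial A.supportGraph).width := Nat.sInf_le ⟨_, rfl⟩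
  refine h.trans ((Nat.sub_le _ _).trans (Finset.sup_le fun t _ => ?_))
  simpa using Finset.card_le_univ ((TreeDecomposition.trivial A.supportGraph).bag t)

/-- The two ends of an edge share a bag. Hence the costly branch of the program is taken only for
treewidth at least 1, where the time bound is not merely polynomial. -/
theorem treewidth_pos {i j : Fin n} (hij : i ≠ j) (h : A i j ≠ 0) : 1 ≤ A.treewidth := by
  obtain ⟨D, hD⟩ := A.supportGraph.exists_width_eq_treewidth
  obtain ⟨t, hi, hj⟩ := D.edge_cover i j (by
    rw [Matrix.supportGraph, SimpleGraph.fromRel_adj]; exact ⟨hij, .inl h⟩)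
  have h1 : 1 < (D.bag t).card := one_lt_card.mpr ⟨i, hi, j, hj, hij⟩
  have h2 : (D.bag t).card ≤ univ.sup fun t => (D.bag t).card :=
    le_sup (f := fun t => (D.bag t).card) (mem_univ t)
  rw [Matrix.treewidth, ← hD, TreeDecomposition.width]
  omega

theorem win_pad (hA : (A.map (fun x : ℚ => (x : ℝ))).PosSemidef) {X : ℕ → ℕ}
    (hX : ∀ j ≤ A.treewidth, X j = n) {y : ℕ} (hy : y < n) :
    Win (pad A) n (A.treewidth + 1) n X y := by
  obtain ⟨D, hD⟩ := A.supportGraph.exists_width_eq_treewidth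
  refine win_of_treeDecomposition (pad_symm hA) (fun a b h => pad_of_le (.inl h))
    (fun i j hij h => ?_) D hD.le hX hy
  rw [pad_fin] at h
  rw [Matrix.supportGraph, SimpleGraph.fromRel_adj]
  exact ⟨hij, .inl h⟩

end Elimination

/-! ### The whole program and its resources -/

namespace Algo

open Imp Cmd Table Grassmann Elimination Finset

variable {Γ : Par} {d : Dat} {n : ℕ} {A : Matrix (Fin n) (Fin n) ℚ}

theorem IsRoot.le {p : ℕ} (h : IsRoot n p) : p ≤ n := by
  by_contra hn
  have h1 := h.2 n (by omega)
  have h2 := Nat.le_mul_self n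
  omega

theorem IsRoot.unique {p q : ℕ} (h : IsRoot n p) (h' : IsRoot n q) : p = q := by
  rcases lt_trichotomy p q with hpq | rfl | hpq
  · have := h'.2 p hpq; have := h.1; omega
  · rfl
  · have := h.2 q hpq; have := h'.1; omega

theorem exists_isRoot (n : ℕ) : ∃ p, IsRoot n p := by
  classical
  have h : ∃ p, n ≤ p * p := ⟨n, Nat.le_mul_self n⟩
  exact ⟨Nat.find h, Nat.find_spec h, fun q hq => not_le.mp (Nat.find_min h hq)⟩

/-- The limits on the tables are required only for positive treewidth, because diagonal matrices
never reach `greedyC`. The exponent found by the program is the `p` of the data, as rounded square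
roots are unique. -/
theorem spec_main (hA : (A.map (fun x : ℚ => (x : ℝ))).PosSemidef) (hdn : d.n = n)
    (hdA : d.A = pad A) (hp : IsRoot n d.p) (hinp : Γ.inp = n * n) (hB : n + 1 ≤ Γ.B)
    (hNB : (n + 1) * (n + 1) ≤ Γ.NB) (hl : 1 ≤ A.treewidth → Lims Γ d A.treewidth) :
    Spec Γ mainC (initSt A) fun τ => ∃ S : Finset (Fin n),
      (∀ i : Fin n, τ.qa qIn i = 1 ↔ i ∈ S) ∧ A.IsMapApprox ((2 : ℝ) ^ √(n : ℝ)) S := by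
  have hB' : n ≤ Γ.B := by omega
  have n1 : n + 1 ≤ Γ.NB := by nlinarith
  refine (spec_copy (n := n) (a := pad A) (by simp [initSt]) hB' hNB hinp
    (fun y hy z hz => ?_) (by simp [initSt]) fun y z h => pad_of_le h).then fun σ₁ hF h1 => ?_
  · have := entry_eq A ⟨y, hy⟩ ⟨z, hz⟩
    simpa [initSt, pad, hy, hz] using this
  have hn : σ₁.nv vn = n := (hF.nv _ rfl).trans (by simp [initSt])
  have hal : ∀ v, σ₁.qa qAl v = 0 := by rw [hF.qa _ rfl]; simp [initSt]
  have hbe : ∀ v, σ₁.qa qBe v = 0 := by rw [hF.qa _ rfl]; simp [initSt]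
  clear hF
  refine (spec_flag hn hB' hNB h1).then fun σ₂ hF h2 => ?_
  rw [← hF.nv _ rfl] at hn
  rw [← hF.qa _ rfl] at h1 hal hbe
  clear hF
  refine (spec_root hn hB' hNB).then fun σ₃ hF h3 => ?_
  rw [← hF.nv _ rfl] at hn h2
  rw [← hF.qa _ rfl] at h1 hal hbe
  clear hF
  refine Spec.then (P := fun τ => ∃ S : Finset (Fin n), (∀ i : Fin n, τ.qa qBe i = 1 ↔ i ∈ S) ∧
    A.IsMapApprox ((2 : ℝ) ^ √(n : ℝ)) S) ?_ fun σ₄ hF h4 => ?_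
  · refine Spec.ite (by simp) (fun t => ?_) (fun t => ?_)
    all_goals
      simp only [BE.eval_eq, QE.eval_nat, NE.eval_var, NE.eval_zero, Nat.cast_inj] at t
      rw [h2] at t
    · refine (spec_diag hn hB' hNB h1).mono fun τ _ h => ?_
      refine ⟨univ.filter fun i => 1 ≤ A i i, fun i => ?_, isMapApprox_diag hA (fun i j hij => ?_)
        (Real.one_le_rpow one_le_two (Real.sqrt_nonneg _)) (by simp)⟩
      · rw [h i i.2, pad_fin]
        by_cases h' : A i i < 1 <;> simp [h', not_le.mpr, not_lt.mp]
      · exact (pad_fin (A := A) i j).symm.trans (t i i.2 j j.2 fun h => hij (Fin.ext h))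
    · push Not at t
      obtain ⟨y, hy, z, hz, hyz, h0⟩ := t
      have hw : 1 ≤ A.treewidth := treewidth_pos (i := ⟨y, hy⟩) (j := ⟨z, hz⟩)
        (fun h => hyz (by simpa using h)) (by simpa [pad, hy, hz] using h0)
      have hp0 : d.p ≠ 0 := fun h => by have := hp.1; rw [h] at this; omega
      have hC : Core d σ₃ := ⟨hn.trans hdn.symm, h3.unique hp, by rw [hdn, hdA]; exact h1⟩
      refine (spec_greedy (w := A.treewidth) (treewidth_le.trans hdn.ge) (hl hw) ?_ (hdn ▸ hB) (hdn ▸ n1)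
        hC (fun T => ?_) hal hbe).mono fun τ _ h => ?_
      · rw [hdn, hdA]
        exact fun X hX y hy => win_pad hA hX hy
      · rw [hdn, hdA, dt_pad (S := univ.filter fun i : Fin n => (i : ℕ) ∈ T) (by simp)]
        exact principalMinor_nonneg hA _
      · rw [hdn, hdA] at h
        have hS : ∀ i : Fin n, i ∈ univ.filter (fun i : Fin n => τ.qa qBe i = 1) ↔
          τ.qa qBe i = 1 := by simp
        exact ⟨_, fun i => (hS i).symm, isMapApprox_rounded hA hp0 hp.1 h hS⟩
  · rw [← hF.nv _ rfl] at hn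
    obtain ⟨S, h5, h6⟩ := h4
    exact (spec_out hn hB' hNB hinp).mono fun τ _ h => ⟨S, fun i => by rw [h i i.2, h5], h6⟩

/-! ### Bounds -/

variable (A)

/-- A common denominator. -/
def cden : ℕ := ∏ i, ∏ j, (A i j).den

/-- The bound on the lengths of all loops. -/
def loopBound (n w p : ℕ) : ℕ :=
  if w = 0 then n + 1 else 2 * (2 ^ (2 * (p * (w + 1))) * (n + 1) ^ (w + 1))

/-- The data, up to the number of slots and the weights. -/
def dat (p : ℕ) : Dat :=
  ⟨n, p, 0, pad A, 0, 0, cden A, 2 ^ (2 * A.bitSize + 1), 10 * (n + 1) ^ 3⟩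

/-- The bounds for the program. -/
noncomputable def par (p : ℕ) : Par :=
  ⟨n * n, 2 ^ (4 * (n + 1) ^ 2), loopBound n A.treewidth p,
    Bd (cden A) (2 ^ (2 * A.bitSize + 1)) (10 * (n + 1) ^ 3)⟩

theorem num_lt (x : ℚ) : x.num.natAbs + 1 ≤ 2 ^ ratSize x :=
  (Nat.le_pow_clog one_lt_two _).trans (Nat.pow_le_pow_right two_pos (by unfold ratSize; omega))

theorem den_le (x : ℚ) : x.den ≤ 2 ^ ratSize x :=
  (Nat.le_succ _).trans ((Nat.le_pow_clog one_lt_two (x.den + 1)).trans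
    (Nat.pow_le_pow_right two_pos (by unfold ratSize; omega)))

theorem ratSize_le_bitSize (i j : Fin n) : ratSize (A i j) ≤ A.bitSize := by
  have h1 := single_le_sum (f := fun j => ratSize (A i j)) (fun _ _ => Nat.zero_le _) (mem_univ j)
  have h2 := single_le_sum (f := fun i => ∑ j, ratSize (A i j)) (fun _ _ => Nat.zero_le _)
    (mem_univ i)
  unfold Matrix.bitSize
  omega

theorem cden_pos : 1 ≤ cden A :=
  Nat.one_le_iff_ne_zero.mpr (prod_ne_zero_iff.mpr fun _ _ => prod_ne_zero_iff.mpr fun _ _ =>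
    Rat.den_nz _)

theorem cden_le : cden A ≤ 2 ^ A.bitSize := by
  calc cden A ≤ ∏ i, ∏ j, 2 ^ ratSize (A i j) :=
        prod_le_prod' fun _ _ => prod_le_prod' fun _ _ => den_le _
    _ = 2 ^ ∑ i, ∑ j, ratSize (A i j) := by simp only [prod_pow_eq_pow_sum]
    _ ≤ _ := Nat.pow_le_pow_right two_pos (by unfold Matrix.bitSize; omega)

theorem two_cden_le : 2 * cden A ≤ 2 ^ (2 * A.bitSize + 1) := by
  have h1 := cden_le A
  have h2 : 2 ^ A.bitSize ≤ 2 ^ (2 * A.bitSize) := Nat.pow_le_pow_right two_pos (by omega)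
  rw [pow_succ]
  omega

theorem pad_cden (a b : ℕ) : ∃ m : ℤ, pad A a b * cden A = m := by
  by_cases h : a < n ∧ b < n
  · obtain ⟨c, hc⟩ : (A ⟨a, h.1⟩ ⟨b, h.2⟩).den ∣ cden A :=
      (dvd_prod_of_mem (fun j => (A ⟨a, h.1⟩ j).den) (mem_univ (Fin.mk b h.2))).trans
        (dvd_prod_of_mem (fun i => ∏ j, (A i j).den) (mem_univ (Fin.mk a h.1)))
    refine ⟨(A ⟨a, h.1⟩ ⟨b, h.2⟩).num * c, ?_⟩
    rw [pad, dif_pos h, hc]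
    push_cast
    rw [← mul_assoc, Rat.mul_den_eq_num]
  · exact ⟨0, by rw [pad_of_le (by omega)]; simp⟩

theorem pad_bound (a b : ℕ) : (1 + |pad A a b|) * cden A ≤ (2 ^ (2 * A.bitSize + 1) : ℕ) := by
  have h1 : (1 + |pad A a b|) ≤ (2 ^ A.bitSize : ℕ) := by
    by_cases h : a < n ∧ b < n
    · rw [pad, dif_pos h]
      obtain ⟨x, hx⟩ : ∃ x, x = A ⟨a, h.1⟩ ⟨b, h.2⟩ := ⟨_, rfl⟩
      have h2 : x.num.natAbs + 1 ≤ 2 ^ A.bitSize := (num_lt x).trans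
        (Nat.pow_le_pow_right two_pos (hx ▸ ratSize_le_bitSize A _ _))
      have h3 : |x| ≤ (x.num.natAbs : ℚ) := by
        have h4 : |x| * x.den = (x.num.natAbs : ℚ) := by
          rw [Nat.cast_natAbs, Int.cast_abs, ← Rat.mul_den_eq_num x, abs_mul, Nat.abs_cast]
        rw [← h4]
        exact le_mul_of_one_le_right (abs_nonneg _) (by exact_mod_cast x.den_pos)
      rw [← hx]
      have h2' : ((x.num.natAbs + 1 : ℕ) : ℚ) ≤ (2 ^ A.bitSize : ℕ) := Nat.cast_le.mpr h2
      push_cast at h2' h3 ⊢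
      linarith
    · rw [pad_of_le (by omega), abs_zero, add_zero]
      exact_mod_cast Nat.one_le_two_pow
  have h2 : ((cden A : ℕ) : ℚ) ≤ (2 ^ A.bitSize : ℕ) := Nat.cast_le.mpr (cden_le A)
  calc _ ≤ ((2 ^ A.bitSize : ℕ) : ℚ) * (2 ^ A.bitSize : ℕ) :=
        mul_le_mul h1 h2 (by positivity) (by positivity)
    _ = ((2 ^ (2 * A.bitSize) : ℕ) : ℚ) := by rw [← Nat.cast_mul, ← pow_add, two_mul]
    _ ≤ _ := Nat.cast_le.mpr (Nat.pow_le_pow_right two_pos (by omega))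

variable {A}

/-- The denominator divides `cden A ^ E`, and the numerator is then at most `|x| * cden A ^ E`, so
both have a number of bits linear in `s * E + E`. -/
theorem ratSize_le {s E : ℕ} {x : ℚ} (hs : A.bitSize = s)
    (h : Bd (cden A) (2 ^ (2 * s + 1)) E x) : ratSize x ≤ (3 * s + 1) * E + 3 := by
  obtain ⟨⟨m, hm⟩, h2⟩ := h
  have hQ : (0 : ℚ) < cden A := by exact_mod_cast cden_pos A
  have hd : x.den ≤ cden A ^ E := by
    have h1 : x = (m : ℚ) / ((cden A ^ E : ℕ) : ℤ) := by
      rw [← hm]; push_cast; field_simp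
    have h3 := Rat.den_dvd m ((cden A ^ E : ℕ) : ℤ)
    rw [Rat.divInt_eq_div, ← h1] at h3
    exact Nat.le_of_dvd (Nat.pow_pos (cden_pos A)) (by exact_mod_cast h3)
  have hn : x.num.natAbs ≤ (2 ^ (2 * s + 1)) ^ E := by
    have h4 : (x.num.natAbs : ℚ) = |x| * x.den := by
      rw [Nat.cast_natAbs, Int.cast_abs, ← Rat.mul_den_eq_num x, abs_mul, Nat.abs_cast]
    have h5 : (x.num.natAbs : ℚ) ≤ ((2 ^ (2 * s + 1) : ℕ) : ℚ) ^ E := by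
      rw [h4]
      refine le_trans (mul_le_mul_of_nonneg_left ?_ (abs_nonneg x)) h2
      exact_mod_cast hd
    exact_mod_cast h5
  have hd' : x.den ≤ 2 ^ (s * E) := by
    rw [pow_mul]
    exact hd.trans (Nat.pow_le_pow_left (hs ▸ cden_le A) E)
  rw [← pow_mul] at hn
  have c : ∀ y e : ℕ, y ≤ 2 ^ e → Nat.clog 2 (y + 1) ≤ e + 1 := fun y e h =>
    Nat.clog_le_of_le_pow (by rw [pow_succ]; have := Nat.one_le_two_pow (n := e); omega)
  have h1 := c _ _ hn
  have h3 := c _ _ hd'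
  unfold ratSize
  have : (3 * s + 1) * E = (2 * s + 1) * E + s * E := by ring
  omega

theorem loopBound_le {w p : ℕ} (hw : w ≤ n) (hp : p ≤ n) :
    loopBound n w p ≤ 2 ^ (4 * (n + 1) ^ 2) := by
  have h1 : n + 1 ≤ 2 ^ n := Nat.lt_two_pow_self
  unfold loopBound
  split_ifs
  · exact h1.trans (Nat.pow_le_pow_right two_pos (by nlinarith))
  · calc 2 * (2 ^ (2 * (p * (w + 1))) * (n + 1) ^ (w + 1))
        ≤ 2 * (2 ^ (2 * (n * (n + 1))) * (2 ^ n) ^ (n + 1)) := by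
          refine Nat.mul_le_mul_left _ (Nat.mul_le_mul (Nat.pow_le_pow_right two_pos ?_) ?_)
          · exact Nat.mul_le_mul_left _ (Nat.mul_le_mul hp (by omega))
          · exact (Nat.pow_le_pow_left h1 _).trans
              (Nat.pow_le_pow_right (Nat.two_pow_pos _) (by omega))
      _ = 2 ^ (1 + 2 * (n * (n + 1)) + n * (n + 1)) := by rw [← pow_mul, pow_add, pow_add]; ring
      _ ≤ _ := Nat.pow_le_pow_right two_pos (by nlinarith)

/-- A natural `m ≤ 2 ^ E` satisfies the bound since `m Q^E ≤ (2 Q)^E ≤ U^E`. The exponent `E`, cubic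
in `n`, exceeds the bit length of all addresses and counters, which is quadratic. -/
theorem par_wf {p : ℕ} (hp : p ≤ n) : (par A p).Wf := by
  intro m hm
  have h1 := loopBound_le (treewidth_le (A := A)) hp
  have h2 := two_cden_le A
  have h3 : n * n ≤ 2 ^ (4 * (n + 1) ^ 2) :=
    (show n * n ≤ 4 * (n + 1) ^ 2 by nlinarith).trans Nat.lt_two_pow_self.le
  have h4 : 2 ^ 4 ≤ 2 ^ (4 * (n + 1) ^ 2) := Nat.pow_le_pow_right two_pos (by nlinarith)
  have h5 : m ≤ 2 ^ (10 * (n + 1) ^ 3) := by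
    calc m ≤ 2 ^ (4 * (n + 1) ^ 2) * 2 ^ 6 := by simp only [par] at hm; omega
      _ = 2 ^ (4 * (n + 1) ^ 2 + 6) := (pow_add _ _ _).symm
      _ ≤ _ := Nat.pow_le_pow_right two_pos (by nlinarith)
  refine ⟨⟨m * cden A ^ (10 * (n + 1) ^ 3), by push_cast; ring⟩, ?_⟩
  rw [Nat.abs_cast]
  have h6 : m * cden A ^ (10 * (n + 1) ^ 3) ≤ (2 ^ (2 * A.bitSize + 1)) ^ (10 * (n + 1) ^ 3) :=
    calc _ ≤ 2 ^ (10 * (n + 1) ^ 3) * cden A ^ (10 * (n + 1) ^ 3) := Nat.mul_le_mul_right _ h5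
      _ = (2 * cden A) ^ (10 * (n + 1) ^ 3) := (mul_pow _ _ _).symm
      _ ≤ _ := Nat.pow_le_pow_left h2 _
  exact_mod_cast h6

theorem par_entry {p : ℕ} (i j : Fin n) : (par A p).V (A i j) := by
  refine Bd.mono (e := 1) (two_cden_le A) (Nat.mul_pos (by norm_num) (Nat.pow_pos (Nat.succ_pos n)))
    ⟨?_, ?_⟩
  · simpa [pad_fin] using pad_cden A i j
  · have := pad_bound A i j
    rw [pad_fin, add_mul, one_mul] at this
    rw [pow_one, pow_one]
    have h0 : (0 : ℚ) ≤ cden A := by positivity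
    linarith

/-- The bounds on naturals are compared by exponents of 2. With `h = (n + 1) ^ 2` one has at most `2
^ h` positions, tables of at most `2 ^ (2 h)` entries and other factors of at most `2 ^ h`, so every
index stays below `2 ^ (4 h)`. -/
theorem par_lims (hA : (A.map (fun x : ℚ => (x : ℝ))).PosSemidef) {p : ℕ} (hp : IsRoot n p)
    (hw : 1 ≤ A.treewidth) : Lims (par A p) (dat A p) A.treewidth := by
  intro k hk0 hk al be hal hbe
  have hwn := treewidth_le (A := A)
  have hpn := hp.le
  have hp0 : p ≠ 0 := by
    rintro rfl
    have := hp.1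
    omega
  obtain ⟨w, hw'⟩ : ∃ w, w = A.treewidth := ⟨_, rfl⟩
  rw [← hw'] at hk hw hwn
  have hB : (par A p).B = 2 * (2 ^ (2 * (p * (w + 1))) * (n + 1) ^ (w + 1)) := by
    simp only [par, loopBound, ← hw', if_neg (show ¬ w = 0 by omega)]
  have hNB : (par A p).NB = 2 ^ (4 * (n + 1) ^ 2) := rfl
  obtain ⟨h, hh⟩ : ∃ h, h = (n + 1) ^ 2 := ⟨_, rfl⟩
  have p2 : ∀ m, m < 2 ^ m := fun m => Nat.lt_two_pow_self
  have le2 : ∀ {a b : ℕ}, a ≤ b → 2 ^ a ≤ 2 ^ b := fun h => Nat.pow_le_pow_right two_pos h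
  have mul2 : ∀ {a b x y : ℕ}, a ≤ 2 ^ x → b ≤ 2 ^ y → a * b ≤ 2 ^ (x + y) := fun h1 h2 =>
    (Nat.mul_le_mul h1 h2).trans (pow_add _ _ _).ge
  have hn1 : n + 1 ≤ 2 ^ n := p2 n
  have hpk : p * k ≤ h := by
    calc p * k ≤ n * (n + 1) := Nat.mul_le_mul hpn (by omega)
      _ ≤ h := by rw [hh]; nlinarith
  have hnh : n + 1 ≤ h := by rw [hh]; nlinarith
  have hN : 2 ^ (2 * (p * k)) ≤ 2 ^ (2 * h) := le2 (by omega)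
  have hM : (n + 1) ^ k ≤ 2 ^ h := by
    calc (n + 1) ^ k ≤ (2 ^ n) ^ (n + 1) := (Nat.pow_le_pow_left hn1 _).trans
          (Nat.pow_le_pow_right (Nat.two_pow_pos _) (by omega))
      _ = 2 ^ (n * (n + 1)) := (pow_mul _ _ _).symm
      _ ≤ _ := le2 (by rw [hh]; nlinarith)
  have hkh : k ≤ h := by omega
  have h2h : h ≤ 2 ^ h := (p2 h).le
  have hNB' : ∀ {a x : ℕ}, a ≤ 2 ^ x → x ≤ 4 * h → a ≤ (par A p).NB := fun h1 h2 => by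
    rw [hNB, ← hh]; exact h1.trans (le2 h2)
  have b1 : 1 ≤ (n + 1) ^ (w + 1) := Nat.one_le_pow _ _ (by omega)
  have b2 : 1 ≤ 2 ^ (2 * (p * (w + 1))) := Nat.one_le_two_pow
  have b3 : n + 1 ≤ (n + 1) ^ (w + 1) := Nat.le_self_pow (by omega) _
  have b4 : (n + 1) ^ k ≤ (n + 1) ^ (w + 1) := Nat.pow_le_pow_right (by omega) hk
  have b5 : 2 * (p * k) ≤ 2 * (p * (w + 1)) := Nat.mul_le_mul_left _ (Nat.mul_le_mul_left _ hk)
  have b6 : 2 ^ (2 * (p * k)) ≤ 2 ^ (2 * (p * (w + 1))) := le2 b5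
  have b7 : 2 * (p * k) < 2 ^ (2 * (p * k)) := p2 _
  have b8 : (n + 1) ^ (w + 1) ≤ 2 ^ (2 * (p * (w + 1))) * (n + 1) ^ (w + 1) :=
    Nat.le_mul_of_pos_left _ b2
  have b9 : 2 ^ (2 * (p * (w + 1))) ≤ 2 ^ (2 * (p * (w + 1))) * (n + 1) ^ (w + 1) :=
    Nat.le_mul_of_pos_right _ b1
  constructor <;> try simp only [dat, Dat.N, Dat.M, Dat.L, Dat.η]
  · exact psd_pad hA
  · exact hp0
  · exact hk0
  · omega
  · omega
  · omega
  · omega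
  · omega
  · omega
  · exact hNB' (mul2 (mul2 hM ((show n ≤ h by omega).trans h2h)) hN) (by omega)
  · exact hNB' (mul2 hM (hnh.trans h2h)) (by omega)
  · exact hNB' (mul2 hM (hkh.trans h2h)) (by omega)
  · exact hNB' (mul2 hN (((show 2 * (p * k) ≤ 2 * h by omega).trans (p2 _).le))) (by omega)
  · exact hNB' (mul2 (hnh.trans h2h) (hnh.trans h2h)) (by omega)
  · exact hNB' (mul2 (show 2 ≤ 2 ^ 1 by norm_num) hN) (by omega)
  · exact hNB' ((p2 _).le.trans (le2 (show 2 * (p * k) + k ≤ 4 * h by omega))) le_rfl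
  · exact hNB' ((p2 _).le.trans (le2 (show p + 2 ≤ 4 * h by omega))) le_rfl
  · exact fun x hx => hx
  · exact two_cden_le A
  · exact pad_cden A
  · exact pad_bound A
  · exact hal
  · exact hbe
  -- Since `η ≤ 3 (n + 1) ^ 2`, the exponent needed for `n` vertices and one extra step is well
  -- below `10 (n + 1) ^ 3`.
  · have e1 : 2 * k * p = 2 * (p * k) := by ring
    rw [e1]
    have e2 : 2 * (p * k) + 1 ≤ 3 * h := by omega
    calc (2 * (p * k) + 1) * n + (2 * (p * k) + 1) + 1 ≤ 3 * h * n + 3 * h + h := by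
          have := Nat.mul_le_mul_right n e2
          omega
      _ ≤ 10 * (n + 1) ^ 3 := by rw [hh]; nlinarith [Nat.zero_le (n ^ 3), Nat.zero_le (n ^ 2)]

end Algo

/-! ### Constants in the bounds, and the conclusion -/

namespace Algo

open Imp Cmd Table Elimination

/-- Bernoulli gives `1 + s ≤ 2 ^ s` for `s = √n ≥ 1`, and squaring dominates `s ^ 2 + 1`. -/
theorem succ_le_rpow (n : ℕ) : (n : ℝ) + 1 ≤ 2 ^ (2 * √(n : ℝ)) := by
  rcases Nat.eq_zero_or_pos n with rfl | hn
  · simp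
  have h1 : 1 ≤ √(n : ℝ) := Real.one_le_sqrt.mpr (by exact_mod_cast hn)
  have h2 := one_add_mul_self_le_rpow_one_add (s := 1) (by norm_num) h1
  rw [mul_one, one_add_one_eq_two] at h2
  calc (n : ℝ) + 1 = √(n : ℝ) ^ 2 + 1 := by rw [Real.sq_sqrt (by positivity)]
    _ ≤ (1 + √(n : ℝ)) ^ 2 := by nlinarith
    _ ≤ (2 ^ √(n : ℝ)) ^ 2 := pow_le_pow_left₀ (by positivity) h2 2
    _ = 2 ^ (2 * √(n : ℝ)) := by rw [← Real.rpow_natCast, ← Real.rpow_mul (by norm_num)]; ring_nf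

/-- The 14 is `2 + 8 + 4`: constants up to 4 cost `2 w√n`, the size of a table costs `8 w√n` by `p ≤
2√n` and `w + 1 ≤ 2 w`, and the number of positions costs `4 w√n` by `n + 1 ≤ 2 ^ (2√n)`. Base 2 is
finally replaced by `w + 1`. -/
theorem loopBound_le_rpow {n w p : ℕ} (hwn : w ≤ n) (hw : 1 ≤ w) (hp : IsRoot n p) :
    (loopBound n w p : ℝ) + 1 ≤ (w + 1) ^ (14 * (w * √(n : ℝ))) := by
  have hn : 1 ≤ n := hw.trans hwn
  obtain ⟨s, hs⟩ : ∃ s, s = √(n : ℝ) := ⟨_, rfl⟩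
  have h1 : 1 ≤ s := hs ▸ Real.one_le_sqrt.mpr (by exact_mod_cast hn)
  have hps : (p : ℝ) ≤ 2 * s := by
    have hp0 : p ≠ 0 := fun h => by have := hp.1; rw [h] at this; omega
    have h2 := hp.2 (p - 1) (by omega)
    have h3 : ((p - 1 : ℕ) : ℝ) < s := by
      rw [hs]
      refine Real.lt_sqrt_of_sq_lt ?_
      rw [sq]
      exact_mod_cast h2
    rw [Nat.cast_sub (by omega), Nat.cast_one] at h3
    linarith
  have hw1 : (1 : ℝ) ≤ w := by exact_mod_cast hw
  have hn2 : (n : ℝ) + 1 ≤ 2 ^ (2 * s) := hs ▸ succ_le_rpow n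
  rw [← hs]
  have h2 : (2 : ℝ) ^ (14 * (w * s)) ≤ (w + 1) ^ (14 * (w * s)) :=
    Real.rpow_le_rpow (by norm_num) (by linarith) (by positivity)
  refine le_trans ?_ h2
  rw [loopBound, if_neg (by omega)]
  push_cast
  have h3 : (2 : ℝ) ^ (2 * (p * (w + 1))) ≤ 2 ^ (8 * (w * s)) := by
    rw [← Real.rpow_natCast]
    refine Real.rpow_le_rpow_of_exponent_le (by norm_num) ?_
    push_cast
    nlinarith [mul_le_mul hps (show (w : ℝ) + 1 ≤ 2 * w by linarith) (by positivity) (by positivity)]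
  have h4 : ((n : ℝ) + 1) ^ (w + 1) ≤ 2 ^ (4 * (w * s)) := by
    refine (pow_le_pow_left₀ (by positivity) hn2 _).trans ?_
    rw [← Real.rpow_natCast, ← Real.rpow_mul (by norm_num)]
    refine Real.rpow_le_rpow_of_exponent_le (by norm_num) ?_
    push_cast
    nlinarith
  have h5 : (4 : ℝ) ≤ 2 ^ (2 * (w * s)) := by
    have : (2 : ℝ) ^ (2 : ℝ) ≤ 2 ^ (2 * (w * s)) :=
      Real.rpow_le_rpow_of_exponent_le (by norm_num) (by nlinarith)
    norm_num at this ⊢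
    exact this
  have h6 : (1 : ℝ) ≤ 2 ^ (2 * (p * (w + 1))) * ((n : ℝ) + 1) ^ (w + 1) :=
    one_le_mul_of_one_le_of_one_le (one_le_pow₀ (by norm_num)) (one_le_pow₀ (by linarith [Nat.cast_nonneg (α := ℝ) n]))
  calc 2 * ((2 : ℝ) ^ (2 * (p * (w + 1))) * ((n : ℝ) + 1) ^ (w + 1)) + 1
      ≤ 4 * ((2 : ℝ) ^ (2 * (p * (w + 1))) * ((n : ℝ) + 1) ^ (w + 1)) := by linarith
    _ ≤ 2 ^ (2 * (w * s)) * (2 ^ (8 * (w * s)) * 2 ^ (4 * (w * s))) := by gcongr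
    _ = 2 ^ (14 * (w * s)) := by
        rw [← Real.rpow_add (by norm_num), ← Real.rpow_add (by norm_num)]; ring_nf

/-- The constant in the bounds. -/
def cst (a e : ℕ) : ℕ := (3 + a) * 2 ^ e + 14 * e + 100

/-- For `w = 0` the factor with base `w + 1` is 1, so the polynomial factor has to carry everything;
`loopBound` is linear in that case. For `w ≥ 1` the nesting depth `e` multiplies the exponent 14,
and the other factor is not needed. -/
theorem time_le {n w p : ℕ} (hwn : w ≤ n) (hp : IsRoot n p) (a e : ℕ) :
    ((3 + a * (loopBound n w p + 1) ^ e : ℕ) : ℝ) ≤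
      (cst a e : ℝ) * ((w : ℝ) + 1) ^ ((cst a e : ℝ) * (w : ℝ) * √(n : ℝ)) *
        ((n : ℝ) + 1) ^ cst a e := by
  have hC : ((3 + a) * 2 ^ e : ℕ) ≤ cst a e := by unfold cst; omega
  have hC1 : 3 + a ≤ cst a e := (Nat.le_mul_of_pos_right _ (Nat.two_pow_pos e)).trans hC
  have hC2 : 14 * e ≤ cst a e := by unfold cst; omega
  have h1 : 3 + a * (loopBound n w p + 1) ^ e ≤ (3 + a) * (loopBound n w p + 1) ^ e := by
    have : 1 ≤ (loopBound n w p + 1) ^ e := Nat.one_le_pow _ _ (by omega)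
    nlinarith
  refine (Nat.cast_le.mpr h1).trans ?_
  have hn0 : (0 : ℝ) ≤ n := Nat.cast_nonneg n
  rcases Nat.eq_zero_or_pos w with rfl | hw
  · have h2 : (3 + a) * (loopBound n 0 p + 1) ^ e ≤ cst a e * (n + 1) ^ cst a e := by
      rw [loopBound, if_pos rfl]
      calc (3 + a) * (n + 1 + 1) ^ e ≤ (3 + a) * (2 * (n + 1)) ^ e :=
            Nat.mul_le_mul_left _ (Nat.pow_le_pow_left (by omega) _)
        _ = (3 + a) * 2 ^ e * (n + 1) ^ e := by rw [mul_pow, mul_assoc]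
        _ ≤ _ := Nat.mul_le_mul hC (Nat.pow_le_pow_right (by omega) (by unfold cst; omega))
    refine (Nat.cast_le.mpr h2).trans (le_of_eq ?_)
    push_cast
    simp
  · have h2 := loopBound_le_rpow hwn hw hp
    have hw0 : (0 : ℝ) ≤ w := Nat.cast_nonneg w
    have h3 : ((loopBound n w p : ℝ) + 1) ^ e ≤
        ((w : ℝ) + 1) ^ ((cst a e : ℝ) * (w : ℝ) * √(n : ℝ)) := by
      refine (pow_le_pow_left₀ (by positivity) h2 e).trans ?_
      rw [← Real.rpow_natCast, ← Real.rpow_mul (by positivity)]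
      refine Real.rpow_le_rpow_of_exponent_le (by linarith) ?_
      have hC2' : (14 * e : ℝ) ≤ cst a e := by exact_mod_cast hC2
      have := mul_le_mul_of_nonneg_right hC2' (show 0 ≤ (w : ℝ) * √(n : ℝ) by positivity)
      nlinarith
    have h4 : (3 + a : ℝ) ≤ cst a e := by exact_mod_cast hC1
    push_cast
    calc (3 + (a : ℝ)) * ((loopBound n w p : ℝ) + 1) ^ e
        ≤ (cst a e : ℝ) * ((w : ℝ) + 1) ^ ((cst a e : ℝ) * (w : ℝ) * √(n : ℝ)) := by gcongr
      _ ≤ _ := le_mul_of_one_le_right (by positivity) (one_le_pow₀ (by linarith))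

/-- The base is at most `2 ^ w₀`, and the polynomial factor is at most `2 ^ (2 C √n)`; the exponents
add up to the constant on the right. -/
theorem time_le_of_treewidth_le (C w₀ : ℕ) {n w : ℕ} (hw : w ≤ w₀) :
    (C : ℝ) * ((w : ℝ) + 1) ^ ((C : ℝ) * (w : ℝ) * √(n : ℝ)) * ((n : ℝ) + 1) ^ C ≤
      ((C * w₀ * w₀ + 2 * C + C : ℕ) : ℝ) *
        (2 : ℝ) ^ (((C * w₀ * w₀ + 2 * C + C : ℕ) : ℝ) * √(n : ℝ)) := by
  have hw' : (w : ℝ) ≤ w₀ := by exact_mod_cast hw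
  have h2w : (w : ℝ) + 1 ≤ 2 ^ (w₀ : ℝ) := by
    rw [Real.rpow_natCast]
    exact_mod_cast (show w + 1 ≤ 2 ^ w₀ from (Nat.lt_two_pow_self.trans_le
      (Nat.pow_le_pow_right two_pos hw)))
  have h1 : ((w : ℝ) + 1) ^ ((C : ℝ) * (w : ℝ) * √(n : ℝ)) ≤ 2 ^ (C * w₀ * w₀ * √(n : ℝ)) := by
    refine (Real.rpow_le_rpow (by positivity) h2w (by positivity)).trans ?_
    rw [← Real.rpow_mul (by norm_num)]
    refine Real.rpow_le_rpow_of_exponent_le (by norm_num) ?_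
    calc (w₀ : ℝ) * (C * w * √(n : ℝ)) ≤ w₀ * (C * w₀ * √(n : ℝ)) := by gcongr
      _ = _ := by ring
  have h2 : ((n : ℝ) + 1) ^ C ≤ 2 ^ (2 * C * √(n : ℝ)) := by
    refine (pow_le_pow_left₀ (by positivity) (succ_le_rpow n) C).trans (le_of_eq ?_)
    rw [← Real.rpow_natCast, ← Real.rpow_mul (by norm_num)]
    ring_nf
  calc _ ≤ (C : ℝ) * 2 ^ (C * w₀ * w₀ * √(n : ℝ)) * 2 ^ (2 * C * √(n : ℝ)) := by gcongr
    _ = (C : ℝ) * 2 ^ ((C * w₀ * w₀ + 2 * C) * √(n : ℝ)) := by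
        rw [mul_assoc, ← Real.rpow_add (by norm_num)]; ring_nf
    _ ≤ _ := by
        have h3 : (0 : ℝ) ≤ C * w₀ * w₀ := by positivity
        have h4 : (0 : ℝ) ≤ C := Nat.cast_nonneg C
        refine mul_le_mul (by push_cast; linarith) ?_ (by positivity) (by positivity)
        refine Real.rpow_le_rpow_of_exponent_le (by norm_num)
          (mul_le_mul_of_nonneg_right ?_ (Real.sqrt_nonneg _))
        push_cast
        linarith

theorem size_le {n s C : ℕ} (hn : n ≤ s) (hC : 100 ≤ C) :
    (3 * s + 1) * (10 * (n + 1) ^ 3) + 3 ≤ C * (s + 1) ^ C := by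
  have h1 : (n + 1) ^ 3 ≤ (s + 1) ^ 3 := Nat.pow_le_pow_left (by omega) 3
  calc (3 * s + 1) * (10 * (n + 1) ^ 3) + 3
      ≤ (3 * (s + 1)) * (10 * (s + 1) ^ 3) + 3 * (s + 1) ^ 4 := by
        refine Nat.add_le_add (Nat.mul_le_mul (by omega) (by omega)) ?_
        exact Nat.le_mul_of_pos_right _ (Nat.pow_pos (Nat.succ_pos s))
    _ = 33 * (s + 1) ^ 4 := by ring
    _ ≤ _ := Nat.mul_le_mul (by omega) (Nat.pow_le_pow_right (Nat.succ_pos s) (by omega))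

/-- All three claims hold for every `ω`: the compiled language has no coin instruction, so the same
safe run of `mainC` is simulated for all outcomes. -/
theorem program_mainC {n : ℕ} {A : Matrix (Fin n) (Fin n) ℚ}
    (hA : (A.map (fun x : ℚ => (x : ℝ))).PosSemidef) (ω : ℕ → Bool) :
    RAM.HaltsWithin mainC.program A ω
      ((cst mainC.size mainC.depth : ℝ) * ((A.treewidth : ℝ) + 1) ^
        ((cst mainC.size mainC.depth : ℝ) * (A.treewidth : ℝ) * √(n : ℝ)) *
          ((n : ℝ) + 1) ^ cst mainC.size mainC.depth) ∧
    RAM.NumbersBounded mainC.program A ω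
      (cst mainC.size mainC.depth * (A.bitSize + 1) ^ cst mainC.size mainC.depth) ∧
    ∃ S : Finset (Fin n), RAM.Outputs mainC.program A ω S ∧
      A.IsMapApprox ((2 : ℝ) ^ √(n : ℝ)) S := by
  obtain ⟨p, hp⟩ := exists_isRoot n
  have hn0 : n + 1 ≤ loopBound n A.treewidth p := by
    unfold loopBound
    split_ifs
    · exact le_rfl
    · have h1 : n + 1 ≤ (n + 1) ^ (A.treewidth + 1) := Nat.le_self_pow (by omega) _
      have h2 := Nat.le_mul_of_pos_left ((n + 1) ^ (A.treewidth + 1))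
        (Nat.two_pow_pos (2 * (p * (A.treewidth + 1))))
      omega
  have hNB : (n + 1) * (n + 1) ≤ 2 ^ (4 * (n + 1) ^ 2) :=
    (show (n + 1) * (n + 1) ≤ 4 * (n + 1) ^ 2 by nlinarith).trans Nat.lt_two_pow_self.le
  obtain ⟨hs, S, hS, happ⟩ := spec_main (Γ := par A p) (d := dat A p) hA rfl rfl hp rfl hn0 hNB
    (par_lims hA hp)
  obtain ⟨c, t, hrun, hhalt, hrel, ht⟩ := mainC.program_run A ω (Γ := par A p) rfl (par_wf hp.le)
    par_entry hs
  have htot := hrun.total hhalt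
  refine ⟨⟨t, (Nat.cast_le.mpr ht).trans (time_le treewidth_le hp _ _), ?_⟩, fun s k => ?_,
    S, ⟨t, ?_, ?_⟩, happ⟩
  · rw [RAM.run, (htot t).2 le_rfl]
    exact hhalt
  · have hV : ∀ x, (par A p).V x → ratSize x ≤
        cst mainC.size mainC.depth * (A.bitSize + 1) ^ cst mainC.size mainC.depth := fun x hx => by
      refine (ratSize_le rfl hx).trans (size_le ?_ (by unfold cst; omega))
      have := Nat.le_mul_self n
      unfold Matrix.bitSize
      omega
    exact ⟨hV _ ((htot s).1 k).1, hV _ ((htot s).1 k).2⟩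
  · rw [RAM.run, (htot t).2 le_rfl]
    exact hhalt
  · rw [RAM.run, (htot t).2 le_rfl]
    ext i
    have hi : (i : ℕ) < n * n := i.2.trans_le (Nat.le_mul_self n)
    have h := hrel.qa qIn i fun _ => hi
    rw [locQ, if_pos rfl] at h
    simp [RAM.Config.outputSet, h, hS]

end Algo

theorem mainTheorem8 :
    ∃ P : RAM.Program,
      -- time `(w + 1)^{O(w √n)} n^{O(1)}`, with numbers of polynomially many bits, in every run
      (∃ C : ℕ, ∀ (n : ℕ) (A : Matrix (Fin n) (Fin n) ℚ),
        (A.map (fun x : ℚ => (x : ℝ))).PosSemidef →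
          ∀ ω : ℕ → Bool,
            RAM.HaltsWithin P A ω
              ((C : ℝ) * ((A.treewidth : ℝ) + 1) ^ ((C : ℝ) * (A.treewidth : ℝ) * √(n : ℝ))
                * ((n : ℝ) + 1) ^ C) ∧
            RAM.NumbersBounded P A ω (C * (A.bitSize + 1) ^ C)) ∧
      -- for every fixed bound on the treewidth, time `2^{O(√n)}`
      (∀ w : ℕ, ∃ K : ℕ, ∀ (n : ℕ) (A : Matrix (Fin n) (Fin n) ℚ),
        (A.map (fun x : ℚ => (x : ℝ))).PosSemidef → A.treewidth ≤ w →
          ∀ ω : ℕ → Bool,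
            RAM.HaltsWithin P A ω ((K : ℝ) * (2 : ℝ) ^ ((K : ℝ) * √(n : ℝ)))) ∧
      -- a `2^{√n}`-approximation with probability at least `1 - 2^{-n}`
      (∀ (n : ℕ) (A : Matrix (Fin n) (Fin n) ℚ),
        (A.map (fun x : ℚ => (x : ℝ))).PosSemidef →
          1 - (1 / 2 : ℝ) ^ n ≤
            RAM.fairCoins.real
              {ω | ∃ S : Finset (Fin n),
                RAM.Outputs P A ω S ∧ A.IsMapApprox ((2 : ℝ) ^ √(n : ℝ)) S}) := by
  obtain ⟨C, hC⟩ : ∃ C, C = Algo.cst Algo.mainC.size Algo.mainC.depth := ⟨_, rfl⟩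
  refine ⟨Algo.mainC.program, ⟨C, fun n A hA ω => ?_⟩, fun w => ⟨C * w * w + 2 * C + C,
    fun n A hA hw ω => ?_⟩, fun n A hA => ?_⟩
  · exact hC ▸ ⟨(Algo.program_mainC hA ω).1, (Algo.program_mainC hA ω).2.1⟩
  · obtain ⟨t, ht, hh⟩ := (Algo.program_mainC hA ω).1
    exact ⟨t, ht.trans (hC ▸ Algo.time_le_of_treewidth_le _ w hw), hh⟩
  -- The output is good for every outcome of the coins, so the event is the whole space and has
  -- probability 1.
  · have h : {ω | ∃ S : Finset (Fin n), RAM.Outputs Algo.mainC.program A ω S ∧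
        A.IsMapApprox ((2 : ℝ) ^ √(n : ℝ)) S} = Set.univ :=
      Set.eq_univ_of_forall fun ω => (Algo.program_mainC hA ω).2.2
    have : MeasureTheory.IsProbabilityMeasure RAM.fairCoins := by
      have (_ : ℕ) : MeasureTheory.IsProbabilityMeasure (PMF.uniformOfFintype Bool).toMeasure :=
        PMF.toMeasure.isProbabilityMeasure _
      unfold RAM.fairCoins
      infer_instance
    rw [h, MeasureTheory.probReal_univ]
    have : (0 : ℝ) ≤ (1 / 2) ^ n := by positivity
    linarith
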